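/- Conventions. $\mathcal T$ is the category of pointed compactly generated spaces (topologized by maps from compact Hausdorff spaces) and based continuous maps, with smash product $\wedge$ and based mapping spaces $\mathrm{Map}_*$; $S^U$ is the one-point compactification of $\mathbb R^U$ for a finite set $U$, so that $S^U=\Sigma^US^0$, and $\Omega^U X=\mathrm{Map}_*(S^U,X)$. A functor $F:\mathcal T^n\to\mathcal T$ is continuous if the maps $\prod_k\mathrm{Map}_*(X_k,Y_k)\to\mathrm{Map}_*(F(X),F(Y))$ are continuous, and multipointed if $F(X_1,\dots,X_n)=*$ as soon as some $X_k=*$. A multipointed functor-operad (multitensor) $\mathcal F_*$ of spaces consists of continuous multipointed functors $\mathcal F_n:\mathcal T^n\to\mathcal T$, $n\ge 1$, with natural symmetry isomorphisms $\mathcal F_n(X_1,\dots,X_n)\cong\mathcal F_n(X_{\sigma(1)},\dots,X_{\sigma(n)})$, a natural unit $\eta:X\to\mathcal F_1(X)$ and a natural multiplication $\gamma:\mathcal F_k(\mathcal F_{j_1}(\dots),\dots,\mathcal F_{j_k}(\dots))\to\mathcal F_{j_1+\dots+j_k}(\dots)$ which are equivariant, associative and unital (a monoid for the composition product of symmetric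 functor sequences). Let $\mathbb I$ be the skeleton of the category of finite sets and injections, and $\mathbb N\subset\mathbb I$ the subcategory with the same objects and only the standard inclusions. For a continuous multipointed functor $F:\mathcal T^n\to\mathcal T$ and $X=(X_1,\dots,X_n)$ in $\mathcal T^n$ let $\Omega^{\bullet}F(\Sigma^\bullet X)$ be the diagram $$(U_1,\dots,U_n)\longmapsto \Omega^{U_1}\cdots\Omega^{U_n}F(\Sigma^{U_1}X_1,\dots,\Sigma^{U_n}X_n)$$ on $\mathbb I^n$, whose maps are given by smashing with the spheres of the complements and assembling these into the variables of $F$. Its based (Bousfield–Kan) homotopy colimit over $\mathbb I^n$ is denoted $\mathbb D_1^{(n)}F(X)$, and the based homotopy colimit of its restriction to $\mathbb N^n$ is the usual multilinearization $D_1^{(n)}F(X)$; for $X=(S^0,\dots,S^0)$ they are written $\mathbb D_1^{(n)}F(S^0)$ and $D_1^{(n)}F(S^0)$. Statement. Let $\mathcal F_*$ be a multipointed functor-operad of spaces. (1) The symmetric sequence $\mathbb D_1^{(*)}\mathcal F_*(S^0)=\{\mathbb D_1^{(n)}\mathcal F_n(S^0,\dots,S^0)\}_{n\ge1}$ (with the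 action that permutes the inputs of $\mathcal F_n$ and block-permutes the loops) is an operad in $(\mathcal T,\wedge)$, with the following structure. The unit is the point $\eta_{S^0}\in\mathrm{Map}_*(S^0,\mathcal F_1(S^0))$ at the initial object of $\mathbb I$. The composition $$\mathbb D_1^{(k)}\mathcal F_k(S^0)\wedge\mathbb D_1^{(j_1)}\mathcal F_{j_1}(S^0)\wedge\cdots\wedge\mathbb D_1^{(j_k)}\mathcal F_{j_k}(S^0)\longrightarrow\mathbb D_1^{(j_1+\cdots+j_k)}\mathcal F_{j_1+\cdots+j_k}(S^0)$$ is induced on homotopy colimits by $((U_i)_i,(V^i_a)_{i,a})\mapsto(U_i\amalg V^i_a)_{i,a}$ and by the maps that send $g\in\Omega^{\amalg U_i}\mathcal F_k(S^{U_1},\dots,S^{U_k})$ and $f_i\in\Omega^{\amalg_a V^i_a}\mathcal F_{j_i}(S^{V^i_1},\dots,S^{V^i_{j_i}})$ to the loop obtained from $g\wedge f_1\wedge\dots\wedge f_k$ by smashing with the spheres $\mathbf S_{j_i}^{\wedge U_i}$, assembling these into the $i$-th variable of $\mathcal F_k$, then assembling one copy of $S^{U_i}$ into each of the $j_i$ variables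 of $\mathcal F_{j_i}$, and applying $\gamma$. Here $\mathbf S_j$ is the sphere operad, in the form of the one-point compactification of $\{d\in\mathbb R^j:\max_a d_a=0\}$ (homeomorphic to an open $(j-1)$-simplex) with the homeomorphism $\mathbf S_j\wedge S^1\cong S^j$, $(d,t)\mapsto(t+d_a)_a$. (2) Let $n\ge 1$ and let $G:\mathbb I^n\to\mathcal T$ be the diagram $\Omega^{\bullet}\mathcal F_n(\Sigma^\bullet X)$ for $X=(S^0,\dots,S^0)$, or more generally for some $X\in\mathcal T^n$. Suppose that the spaces $G(U)$ are well-pointed (i.e. $(G(U),*)$ is an NDR pair) and that $G$ satisfies the connectivity condition: there are numbers $\nu_m$ with $\nu_m\to\infty$ as $m\to\infty$ such that for each $\mathbf x\in\mathbb I^n$ the diagram $G$ sends all maps of the full subcategory of objects receiving a map from $\mathbf x$ to $\nu_{|\mathbf x|}$-connected maps, where $|\mathbf x|$ is the smallest of the cardinalities of the entries of $\mathbf x$. Then the natural map $D_1^{(n)}\mathcal F_n(X)\to\mathbb D_1^{(n)}\mathcal F_n(X)$ is a weak homotopy equivalence. -/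

import Mathlib

open CategoryTheory Topology

namespace Multilin

/-- The compact Hausdorff spaces, as a family of test spaces.  The spaces generated by this family
are the compactly generated spaces. -/
abbrev CH : CompHaus.{0} → Type := fun K => K

instance instGeneratedOfCompact (A : Type) [TopologicalSpace A] [CompactSpace A] [T2Space A] :
    IsGeneratedBy CH A :=
  inferInstanceAs (IsGeneratedBy CH (CompHaus.of A))

instance instLocallyCompactCH (K : CompHaus.{0}) : LocallyCompactSpace (CH K) :=
  have h (A : Type) [TopologicalSpace A] [CompactSpace A] [T2Space A] : LocallyCompactSpace A :=
    inferInstance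
  h K

instance instGeneratedProd (K L : CompHaus.{0}) : IsGeneratedBy CH (CH K × CH L) :=
  instGeneratedOfCompact (K × L)

/-- A pointed (compactly generated) space. -/
structure PSpace : Type 1 where
  carrier : Type
  [top : TopologicalSpace carrier]
  [gen : IsGeneratedBy CH carrier]
  pt : carrier

instance : CoeSort PSpace Type := ⟨PSpace.carrier⟩

attribute [instance] PSpace.top PSpace.gen

/-- Based continuous maps. -/
@[ext] structure PSpace.Hom (X Y : PSpace) where
  toFun : X → Y
  cont : Continuous toFun
  map_pt : toFun X.pt = Y.pt

/-- The category `𝒯` of pointed spaces. -/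
instance : Category PSpace where
  Hom := PSpace.Hom
  id X := ⟨id, continuous_id, rfl⟩
  comp f g := ⟨g.toFun ∘ f.toFun, g.cont.comp f.cont, by simp [f.map_pt, g.map_pt]⟩

@[ext] lemma PSpace.hom_ext {X Y : PSpace} {f g : X ⟶ Y} (h : ∀ x, f.toFun x = g.toFun x) :
    f = g := PSpace.Hom.ext (funext h)

@[simp] lemma PSpace.id_toFun (X : PSpace) (x : X) : PSpace.Hom.toFun (𝟙 X) x = x := rfl

@[simp] lemma PSpace.comp_toFun {X Y Z : PSpace} (f : X ⟶ Y) (g : Y ⟶ Z) (x : X) :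
    PSpace.Hom.toFun (f ≫ g) x = g.toFun (f.toFun x) := rfl

/-- The constant map at the basepoint. -/
def zeroHom (X Y : PSpace) : X ⟶ Y := PSpace.Hom.mk (fun _ => Y.pt) continuous_const rfl

/-- The continuous map underlying a based map, in the form in which Mathlib topologizes function
spaces of compactly generated spaces. -/
def PSpace.Hom.toCMG {X Y : PSpace} (f : X ⟶ Y) : ContinuousMapGeneratedBy CH X Y :=
  ⟨f.toFun, f.cont.continuousGeneratedBy⟩

/-- The (compactly generated version of the) compact-open topology on based maps: the coarsest one
such that precomposition with each continuous map `K → X` from a compact Hausdorff space `K`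
is a continuous map to `C(K, Y)` with its compact-open topology. -/
instance homTopology (X Y : PSpace) : TopologicalSpace (X ⟶ Y) :=
  .induced PSpace.Hom.toCMG inferInstance

/-- The based mapping space `Map_*(X, Y)`, an object of `𝒯`. -/
def mapSpace (X Y : PSpace) : PSpace :=
  @PSpace.mk (X ⟶ Y) (TopologicalSpace.generatedBy CH)
    (inferInstanceAs (IsGeneratedBy CH (WithGeneratedByTopology CH (X ⟶ Y)))) (zeroHom X Y)

lemma continuous_hom_iff {X Y : PSpace} {A : Type} [TopologicalSpace A] [IsGeneratedBy CH A]
    (φ : A → (X ⟶ Y)) :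
    Continuous φ ↔ ∀ ⦃K : CompHaus.{0}⦄ (a : C(CH K, A)) ⦃L : CompHaus.{0}⦄ (b : C(CH L, X)),
      Continuous fun p : CH K × CH L => (φ (a p.1)).toFun (b p.2) := by
  rw [continuous_induced_rng, IsGeneratedBy.continuous_iff CH]
  exact ContinuousMapGeneratedBy.continuousGeneratedBy_iff_uncurry (X := CH)
    (PSpace.Hom.toCMG ∘ φ)

lemma continuous_mapSpace {X Y : PSpace} {A : Type} [TopologicalSpace A] [IsGeneratedBy CH A]
    {φ : A → mapSpace X Y} (h : @Continuous A (X ⟶ Y) _ (homTopology X Y) φ) : Continuous φ :=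
  (IsGeneratedBy.equiv_symm_comp_continuous_iff (X := CH) (Y := A) (Z := (X ⟶ Y)) φ).mpr h

lemma continuous_of_mapSpace (X Y : PSpace) :
    @Continuous (mapSpace X Y) (X ⟶ Y) _ _ (fun f => f) :=
  WithGeneratedByTopology.continuous_equiv (X := CH) (Y := (X ⟶ Y))

/-! ### Spheres -/

/-- The sphere `S^ι`: the one-point compactification of `ℝ^ι`, based at infinity.  It is the smash
product of `ι` copies of `S¹ = ℝ ∪ {∞}`; `S^∅` is `S⁰`. -/
def sphere (ι : Type) [Finite ι] : PSpace where
  carrier := OnePoint (ι → ℝ)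
  pt := OnePoint.infty

instance (ι : Type) [Finite ι] : CompactSpace (sphere ι) :=
  inferInstanceAs (CompactSpace (OnePoint (ι → ℝ)))

instance (ι : Type) [Finite ι] : T2Space (sphere ι) :=
  inferInstanceAs (T2Space (OnePoint (ι → ℝ)))

/-- The point of `S^ι` with finite coordinates `y`. -/
def sphere.coe {ι : Type} [Finite ι] (y : ι → ℝ) : sphere ι := OnePoint.some y

open Classical in
/-- The quotient map `(S¹)^ι → S^ι`, which sends a tuple to its coordinates if all of them are
finite, and to infinity otherwise. -/
noncomputable def collapse {ι : Type} [Finite ι] (y : ι → OnePoint ℝ) : sphere ι :=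
  if h : ∃ z : ι → ℝ, y = fun i => (z i : OnePoint ℝ) then sphere.coe h.choose else (sphere ι).pt

lemma collapse_coe {ι : Type} [Finite ι] (z : ι → ℝ) :
    collapse (fun i => (z i : OnePoint ℝ)) = sphere.coe z := by
  have h : ∃ w : ι → ℝ, (fun i => (z i : OnePoint ℝ)) = fun i => (w i : OnePoint ℝ) := ⟨z, rfl⟩
  rw [collapse, dif_pos h]
  congr 1
  funext i
  exact (OnePoint.coe_eq_coe.mp (congrFun h.choose_spec i)).symm

lemma collapse_infty {ι : Type} [Finite ι] (y : ι → OnePoint ℝ) {i : ι}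
    (h : y i = OnePoint.infty) : collapse y = (sphere ι).pt := by
  rw [collapse, dif_neg]
  rintro ⟨z, rfl⟩
  exact OnePoint.coe_ne_infty _ h

lemma eq_coe_or_infty {ι : Type} (y : ι → OnePoint ℝ) :
    (∃ z : ι → ℝ, y = fun i => (z i : OnePoint ℝ)) ∨ ∃ i, y i = OnePoint.infty := by
  by_cases h : ∃ i, y i = OnePoint.infty
  · exact .inr h
  · push Not at h
    choose z hz using fun i => OnePoint.ne_infty_iff_exists.mp (h i)
    exact .inl ⟨z, funext fun i => (hz i).symm⟩

/-- The quotient map `(S¹)^ι → S^ι` is continuous. -/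
lemma continuous_collapse {ι : Type} [Finite ι] :
    Continuous (collapse : (ι → OnePoint ℝ) → sphere ι) := by
  have hj : Continuous fun (z : ι → ℝ) (i : ι) => (z i : OnePoint ℝ) :=
    continuous_pi fun i => OnePoint.continuous_coe.comp (continuous_apply i)
  have hinj : Function.Injective fun (z : ι → ℝ) (i : ι) => (z i : OnePoint ℝ) :=
    fun z w e => funext fun i => OnePoint.coe_eq_coe.mp (congrFun e i)
  -- the finite points of the preimage of a set
  have key : ∀ t : Set (sphere ι), (sphere ι).pt ∉ t →
      collapse ⁻¹' t = (fun (z : ι → ℝ) (i : ι) => (z i : OnePoint ℝ)) '' (sphere.coe ⁻¹' t) := by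
    intro t ht
    ext y
    rcases eq_coe_or_infty y with ⟨z, rfl⟩ | ⟨i, hi⟩
    · rw [Set.mem_preimage, collapse_coe]
      exact (hinj.mem_set_image (s := sphere.coe ⁻¹' t)).symm
    · rw [Set.mem_preimage, collapse_infty y hi]
      refine ⟨fun h => absurd h ht, ?_⟩
      rintro ⟨w, -, rfl⟩
      exact absurd hi (OnePoint.coe_ne_infty _)
  rw [continuous_iff_isClosed]
  intro t ht
  by_cases h : (sphere ι).pt ∈ t
  · rw [← isOpen_compl_iff, ← Set.preimage_compl, key _ (by simpa using h)]
    have hopen : IsOpenMap (fun (z : ι → ℝ) (i : ι) => (z i : OnePoint ℝ)) :=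
      IsOpenMap.piMap (f := fun _ : ι => ((↑) : ℝ → OnePoint ℝ))
        (fun _ => OnePoint.isOpenMap_coe) (by simp)
    exact hopen _ (((OnePoint.isClosed_iff_of_mem (X := ι → ℝ) h).mp ht).isOpen_compl)
  · rw [key t h]
    exact (((OnePoint.isClosed_iff_of_notMem (X := ι → ℝ) h).mp ht).2.image hj).isClosed

lemma sphere_cases {ι : Type} [Finite ι] (s : sphere ι) :
    s = (sphere ι).pt ∨ ∃ z, s = sphere.coe z := by
  change OnePoint (ι → ℝ) at s
  induction s using OnePoint.rec with
  | infty => exact .inl rfl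
  | coe z => exact .inr ⟨z, rfl⟩

/-- Continuity of a family of maps out of a sphere may be tested on `(S¹)^ι` and at infinity. -/
lemma continuous_of_collapse {A Z ι : Type} [Finite ι] [TopologicalSpace A] [CompactSpace A]
    [T2Space A] [TopologicalSpace Z] (g : A × sphere ι → Z)
    (h1 : Continuous fun p : A × (ι → OnePoint ℝ) => g (p.1, collapse p.2))
    (h2 : Continuous fun a => g (a, (sphere ι).pt)) : Continuous g := by
  let q : (A × (ι → OnePoint ℝ)) ⊕ A → A × sphere ι :=
    Sum.elim (fun p => (p.1, collapse p.2)) (fun a => (a, (sphere ι).pt))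
  have hq : Continuous q :=
    (continuous_fst.prodMk (continuous_collapse.comp continuous_snd)).sumElim
      (continuous_id.prodMk continuous_const)
  have hs : Function.Surjective q := by
    rintro ⟨a, s⟩
    rcases sphere_cases s with rfl | ⟨z, rfl⟩
    · exact ⟨.inr a, rfl⟩
    · exact ⟨.inl (a, fun i => z i), by simp [q, collapse_coe]⟩
  rw [(IsQuotientMap.of_surjective_continuous hs hq).continuous_iff]
  exact continuous_sum_dom.mpr ⟨h1, h2⟩


/-- Case distinction between infinity and the points with finite coordinates. -/
def sphereElim {ι : Type} [Finite ι] {Z : Type} (z₀ : Z) (f : (ι → ℝ) → Z) (s : sphere ι) : Z :=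
  OnePoint.elim (X := ι → ℝ) s z₀ f

@[simp] lemma sphereElim_pt {ι : Type} [Finite ι] {Z : Type} (z₀ : Z) (f : (ι → ℝ) → Z) :
    sphereElim z₀ f (sphere ι).pt = z₀ := rfl

@[simp] lemma sphereElim_coe {ι : Type} [Finite ι] {Z : Type} (z₀ : Z) (f : (ι → ℝ) → Z)
    (y : ι → ℝ) : sphereElim z₀ f (sphere.coe y) = f y := rfl

lemma sphereHom_ext {ι : Type} [Finite ι] {X : PSpace} {f g : sphere ι ⟶ X}
    (h : ∀ y, f.toFun (sphere.coe y) = g.toFun (sphere.coe y)) : f = g := by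
  ext s
  rcases sphere_cases s with rfl | ⟨z, rfl⟩
  · rw [f.map_pt, g.map_pt]
  · exact h z

/-- The identification `S^ι ≅ S^κ` induced by a bijection `e : ι ≃ κ` (relabelling). -/
def sphereRelabel {ι κ : Type} [Finite ι] [Finite κ] (e : ι ≃ κ) : sphere ι ⟶ sphere κ where
  toFun := OnePoint.map (X := ι → ℝ) (Y := κ → ℝ) fun y => y ∘ e.symm
  cont := OnePoint.continuous_map (X := ι → ℝ) (Y := κ → ℝ) (f := fun y => y ∘ e.symm)
    (Homeomorph.piCongrLeft (Y := fun _ : ι => ℝ) e.symm).symm.continuous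
    (by
      rw [Filter.coclosedCompact_eq_cocompact, Filter.coclosedCompact_eq_cocompact]
      exact (Homeomorph.piCongrLeft (Y := fun _ : ι => ℝ)
        e.symm).symm.isClosedEmbedding.tendsto_cocompact)
  map_pt := rfl

lemma sphereRelabel_coe {ι κ : Type} [Finite ι] [Finite κ] (e : ι ≃ κ) (z : κ → ℝ) :
    (sphereRelabel e).toFun (sphere.coe fun c => z (e c)) = sphere.coe z := by
  change sphere.coe _ = _
  congr 1
  funext c
  simp

open Function in
/-- For an injection `i : ι ↪ κ` and `y ∈ (S¹)^κ`, the map `S^ι → S^κ` that smashes with the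
coordinates of `y` outside the image of `i`:  the coordinate `i u` of the image of `z` is `z u`,
and the coordinates outside the image of `i` are those of `y`. -/
noncomputable def insertFun {ι κ : Type} [Finite ι] [Finite κ] (i : ι ↪ κ) (y : κ → OnePoint ℝ) :
    sphere ι → sphere κ :=
  sphereElim (sphere κ).pt fun z => collapse (extend i (fun u => (z u : OnePoint ℝ)) y)

lemma insertFun_collapse {ι κ : Type} [Finite ι] [Finite κ] (i : ι ↪ κ) (y : κ → OnePoint ℝ)
    (z : ι → OnePoint ℝ) : insertFun i y (collapse z) = collapse (Function.extend i z y) := by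
  rcases eq_coe_or_infty z with ⟨z, rfl⟩ | ⟨u, hu⟩
  · rw [collapse_coe]; rfl
  · rw [collapse_infty z hu, collapse_infty (i := i u)]
    · rfl
    · rw [i.injective.extend_apply, hu]

lemma continuous_extend {ι κ : Type} (i : ι ↪ κ) :
    Continuous fun p : (κ → OnePoint ℝ) × (ι → OnePoint ℝ) => Function.extend i p.2 p.1 := by
  refine continuous_pi fun v => ?_
  by_cases h : ∃ u, i u = v
  · obtain ⟨u, rfl⟩ := h
    simp only [i.injective.extend_apply]
    fun_prop
  · simp only [Function.extend_apply' _ _ _ h]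
    fun_prop

lemma continuous_insertFun {ι κ : Type} [Finite ι] [Finite κ] (i : ι ↪ κ) :
    Continuous fun p : (κ → OnePoint ℝ) × sphere ι => insertFun i p.1 p.2 := by
  refine continuous_of_collapse _ ?_ continuous_const
  simp only [insertFun_collapse]
  exact continuous_collapse.comp (continuous_extend i)

/-- `insertFun` as a based map. -/
noncomputable def insertMap {ι κ : Type} [Finite ι] [Finite κ] (i : ι ↪ κ)
    (y : κ → OnePoint ℝ) : sphere ι ⟶ sphere κ where
  toFun := insertFun i y
  cont := (continuous_insertFun i).comp (Continuous.prodMk_right y)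
  map_pt := rfl

lemma insertMap_coe {ι κ : Type} [Finite ι] [Finite κ] (i : ι ↪ κ) (y : κ → ℝ) (z : ι → ℝ) :
    (insertMap i fun v => (y v : OnePoint ℝ)).toFun (sphere.coe z) =
      sphere.coe (Function.extend i z y) := by
  have : Function.extend i (fun u => (z u : OnePoint ℝ)) (fun v => (y v : OnePoint ℝ)) =
      fun v => ((Function.extend i z y v : ℝ) : OnePoint ℝ) := by
    funext v
    by_cases h : ∃ u, i u = v
    · obtain ⟨u, rfl⟩ := h
      simp only [i.injective.extend_apply]
    · simp only [Function.extend_apply' _ _ _ h]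
  change collapse _ = _
  rw [this, collapse_coe]

lemma insertMap_infty {ι κ : Type} [Finite ι] [Finite κ] (i : ι ↪ κ) (y : κ → OnePoint ℝ)
    {v : κ} (hv : y v = OnePoint.infty) (h : ¬ ∃ u, i u = v) :
    insertMap i y = zeroHom _ _ := by
  refine sphereHom_ext fun z => collapse_infty (i := v) _ ?_
  rw [Function.extend_apply' _ _ _ h, hv]

lemma insertMap_refl {ι : Type} [Finite ι] (y : ι → OnePoint ℝ) :
    insertMap (Function.Embedding.refl ι) y = 𝟙 _ := by
  refine sphereHom_ext fun z => ?_
  change collapse _ = sphere.coe z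
  rw [← collapse_coe]
  congr 1
  funext v
  exact Function.Injective.extend_apply (Function.Embedding.refl ι).injective _ _ v

lemma insertMap_comp {ι κ μ : Type} [Finite ι] [Finite κ] [Finite μ] (i : ι ↪ κ) (j : κ ↪ μ)
    (y : μ → OnePoint ℝ) :
    insertMap i (y ∘ j) ≫ insertMap j y = insertMap (i.trans j) y := by
  refine sphereHom_ext fun z => ?_
  change insertFun j y (collapse _) = collapse _
  rw [insertFun_collapse]
  congr 1
  funext w
  by_cases h : ∃ v, j v = w
  · obtain ⟨v, rfl⟩ := h
    rw [j.injective.extend_apply]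
    by_cases h' : ∃ u, i u = v
    · obtain ⟨u, rfl⟩ := h'
      rw [i.injective.extend_apply]
      exact ((i.trans j).injective.extend_apply (fun u => (z u : OnePoint ℝ)) y u).symm
    · rw [Function.extend_apply' _ _ _ h', Function.extend_apply']
      · rfl
      · rintro ⟨u, hu⟩
        exact h' ⟨u, j.injective hu⟩
  · rw [Function.extend_apply' _ _ _ h, Function.extend_apply']
    rintro ⟨u, hu⟩
    exact h ⟨i u, hu⟩

/-! ### Continuous multipointed functors -/

/-- A functor `𝒯^K → 𝒯` which is continuous (i.e. `∏ₖ Map_*(Xₖ, Yₖ) → Map_*(F X, F Y)` is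
continuous, for the compactly generated topology on the product) and multipointed (i.e. pointed in
each variable: `F X` is a one-point space as soon as one of the `Xₖ` is). -/
structure MFunctor (K : Type) where
  functor : (K → PSpace) ⥤ PSpace
  continuous_map : ∀ X Y : K → PSpace,
    ContinuousGeneratedBy CH fun f : (∀ k, X k ⟶ Y k) => functor.map (X := X) (Y := Y) f
  multipointed : ∀ X : K → PSpace, (∃ k, Subsingleton (X k)) → Subsingleton (functor.obj X)

namespace MFunctor

variable {K : Type} (F : MFunctor K)

lemma continuous_apply {X Y : K → PSpace} {A : Type} [TopologicalSpace A] [CompactSpace A]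
    [T2Space A] (c : A → ∀ k, X k ⟶ Y k)
    (hc : ∀ k, Continuous fun a => c a k) {x : A → F.functor.obj X}
    (hx : Continuous x) :
    Continuous fun a => (F.functor.map (X := X) (Y := Y) (c a)).toFun (x a) := by
  have h1 : Continuous fun a => F.functor.map (X := X) (Y := Y) (c a) :=
    F.continuous_map X Y (i := CompHaus.of A) ⟨c, continuous_pi hc⟩
  have h2 := (continuous_hom_iff _).mp h1 (K := CompHaus.of A) ⟨id, continuous_id⟩
    (L := CompHaus.of A) ⟨x, hx⟩
  exact h2.comp (continuous_id.prodMk continuous_id)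

lemma map_zero {X Y : K → PSpace} (f : X ⟶ Y) {k : K} (h : f k = zeroHom _ _) :
    F.functor.map f = zeroHom _ _ := by
  classical
  let P : PSpace := ⟨PUnit, ⟨⟩⟩
  let Z : K → PSpace := fun l => if l = k then P else Y l
  have hZ : ∃ l, Subsingleton (Z l) := ⟨k, by simp only [Z, if_true]; exact inferInstanceAs (Subsingleton PUnit)⟩
  have : ∃ (g : X ⟶ Z) (g' : Z ⟶ Y), f = g ≫ g' := by
    have H : ∀ l, ∃ (g : X l ⟶ Z l) (g' : Z l ⟶ Y l), f l = g ≫ g' := by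
      intro l
      by_cases hl : l = k
      · subst hl
        exact ⟨zeroHom _ _, zeroHom _ _, by rw [h]; rfl⟩
      · have : Z l = Y l := if_neg hl
        rw [this]
        exact ⟨f l, 𝟙 _, (Category.comp_id _).symm⟩
    choose g g' hg using H
    exact ⟨g, g', funext hg⟩
  obtain ⟨g, g', rfl⟩ := this
  have := F.multipointed Z hZ
  ext x
  rw [F.functor.map_comp, PSpace.comp_toFun,
    Subsingleton.elim ((F.functor.map g).toFun x) (F.functor.obj Z).pt, (F.functor.map g').map_pt]
  rfl

end MFunctor

/-! ### The category `𝕀` and the diagram `Ω^• F(Σ^• S⁰)` -/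

/-- The skeleton `𝕀` of the category of finite sets and injections: the objects are the finite
sets `{0, …, n - 1}`, the morphisms are all injections. -/
structure II : Type where
  card : ℕ

instance : Category II where
  Hom m n := Fin m.card ↪ Fin n.card
  id m := Function.Embedding.refl _
  comp f g := f.trans g

/-- The injection underlying a morphism of `𝕀`. -/
def II.inj {m n : II} (f : m ⟶ n) : Fin m.card ↪ Fin n.card := f

/-- The category `ℕ` with the same objects as `𝕀`, and only the standard inclusions. -/
structure NN : Type where
  card : ℕ

instance : Category NN where
  Hom m n := PLift (m.card ≤ n.card)
  id m := ⟨le_refl _⟩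
  comp f g := ⟨f.down.trans g.down⟩

/-- The inclusion `ℕ → 𝕀`. -/
def inclNN : NN ⥤ II where
  obj n := ⟨n.card⟩
  map f := (Fin.castLEEmb f.down : Fin _ ↪ Fin _)

/-- The disjoint union `∐ₖ Uₖ` for an object `U` of `𝕀^K`. -/
abbrev Coord {K : Type} (U : K → II) : Type := Σ k, Fin (U k).card

/-- The tuple of spheres `(S^{Uₖ})ₖ`. -/
def spheres {K : Type} (U : K → II) : K → PSpace := fun k => sphere (Fin (U k).card)

/-- The injection of disjoint unions induced by a morphism of `𝕀^K`. -/
def coordMap {K : Type} {U V : K → II} (i : U ⟶ V) : Coord U ↪ Coord V :=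
  Function.Embedding.sigmaMap (Function.Embedding.refl K) (fun k => II.inj (i k))

/-- The maps `S^{Uₖ} → S^{Vₖ}` that insert the coordinates of `y` outside of the image of `Uₖ`. -/
noncomputable def insertMaps {K : Type} {U V : K → II} (i : U ⟶ V) (y : Coord V → OnePoint ℝ) :
    spheres U ⟶ spheres V :=
  fun k => insertMap (II.inj (i k)) fun v => y ⟨k, v⟩

lemma insertMaps_id {K : Type} (U : K → II) (y : Coord U → OnePoint ℝ) :
    insertMaps (𝟙 U) y = 𝟙 (spheres U) :=
  funext fun _ => insertMap_refl _

lemma insertMaps_comp {K : Type} {U V W : K → II} (i : U ⟶ V) (j : V ⟶ W)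
    (y : Coord W → OnePoint ℝ) :
    insertMaps i (fun c => y (coordMap j c)) ≫ insertMaps j y = insertMaps (i ≫ j) y :=
  funext fun k => insertMap_comp (II.inj (i k)) (II.inj (j k)) fun v => y ⟨k, v⟩

/-- `Ω^{U₁} ⋯ Ω^{Uₙ} F(S^{U₁}, …, S^{Uₙ})`, the space of based maps from the smash product
`S^{∐ Uₖ}` of the `S^{Uₖ}` to `F(S^{U₁}, …, S^{Uₙ})`. -/
def loopSpace {K : Type} [Finite K] (F : MFunctor K) (U : K → II) : PSpace :=
  mapSpace (sphere (Coord U)) (F.functor.obj (spheres U))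

section stabilization

variable {K : Type} [Finite K] (F : MFunctor K) {U V : K → II}

/-- Stabilization along injections `iₖ : Uₖ → Vₖ`: a based map
`f : S^{∐ Uₖ} → F(S^{U₁}, …, S^{Uₙ})` is smashed with the spheres `S^{Vₖ - Uₖ}`, which are then
assembled into the `k`-th variable of `F`.  At the point with coordinates `y`, the assembly map is
induced by the maps `S^{Uₖ} → S^{Vₖ}` that insert the coordinates of `y` outside of `Uₖ`. -/
noncomputable def stabFun (i : U ⟶ V) (f : sphere (Coord U) ⟶ F.functor.obj (spheres U)) :
    sphere (Coord V) → F.functor.obj (spheres V) :=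
  sphereElim (F.functor.obj (spheres V)).pt fun y =>
    (F.functor.map (insertMaps i fun v => (y v : OnePoint ℝ))).toFun
        (f.toFun (sphere.coe fun c => y (coordMap i c)))

lemma stabFun_collapse (i : U ⟶ V) (f : sphere (Coord U) ⟶ F.functor.obj (spheres U))
    (y : Coord V → OnePoint ℝ) :
    stabFun F i f (collapse y) =
      (F.functor.map (insertMaps i y)).toFun (f.toFun (collapse fun c => y (coordMap i c))) := by
  rcases eq_coe_or_infty y with ⟨z, rfl⟩ | ⟨⟨k, v⟩, hv⟩
  · rw [collapse_coe, collapse_coe (fun c => z (coordMap i c))]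
    rfl
  · rw [collapse_infty y hv]
    change (F.functor.obj (spheres V)).pt = _
    by_cases h : ∃ u, II.inj (i k) u = v
    · obtain ⟨u, rfl⟩ := h
      rw [collapse_infty (i := ⟨k, u⟩) _ hv, f.map_pt, PSpace.Hom.map_pt]
    · rw [F.map_zero (k := k) (insertMaps i y) (insertMap_infty (II.inj (i k)) _ hv h)]
      rfl

lemma continuous_stabFun (i : U ⟶ V) {A : Type} [TopologicalSpace A] [CompactSpace A] [T2Space A]
    (f : A → (sphere (Coord U) ⟶ F.functor.obj (spheres U))) (hf : Continuous f) :
    Continuous fun p : A × sphere (Coord V) => stabFun F i (f p.1) p.2 := by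
  refine continuous_of_collapse _ ?_ continuous_const
  simp only [stabFun_collapse]
  refine F.continuous_apply (X := spheres U) (Y := spheres V)
    (fun p : A × (Coord V → OnePoint ℝ) => insertMaps i p.2)
    (fun k => ?_) ?_
  · refine (continuous_hom_iff (X := spheres U k) (Y := spheres V k) _).mpr ?_
    intro L a M b
    have h1 : Continuous fun q : CH L × CH M => ((fun v => (a q.1).2 ⟨k, v⟩, b q.2) :
        (Fin (V k).card → OnePoint ℝ) × sphere (Fin (U k).card)) := by
      refine Continuous.prodMk (continuous_pi fun v => ?_) (b.continuous.comp continuous_snd)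
      exact (continuous_apply _).comp
        (continuous_snd.comp (a.continuous.comp continuous_fst))
    exact (continuous_insertFun (II.inj (i k))).comp h1
  · have h2 := (continuous_hom_iff f).mp hf (K := CompHaus.of (A × (Coord V → OnePoint ℝ)))
      ⟨Prod.fst, continuous_fst⟩ (L := CompHaus.of (A × (Coord V → OnePoint ℝ)))
      ⟨fun p => collapse fun c => p.2 (coordMap i c), continuous_collapse.comp
        (continuous_pi fun c => (continuous_apply _).comp continuous_snd)⟩
    exact h2.comp (continuous_id.prodMk continuous_id)

/-- Stabilization of a based map. -/
noncomputable def stab (i : U ⟶ V) (f : sphere (Coord U) ⟶ F.functor.obj (spheres U)) :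
    sphere (Coord V) ⟶ F.functor.obj (spheres V) where
  toFun := stabFun F i f
  cont := (continuous_stabFun F i (fun _ : PUnit => f) continuous_const).comp
    (Continuous.prodMk_right PUnit.unit)
  map_pt := rfl

/-- Stabilization as a based map of mapping spaces. -/
noncomputable def stabMap (i : U ⟶ V) : loopSpace F U ⟶ loopSpace F V where
  toFun := stab F i
  cont := by
    refine continuous_mapSpace ((continuous_hom_iff _).mpr fun L a M b => ?_)
    have h := continuous_stabFun F i (A := CH L) (fun l => a l)
      ((continuous_of_mapSpace _ _).comp a.continuous)
    exact h.comp (continuous_fst.prodMk (b.continuous.comp continuous_snd))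
  map_pt := by
    refine sphereHom_ext fun y => ?_
    exact PSpace.Hom.map_pt _

end stabilization

/-- The diagram `Ω^{•,…,•} F(Σ^• S⁰, …, Σ^• S⁰)` of shape `𝕀^K`. -/
noncomputable def loopDiagram {K : Type} [Finite K] (F : MFunctor K) : (K → II) ⥤ PSpace where
  obj U := loopSpace F U
  map i := stabMap F i
  map_id U := by
    ext f
    refine sphereHom_ext fun y => ?_
    refine (congrArg (fun φ => (F.functor.map φ).toFun
      (PSpace.Hom.toFun (X := sphere (Coord U)) f (sphere.coe y))) (insertMaps_id U _)).trans ?_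
    rw [F.functor.map_id]
    rfl
  map_comp {U V W} i j := by
    ext f
    refine sphereHom_ext fun y => ?_
    refine (congrArg (fun φ => (F.functor.map φ).toFun
      (PSpace.Hom.toFun (X := sphere (Coord U)) f
        (sphere.coe fun c => y (coordMap j (coordMap i c))))) (insertMaps_comp i j _).symm).trans ?_
    rw [F.functor.map_comp]
    rfl

/-! ### Homotopy colimits -/

section hocolim

variable {C : Type} [Category.{0} C]

/-- The disjoint union, over all `p` and all chains `c₀ → ⋯ → c_p` in `C`, of the spaces
`D(c₀) × Δ^p`. -/
abbrev ChainSpace (D : C ⥤ PSpace) : Type :=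
  Σ s : (Σ p : ℕ, Fin (p + 1) ⥤ C), D.obj (s.2.obj 0) × stdSimplex ℝ (Fin (s.1 + 1))

/-- `ChainSpace D` with its compactly generated topology. -/
abbrev ChainSpaceCG (D : C ⥤ PSpace) : Type := WithGeneratedByTopology CH (ChainSpace D)

/-- The point `(x, t)` of `D(c₀) × Δ^p` in the summand of the chain `c`. -/
def chainPoint (D : C ⥤ PSpace) {p : ℕ} (c : Fin (p + 1) ⥤ C) (x : D.obj (c.obj 0))
    (t : stdSimplex ℝ (Fin (p + 1))) : ChainSpaceCG D :=
  WithGeneratedByTopology.equiv.symm ⟨⟨p, c⟩, x, t⟩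

/-- The identifications made in the (based) homotopy colimit: those of the geometric realization of
the simplicial replacement of `D`, and all points over a basepoint are identified. -/
inductive HocolimRel (D : C ⥤ PSpace) : ChainSpaceCG D → ChainSpaceCG D → Prop
  | simplicial {p q : ℕ} (θ : Fin (p + 1) →o Fin (q + 1)) (c : Fin (q + 1) ⥤ C)
      (x : D.obj (c.obj 0)) (t : stdSimplex ℝ (Fin (p + 1))) :
      HocolimRel D (chainPoint D c x (stdSimplex.map θ t))
        (chainPoint D (θ.monotone.functor ⋙ c)
          ((D.map (c.map (homOfLE (Fin.zero_le (θ 0))))).toFun x) t)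
  | base {p q : ℕ} (c : Fin (p + 1) ⥤ C) (c' : Fin (q + 1) ⥤ C)
      (t : stdSimplex ℝ (Fin (p + 1))) (t' : stdSimplex ℝ (Fin (q + 1))) :
      HocolimRel D (chainPoint D c (D.obj (c.obj 0)).pt t)
        (chainPoint D c' (D.obj (c'.obj 0)).pt t')

variable {C' : Type} [Category.{0} C']

/-- The map of `hocolim.map` on representatives. -/
def hocolim.mapFun {D : C ⥤ PSpace} {D' : C' ⥤ PSpace} (Φ : C ⥤ C')
    (α : D ⟶ Φ ⋙ D') (x : ChainSpace D) : ChainSpace D' :=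
  ⟨⟨x.1.1, x.1.2 ⋙ Φ⟩, (α.app (x.1.2.obj 0)).toFun x.2.1, x.2.2⟩

lemma hocolim.continuous_mapFun {D : C ⥤ PSpace} {D' : C' ⥤ PSpace} (Φ : C ⥤ C')
    (α : D ⟶ Φ ⋙ D') : Continuous (hocolim.mapFun Φ α) := by
  refine continuous_sigma fun s => ?_
  exact (continuous_sigmaMk (σ := fun s : (Σ p : ℕ, Fin (p + 1) ⥤ C') =>
      D'.obj (s.2.obj 0) × stdSimplex ℝ (Fin (s.1 + 1))) (i := ⟨s.1, s.2 ⋙ Φ⟩)).comp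
    (((α.app (s.2.obj 0)).cont.comp continuous_fst).prodMk continuous_snd)

variable [Nonempty C]

/-- The based homotopy colimit of `D : C ⥤ 𝒯` (Bousfield–Kan construction). -/
noncomputable def hocolim (D : C ⥤ PSpace) : PSpace where
  carrier := Quot (HocolimRel D)
  pt := Quot.mk _ (chainPoint D (p := 0) ((Functor.const _).obj (Classical.arbitrary C))
    (D.obj (Classical.arbitrary C)).pt (stdSimplex.vertex 0))

/-- The point of the homotopy colimit given by a chain `c₀ → ⋯ → c_p`, a point of `D(c₀)` and a
point of `Δ^p`. -/
def hocolim.mk (D : C ⥤ PSpace) {p : ℕ} (c : Fin (p + 1) ⥤ C) (x : D.obj (c.obj 0))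
    (t : stdSimplex ℝ (Fin (p + 1))) : hocolim D :=
  Quot.mk (HocolimRel D) (chainPoint D c x t)

lemma hocolim.mk_pt (D : C ⥤ PSpace) {p : ℕ} (c : Fin (p + 1) ⥤ C)
    (t : stdSimplex ℝ (Fin (p + 1))) : hocolim.mk D c (D.obj (c.obj 0)).pt t = (hocolim D).pt :=
  Quot.sound (HocolimRel.base (D := D) _ _ _ _)

variable [Nonempty C']

/-- The map of homotopy colimits induced by a functor `Φ` between the indexing categories and a
natural transformation `D ⟶ Φ ⋙ D'`. -/
noncomputable def hocolim.map {D : C ⥤ PSpace} {D' : C' ⥤ PSpace} (Φ : C ⥤ C')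
    (α : D ⟶ Φ ⋙ D') : hocolim D ⟶ hocolim D' where
  toFun := Quot.lift (fun x => Quot.mk (HocolimRel D') (WithGeneratedByTopology.equiv.symm
      (hocolim.mapFun Φ α (WithGeneratedByTopology.equiv x))))
    (by
      rintro _ _ (⟨θ, c, x, t⟩ | ⟨c, c', t, t'⟩)
      · refine (Quot.sound (HocolimRel.simplicial (D := D') θ (c ⋙ Φ)
          ((α.app (c.obj 0)).toFun x) t)).trans ?_
        have h := congrArg (fun φ => PSpace.Hom.toFun φ x)
          (α.naturality (c.map (homOfLE (Fin.zero_le (θ 0)))))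
        exact congrArg (fun z => hocolim.mk D' (θ.monotone.functor ⋙ c ⋙ Φ) z t) h.symm
      · refine Eq.trans ?_ ((Quot.sound (HocolimRel.base (D := D') (c ⋙ Φ) (c' ⋙ Φ) t t')).trans ?_)
        · exact congrArg (fun z => hocolim.mk D' (c ⋙ Φ) z t) (α.app (c.obj 0)).map_pt
        · exact congrArg (fun z => hocolim.mk D' (c' ⋙ Φ) z t') (α.app (c'.obj 0)).map_pt.symm)
  cont := continuous_quot_lift _ (continuous_quot_mk.comp
    ((hocolim.continuous_mapFun Φ α).continuousGeneratedBy (X := CH)).continuousMap.continuous)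
  map_pt := (congrArg (fun z => hocolim.mk D' ((Functor.const _).obj (Classical.arbitrary C) ⋙ Φ)
      z (stdSimplex.vertex 0)) (α.app _).map_pt).trans (hocolim.mk_pt D' _ _)

lemma hocolim.map_mk {D : C ⥤ PSpace} {D' : C' ⥤ PSpace} (Φ : C ⥤ C')
    (α : D ⟶ Φ ⋙ D') {p : ℕ} (c : Fin (p + 1) ⥤ C) (x : D.obj (c.obj 0))
    (t : stdSimplex ℝ (Fin (p + 1))) :
    (hocolim.map Φ α).toFun (hocolim.mk D c x t) =
      hocolim.mk D' (c ⋙ Φ) ((α.app (c.obj 0)).toFun x) t := rfl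

end hocolim

instance : Nonempty II := ⟨⟨0⟩⟩
instance : Nonempty NN := ⟨⟨0⟩⟩

/-! ### Symmetric sequences and operads -/

instance instNonemptySigma {K : Type} {J : K → Type} [Nonempty K] [∀ k, Nonempty (J k)] :
    Nonempty (Σ k, J k) :=
  ⟨⟨Classical.arbitrary K, Classical.arbitrary _⟩⟩

/-- A symmetric sequence of pointed spaces: a functor on the groupoid of non-empty finite sets and
bijections.  It is written contravariantly, i.e. the symmetric groups act from the right. -/
structure SymmSeq where
  A : ∀ (K : Type) [Finite K] [Nonempty K], PSpace
  ρ : ∀ {K K' : Type} [Finite K] [Nonempty K] [Finite K'] [Nonempty K'] (_ : K ≃ K'), A K' ⟶ A K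
  ρ_refl : ∀ (K : Type) [Finite K] [Nonempty K], ρ (Equiv.refl K) = 𝟙 (A K)
  ρ_trans : ∀ {K K' K'' : Type} [Finite K] [Nonempty K] [Finite K'] [Nonempty K'] [Finite K'']
    [Nonempty K''] (e : K ≃ K') (e' : K' ≃ K''), ρ (e.trans e') = ρ e' ≫ ρ e

/-- An operad structure on a symmetric sequence `A`, with respect to the smash product.
The unit `S⁰ → A(1)` is a point of `A(1)`.  For a finite set which is partitioned into blocks
`J k` indexed by `k : K`, the composition is a based map `A(K) ∧ ⋀ₖ A(J k) → A(∐ₖ J k)`, i.e. a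
map on the product which is continuous for the compactly generated topology and which has the value
`*` as soon as one of its arguments is `*`. -/
structure OperadStructure (S : SymmSeq) where
  one : S.A Unit
  comp : ∀ {K : Type} {J : K → Type} [Finite K] [Nonempty K] [∀ k, Finite (J k)]
    [∀ k, Nonempty (J k)], S.A K → (∀ k, S.A (J k)) → S.A (Σ k, J k)
  continuous_comp : ∀ {K : Type} {J : K → Type} [Finite K] [Nonempty K] [∀ k, Finite (J k)]
    [∀ k, Nonempty (J k)],
    ContinuousGeneratedBy CH fun p : S.A K × (∀ k, S.A (J k)) => comp p.1 p.2
  comp_pt_left : ∀ {K : Type} {J : K → Type} [Finite K] [Nonempty K] [∀ k, Finite (J k)]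
    [∀ k, Nonempty (J k)] (b : ∀ k, S.A (J k)), comp (S.A K).pt b = (S.A (Σ k, J k)).pt
  comp_pt_right : ∀ {K : Type} {J : K → Type} [Finite K] [Nonempty K] [∀ k, Finite (J k)]
    [∀ k, Nonempty (J k)] (a : S.A K) (b : ∀ k, S.A (J k)) (k : K),
    b k = (S.A (J k)).pt → comp a b = (S.A (Σ k, J k)).pt
  /-- Equivariance. -/
  equivariant : ∀ {K K' : Type} {J : K → Type} {J' : K' → Type} [Finite K] [Nonempty K]
    [Finite K'] [Nonempty K'] [∀ k, Finite (J k)] [∀ k, Nonempty (J k)] [∀ k, Finite (J' k)]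
    [∀ k, Nonempty (J' k)] (e : K ≃ K') (e' : ∀ k, J k ≃ J' (e k)) (a : S.A K')
    (b : ∀ k, S.A (J' k)),
    (S.ρ (Equiv.sigmaCongr e e')).toFun (comp a b) =
      comp ((S.ρ e).toFun a) (fun k => (S.ρ (e' k)).toFun (b (e k)))
  /-- Associativity. -/
  assoc : ∀ {K : Type} {J : K → Type} {L : ∀ k, J k → Type} [Finite K] [Nonempty K]
    [∀ k, Finite (J k)] [∀ k, Nonempty (J k)] [∀ k j, Finite (L k j)] [∀ k j, Nonempty (L k j)]
    (a : S.A K) (b : ∀ k, S.A (J k)) (c : ∀ k j, S.A (L k j)),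
    (S.ρ (Equiv.sigmaAssoc L)).toFun (comp a fun k => comp (b k) (c k)) =
      comp (comp a b) (fun p : (Σ k, J k) => c p.1 p.2)
  /-- Left unit. -/
  one_comp : ∀ {K : Type} [Finite K] [Nonempty K] (a : S.A K),
    comp one (fun _ : Unit => a) = (S.ρ (Equiv.uniqueSigma fun _ : Unit => K)).toFun a
  /-- Right unit. -/
  comp_one : ∀ {K : Type} [Finite K] [Nonempty K] (a : S.A K),
    comp a (fun _ : K => one) = (S.ρ (Equiv.sigmaPUnit K)).toFun a

/-! ### Symmetric functor sequences and functor-operads -/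

/-- A multipointed symmetric functor sequence: continuous multipointed functors
`F_K : 𝒯^K → 𝒯` for the non-empty finite sets `K`, and isomorphisms
`F_{K'}(X) → F_K(X ∘ e)`, natural in `X`, for the bijections `e : K ≃ K'`. -/
structure SymmFun where
  F : ∀ (K : Type) [Finite K] [Nonempty K], MFunctor K
  σ : ∀ {K K' : Type} [Finite K] [Nonempty K] [Finite K'] [Nonempty K'] (e : K ≃ K')
    (X : K' → PSpace), (F K').functor.obj X ⟶ (F K).functor.obj (fun k => X (e k))
  σ_naturality : ∀ {K K' : Type} [Finite K] [Nonempty K] [Finite K'] [Nonempty K'] (e : K ≃ K')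
    {X Y : K' → PSpace} (f : X ⟶ Y),
    (F K').functor.map f ≫ σ e Y =
      σ e X ≫ (F K).functor.map (X := fun k => X (e k)) (Y := fun k => Y (e k)) fun k => f (e k)
  σ_refl : ∀ {K : Type} [Finite K] [Nonempty K] (X : K → PSpace),
    σ (Equiv.refl K) X = 𝟙 ((F K).functor.obj X)
  σ_trans : ∀ {K K' K'' : Type} [Finite K] [Nonempty K] [Finite K'] [Nonempty K'] [Finite K'']
    [Nonempty K''] (e : K ≃ K') (e' : K' ≃ K'') (X : K'' → PSpace),
    σ (e.trans e') X = σ e' X ≫ σ e (fun k => X (e' k))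

/-- A multipointed functor-operad (multitensor) of pointed spaces: a monoid for the composition
product of symmetric functor sequences.  The multiplication has one component
`F_K((F_{J k}((X_{k,j})_j))_k) → F_{∐ₖ J k}((X_{k,j})_{k,j})` for each partition into blocks. -/
structure FunctorOperad extends SymmFun where
  η : ∀ X : PSpace, X ⟶ (F Unit).functor.obj (fun _ => X)
  η_naturality : ∀ {X Y : PSpace} (f : X ⟶ Y),
    f ≫ η Y = η X ≫ (F Unit).functor.map (X := fun _ => X) (Y := fun _ => Y) fun _ => f
  γ : ∀ {K : Type} {J : K → Type} [Finite K] [Nonempty K] [∀ k, Finite (J k)]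
    [∀ k, Nonempty (J k)] (X : (Σ k, J k) → PSpace),
    (F K).functor.obj (fun k => (F (J k)).functor.obj fun j => X ⟨k, j⟩) ⟶
      (F (Σ k, J k)).functor.obj X
  γ_naturality : ∀ {K : Type} {J : K → Type} [Finite K] [Nonempty K] [∀ k, Finite (J k)]
    [∀ k, Nonempty (J k)] {X Y : (Σ k, J k) → PSpace} (f : X ⟶ Y),
    (F K).functor.map (X := fun k => (F (J k)).functor.obj fun j => X ⟨k, j⟩)
        (Y := fun k => (F (J k)).functor.obj fun j => Y ⟨k, j⟩)
        (fun k => (F (J k)).functor.map (X := fun j => X ⟨k, j⟩) (Y := fun j => Y ⟨k, j⟩)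
          fun j => f ⟨k, j⟩) ≫ γ Y =
      γ X ≫ (F (Σ k, J k)).functor.map f
  /-- Equivariance. -/
  equivariant : ∀ {K K' : Type} {J : K → Type} {J' : K' → Type} [Finite K] [Nonempty K]
    [Finite K'] [Nonempty K'] [∀ k, Finite (J k)] [∀ k, Nonempty (J k)] [∀ k, Finite (J' k)]
    [∀ k, Nonempty (J' k)] (e : K ≃ K') (e' : ∀ k, J k ≃ J' (e k))
    (X : (Σ k, J' k) → PSpace),
    γ X ≫ σ (Equiv.sigmaCongr e e') X =
      σ e (fun k => (F (J' k)).functor.obj fun j => X ⟨k, j⟩) ≫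
        (F K).functor.map (X := fun k => (F (J' (e k))).functor.obj fun j => X ⟨e k, j⟩)
          (Y := fun k => (F (J k)).functor.obj fun j => X ⟨e k, e' k j⟩)
          (fun k => σ (e' k) fun j => X ⟨e k, j⟩) ≫
        γ (fun p : (Σ k, J k) => X ⟨e p.1, e' p.1 p.2⟩)
  /-- Associativity. -/
  assoc : ∀ {K : Type} {J : K → Type} {L : ∀ k, J k → Type} [Finite K] [Nonempty K]
    [∀ k, Finite (J k)] [∀ k, Nonempty (J k)] [∀ k j, Finite (L k j)] [∀ k j, Nonempty (L k j)]
    (X : (Σ k, Σ j, L k j) → PSpace),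
    (F K).functor.map
        (X := fun k => (F (J k)).functor.obj fun j => (F (L k j)).functor.obj fun l => X ⟨k, j, l⟩)
        (Y := fun k => (F (Σ j, L k j)).functor.obj fun q => X ⟨k, q⟩)
        (fun k => γ fun q : (Σ j, L k j) => X ⟨k, q⟩) ≫
      γ X ≫ σ (Equiv.sigmaAssoc L) X =
    γ (fun p : (Σ k, J k) => (F (L p.1 p.2)).functor.obj fun l => X ⟨p.1, p.2, l⟩) ≫
      γ (fun q : (Σ p : (Σ k, J k), L p.1 p.2) => X ⟨q.1.1, q.1.2, q.2⟩)
  /-- Left unit. -/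
  η_γ : ∀ {K : Type} [Finite K] [Nonempty K] (X : K → PSpace),
    η ((F K).functor.obj X) ≫ γ (fun p : (Σ _ : Unit, K) => X p.2) =
      σ (Equiv.uniqueSigma fun _ : Unit => K) X
  /-- Right unit. -/
  map_η_γ : ∀ {K : Type} [Finite K] [Nonempty K] (X : K → PSpace),
    (F K).functor.map (X := X) (Y := fun k => (F Unit).functor.obj fun _ => X k)
        (fun k => η (X k)) ≫ γ (fun p : (Σ _ : K, Unit) => X p.1) =
      σ (Equiv.sigmaPUnit K) X

/-! ### Multilinearization over `𝕀` -/

/-- The multilinearization `𝔻₁^{(K)} F(S⁰)` over `𝕀`, evaluated at `S⁰`. -/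
noncomputable def multilin {K : Type} [Finite K] (F : MFunctor K) : PSpace :=
  hocolim (loopDiagram F)

section action

variable (S : SymmFun) {K K' : Type} [Finite K] [Nonempty K] [Finite K'] [Nonempty K']

/-- The action of a bijection on `Ω^{∐ Uₖ} F(S^{U₁}, …, S^{Uₙ})`: it permutes the inputs of `F`
and block-permutes the loops. -/
noncomputable def loopAct (e : K ≃ K') (U : K' → II) :
    loopSpace (S.F K') U ⟶ loopSpace (S.F K) (fun k => U (e k)) where
  toFun f := sphereRelabel (Equiv.sigmaCongrLeft (β := fun k => Fin (U k).card) e) ≫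
    (f : sphere (Coord U) ⟶ (S.F K').functor.obj (spheres U)) ≫ S.σ e (spheres U)
  cont := by
    refine continuous_mapSpace ((continuous_hom_iff _).mpr fun L a M b => ?_)
    have h := (continuous_hom_iff (fun f : loopSpace (S.F K') U =>
      (f : sphere (Coord U) ⟶ (S.F K').functor.obj (spheres U)))).mp (continuous_of_mapSpace _ _) a
      ⟨fun m => (sphereRelabel (Equiv.sigmaCongrLeft (β := fun k => Fin (U k).card) e)).toFun (b m),
        (sphereRelabel _).cont.comp b.continuous⟩
    exact (S.σ e (spheres U)).cont.comp h
  map_pt := sphereHom_ext fun _ => PSpace.Hom.map_pt _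

lemma loopAct_coe (e : K ≃ K') (U : K' → II)
    (f : sphere (Coord U) ⟶ (S.F K').functor.obj (spheres U)) (z : Coord U → ℝ) :
    PSpace.Hom.toFun (X := sphere (Coord fun k => U (e k))) ((loopAct S e U).toFun f)
      (sphere.coe fun c => z (Equiv.sigmaCongrLeft (β := fun k => Fin (U k).card) e c)) =
    (S.σ e (spheres U)).toFun (f.toFun (sphere.coe z)) :=
  congrArg (fun s => (S.σ e (spheres U)).toFun (f.toFun s)) (sphereRelabel_coe _ z)

lemma loopAct_naturality (e : K ≃ K') {U V : K' → II} (i : U ⟶ V) :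
    stabMap (S.F K') i ≫ loopAct S e V =
      loopAct S e U ≫
        stabMap (S.F K) (U := fun k => U (e k)) (V := fun k => V (e k)) (fun k => i (e k)) := by
  ext f
  refine sphereHom_ext fun y => ?_
  obtain ⟨z, rfl⟩ : ∃ z : Coord V → ℝ,
      y = fun c => z (Equiv.sigmaCongrLeft (β := fun k => Fin (V k).card) e c) :=
    ⟨fun c => y ((Equiv.sigmaCongrLeft (β := fun k => Fin (V k).card) e).symm c),
      funext fun c => congrArg y (Equiv.symm_apply_apply _ c).symm⟩
  refine (loopAct_coe S e V _ z).trans ?_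
  have h1 := congrArg (fun φ => PSpace.Hom.toFun φ
    (PSpace.Hom.toFun (X := sphere (Coord U)) f (sphere.coe fun c => z (coordMap i c))))
    (S.σ_naturality e (insertMaps i fun v => (z v : OnePoint ℝ)))
  refine h1.trans ?_
  have h2 := loopAct_coe S e U f (fun c => z (coordMap i c))
  exact congrArg (PSpace.Hom.toFun ((S.F K).functor.map _)) h2.symm

/-- The action of a bijection on `𝔻₁^{(K)} F(S⁰)`. -/
noncomputable def multilinAct (e : K ≃ K') : multilin (S.F K') ⟶ multilin (S.F K) :=
  hocolim.map (Pi.comap (fun _ : K' => II) e)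
    { app := fun U => loopAct S e U
      naturality := fun _ _ i => loopAct_naturality S e i }

end action

/-- The symmetric sequence `𝔻₁^{(∗)} F_∗(S⁰)`. -/
noncomputable def multilinSeq (S : SymmFun) : SymmSeq where
  A K := multilin (S.F K)
  ρ e := multilinAct S e
  ρ_refl K _ _ := by
    ext x
    obtain ⟨⟨⟨p, c⟩, f, t⟩, rfl⟩ := Quot.exists_rep x
    refine congrArg (fun z => hocolim.mk (loopDiagram (S.F K)) c z t) ?_
    refine sphereHom_ext fun y => ?_
    refine (loopAct_coe S (Equiv.refl K) (c.obj 0) f y).trans ?_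
    rw [S.σ_refl]
    rfl
  ρ_trans {K K' K''} _ _ _ _ _ _ e e' := by
    ext x
    obtain ⟨⟨⟨p, c⟩, f, t⟩, rfl⟩ := Quot.exists_rep x
    refine congrArg (fun z => hocolim.mk (loopDiagram (S.F K))
      (c ⋙ Pi.comap (fun _ : K'' => II) (e.trans e')) z t) ?_
    refine sphereHom_ext fun y => ?_
    let E := Equiv.sigmaCongrLeft (β := fun k => Fin (c.obj 0 k).card) (e.trans e')
    obtain ⟨z, rfl⟩ : ∃ z : Coord (c.obj 0) → ℝ, y = fun c => z (E c) :=
      ⟨fun c => y (E.symm c), funext fun c => congrArg y (Equiv.symm_apply_apply E c).symm⟩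
    refine (loopAct_coe S (e.trans e') (c.obj 0) f z).trans ?_
    rw [S.σ_trans]
    refine Eq.trans ?_ (loopAct_coe S e (fun k => c.obj 0 (e' k)) _
      (fun d => z (Equiv.sigmaCongrLeft (β := fun k => Fin (c.obj 0 k).card) e' d))).symm
    exact congrArg (S.σ e (spheres fun k => c.obj 0 (e' k))).toFun
      (loopAct_coe S e' (c.obj 0) f z).symm

/-! ### Comparison with the usual multilinearization -/

/-- The inclusion `ℕ^K → 𝕀^K`. -/
def inclPi (K : Type) : (K → NN) ⥤ (K → II) := Functor.pi fun _ => inclNN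

/-- The usual multilinearization at `S⁰`, the homotopy colimit over `i₁, …, iₙ → ∞` of
`Ω^{i₁} ⋯ Ω^{iₙ} F(S^{i₁}, …, S^{iₙ})`. -/
noncomputable def usualMultilin {K : Type} [Finite K] (F : MFunctor K) : PSpace :=
  hocolim (inclPi K ⋙ loopDiagram F)

/-- The natural map from the usual multilinearization to the one over `𝕀`. -/
noncomputable def comparison {K : Type} [Finite K] (F : MFunctor K) :
    usualMultilin F ⟶ multilin F :=
  hocolim.map (inclPi K) (𝟙 _)

/-- A map `f : X → Y` is `n`-connected if it induces, for all basepoints, a bijection on `π_k` for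
`k < n` and a surjection for `k = n`.  This is expressed by compression: for `k ≤ n`, each map of
pairs `(I^k, ∂I^k) → (Y, X)` is homotopic relative to `∂I^k` to one that lifts to `X`. -/
def IsConnectedMap (n : ℤ) {X Y : PSpace} (f : X ⟶ Y) : Prop :=
  ∀ k : ℕ, (k : ℤ) ≤ n → ∀ (a : C(Cube.boundary (Fin k), X)) (b : C(Fin k → unitInterval, Y)),
    (∀ s : Cube.boundary (Fin k), f.toFun (a s) = b s) →
    ∃ a' : C(Fin k → unitInterval, X), (∀ s : Cube.boundary (Fin k), a' s = a s) ∧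
      (ContinuousMap.comp ⟨f.toFun, f.cont⟩ a').HomotopicRel b (Cube.boundary (Fin k))

/-- Weak homotopy equivalences. -/
def IsWeakEquiv {X Y : PSpace} (f : X ⟶ Y) : Prop := ∀ n : ℤ, IsConnectedMap n f

/-- The space `X` is well-pointed: `(X, *)` is an NDR pair. -/
def WellPointed (X : PSpace) : Prop :=
  ∃ (u : C(X, unitInterval)) (h : C(X × unitInterval, X)),
    (∀ x, u x = 0 ↔ x = X.pt) ∧ (∀ x, h (x, 0) = x) ∧ (∀ t, h (X.pt, t) = X.pt) ∧
      ∀ x, u x < 1 → h (x, 1) = X.pt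

/-- The size `|x|` of an object `x` of `𝕀^K`: the smallest of the cardinalities of its entries. -/
noncomputable def size {K : Type} (x : K → II) : ℕ := ⨅ k, (x k).card

/-- The connectivity condition on a diagram `G : 𝕀^K → 𝒯`: there are numbers `ν m → ∞` such that
`G` sends the maps of the full subcategory of objects receiving a map from `x` to
`ν |x|`-connected maps. -/
def ConnectivityCondition {K : Type} (G : (K → II) ⥤ PSpace) : Prop :=
  ∃ ν : ℕ → ℤ, Filter.Tendsto ν Filter.atTop Filter.atTop ∧
    ∀ x y z : K → II, Nonempty (x ⟶ y) → Nonempty (x ⟶ z) → ∀ f : y ⟶ z,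
      IsConnectedMap (ν (size x)) (G.map f)

/-! ### Smash products, and multilinearization at arbitrary spaces -/

/-- The identifications in the smash product: all points of the wedge are identified. -/
def SmashRel (X Y : PSpace) (p q : WithGeneratedByTopology CH (X × Y)) : Prop :=
  ((WithGeneratedByTopology.equiv p).1 = X.pt ∨ (WithGeneratedByTopology.equiv p).2 = Y.pt) ∧
    ((WithGeneratedByTopology.equiv q).1 = X.pt ∨ (WithGeneratedByTopology.equiv q).2 = Y.pt)

/-- The smash product `X ∧ Y` in `𝒯`. -/
def smash (X Y : PSpace) : PSpace where
  carrier := Quot (SmashRel X Y)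
  pt := Quot.mk _ (WithGeneratedByTopology.equiv.symm (X.pt, Y.pt))

/-- The point `x ∧ y`. -/
def smash.mk {X Y : PSpace} (x : X) (y : Y) : smash X Y :=
  Quot.mk _ (WithGeneratedByTopology.equiv.symm (x, y))

lemma smash.mk_eq_pt {X Y : PSpace} (x : X) (y : Y) (h : x = X.pt ∨ y = Y.pt) :
    smash.mk x y = (smash X Y).pt :=
  Quot.sound ⟨h, .inl rfl⟩

/-- The map `f ∧ Y`. -/
def smashMap {X X' : PSpace} (f : X ⟶ X') (Y : PSpace) : smash X Y ⟶ smash X' Y where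
  toFun := Quot.lift (fun p => smash.mk (f.toFun (WithGeneratedByTopology.equiv p).1)
      (WithGeneratedByTopology.equiv p).2) (by
    rintro p q ⟨hp, hq⟩
    rw [smash.mk_eq_pt, smash.mk_eq_pt]
    · exact hq.imp (fun h => by rw [h, f.map_pt]) id
    · exact hp.imp (fun h => by rw [h, f.map_pt]) id)
  cont := by
    refine continuous_quot_lift _ (continuous_quot_mk.comp ?_)
    have h : Continuous fun p : X × Y => (f.toFun p.1, p.2) :=
      (f.cont.comp continuous_fst).prodMk continuous_snd
    exact (h.continuousGeneratedBy (X := CH)).continuousMap.continuous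
  map_pt := smash.mk_eq_pt _ _ (.inr rfl)

/-- Continuity of `f ↦ f ∧ Y`. -/
lemma continuous_smashMap {X X' Y : PSpace} {A : Type} [TopologicalSpace A] [CompactSpace A]
    [T2Space A] (c : A → (X ⟶ X')) (hc : Continuous c) :
    Continuous fun a => smashMap (c a) Y := by
  refine (continuous_hom_iff _).mpr fun L a M b => ?_
  have key : ∀ (N : CompHaus.{0}) (q : C(CH N, X × Y)), Continuous fun p : CH N × CH L =>
      (smashMap (c (a p.2)) Y).toFun (smash.mk (q p.1).1 (q p.1).2) := by
    intro N q
    have h1 := (continuous_hom_iff c).mp hc a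
      ⟨fun n => (q n).1, continuous_fst.comp q.continuous⟩
    have h2 : Continuous fun p : CH N × CH L => ((c (a p.2)).toFun (q p.1).1, (q p.1).2) :=
      (h1.comp continuous_swap).prodMk
        (continuous_snd.comp (q.continuous.comp continuous_fst))
    exact continuous_quot_mk.comp
      ((IsGeneratedBy.equiv_symm_comp_continuous_iff (X := CH) _).mpr h2)
  have hs : ∀ s : smash X Y, Continuous fun l : CH L => (smashMap (c (a l)) Y).toFun s := by
    intro s
    obtain ⟨⟨x, y⟩, rfl⟩ := Quot.exists_rep s
    exact (key (CompHaus.of PUnit) ⟨fun _ => (x, y), continuous_const⟩).comp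
      (Continuous.prodMk_right PUnit.unit)
  let Φ : smash X Y → C(CH L, smash X' Y) := fun s => ⟨_, hs s⟩
  have hΦ : Continuous Φ := by
    refine (isQuotientMap_quot_mk (r := SmashRel X Y)).continuous_iff.mpr ?_
    refine (WithGeneratedByTopology.continuous_from_iff _).mpr fun N q => ?_
    exact (ContinuousMap.curry ⟨_, key N q⟩).continuous
  have h3 : Continuous (Function.uncurry fun s l => Φ s l) :=
    ContinuousMap.continuous_uncurry_of_continuous ⟨Φ, hΦ⟩
  exact h3.comp ((b.continuous.comp continuous_snd).prodMk continuous_fst)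

lemma smashMap_id (X Y : PSpace) : smashMap (𝟙 X) Y = 𝟙 (smash X Y) := by
  ext s
  obtain ⟨p, rfl⟩ := Quot.exists_rep s
  rfl

lemma smashMap_comp {X X' X'' : PSpace} (f : X ⟶ X') (g : X' ⟶ X'') (Y : PSpace) :
    smashMap (f ≫ g) Y = smashMap f Y ≫ smashMap g Y := by
  ext s
  obtain ⟨p, rfl⟩ := Quot.exists_rep s
  rfl

/-- The functor `(Y₁, …, Yₙ) ↦ F(Y₁ ∧ X₁, …, Yₙ ∧ Xₙ)`. -/
def MFunctor.smashRight {K : Type} (F : MFunctor K) (X : K → PSpace) : MFunctor K where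
  functor :=
    { obj := fun Y => F.functor.obj fun k => smash (Y k) (X k)
      map := fun {Y Y'} f => F.functor.map (X := fun k => smash (Y k) (X k))
        (Y := fun k => smash (Y' k) (X k)) fun k => smashMap (f k) (X k)
      map_id := fun Y => (congrArg (fun φ => F.functor.map φ)
        (funext fun k => smashMap_id (Y k) (X k))).trans (F.functor.map_id _)
      map_comp := fun {Y Y' Y''} f g => (congrArg (fun φ => F.functor.map φ)
        (funext fun k => smashMap_comp (f k) (g k) (X k))).trans (F.functor.map_comp _ _) }
  continuous_map Y Y' := fun i f =>
    F.continuous_map (fun k => smash (Y k) (X k)) (fun k => smash (Y' k) (X k)) (i := i)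
      ⟨fun a k => smashMap (f a k) (X k), continuous_pi fun k =>
        continuous_smashMap (A := CH i) (fun a => f a k)
          ((_root_.continuous_apply k).comp f.continuous)⟩
  multipointed Y := by
    rintro ⟨k, hk⟩
    refine F.multipointed _ ⟨k, ⟨fun s s' => ?_⟩⟩
    obtain ⟨p, rfl⟩ := Quot.exists_rep s
    obtain ⟨q, rfl⟩ := Quot.exists_rep s'
    exact Quot.sound ⟨.inl (Subsingleton.elim _ _), .inl (Subsingleton.elim _ _)⟩

/-! ### The composition of loops -/

section composition

/-- For `x ∈ F(S^{V₁}, …, S^{Vₙ})` and `d₁, …, dₙ ∈ ℝ^m`, the map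
`S^m → F(S^{m + V₁}, …, S^{m + Vₙ})` that assembles one copy of `S^m`, translated by `d_j`, into the
`j`-th variable of `F`:  it sends `z` to the image of `x` under the map induced by the maps
`S^{V_j} → S^{m + V_j}`, `w ↦ (z + d_j, w)`. -/
noncomputable def slideFun {J : Type} (F : MFunctor J) {m : ℕ} (V : J → ℕ) (d : J → Fin m → ℝ)
    (x : F.functor.obj fun j => sphere (Fin (V j))) :
    sphere (Fin m) → F.functor.obj fun j => sphere (Fin (m + V j)) :=
  sphereElim (F.functor.obj _).pt fun z =>
    (F.functor.map (X := fun j => sphere (Fin (V j))) (Y := fun j => sphere (Fin (m + V j)))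
      fun j => insertMap (Fin.natAddEmb m)
        (Fin.append (fun u => ((z u + d j u : ℝ) : OnePoint ℝ)) fun _ => ((0 : ℝ) : OnePoint ℝ))).toFun x

lemma slideFun_collapse {J : Type} [Nonempty J] (F : MFunctor J) {m : ℕ} (V : J → ℕ)
    (d : J → Fin m → ℝ) (x : F.functor.obj fun j => sphere (Fin (V j))) (z : Fin m → OnePoint ℝ) :
    slideFun F V d x (collapse z) =
      (F.functor.map (X := fun j => sphere (Fin (V j))) (Y := fun j => sphere (Fin (m + V j)))
        fun j => insertMap (Fin.natAddEmb m)
          (Fin.append (fun u => OnePoint.map (fun r => r + d j u) (z u))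
            fun _ => ((0 : ℝ) : OnePoint ℝ))).toFun x := by
  rcases eq_coe_or_infty z with ⟨z, rfl⟩ | ⟨u, hu⟩
  · rw [collapse_coe]
    rfl
  · rw [collapse_infty z hu]
    obtain ⟨j⟩ := ‹Nonempty J›
    rw [F.map_zero (k := j)]
    · rfl
    · refine insertMap_infty _ _ (v := Fin.castAdd _ u) ?_ ?_
      · rw [Fin.append_left, hu]
        rfl
      · rintro ⟨w, hw⟩
        have := congrArg Fin.val hw
        simp at this
        omega

/-- `slideFun` as a based map. -/
noncomputable def slide {J : Type} [Nonempty J] (F : MFunctor J) {m : ℕ} (V : J → ℕ)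
    (d : J → Fin m → ℝ) (x : F.functor.obj fun j => sphere (Fin (V j))) :
    sphere (Fin m) ⟶ F.functor.obj fun j => sphere (Fin (m + V j)) where
  toFun := slideFun F V d x
  cont := by
    suffices h : Continuous fun p : PUnit × sphere (Fin m) => slideFun F V d x p.2 from
      h.comp (Continuous.prodMk_right PUnit.unit)
    refine continuous_of_collapse _ ?_ continuous_const
    simp only [slideFun_collapse]
    refine F.continuous_apply (X := fun j => sphere (Fin (V j)))
      (Y := fun j => sphere (Fin (m + V j))) (fun p : PUnit × (Fin m → OnePoint ℝ) => fun j => insertMap (Fin.natAddEmb m)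
          (Fin.append (fun u => OnePoint.map (fun r => r + d j u) (p.2 u))
            fun _ => ((0 : ℝ) : OnePoint ℝ))) (fun j => ?_) continuous_const
    refine (continuous_hom_iff _).mpr fun L a M b => ?_
    have h1 : Continuous fun q : CH L × CH M =>
        ((Fin.append (fun u => OnePoint.map (fun r => r + d j u) ((a q.1).2 u))
            fun _ => ((0 : ℝ) : OnePoint ℝ), b q.2) :
          (Fin (m + V j) → OnePoint ℝ) × sphere (Fin (V j))) := by
      refine Continuous.prodMk (continuous_pi fun v => ?_) (b.continuous.comp continuous_snd)
      refine Fin.addCases (fun u => ?_) (fun w => ?_) v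
      · simp only [Fin.append_left]
        have h2 : Continuous (OnePoint.map fun r : ℝ => r + d j u) :=
          OnePoint.continuous_map (by fun_prop) (by
            rw [Filter.coclosedCompact_eq_cocompact]
            exact (Homeomorph.addRight (d j u)).isClosedEmbedding.tendsto_cocompact)
        exact h2.comp ((continuous_apply u).comp
          (continuous_snd.comp (a.continuous.comp continuous_fst)))
      · simp only [Fin.append_right]
        exact continuous_const
    exact (continuous_insertFun (Fin.natAddEmb m)).comp h1
  map_pt := rfl

variable {K : Type} {J : K → Type}

/-- The family of finite sets `(U_k ∐ V_{k,j})_{k,j}`. -/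
def addObj (U : K → II) (V : ∀ k, J k → II) : (Σ k, J k) → II :=
  fun p => ⟨(U p.1).card + (V p.1 p.2).card⟩

/-- The disjoint union `i ∐ j` of injections. -/
def addInj {m m' n n' : ℕ} (i : Fin m ↪ Fin m') (j : Fin n ↪ Fin n') :
    Fin (m + n) ↪ Fin (m' + n') :=
  (finSumFinEquiv.symm.toEmbedding.trans (i.sumMap j)).trans finSumFinEquiv.toEmbedding

lemma addInj_refl (m n : ℕ) :
    addInj (Function.Embedding.refl (Fin m)) (Function.Embedding.refl (Fin n)) =
      Function.Embedding.refl _ := by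
  ext x
  refine Fin.addCases (fun u => ?_) (fun w => ?_) x <;> simp [addInj]

lemma addInj_trans {m m' m'' n n' n'' : ℕ} (i : Fin m ↪ Fin m') (i' : Fin m' ↪ Fin m'')
    (j : Fin n ↪ Fin n') (j' : Fin n' ↪ Fin n'') :
    addInj (i.trans i') (j.trans j') = (addInj i j).trans (addInj i' j') := by
  ext x
  refine Fin.addCases (fun u => ?_) (fun w => ?_) x <;> simp [addInj]

/-- The functor `∐` applied to chains in `𝕀^K` and `𝕀^{J k}`. -/
def addChain {p : ℕ} (U : Fin (p + 1) ⥤ (K → II)) (V : ∀ k, Fin (p + 1) ⥤ (J k → II)) :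
    Fin (p + 1) ⥤ ((Σ k, J k) → II) where
  obj a := addObj (U.obj a) fun k => (V k).obj a
  map h := fun q => (addInj (II.inj (U.map h q.1)) (II.inj ((V q.1).map h q.2)) : Fin _ ↪ Fin _)
  map_id a := by
    funext q
    rw [U.map_id, (V q.1).map_id]
    exact addInj_refl _ _
  map_comp f g := by
    funext q
    rw [U.map_comp, (V q.1).map_comp]
    exact addInj_trans (II.inj (U.map f q.1)) (II.inj (U.map g q.1))
      (II.inj ((V q.1).map f q.2)) (II.inj ((V q.1).map g q.2))

variable [Finite K] [Nonempty K] [∀ k, Finite (J k)] [∀ k, Nonempty (J k)]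

/-- `h` is the composite of the loop `g : S^{∐ U_k} → F_K(S^{U₁}, …)` with the loops
`f_k : S^{∐ V_{k,j}} → F_{J k}((S^{V_{k,j}})_j)`.

Write the finite coordinates of a point of `S^{∐ (U_k ∐ V_{k,j})}` as `(y, v)`, with
`y_{k,j} ∈ ℝ^{U_k}` and `v_{k,j} ∈ ℝ^{V_{k,j}}`.  Under the homeomorphism
`S^{∐_{J k} U_k} ≅ S_{J k}^{∧ U_k} ∧ S^{U_k}` of the sphere operad, where `S_J` is the one-point
compactification of the open simplex, in the form `{d ∈ ℝ^J | max d = 0}`, the point `y_k`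
corresponds to `m_k = max_j y_{k,j}` and `d_{k,j} = y_{k,j} - m_k`.  Now `g` is evaluated at `m`,
the `f_k` at `v_k`, and the spheres are assembled into `F_K` and the `F_{J k}`; at last the
multiplication of the functor-operad is applied. -/
def IsLoopComposite (O : FunctorOperad) {U : K → II} {V : ∀ k, J k → II}
    (g : sphere (Coord U) ⟶ (O.F K).functor.obj (spheres U))
    (f : ∀ k, sphere (Coord (V k)) ⟶ (O.F (J k)).functor.obj (spheres (V k)))
    (h : sphere (Coord (addObj U V)) ⟶ (O.F (Σ k, J k)).functor.obj (spheres (addObj U V))) :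
    Prop :=
  ∀ y : Coord (addObj U V) → ℝ,
    let m : Coord U → ℝ := fun c => ⨆ j : J c.1, y ⟨⟨c.1, j⟩, Fin.castAdd _ c.2⟩
    let d : ∀ k, J k → Fin (U k).card → ℝ :=
      fun k j u => y ⟨⟨k, j⟩, Fin.castAdd _ u⟩ - m ⟨k, u⟩
    let v : ∀ k, Coord (V k) → ℝ := fun k c => y ⟨⟨k, c.1⟩, Fin.natAdd _ c.2⟩
    h.toFun (sphere.coe y) =
      (O.γ (spheres (addObj U V))).toFun
        (((O.F K).functor.map (X := spheres U)
          (Y := fun k => (O.F (J k)).functor.obj fun j => spheres (addObj U V) ⟨k, j⟩)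
          fun k => slide (O.F (J k)) (fun j => (V k j).card) (d k)
            ((f k).toFun (sphere.coe (v k)))).toFun (g.toFun (sphere.coe m)))

end composition

/-- The element of `Ω^∅ F₁(S^∅) = Map_*(S⁰, F₁(S⁰))` given by the unit `id → F₁` of the
functor-operad. -/
noncomputable def unitLoop (O : FunctorOperad) :
    sphere (Coord fun _ : Unit => (⟨0⟩ : II)) ⟶
      (O.F Unit).functor.obj (spheres fun _ : Unit => (⟨0⟩ : II)) :=
  sphereRelabel (Equiv.uniqueSigma fun _ : Unit => Fin 0) ≫ O.η (sphere (Fin 0))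

end Multilin

open Multilin

/-!
The homotopy colimits are realizations of simplicial spaces: `chainS D` consists of the chains in the
index category, with a point of the first space of the diagram `D`, and `toHocolim` collapses the
realization of the chains of basepoints.

**The operad structure.** Realization commutes with finite products of compactly generated spaces:
finitely many points of simplices are images of one interior point of a simplex
(`exists_common_refinement`), which gives a map `prodReal` from the product of realizations to the
realization of the product.  Hence a pointed simplicial map out of a product of chain spaces induces a map
of homotopy colimits (`smashHocolim`).  It is applied to the composition of loops `loopComp`, which is
natural in all index sets (`loopComp_naturality`).  In coordinates, the homeomorphism `𝐒_j ∧ S¹ ≅ S^j`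
separates the maximum of `j` real numbers from the differences to it.  The composition is continuous at
infinity because it is continuous on a compact space of maxima and differences, `SplitCoord`, which is
mapped onto the one-point compactification (`continuous_loopCompFun`).  Any finite number of points of
homotopy colimits are represented over a common point of a simplex.  The axioms of an operad therefore
follow from those for loops, namely `loopComp_equivariant`, `evalLoop_assoc`, `evalLoop_unit_comp` and
`evalLoop_comp_unit`; the first rests on the invariance of maxima under permutations, and the second on
the fact that iterated maxima are maxima.  The index sets of both sides of an axiom have equal
cardinality, but are equal only up to a cast, which is treated by `hocolim_mk_eq`.

**The comparison.** Let `N` be given, and let `m` be so large that `G` sends all maps between tuples of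
cardinalities at least `m` to `N`-connected maps.  The functor `U ↦ m ∐ U` receives a natural transformation from the
identity.  Hence the homotopy colimit of `G` is a homotopy retract of the homotopy colimit of the shifted
diagram, whose maps are all `N`-connected.  If all maps of a well-pointed diagram over a category with an
initial object are `N`-connected, then so are the inclusions of its values into the homotopy colimit
(`connMap_incl`).  It follows that the value at `m` is included in the homotopy colimit of `G` by an
`N`-connected map (`connMap_incl_shift`).  The same argument applies to the index category `ℕ^n`, and the
comparison map is `N`-connected by cancellation (`ConnMap.of_comp`).  No cofinality is needed.

The inclusion of a value is compared with the constant diagram at the value on the initial object, whose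
unbased homotopy colimit contracts to that value.  This uses two facts on realizations of simplicial spaces
whose degenerate simplices form open and closed subspaces.

* A levelwise `N`-connected map that preserves nondegenerate simplices has an `N`-connected realization
  (`SHom.ReflectsDeg.connMap_real`).  This is proved by induction over skeleta, since a map is
  `N`-connected if it is so over each member of an open cover that is closed under intersections
  (`ConnMap.of_cover`, by compression on the cells of a fine cubical grid).
* For a well-pointed diagram, the unbased and the based homotopy colimit agree (`connMap_toHocolim`):
  the subcomplex of the basepoints has the homotopy extension property
  (`exists_homotopy_extension_real`) and is contractible.
-/


namespace Multilin

/-! ### Points of simplices and monotone maps -/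

/-- `Δ n` is the standard `n`-simplex. -/
abbrev Δ (n : ℕ) : Type := stdSimplex ℝ (Fin (n + 1))

lemma map_apply_eq_sum {A B : Type} [Fintype A] [Fintype B] [DecidableEq B] (f : A → B)
    (s : stdSimplex ℝ A) (y : B) :
    (stdSimplex.map f s) y = ∑ x with f x = y, s x := by
  rw [stdSimplex.map_coe, FunOnFinite.linearMap_apply_apply]

lemma map_map_simplex {p q r : ℕ} (θ : Fin (p + 1) →o Fin (q + 1)) (φ : Fin (q + 1) →o Fin (r + 1))
    (t : Δ p) : stdSimplex.map φ (stdSimplex.map θ t) = stdSimplex.map (φ.comp θ) t :=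
  stdSimplex.map_comp_apply _ _ _

/-- The distribution function of a point of a simplex. -/
noncomputable def cum {n : ℕ} (t : Δ n) (l : Fin (n + 1)) : ℝ := ∑ m with m ≤ l, t m

lemma cum_mono {n : ℕ} (t : Δ n) : Monotone (cum t) := fun _ _ h =>
  Finset.sum_le_sum_of_subset_of_nonneg
    (fun m hm => by simp only [Finset.mem_filter] at *; exact ⟨hm.1, hm.2.trans h⟩)
    fun m _ _ => stdSimplex.zero_le t m

lemma cum_nonneg {n : ℕ} (t : Δ n) (l : Fin (n + 1)) : 0 ≤ cum t l :=
  Finset.sum_nonneg fun m _ => stdSimplex.zero_le t m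

lemma cum_last {n : ℕ} (t : Δ n) : cum t (Fin.last n) = 1 := by
  rw [← stdSimplex.sum_eq_one t, cum]
  congr 1
  ext m
  simp [Fin.le_last]

lemma cum_le_one {n : ℕ} (t : Δ n) (l : Fin (n + 1)) : cum t l ≤ 1 :=
  (cum_mono t (Fin.le_last l)).trans (cum_last t).le

lemma cum_injective {n : ℕ} {t t' : Δ n} (h : ∀ l, cum t l = cum t' l) : t = t' := by
  have key : ∀ (s : Δ n) (l : Fin (n + 1)), s l = cum s l - ∑ m with m < l, s m := by
    intro s l
    have : (Finset.univ.filter fun m => m ≤ l) = insert l (Finset.univ.filter fun m => m < l) := by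
      ext m; simp [le_iff_eq_or_lt]
    rw [cum, this, Finset.sum_insert (by simp)]
    ring
  refine stdSimplex.ext (funext fun l => ?_)
  induction l using Fin.induction with
  | zero => rw [key t, key t', h]; simp
  | succ i _ =>
    have : ∀ s : Δ n, ∑ m with m < i.succ, s m = cum s i.castSucc := fun s => by
      rw [cum]; congr 1; ext m; simp [Fin.le_castSucc_iff]
    rw [key t, key t', this, this, h, h]

lemma cum_map {p q : ℕ} (θ : Fin (p + 1) → Fin (q + 1)) (t : Δ p) (l : Fin (q + 1)) :
    cum (stdSimplex.map θ t) l = ∑ j with θ j ≤ l, t j := by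
  simp only [cum, map_apply_eq_sum]
  rw [← Finset.sum_biUnion]
  · congr 1; ext j; simp
  · intro a _ b _ hab
    rw [Function.onFun, Finset.disjoint_filter]
    rintro j - rfl h
    exact hab h

/-- A monotone map is determined by its effect on an interior point of the simplex. -/
lemma eq_of_map_eq {p q : ℕ} {θ θ' : Fin (p + 1) →o Fin (q + 1)} {t : Δ p} (ht : ∀ j, 0 < t j)
    (h : stdSimplex.map θ t = stdSimplex.map θ' t) : θ = θ' := by
  have aux : ∀ (θ θ' : Fin (p + 1) →o Fin (q + 1)),
      stdSimplex.map θ t = stdSimplex.map θ' t → ∀ j, θ j ≤ θ' j := by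
    intro θ θ' h j
    by_contra hj
    push Not at hj
    have hc := congrArg (fun s => cum s (θ' j)) h
    simp only [cum_map] at hc
    refine absurd hc (ne_of_lt (Finset.sum_lt_sum_of_subset (i := j) ?_ ?_ ?_ (ht j)
      fun m _ _ => (ht m).le))
    · intro m hm
      simp only [Finset.mem_filter, Finset.mem_univ, true_and] at hm ⊢
      have : m ≤ j := by
        by_contra hmj
        push Not at hmj
        exact absurd (θ.monotone hmj.le) (not_le.mpr (hm.trans_lt hj))
      exact θ'.monotone this
    · simp
    · simpa using hj
  ext j
  exact congrArg Fin.val (le_antisymm (aux θ θ' h j) (aux θ' θ h.symm j))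

lemma sum_steps {r : ℕ} (b : Fin (r + 2) → ℝ) (j₀ : Fin (r + 2)) :
    ∑ j : Fin (r + 1) with j.succ ≤ j₀, (b j.succ - b j.castSucc) = b j₀ - b 0 := by
  induction j₀ using Fin.induction with
  | zero => simp
  | succ i ih =>
    have : (Finset.univ.filter fun j : Fin (r + 1) => j.succ ≤ i.succ) =
        insert i (Finset.univ.filter fun j : Fin (r + 1) => j.succ ≤ i.castSucc) := by
      ext m
      simp only [Finset.mem_filter, Finset.mem_univ, true_and, Finset.mem_insert, Fin.le_def,
        Fin.val_succ, Fin.val_castSucc, Fin.ext_iff]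
      omega
    rw [this, Finset.sum_insert (by simp), ih]
    ring

/-- Finitely many points of simplices have a common refinement: they are images of one interior
point of a simplex, whose dimension is bounded.  The vertices of the new simplex are the steps
between consecutive values of the distribution functions. -/
lemma exists_common_refinement {ι : Type} [Finite ι] (p : ι → ℕ) :
    ∃ N : ℕ, ∀ t : ∀ i, Δ (p i), ∃ r ≤ N, ∃ (τ : Δ r) (θ : ∀ i, Fin (r + 1) →o Fin (p i + 1)),
      (∀ j, 0 < τ j) ∧ ∀ i, stdSimplex.map (θ i) τ = t i := by
  classical
  cases nonempty_fintype ι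
  refine ⟨Fintype.card (Σ i, Fin (p i + 1)) + 2, fun t => ?_⟩
  -- all values of the distribution functions
  let B : Finset ℝ := insert 0 (insert 1
    (Finset.univ.image fun x : (Σ i, Fin (p i + 1)) => cum (t x.1) x.2))
  have hB2 : 2 ≤ B.card := by
    rw [← Finset.card_pair (zero_ne_one' ℝ)]
    exact Finset.card_le_card (by intro x; simp only [B, Finset.mem_insert, Finset.mem_singleton]; tauto)
  obtain ⟨r, hr⟩ : ∃ r, B.card = r + 2 := ⟨B.card - 2, by omega⟩
  have hrN : r ≤ Fintype.card (Σ i, Fin (p i + 1)) + 2 := by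
    have h1 : B.card ≤ _ := (Finset.card_insert_le _ _).trans
      (Nat.add_le_add_right (Finset.card_insert_le _ _) 1)
    have h2 := Finset.card_image_le (s := (Finset.univ : Finset (Σ i, Fin (p i + 1))))
      (f := fun x => cum (t x.1) x.2)
    rw [Finset.card_univ] at h2
    omega
  -- these values in increasing order; the barycentric coordinates of the new point are the steps
  let b := B.orderEmbOfFin hr
  have hbs : StrictMono b := b.strictMono
  have hbrange : ∀ c ∈ B, ∃ j, b j = c := fun c hc => by
    have : c ∈ Set.range b := by
      rw [Finset.range_orderEmbOfFin B hr]
      exact hc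
    exact this
  have hBI : ∀ c ∈ B, 0 ≤ c ∧ c ≤ 1 := by
    intro c hc
    simp only [B, Finset.mem_insert, Finset.mem_image, Finset.mem_univ, true_and] at hc
    rcases hc with rfl | rfl | ⟨x, rfl⟩
    · simp
    · simp
    · exact ⟨cum_nonneg _ _, cum_le_one _ _⟩
  have hb0 : b 0 = 0 := by
    obtain ⟨j, hj⟩ := hbrange 0 (by simp [B])
    exact le_antisymm (hj ▸ hbs.monotone (Fin.zero_le j)) (hBI _ (Finset.orderEmbOfFin_mem B hr 0)).1
  have hb1 : b (Fin.last _) = 1 := by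
    obtain ⟨j, hj⟩ := hbrange 1 (by simp [B])
    exact le_antisymm (hBI _ (Finset.orderEmbOfFin_mem B hr _)).2 (hj ▸ hbs.monotone (Fin.le_last j))
  have hsum : ∑ j : Fin (r + 1), (b j.succ - b j.castSucc) = 1 := by
    have := sum_steps b (Fin.last _)
    rw [hb0, hb1, sub_zero] at this
    rw [← this]
    congr 1
    ext j
    simp [Fin.le_last]
  let τ : Δ r := ⟨fun j => b j.succ - b j.castSucc,
    fun j => sub_nonneg.mpr (hbs.monotone (Fin.castSucc_lt_succ).le), hsum⟩
  have hne : ∀ i (j : Fin (r + 1)),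
      (Finset.univ.filter fun l => b j.succ ≤ cum (t i) l).Nonempty := fun i j =>
    ⟨Fin.last _, by
      simp only [Finset.mem_filter, Finset.mem_univ, true_and, cum_last]
      exact (hBI _ (Finset.orderEmbOfFin_mem B hr _)).2⟩
  -- `θ i` is the quantile function of `t i`, which is constant on each step
  let θ₀ : ∀ i, Fin (r + 1) → Fin (p i + 1) := fun i j => Finset.min' _ (hne i j)
  have hθ : ∀ i j l, θ₀ i j ≤ l ↔ b j.succ ≤ cum (t i) l := by
    intro i j l
    constructor
    · intro h
      have := Finset.min'_mem _ (hne i j)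
      simp only [Finset.mem_filter, Finset.mem_univ, true_and] at this
      exact this.trans (cum_mono _ h)
    · intro h
      exact Finset.min'_le _ _ (by simpa using h)
  refine ⟨r, hrN, τ, fun i => ⟨θ₀ i, fun j j' h => ?_⟩, fun j => ?_, fun i => ?_⟩
  · rw [hθ]
    exact (hbs.monotone (Fin.succ_le_succ_iff.mpr h)).trans ((hθ i j' _).mp le_rfl)
  · exact sub_pos.mpr (hbs Fin.castSucc_lt_succ)
  · refine cum_injective fun l => ?_
    rw [cum_map]
    obtain ⟨j₀, hj₀⟩ := hbrange (cum (t i) l) (by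
      simp only [B, Finset.mem_insert, Finset.mem_image, Finset.mem_univ, true_and]
      exact .inr (.inr ⟨⟨i, l⟩, rfl⟩))
    have := sum_steps b j₀
    rw [hb0, sub_zero, hj₀] at this
    rw [← this]
    refine Finset.sum_congr ?_ fun _ _ => rfl
    ext j
    simp only [Finset.mem_filter, Finset.mem_univ, true_and]
    exact (hθ i j l).trans (by rw [← hj₀, hbs.le_iff_le])

/-- Each point of a simplex is in the interior of a unique face, which is spanned by its support. -/
lemma exists_restrict_support {p : ℕ} (t : Δ p) :
    ∃ r ≤ p, ∃ (τ : Δ r) (ε : Fin (r + 1) ↪o Fin (p + 1)),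
      (∀ j, 0 < τ j) ∧ stdSimplex.map ε τ = t ∧ ∀ l, 0 < t l ↔ l ∈ Set.range ε := by
  classical
  let s : Finset (Fin (p + 1)) := Finset.univ.filter fun l => 0 < t l
  have hs : s.Nonempty := by
    by_contra h
    have h0 : ∀ l, t l = 0 := fun l => le_antisymm
      (not_lt.mp fun hl => h ⟨l, by simpa [s] using hl⟩) (stdSimplex.zero_le t l)
    have := stdSimplex.sum_eq_one t
    simp [h0] at this
  obtain ⟨r, hr⟩ : ∃ r, s.card = r + 1 := ⟨s.card - 1, by have := hs.card_pos; omega⟩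
  have hrp : r ≤ p := by
    have := Finset.card_le_univ s
    simp at this
    omega
  let ε := s.orderEmbOfFin hr
  have hε : Set.range ε = s := Finset.range_orderEmbOfFin s hr
  have hpos : ∀ l, 0 < t l ↔ l ∈ Set.range ε := fun l => by rw [hε]; simp [s]
  have hsum : ∑ j, t (ε j) = 1 := by
    rw [← stdSimplex.sum_eq_one t]
    refine (Finset.sum_map Finset.univ ε.toEmbedding (fun l => t l)).symm.trans ?_
    refine Finset.sum_subset (Finset.subset_univ _) fun l _ hl => ?_
    refine le_antisymm (not_lt.mp fun h => hl ?_) (stdSimplex.zero_le t l)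
    obtain ⟨j, rfl⟩ := (hpos l).mp h
    exact Finset.mem_map_of_mem _ (Finset.mem_univ _)
  refine ⟨r, hrp, ⟨fun j => t (ε j), fun j => stdSimplex.zero_le t _, hsum⟩, ε,
    fun j => (hpos _).mpr ⟨j, rfl⟩, ?_, hpos⟩
  refine stdSimplex.ext (funext fun l => ?_)
  rw [map_apply_eq_sum]
  by_cases hl : l ∈ Set.range ε
  · obtain ⟨j, rfl⟩ := hl
    rw [Finset.sum_eq_single j]
    · rfl
    · intro m hm hne
      simp only [Finset.mem_filter, Finset.mem_univ, true_and] at hm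
      exact absurd (ε.injective hm) hne
    · simp
  · rw [Finset.sum_eq_zero]
    · exact (le_antisymm (not_lt.mp fun h => hl ((hpos l).mp h)) (stdSimplex.zero_le t l)).symm
    · intro m hm
      simp only [Finset.mem_filter, Finset.mem_univ, true_and] at hm
      exact absurd ⟨m, hm⟩ hl

/-! ### Compactly generated spaces -/

/-- The product of a compactly generated space and a compact Hausdorff space is compactly
generated. -/
instance instGeneratedProdCompact (A L : Type) [TopologicalSpace A] [IsGeneratedBy CH A]
    [TopologicalSpace L] [CompactSpace L] [T2Space L] : IsGeneratedBy CH (A × L) := by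
  let e : A × L → WithGeneratedByTopology CH (A × L) := WithGeneratedByTopology.equiv.symm
  have h1 : ∀ (K : CompHaus.{0}) (a : C(CH K, A)),
      Continuous fun q : CH K × L => e (a q.1, q.2) := fun K a => by
    refine (IsGeneratedBy.equiv_symm_comp_continuous_iff (X := CH) (Y := CH K × L)
      (fun q => (a q.1, q.2))).mpr ?_
    fun_prop
  have h2 : ∀ x : A, Continuous fun l : L => e (x, l) := fun x =>
    (h1 (CompHaus.of PUnit) ⟨fun _ => x, continuous_const⟩).comp (Continuous.prodMk_right PUnit.unit)
  let Φ : A → C(L, WithGeneratedByTopology CH (A × L)) := fun x => ⟨_, h2 x⟩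
  have hΦ : Continuous Φ := (IsGeneratedBy.continuous_iff CH Φ).mpr fun K a =>
    (ContinuousMap.curry ⟨_, h1 K a⟩).continuous
  exact ⟨ContinuousMap.continuous_uncurry_of_continuous ⟨Φ, hΦ⟩⟩

/-- The product of a quotient map with a space is a quotient map for the compactly generated
topologies.  By cartesian closedness, a map out of the product is a map to a mapping space. -/
lemma continuousGeneratedBy_of_quotient_param {A B Y Z : Type} [TopologicalSpace A]
    [TopologicalSpace B] [TopologicalSpace Y] [TopologicalSpace Z] [IsGeneratedBy CH A] {q : A → B}
    (hq : IsQuotientMap q) (f : B × Y → Z)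
    (h : ContinuousGeneratedBy CH fun x : A × Y => f (q x.1, x.2)) :
    ContinuousGeneratedBy CH f := by
  -- as a map from `B` to the space of maps `Y → Z`
  have hf : ∀ b, ContinuousGeneratedBy CH fun y => f (b, y) := fun b => by
    obtain ⟨a, rfl⟩ := hq.surjective b
    intro K y
    exact h (i := K) ⟨fun k => (a, y k), by fun_prop⟩
  let Φ : B → ContinuousMapGeneratedBy CH Y Z := fun b => ⟨_, hf b⟩
  have h1 : Continuous (Φ ∘ q) := by
    refine (IsGeneratedBy.continuous_iff CH _).mpr ?_
    refine (ContinuousMapGeneratedBy.continuousGeneratedBy_iff_uncurry (X := CH) (Φ ∘ q)).mpr ?_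
    intro K a L y
    exact h (i := CompHaus.of (CH K × CH L)) ⟨fun x => (a x.1, y x.2), by fun_prop⟩
  have h2 : Continuous Φ := hq.continuous_iff.mpr h1
  have h3 := (ContinuousMapGeneratedBy.continuousGeneratedBy_iff_uncurry (X := CH) Φ).mp
    h2.continuousGeneratedBy
  intro K x
  exact (h3 (i₁ := K) ⟨fun k => (x k).1, by fun_prop⟩ (i₂ := K) ⟨fun k => (x k).2, by fun_prop⟩).comp
    (continuous_id.prodMk continuous_id)

/-- A product of finitely many quotient maps of compactly generated spaces is a quotient map for the
compactly generated topologies. -/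
lemma continuousGeneratedBy_of_quotient_pi {ι : Type} [Finite ι] : ∀ (A B : ι → Type)
    [∀ i, TopologicalSpace (A i)] [∀ i, TopologicalSpace (B i)] [∀ i, IsGeneratedBy CH (A i)]
    (Y Z : Type) [TopologicalSpace Y] [TopologicalSpace Z] (q : ∀ i, A i → B i)
    (_ : ∀ i, IsQuotientMap (q i)) (f : (∀ i, B i) × Y → Z)
    (_ : ContinuousGeneratedBy CH fun x : (∀ i, A i) × Y => f (fun i => q i (x.1 i), x.2)),
    ContinuousGeneratedBy CH f := by
  refine Finite.induction_empty_option (P := fun ι => ∀ (A B : ι → Type)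
    [∀ i, TopologicalSpace (A i)] [∀ i, TopologicalSpace (B i)] [∀ i, IsGeneratedBy CH (A i)]
    (Y Z : Type) [TopologicalSpace Y] [TopologicalSpace Z] (q : ∀ i, A i → B i)
    (_ : ∀ i, IsQuotientMap (q i)) (f : (∀ i, B i) × Y → Z)
    (_ : ContinuousGeneratedBy CH fun x : (∀ i, A i) × Y => f (fun i => q i (x.1 i), x.2)),
    ContinuousGeneratedBy CH f) ?_ ?_ ?_ ι
  · intro ι κ e ih A B _ _ _ Y Z _ _ q hq f h
    have := ih (fun i => A (e i)) (fun i => B (e i)) Y Z (fun i => q (e i)) (fun i => hq (e i))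
      (fun x => f (Equiv.piCongrLeft B e x.1, x.2)) (by
        have hc : Continuous fun x : (∀ i, A (e i)) × Y => (Equiv.piCongrLeft A e x.1, x.2) :=
          ((Homeomorph.piCongrLeft (Y := A) e).continuous.comp continuous_fst).prodMk continuous_snd
        convert h.comp (hc.continuousGeneratedBy (X := CH)) using 1
        funext x
        refine congrArg (fun z => f (z, x.2)) (funext fun j => ?_)
        obtain ⟨i, rfl⟩ := e.surjective j
        simp only [Equiv.piCongrLeft_apply_apply])
    have hc : Continuous fun x : (∀ i, B i) × Y => ((fun i => x.1 (e i), x.2) :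
        (∀ i, B (e i)) × Y) := by fun_prop
    convert this.comp (hc.continuousGeneratedBy (X := CH)) using 1
    funext x
    refine congrArg (fun z => f (z, x.2)) (funext fun j => ?_)
    obtain ⟨i, rfl⟩ := e.surjective j
    exact (Equiv.piCongrLeft_apply_apply B e (fun i => x.1 (e i)) i).symm
  · intro A B _ _ _ Y Z _ _ q _ f h
    have hc : Continuous fun x : (∀ i, B i) × Y => ((fun i : PEmpty => i.elim, x.2) :
        (∀ i, A i) × Y) := by fun_prop
    convert h.comp (hc.continuousGeneratedBy (X := CH)) using 1
    funext x
    exact congrArg (fun z => f (z, x.2)) (funext fun i => i.elim)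
  · intro ι _ ih A B _ _ _ Y Z _ _ q hq f h
    -- the last variable first, and then the others
    have hc1 : Continuous fun x : A none × ((∀ i, A (some i)) × Y) =>
        ((fun o => Option.rec x.1 x.2.1 o, x.2.2) : (∀ o, A o) × Y) := by
      refine (continuous_pi fun o => ?_).prodMk (by fun_prop)
      cases o <;> fun_prop
    have h1 : ContinuousGeneratedBy CH fun x : A none × ((∀ i, A (some i)) × Y) =>
        f (fun o => Option.rec (q none x.1) (fun i => q (some i) (x.2.1 i)) o, x.2.2) := by
      convert h.comp (hc1.continuousGeneratedBy (X := CH)) using 1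
      funext x
      refine congrArg (fun z => f (z, x.2.2)) (funext fun o => ?_)
      cases o <;> rfl
    have h2 := continuousGeneratedBy_of_quotient_param (hq none)
      (fun x : B none × ((∀ i, A (some i)) × Y) =>
        f (fun o => Option.rec x.1 (fun i => q (some i) (x.2.1 i)) o, x.2.2)) h1
    have hc2 : Continuous fun x : (∀ i, A (some i)) × (B none × Y) =>
        ((x.2.1, (x.1, x.2.2)) : B none × ((∀ i, A (some i)) × Y)) := by fun_prop
    have h3 := ih (fun i => A (some i)) (fun i => B (some i)) (B none × Y) Z
      (fun i => q (some i)) (fun i => hq (some i))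
      (fun x : (∀ i, B (some i)) × (B none × Y) =>
        f (fun o => Option.rec (motive := B) x.2.1 x.1 o, x.2.2))
      (h2.comp (hc2.continuousGeneratedBy (X := CH)))
    have hc3 : Continuous fun x : (∀ o, B o) × Y =>
        ((fun i => x.1 (some i)), (x.1 none, x.2)) := by fun_prop
    convert h3.comp (hc3.continuousGeneratedBy (X := CH)) using 1
    funext x
    refine congrArg (fun z => f (z, x.2)) (funext fun o => ?_)
    cases o <;> rfl

end Multilin

namespace Multilin

/-! ### Simplicial spaces and products of realizations -/

/-- A simplicial space, with the monotone maps `[p] → [q]` acting from the right. -/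
structure SSp where
  obj : ℕ → Type
  [top : ∀ p, TopologicalSpace (obj p)]
  act : ∀ {p q : ℕ}, (Fin (p + 1) →o Fin (q + 1)) → obj q → obj p
  cont_act : ∀ {p q : ℕ} (θ : Fin (p + 1) →o Fin (q + 1)), Continuous (act θ)
  act_id : ∀ {p : ℕ} (x : obj p), act OrderHom.id x = x
  act_act : ∀ {p q r : ℕ} (θ : Fin (p + 1) →o Fin (q + 1)) (φ : Fin (q + 1) →o Fin (r + 1))
    (x : obj r), act θ (act φ x) = act (φ.comp θ) x

attribute [instance] SSp.top

/-- A map of simplicial spaces. -/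
structure SHom (X Y : SSp) where
  app : ∀ {p : ℕ}, X.obj p → Y.obj p
  cont : ∀ p : ℕ, Continuous (app (p := p))
  app_act : ∀ {p q : ℕ} (θ : Fin (p + 1) →o Fin (q + 1)) (x : X.obj q),
    app (X.act θ x) = Y.act θ (app x)

/-- The disjoint union of the spaces `Xₚ × Δᵖ`. -/
abbrev PreReal (X : SSp) : Type := Σ p : ℕ, X.obj p × Δ p

/-- The identifications made in the realization. -/
inductive RealRel (X : SSp) : PreReal X → PreReal X → Prop
  | mk {p q : ℕ} (θ : Fin (p + 1) →o Fin (q + 1)) (x : X.obj q) (t : Δ p) :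
      RealRel X ⟨q, x, stdSimplex.map θ t⟩ ⟨p, X.act θ x, t⟩

/-- The geometric realization of a simplicial space. -/
def Real (X : SSp) : Type := Quot (RealRel X)

instance (X : SSp) : TopologicalSpace (Real X) := inferInstanceAs (TopologicalSpace (Quot _))

instance (X : SSp) [∀ p, IsGeneratedBy CH (X.obj p)] : IsGeneratedBy CH (Real X) :=
  inferInstanceAs (IsGeneratedBy CH (Quot (RealRel X)))

/-- The point of the realization represented by `x ∈ Xₚ` and `t ∈ Δᵖ`. -/
def Real.mk (X : SSp) {p : ℕ} (x : X.obj p) (t : Δ p) : Real X := Quot.mk _ ⟨p, x, t⟩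

lemma Real.sound (X : SSp) {p q : ℕ} (θ : Fin (p + 1) →o Fin (q + 1)) (x : X.obj q) (t : Δ p) :
    Real.mk X x (stdSimplex.map θ t) = Real.mk X (X.act θ x) t :=
  Quot.sound (RealRel.mk θ x t)

lemma Real.ind {X : SSp} (h : Real X) : ∃ (p : ℕ) (x : X.obj p) (t : Δ p), h = Real.mk X x t := by
  obtain ⟨⟨p, x, t⟩, rfl⟩ := Quot.exists_rep h
  exact ⟨p, x, t, rfl⟩

lemma Real.continuous_mk (X : SSp) (p : ℕ) :
    Continuous fun z : X.obj p × Δ p => Real.mk X z.1 z.2 :=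
  continuous_quot_mk.comp (continuous_sigmaMk (σ := fun p => X.obj p × Δ p) (i := p))

/-- Continuous maps out of a realization. -/
lemma Real.continuous_lift {X : SSp} {Z : Type} [TopologicalSpace Z] (f : Real X → Z)
    (h : ∀ p, Continuous fun z : X.obj p × Δ p => f (Real.mk X z.1 z.2)) : Continuous f :=
  isQuotientMap_quot_mk.continuous_iff.mpr (continuous_sigma h)

/-- The map of realizations induced by a map of simplicial spaces. -/
def Real.map {X Y : SSp} (f : SHom X Y) : Real X → Real Y :=
  Quot.lift (fun z => Real.mk Y (f.app z.2.1) z.2.2) (by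
    rintro _ _ ⟨θ, x, t⟩
    rw [f.app_act]
    exact Real.sound Y θ (f.app x) t)

@[simp] lemma Real.map_mk {X Y : SSp} (f : SHom X Y) {p : ℕ} (x : X.obj p) (t : Δ p) :
    Real.map f (Real.mk X x t) = Real.mk Y (f.app x) t := rfl

lemma Real.continuous_map {X Y : SSp} (f : SHom X Y) : Continuous (Real.map f) :=
  Real.continuous_lift _ fun p => (Real.continuous_mk Y p).comp
    (((f.cont p).comp continuous_fst).prodMk continuous_snd)

/-- The product of a family of simplicial spaces, with the compactly generated topology. -/
abbrev prodS {ι : Type} (X : ι → SSp) : SSp where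
  obj p := WithGeneratedByTopology CH (∀ i, (X i).obj p)
  act θ x i := (X i).act θ (x i)
  cont_act {p q} θ := by
    have h : Continuous fun (x : ∀ i, (X i).obj q) i => (X i).act θ (x i) :=
      continuous_pi fun i => ((X i).cont_act θ).comp (continuous_apply i)
    exact (h.continuousGeneratedBy (X := CH)).continuousMap.continuous
  act_id _ := funext fun i => (X i).act_id _
  act_act _ _ _ := funext fun i => (X i).act_act _ _ _

section product

variable {ι : Type} [Finite ι] (X : ι → SSp)

lemma exists_refinement₂ {p q : ℕ} (s : Δ p) (t : Δ q) :
    ∃ (r : ℕ) (τ : Δ r) (θ : Fin (r + 1) →o Fin (p + 1)) (φ : Fin (r + 1) →o Fin (q + 1)),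
      (∀ j, 0 < τ j) ∧ stdSimplex.map θ τ = s ∧ stdSimplex.map φ τ = t := by
  obtain ⟨N, h⟩ := exists_common_refinement (ι := Bool) (fun b => cond b p q)
  obtain ⟨r, -, τ, θ, hτ, hθ⟩ := h (fun b => match b with | true => s | false => t)
  exact ⟨r, τ, θ true, θ false, hτ, hθ true, hθ false⟩

set_option linter.unusedSectionVars false in
/-- Two refinements of a family of points represent the same point of the realization of the
product. -/
lemma refinement_unique (p : ι → ℕ) (x : ∀ i, (X i).obj (p i)) {r r' : ℕ} (τ : Δ r) (τ' : Δ r')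
    (θ : ∀ i, Fin (r + 1) →o Fin (p i + 1)) (θ' : ∀ i, Fin (r' + 1) →o Fin (p i + 1))
    (h : ∀ i, stdSimplex.map (θ i) τ = stdSimplex.map (θ' i) τ') :
    Real.mk (prodS X) (p := r) (fun i => (X i).act (θ i) (x i)) τ =
      Real.mk (prodS X) (p := r') (fun i => (X i).act (θ' i) (x i)) τ' := by
  obtain ⟨s, ρ, α, α', hρ, rfl, rfl⟩ := exists_refinement₂ τ τ'
  refine (Real.sound (prodS X) α _ ρ).trans (Eq.trans ?_ (Real.sound (prodS X) α' _ ρ).symm)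
  congr 1
  funext i
  change (X i).act α _ = (X i).act α' _
  rw [SSp.act_act, SSp.act_act]
  congr 1
  refine eq_of_map_eq hρ ?_
  rw [← map_map_simplex, ← map_map_simplex, h]

/-- The product of a family of representatives. -/
noncomputable def prodFun (z : ∀ i, PreReal (X i)) : Real (prodS X) :=
  have h := (exists_common_refinement (fun i => (z i).1)).choose_spec fun i => (z i).2.2
  Real.mk (prodS X) (fun i => (X i).act (h.choose_spec.2.choose_spec.choose i) (z i).2.1)
    h.choose_spec.2.choose

lemma prodFun_eq (z : ∀ i, PreReal (X i)) {r : ℕ} (τ : Δ r)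
    (θ : ∀ i, Fin (r + 1) →o Fin ((z i).1 + 1)) (h : ∀ i, stdSimplex.map (θ i) τ = (z i).2.2) :
    prodFun X z = Real.mk (prodS X) (p := r) (fun i => (X i).act (θ i) (z i).2.1) τ := by
  have h' := (exists_common_refinement (fun i => (z i).1)).choose_spec fun i => (z i).2.2
  refine refinement_unique X (fun i => (z i).1) (fun i => (z i).2.1) _ _ _ _ fun i => ?_
  rw [h]
  exact h'.choose_spec.2.choose_spec.choose_spec.2 i

lemma RealRel.exists_refinement {X : SSp} {v v' : PreReal X} (h : v = v' ∨ RealRel X v v') {r : ℕ}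
    (τ : Δ r) (ψ : Fin (r + 1) →o Fin (v'.1 + 1)) (hψ : stdSimplex.map ψ τ = v'.2.2) :
    ∃ φ : Fin (r + 1) →o Fin (v.1 + 1), stdSimplex.map φ τ = v.2.2 ∧
      X.act φ v.2.1 = X.act ψ v'.2.1 := by
  rcases h with rfl | h
  · exact ⟨ψ, hψ, rfl⟩
  · obtain ⟨α, x, t⟩ := h
    exact ⟨α.comp ψ, (map_map_simplex ψ α τ).symm.trans (congrArg (stdSimplex.map α) hψ),
      (X.act_act _ _ _).symm⟩

lemma prodFun_rel (z z' : ∀ i, PreReal (X i)) (h : ∀ i, z i = z' i ∨ RealRel (X i) (z i) (z' i)) :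
    prodFun X z = prodFun X z' := by
  obtain ⟨r, -, τ, θ, -, hθ⟩ :=
    (exists_common_refinement (fun i => (z' i).1)).choose_spec fun i => (z' i).2.2
  have : ∀ i, ∃ φ : Fin (r + 1) →o Fin ((z i).1 + 1), stdSimplex.map φ τ = (z i).2.2 ∧
      (X i).act φ (z i).2.1 = (X i).act (θ i) (z' i).2.1 :=
    fun i => RealRel.exists_refinement (h i) τ (θ i) (hθ i)
  choose φ hφ hφ' using this
  rw [prodFun_eq X z τ φ hφ, prodFun_eq X z' τ θ hθ]
  congr 1
  exact funext hφ'

/-- `prodFun` is compatible with the simplicial relations in all variables, which are changed one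
after the other. -/
lemma prodFun_eq_of_eq (z z' : ∀ i, PreReal (X i))
    (h : ∀ i, (Quot.mk _ (z i) : Real (X i)) = Quot.mk _ (z' i)) :
    prodFun X z = prodFun X z' := by
  classical
  cases nonempty_fintype ι
  have step : ∀ (i : ι) (z : ∀ i, PreReal (X i)) (w : PreReal (X i)),
      (Quot.mk _ (z i) : Real (X i)) = Quot.mk _ w →
      prodFun X z = prodFun X (Function.update z i w) := by
    intro i z w hw
    have : ∀ v v' : PreReal (X i), RealRel (X i) v v' →
        prodFun X (Function.update z i v) = prodFun X (Function.update z i v') := by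
      intro v v' hv
      refine prodFun_rel X _ _ fun j => ?_
      by_cases hj : j = i
      · subst hj
        simpa using Or.inr hv
      · simp [hj]
    have := congrArg (Quot.lift (fun v => prodFun X (Function.update z i v)) this) hw
    simpa using this
  have : ∀ s : Finset ι, prodFun X z = prodFun X (s.piecewise z' z) := by
    intro s
    induction s using Finset.induction_on with
    | empty => simp
    | insert i s hi ih =>
      rw [ih, Finset.piecewise_insert]
      refine step i _ _ ?_
      rw [Finset.piecewise_eq_of_notMem _ _ _ hi]
      exact h i
  simpa using this Finset.univ

/-- The natural map from the product of the realizations to the realization of the product. -/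
noncomputable def prodReal (h : ∀ i, Real (X i)) : Real (prodS X) :=
  prodFun X fun i => (Quot.exists_rep (h i)).choose

lemma prodReal_mk (z : ∀ i, PreReal (X i)) :
    prodReal X (fun i => Quot.mk _ (z i)) = prodFun X z :=
  prodFun_eq_of_eq X _ _ fun i => (Quot.exists_rep (Quot.mk _ (z i) : Real (X i))).choose_spec

lemma prodReal_mk_same {p : ℕ} (x : ∀ i, (X i).obj p) (t : Δ p) :
    prodReal X (fun i => Real.mk (X i) (x i) t) = Real.mk (prodS X) (p := p) x t := by
  refine (prodReal_mk X fun i => ⟨p, x i, t⟩).trans ?_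
  refine (prodFun_eq X (fun i => ⟨p, x i, t⟩) t (fun _ => OrderHom.id) fun i =>
    stdSimplex.map_id_apply t).trans ?_
  congr 1
  funext i
  exact (X i).act_id _

/-- Finitely many points of realizations can be represented over the same point of a simplex. -/
lemma exists_common_rep (h : ∀ i, Real (X i)) :
    ∃ (r : ℕ) (τ : Δ r) (x : ∀ i, (X i).obj r), ∀ i, h i = Real.mk (X i) (x i) τ := by
  choose p x t hx using fun i => Real.ind (h i)
  obtain ⟨r, -, τ, θ, -, hθ⟩ := (exists_common_refinement p).choose_spec t
  refine ⟨r, τ, fun i => (X i).act (θ i) (x i), fun i => ?_⟩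
  rw [hx, ← Real.sound, hθ]

lemma exists_lift_sigma {L κ : Type} {A : κ → Type} [TopologicalSpace L]
    [∀ k, TopologicalSpace (A k)] (f : L → Σ k, A k) (hf : Continuous f) (k : κ)
    (h : ∀ l, (f l).1 = k) : ∃ g : L → A k, Continuous g ∧ ∀ l, f l = ⟨k, g l⟩ := by
  have : ∀ l, ∃ a, f l = ⟨k, a⟩ := fun l => by
    have := h l
    rcases hfl : f l with ⟨k', a⟩
    rw [hfl] at this
    obtain rfl : k' = k := this
    exact ⟨a, rfl⟩
  choose g hg using this
  refine ⟨g, ?_, hg⟩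
  rw [(IsOpenEmbedding.sigmaMk (σ := A) (i := k)).isEmbedding.continuous_iff]
  have : f = Sigma.mk k ∘ g := funext hg
  rwa [← this]

/-- For simplices of constant dimensions, there are finitely many types of common refinements, and the
space of all refinements of a given type is compact. -/
lemma continuous_prodFun_const {U : Type} [TopologicalSpace U] [CompactSpace U] [T2Space U]
    (p : ι → ℕ) (g : U → ∀ i, (X i).obj (p i) × Δ (p i)) (hg : Continuous g) :
    Continuous fun u => prodFun X fun i => ⟨p i, g u i⟩ := by
  classical
  obtain ⟨N, hN⟩ := exists_common_refinement p
  -- the compact space of all refinements, by simplices of bounded dimension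
  let Θ := Σ r : Fin (N + 1), ∀ i, Fin (r.1 + 1) →o Fin (p i + 1)
  have hfin : ∀ r : Fin (N + 1), Finite (∀ i, Fin (r.1 + 1) →o Fin (p i + 1)) := fun r => by
    have : ∀ i, Finite (Fin (r.1 + 1) →o Fin (p i + 1)) := fun i => DFunLike.finite _
    infer_instance
  have : Finite Θ := inferInstance
  let S : Θ → Set (U × ∀ r : Fin (N + 1), Δ r.1) := fun c =>
    {w | ∀ i, stdSimplex.map (c.2 i) (w.2 c.1) = (g w.1 i).2}
  have hS : ∀ c, IsClosed (S c) := fun c => by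
    have : S c = ⋂ i, {w | stdSimplex.map (c.2 i) (w.2 c.1) = (g w.1 i).2} := by
      ext; simp [S]
    rw [this]
    refine isClosed_iInter fun i => isClosed_eq ?_ ?_
    · exact (stdSimplex.continuous_map _).comp ((continuous_apply c.1).comp continuous_snd)
    · exact continuous_snd.comp ((continuous_apply i).comp (hg.comp continuous_fst))
  have : ∀ c, CompactSpace (S c) := fun c => isCompact_iff_compactSpace.mp (hS c).isCompact
  let q : (Σ c, S c) → U := fun w => w.2.1.1
  have hq : Continuous q := continuous_sigma fun c => continuous_fst.comp continuous_subtype_val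
  have hs : Function.Surjective q := by
    intro u
    obtain ⟨r, hr, τ, θ, -, hθ⟩ := hN fun i => (g u i).2
    let r' : Fin (N + 1) := ⟨r, by omega⟩
    let τ' : ∀ r : Fin (N + 1), Δ r.1 :=
      Function.update (fun _ => Classical.arbitrary _) r' (show Δ r'.1 from τ)
    have hτ' : τ' r' = τ := Function.update_self _ _ _
    refine ⟨⟨⟨r', θ⟩, ⟨(u, τ'), fun i => ?_⟩⟩, rfl⟩
    change stdSimplex.map (θ i) (τ' r') = _
    rw [hτ']
    exact hθ i
  rw [(IsQuotientMap.of_surjective_continuous hs hq).continuous_iff]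
  refine continuous_sigma fun c => ?_
  have : ((fun u => prodFun X fun i => ⟨p i, g u i⟩) ∘ q) ∘ Sigma.mk c = fun w : S c =>
      Real.mk (prodS X) (p := c.1.1) (fun i => (X i).act (c.2 i) (g w.1.1 i).1) (w.1.2 c.1) := by
    funext w
    exact prodFun_eq X (fun i => ⟨p i, g w.1.1 i⟩) (w.1.2 c.1) c.2 w.2
  refine (this ▸ ?_ : Continuous (((fun u => prodFun X fun i => ⟨p i, g u i⟩) ∘ q) ∘ Sigma.mk c))
  refine (Real.continuous_mk (prodS X) c.1.1).comp (Continuous.prodMk ?_ ?_)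
  · refine (IsGeneratedBy.equiv_symm_comp_continuous_iff (X := CH) (Y := S c)
      (fun w i => (X i).act (c.2 i) (g w.1.1 i).1)).mpr ?_
    refine continuous_pi fun i => ((X i).cont_act _).comp ?_
    exact continuous_fst.comp ((continuous_apply i).comp
      (hg.comp (continuous_fst.comp continuous_subtype_val)))
  · exact (continuous_apply c.1).comp (continuous_snd.comp continuous_subtype_val)

lemma continuousGeneratedBy_prodFun : ContinuousGeneratedBy CH (prodFun X) := by
  intro K a
  change Continuous fun l : CH K => prodFun X (a l)
  rw [continuous_iff_continuousAt]
  intro l₀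
  -- the dimensions of the simplices are locally constant
  let U : Set (CH K) := {l | ∀ i, (a l i).1 = (a l₀ i).1}
  have hU : IsClopen U := by
    have : U = ⋂ i, (fun l => (a l i).1) ⁻¹' {(a l₀ i).1} := by ext; simp [U]
    rw [this]
    refine isClopen_iInter_of_finite fun i => (isClopen_discrete _).preimage ?_
    have h1 : Continuous fun z : PreReal (X i) => z.1 :=
      continuous_sigma fun p => continuous_const
    exact h1.comp ((continuous_apply i).comp a.continuous)
  have hc : CompactSpace (CH K) := inferInstanceAs (CompactSpace K)
  have ht : T2Space (CH K) := inferInstanceAs (T2Space K)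
  have : CompactSpace U := isCompact_iff_compactSpace.mp hU.1.isCompact
  have hlift := fun i => exists_lift_sigma (fun u : U => a u.1 i)
    ((continuous_apply i).comp (a.continuous.comp continuous_subtype_val)) (a l₀ i).1
    fun u => u.2 i
  choose g hg hg' using hlift
  have h := continuous_prodFun_const X (fun i => (a l₀ i).1) (fun (u : U) i => g i u)
    (continuous_pi hg)
  have h2 : ContinuousOn (fun l => prodFun X (a l)) U := by
    rw [continuousOn_iff_continuous_domRestrict]
    convert h using 1
    funext u
    exact congrArg (prodFun X) (funext fun i => hg' i u)
  exact h2.continuousAt (hU.2.mem_nhds fun i => rfl)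

/-- The natural map from the product of the realizations to the realization of the product is
continuous for the compactly generated topology. -/
lemma continuousGeneratedBy_prodReal [∀ i p, IsGeneratedBy CH ((X i).obj p)] :
    ContinuousGeneratedBy CH (prodReal X) := by
  have h1 : ContinuousGeneratedBy CH fun x : (∀ i, PreReal (X i)) × PUnit.{1} =>
      prodReal X fun i => Quot.mk _ (x.1 i) := by
    have : (fun x : (∀ i, PreReal (X i)) × PUnit.{1} => prodReal X fun i => Quot.mk _ (x.1 i)) =
        prodFun X ∘ Prod.fst := funext fun x => prodReal_mk X x.1
    rw [this]
    exact (continuousGeneratedBy_prodFun X).comp continuous_fst.continuousGeneratedBy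
  have h := continuousGeneratedBy_of_quotient_pi (fun i => PreReal (X i)) (fun i => Real (X i))
    PUnit.{1} (Real (prodS X)) (fun i z => (Quot.mk _ z : Real (X i)))
    (fun i => isQuotientMap_quot_mk) (fun x => prodReal X x.1) h1
  intro K a
  exact h (i := K) ⟨fun k => (a k, PUnit.unit.{1}), a.continuous.prodMk continuous_const⟩

end product

end Multilin

namespace Multilin

/-! ### Homotopy colimits as quotients of realizations -/

section chains

variable {C : Type} [Category.{0} C]

lemma map_toFun_id (D : C ⥤ PSpace) {a : C} {f : a ⟶ a} (h : f = 𝟙 a) (x : D.obj a) :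
    (D.map f).toFun x = x := by
  rw [h, D.map_id]
  rfl

lemma map_toFun_comp (D : C ⥤ PSpace) {a b c : C} {f : a ⟶ b} {g : b ⟶ c} {k : a ⟶ c}
    (h : k = f ≫ g) (x : D.obj a) :
    (D.map g).toFun ((D.map f).toFun x) = (D.map k).toFun x := by
  rw [h, D.map_comp]
  rfl

/-- The simplicial replacement of a diagram `D`: its space of `p`-simplices is the disjoint union of
the spaces `D(c₀)` over the chains `c₀ → ⋯ → c_p`. -/
abbrev chainS (D : C ⥤ PSpace) : SSp where
  obj p := Σ c : Fin (p + 1) ⥤ C, D.obj (c.obj 0)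
  act θ z := ⟨θ.monotone.functor ⋙ z.1,
    (D.map (z.1.map (homOfLE (Fin.zero_le (θ 0))))).toFun z.2⟩
  cont_act {p _} θ := continuous_sigma fun c =>
    (continuous_sigmaMk (σ := fun c : Fin (p + 1) ⥤ C => D.obj (c.obj 0))
      (i := θ.monotone.functor ⋙ c)).comp (D.map (c.map (homOfLE (Fin.zero_le (θ 0))))).cont
  act_id z := congrArg (Sigma.mk z.1) (map_toFun_id D (z.1.map_id _) z.2)
  act_act {p _ _} θ φ z :=
    congrArg (Sigma.mk (β := fun c : Fin (p + 1) ⥤ C => D.obj (c.obj 0))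
      ((φ.comp θ).monotone.functor ⋙ z.1)) (map_toFun_comp D (z.1.map_comp
        (homOfLE (Fin.zero_le (φ 0))) (homOfLE (φ.monotone (Fin.zero_le (θ 0))))) z.2)

lemma chainS_ext {D : C ⥤ PSpace} {p : ℕ} {z w : (chainS D).obj p} (h : z.1 = w.1)
    (h' : (D.map (eqToHom (congrArg (fun c => c.obj 0) h))).toFun z.2 = w.2) : z = w := by
  obtain ⟨c, x⟩ := z
  obtain ⟨c', x'⟩ := w
  obtain rfl : c = c' := h
  rw [eqToHom_refl, D.map_id] at h'
  exact congrArg (Sigma.mk c) h'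

variable [Nonempty C] (D : C ⥤ PSpace)

/-- The quotient map from the realization of the simplicial replacement (the unbased homotopy
colimit) to the based homotopy colimit. -/
noncomputable def toHocolim : Real (chainS D) → hocolim D :=
  Quot.lift (fun z => hocolim.mk D z.2.1.1 z.2.1.2 z.2.2) (by
    rintro _ _ ⟨θ, x, t⟩
    exact Quot.sound (HocolimRel.simplicial θ x.1 x.2 t))

lemma toHocolim_mk {p : ℕ} (z : (chainS D).obj p) (t : Δ p) :
    toHocolim D (Real.mk (chainS D) z t) = hocolim.mk D z.1 z.2 t := rfl

variable {D} in
lemma hocolim.ind (h : hocolim D) : ∃ (p : ℕ) (c : Fin (p + 1) ⥤ C) (x : D.obj (c.obj 0)) (t : Δ p),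
    h = hocolim.mk D c x t := by
  obtain ⟨⟨⟨p, c⟩, x, t⟩, rfl⟩ := Quot.exists_rep h
  exact ⟨p, c, x, t, rfl⟩

lemma surjective_toHocolim : Function.Surjective (toHocolim D) := fun h => by
  obtain ⟨p, c, x, t, rfl⟩ := hocolim.ind h
  exact ⟨Real.mk (chainS D) ⟨c, x⟩ t, rfl⟩

lemma hocolim.continuous_mk {p : ℕ} (c : Fin (p + 1) ⥤ C) :
    Continuous fun z : D.obj (c.obj 0) × Δ p => hocolim.mk D c z.1 z.2 := by
  refine continuous_quot_mk.comp ?_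
  refine (IsGeneratedBy.equiv_symm_comp_continuous_iff (X := CH) (Y := D.obj (c.obj 0) × Δ p)
    (fun z => (⟨⟨p, c⟩, z⟩ : ChainSpace D))).mpr ?_
  exact continuous_sigmaMk (σ := fun s : (Σ p : ℕ, Fin (p + 1) ⥤ C) =>
      D.obj (s.2.obj 0) × stdSimplex ℝ (Fin (s.1 + 1))) (i := ⟨p, c⟩)

lemma hocolim.continuous_lift {D : C ⥤ PSpace} {Z : Type} [TopologicalSpace Z] (f : hocolim D → Z)
    (h : ∀ (p : ℕ) (c : Fin (p + 1) ⥤ C),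
      Continuous fun z : D.obj (c.obj 0) × Δ p => f (hocolim.mk D c z.1 z.2)) : Continuous f := by
  refine (isQuotientMap_quot_mk (r := HocolimRel D)).continuous_iff.mpr ?_
  have h1 : Continuous fun z : ChainSpace D => f (hocolim.mk D z.1.2 z.2.1 z.2.2) :=
    continuous_sigma fun s => h s.1 s.2
  exact h1.comp WithGeneratedByTopology.continuous_equiv

lemma continuous_toHocolim : Continuous (toHocolim D) := by
  refine Real.continuous_lift _ fun p => ?_
  have h1 : Continuous fun z : (Σ c : Fin (p + 1) ⥤ C, D.obj (c.obj 0)) × Δ p =>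
      (Homeomorph.sigmaProdDistrib z) := Homeomorph.continuous _
  have h2 : Continuous fun z : (Σ c : Fin (p + 1) ⥤ C, D.obj (c.obj 0) × Δ p) =>
      hocolim.mk D z.1 z.2.1 z.2.2 := continuous_sigma fun c => hocolim.continuous_mk D c
  have h3 := h2.comp h1
  exact h3

lemma isQuotientMap_toHocolim : IsQuotientMap (toHocolim D) := by
  refine isQuotientMap_iff_isClosed.mpr ⟨surjective_toHocolim D, fun s =>
    ⟨fun h => h.preimage (continuous_toHocolim D), fun h => ?_⟩⟩
  rw [← isOpen_compl_iff] at h ⊢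
  have h1 : Continuous fun h : hocolim D => (h ∈ sᶜ : Prop) := by
    refine hocolim.continuous_lift _ fun p c => ?_
    have h2 : Continuous fun h : Real (chainS D) => (toHocolim D h ∈ sᶜ : Prop) :=
      continuous_Prop.mpr h
    exact h2.comp ((Real.continuous_mk (chainS D) p).comp
      (((continuous_sigmaMk (σ := fun c : Fin (p + 1) ⥤ C => D.obj (c.obj 0))).comp
        continuous_fst).prodMk continuous_snd))
  exact continuous_Prop.mp h1

/-- The points of the unbased homotopy colimit that lie over basepoints. -/
def baseSet : Set (Real (chainS D)) :=
  {h | ∃ (p : ℕ) (c : Fin (p + 1) ⥤ C) (t : Δ p),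
    h = Real.mk (chainS D) ⟨c, (D.obj (c.obj 0)).pt⟩ t}

lemma toHocolim_eq_pt {h : Real (chainS D)} (hh : h ∈ baseSet D) :
    toHocolim D h = (hocolim D).pt := by
  obtain ⟨p, c, t, rfl⟩ := hh
  exact hocolim.mk_pt D c t

lemma toHocolim_eq_iff {h h' : Real (chainS D)} :
    toHocolim D h = toHocolim D h' ↔ h = h' ∨ (h ∈ baseSet D ∧ h' ∈ baseSet D) := by
  constructor
  · intro e
    let s : Setoid (Real (chainS D)) :=
      { r := fun h h' => h = h' ∨ (h ∈ baseSet D ∧ h' ∈ baseSet D)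
        iseqv := ⟨fun _ => .inl rfl, fun h => h.imp Eq.symm And.symm, by
          rintro a b c (rfl | h) (rfl | h')
          · exact .inl rfl
          · exact .inr h'
          · exact .inr h
          · exact .inr ⟨h.1, h'.2⟩⟩ }
    let φ : hocolim D → Quotient s := Quot.lift (fun z => ⟦Real.mk (chainS D)
        ⟨(WithGeneratedByTopology.equiv z).1.2, (WithGeneratedByTopology.equiv z).2.1⟩
        (WithGeneratedByTopology.equiv z).2.2⟧) (by
      rintro _ _ (⟨θ, c, x, t⟩ | ⟨c, c', t, t'⟩)
      · exact congrArg _ (Real.sound (chainS D) θ ⟨c, x⟩ t)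
      · exact Quotient.sound (.inr ⟨⟨_, c, t, rfl⟩, ⟨_, c', t', rfl⟩⟩))
    have hφ : ∀ h, φ (toHocolim D h) = ⟦h⟧ := fun h => by
      obtain ⟨p, x, t, rfl⟩ := Real.ind h
      rfl
    have := congrArg φ e
    rw [hφ, hφ] at this
    exact Quotient.exact this
  · rintro (rfl | ⟨h1, h2⟩)
    · rfl
    · rw [toHocolim_eq_pt D h1, toHocolim_eq_pt D h2]

lemma hocolim.mk_congr {p : ℕ} {c c' : Fin (p + 1) ⥤ C} (h : c = c') (x : D.obj (c.obj 0))
    (x' : D.obj (c'.obj 0))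
    (hx : (D.map (eqToHom (congrArg (fun c => c.obj 0) h))).toFun x = x') (t : Δ p) :
    hocolim.mk D c x t = hocolim.mk D c' x' t :=
  congrArg (fun z : (chainS D).obj p => hocolim.mk D z.1 z.2 t)
    (chainS_ext (z := ⟨c, x⟩) (w := ⟨c', x'⟩) h hx)

end chains

/-! ### Maps out of smash products of homotopy colimits -/

/-- A diagram of pointed spaces together with its indexing category. -/
structure Dgm where
  C : Type
  [cat : Category.{0} C]
  [ne : Nonempty C]
  D : C ⥤ PSpace

attribute [instance] Dgm.cat Dgm.ne

section smash

variable {ι : Type} [Finite ι] (Y : ι → Dgm) {E : Dgm}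
  (μ : SHom (prodS fun i => chainS (Y i).D) (chainS E.D))

lemma exists_common_rep_hocolim (h : ∀ i, hocolim (Y i).D) :
    ∃ (r : ℕ) (τ : Δ r) (c : ∀ i, Fin (r + 1) ⥤ (Y i).C) (x : ∀ i, (Y i).D.obj ((c i).obj 0)),
      ∀ i, h i = hocolim.mk (Y i).D (c i) (x i) τ := by
  choose a ha using fun i => surjective_toHocolim (Y i).D (h i)
  obtain ⟨r, τ, x, hx⟩ := exists_common_rep (fun i => chainS (Y i).D) a
  exact ⟨r, τ, fun i => (x i).1, fun i => (x i).2, fun i => by rw [← ha, hx]; rfl⟩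

/-- The map `⋀ᵢ hocolim Dᵢ → hocolim E` induced by a simplicial map from the product of the
simplicial replacements. -/
noncomputable def smashHocolim (h : ∀ i, hocolim (Y i).D) : hocolim E.D :=
  toHocolim E.D (Real.map μ (prodReal _ fun i =>
    Function.surjInv (surjective_toHocolim (Y i).D) (h i)))

/-- The map `μ` is pointed in each variable. -/
def PointedMap : Prop := ∀ (p : ℕ) (x : ∀ i, (chainS (Y i).D).obj p) (i : ι),
  (x i).2 = ((Y i).D.obj ((x i).1.obj 0)).pt →
    (μ.app (p := p) x).2 = (E.D.obj ((μ.app (p := p) x).1.obj 0)).pt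

variable {Y} {μ} (hμ : PointedMap Y μ)

include hμ

lemma map_prodReal_base (a : ∀ i, Real (chainS (Y i).D)) (i : ι) (hi : a i ∈ baseSet (Y i).D) :
    toHocolim E.D (Real.map μ (prodReal _ a)) = (hocolim E.D).pt := by
  classical
  have : ∀ j, ∃ z : PreReal (chainS (Y j).D), a j = Quot.mk _ z ∧
      (j = i → z.2.1.2 = ((Y j).D.obj (z.2.1.1.obj 0)).pt) := by
    intro j
    by_cases hj : j = i
    · subst hj
      obtain ⟨p, c, t, h⟩ := hi
      exact ⟨⟨p, ⟨c, _⟩, t⟩, h, fun _ => rfl⟩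
    · obtain ⟨z, hz⟩ := Quot.exists_rep (a j)
      exact ⟨z, hz.symm, fun h => absurd h hj⟩
  choose z hz hz' using this
  obtain ⟨r, -, τ, θ, -, hθ⟩ :=
    (exists_common_refinement (fun i => (z i).1)).choose_spec fun i => (z i).2.2
  have e : prodReal _ a = Real.mk (prodS fun i => chainS (Y i).D) (p := r)
      (fun i => (chainS (Y i).D).act (θ i) (z i).2.1) τ := by
    rw [show a = fun i => Quot.mk _ (z i) from funext hz, prodReal_mk]
    exact prodFun_eq _ z τ θ hθ
  rw [e]
  refine (congrArg (toHocolim E.D) (Real.map_mk μ _ τ)).trans ((toHocolim_mk E.D _ τ).trans ?_)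
  have := hμ r (fun i => (chainS (Y i).D).act (θ i) (z i).2.1) i
    ((congrArg _ (hz' i rfl)).trans (PSpace.Hom.map_pt _))
  rw [this]
  exact hocolim.mk_pt E.D _ _

lemma smashHocolim_toHocolim (a : ∀ i, Real (chainS (Y i).D)) :
    smashHocolim Y μ (fun i => toHocolim (Y i).D (a i)) =
      toHocolim E.D (Real.map μ (prodReal _ a)) := by
  let a' : ∀ i, Real (chainS (Y i).D) := fun i =>
    Function.surjInv (surjective_toHocolim (Y i).D) (toHocolim (Y i).D (a i))
  have h : ∀ i, toHocolim (Y i).D (a' i) = toHocolim (Y i).D (a i) := fun i =>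
    Function.surjInv_eq _ _
  simp only [toHocolim_eq_iff] at h
  change toHocolim E.D (Real.map μ (prodReal _ a')) = _
  by_cases hb : ∃ i, a' i ∈ baseSet (Y i).D ∧ a i ∈ baseSet (Y i).D
  · obtain ⟨i, h1, h2⟩ := hb
    rw [map_prodReal_base hμ a' i h1, map_prodReal_base hμ a i h2]
  · have : a' = a := funext fun i => (h i).resolve_right fun h' => hb ⟨i, h'⟩
    rw [this]

lemma smashHocolim_mk {r : ℕ} (τ : Δ r) (c : ∀ i, Fin (r + 1) ⥤ (Y i).C)
    (x : ∀ i, (Y i).D.obj ((c i).obj 0)) :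
    smashHocolim Y μ (fun i => hocolim.mk (Y i).D (c i) (x i) τ) =
      hocolim.mk E.D (μ.app (p := r) fun i => ⟨c i, x i⟩).1
        (μ.app (p := r) fun i => ⟨c i, x i⟩).2 τ := by
  have := smashHocolim_toHocolim hμ
    (fun i => Real.mk (chainS (Y i).D) (p := r) ⟨c i, x i⟩ τ)
  rw [prodReal_mk_same] at this
  exact this

lemma smashHocolim_pt (h : ∀ i, hocolim (Y i).D) (i : ι) (hi : h i = (hocolim (Y i).D).pt) :
    smashHocolim Y μ h = (hocolim E.D).pt := by
  choose a ha using fun i => surjective_toHocolim (Y i).D (h i)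
  obtain rfl : (fun i => toHocolim (Y i).D (a i)) = h := funext ha
  rw [smashHocolim_toHocolim hμ]
  refine map_prodReal_base hμ a i ?_
  let b := Real.mk (chainS (Y i).D) (p := 0) ⟨(Functor.const _).obj (Classical.arbitrary _), PSpace.pt _⟩
    (stdSimplex.vertex 0)
  have hb : b ∈ baseSet (Y i).D := ⟨0, _, _, rfl⟩
  rw [← toHocolim_eq_pt (Y i).D hb, toHocolim_eq_iff] at hi
  rcases hi with hi | hi
  · exact hi ▸ hb
  · exact hi.1

lemma continuousGeneratedBy_smashHocolim : ContinuousGeneratedBy CH (smashHocolim Y μ) := by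
  have h1 : ContinuousGeneratedBy CH fun x : (∀ i, Real (chainS (Y i).D)) × PUnit.{1} =>
      smashHocolim Y μ fun i => toHocolim (Y i).D (x.1 i) := by
    simp only [smashHocolim_toHocolim hμ]
    intro K a
    exact (continuous_toHocolim E.D).comp ((Real.continuous_map μ).comp
      (continuousGeneratedBy_prodReal (fun i => chainS (Y i).D) (i := K)
        ⟨fun k => (a k).1, continuous_fst.comp a.continuous⟩))
  have h := continuousGeneratedBy_of_quotient_pi (fun i => Real (chainS (Y i).D))
    (fun i => hocolim (Y i).D) PUnit.{1} (hocolim E.D) (fun i => toHocolim (Y i).D)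
    (fun i => isQuotientMap_toHocolim (Y i).D) (fun x => smashHocolim Y μ x.1) h1
  intro K a
  exact h (i := K) ⟨fun k => (a k, PUnit.unit.{1}), a.continuous.prodMk continuous_const⟩

end smash

end Multilin

namespace Multilin

/-! ### Extension of homotopies from the boundary of a cell -/

/-- A cell structure on `Q`: a continuous gauge `lam` with values in `[0, 1]`, whose level set
`lam = 1` is the boundary, and the homotheties with respect to the centre `lam = 0`. -/
structure Gauge (Q : Type) [TopologicalSpace Q] where
  lam : Q → ℝ
  cont_lam : Continuous lam
  lam_nonneg : ∀ x, 0 ≤ lam x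
  lam_le_one : ∀ x, lam x ≤ 1
  scale : ℝ → Q → Q
  cont_scale : Continuous fun p : ℝ × Q => scale p.1 p.2
  scale_one : ∀ x, scale 1 x = x
  lam_scale : ∀ κ x, 0 ≤ κ → κ * lam x ≤ 1 → lam (scale κ x) = κ * lam x

namespace Gauge

variable {Q : Type} [TopologicalSpace Q] (G : Gauge Q)

/-- The gauge of `Q × [0, 1]`, seen from the point at height `2` over the centre: it is `1` exactly
on the union of the bottom and the sides. -/
noncomputable def mu (w : Q × unitInterval) : ℝ := max (G.lam w.1) (1 - w.2 / 2)

lemma cont_mu : Continuous G.mu :=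
  (G.cont_lam.comp continuous_fst).max (by fun_prop)

lemma half_le_mu (w : Q × unitInterval) : 1 / 2 ≤ G.mu w :=
  le_trans (by linarith [w.2.2.2]) (le_max_right _ _)

lemma mu_pos (w : Q × unitInterval) : 0 < G.mu w := by linarith [G.half_le_mu w]

lemma mu_le_one (w : Q × unitInterval) : G.mu w ≤ 1 :=
  max_le (G.lam_le_one _) (by linarith [w.2.2.1])

lemma mu_eq_one_iff (w : Q × unitInterval) : G.mu w = 1 ↔ G.lam w.1 = 1 ∨ w.2 = 0 := by
  have h1 := G.lam_le_one w.1
  have h2 := w.2.2.1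
  constructor
  · intro h
    by_contra hc
    push Not at hc
    have h3 : G.lam w.1 < 1 := lt_of_le_of_ne h1 hc.1
    have h4 : 0 < (w.2 : ℝ) := lt_of_le_of_ne h2 fun e => hc.2 (Subtype.ext e.symm)
    exact absurd h (ne_of_lt (max_lt h3 (by linarith)))
  · rintro (h | h)
    · exact le_antisymm (G.mu_le_one w) (h ▸ le_max_left _ _)
    · refine le_antisymm (G.mu_le_one w) (le_trans ?_ (le_max_right _ _))
      simp [h]

/-- The factor of the projection from the point at height `2` over the centre which, at the time
`τ`, has moved each point from the bottom or the sides by at most `τ`. -/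
noncomputable def factor (w : Q × unitInterval) (τ : ℝ) : ℝ := max (1 - τ) (G.mu w) / G.mu w

/-- The points on the rays from the point at height `2` over the centre of `Q`: the point
`G.drag w τ` lies on the ray through `w`, on the bottom or the sides for `τ = 0`, and it is `w`
for `τ = 1 - G.mu w`. -/
noncomputable def drag (w : Q × unitInterval) (τ : ℝ) : Q × unitInterval :=
  (G.scale (G.factor w τ) w.1,
    Set.projIcc 0 1 zero_le_one (2 - (2 - w.2) * G.factor w τ))

lemma cont_factor : Continuous fun p : (Q × unitInterval) × ℝ => G.factor p.1 p.2 :=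
  ((continuous_const.sub continuous_snd).max (G.cont_mu.comp continuous_fst)).div
    (G.cont_mu.comp continuous_fst) fun p => (G.mu_pos p.1).ne'

lemma cont_drag : Continuous fun p : (Q × unitInterval) × ℝ => G.drag p.1 p.2 := by
  refine (G.cont_scale.comp (G.cont_factor.prodMk (by fun_prop))).prodMk ?_
  refine continuous_projIcc.comp (continuous_const.sub (Continuous.mul ?_ G.cont_factor))
  fun_prop

lemma drag_of_eq_one {w : Q × unitInterval} {τ : ℝ} (h : G.factor w τ = 1) : G.drag w τ = w := by
  rw [drag, h, G.scale_one]
  refine Prod.ext rfl ?_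
  have : (2 - (2 - (w.2 : ℝ)) * 1) = w.2 := by ring
  simp only [this, Set.projIcc_val]

lemma drag_mu (w : Q × unitInterval) : G.drag w (1 - G.mu w) = w := by
  refine G.drag_of_eq_one ?_
  rw [factor, sub_sub_cancel, max_self, div_self (G.mu_pos w).ne']

lemma drag_of_mu {w : Q × unitInterval} (h : G.mu w = 1) {τ : ℝ} (hτ : 0 ≤ τ) :
    G.drag w τ = w := by
  refine G.drag_of_eq_one ?_
  rw [factor, h, max_eq_right (by linarith), div_one]

lemma mu_drag_zero (w : Q × unitInterval) : G.mu (G.drag w 0) = 1 := by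
  have hμ := G.mu_pos w
  have hf : G.factor w 0 = 1 / G.mu w := by
    rw [factor, sub_zero, max_eq_left (G.mu_le_one w)]
  rw [mu_eq_one_iff]
  have hlam : G.factor w 0 * G.lam w.1 ≤ 1 := by
    rw [hf, one_div, inv_mul_le_iff₀ hμ, mul_one]
    exact le_max_left _ _
  rcases max_cases (G.lam w.1) (1 - w.2 / 2 : ℝ) with ⟨h, -⟩ | ⟨h, -⟩
  · left
    rw [drag, G.lam_scale _ _ (by rw [hf]; positivity) hlam, hf]
    have h' : G.lam w.1 = G.mu w := h.symm
    rw [h', one_div, inv_mul_cancel₀ hμ.ne']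
  · right
    have h' : G.mu w = 1 - w.2 / 2 := h
    have : (2 - (2 - (w.2 : ℝ)) * G.factor w 0) = 0 := by
      rw [hf, h']
      have h2 : 2 - (w.2 : ℝ) ≠ 0 := by
        have := w.2.2.2
        exact ne_of_gt (by linarith)
      rw [show 1 - (w.2 : ℝ) / 2 = (2 - w.2) / 2 by ring]
      field_simp
      ring
    rw [drag]
    simp only [this]
    exact Set.projIcc_left ..

/-- A map on the bottom and the sides of `Q × [0, 1]` extends to `Q × [0, 1]`, without new
values. -/
lemma exists_extension {Z : Type} [TopologicalSpace Z] (g : Q × unitInterval → Z)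
    (hg : ContinuousOn g {w | G.lam w.1 = 1 ∨ w.2 = 0}) :
    ∃ g' : Q × unitInterval → Z, Continuous g' ∧
      (∀ w, G.lam w.1 = 1 ∨ w.2 = 0 → g' w = g w) ∧
      ∀ w, ∃ w', (G.lam w'.1 = 1 ∨ w'.2 = 0) ∧ g' w = g w' := by
  refine ⟨fun w => g (G.drag w 0), ?_, fun w hw => ?_, fun w => ⟨G.drag w 0, ?_, rfl⟩⟩
  · exact hg.comp_continuous (G.cont_drag.comp (Continuous.prodMk_left 0))
      fun w => (G.mu_eq_one_iff _).mp (G.mu_drag_zero w)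
  · simp only [G.drag_of_mu ((G.mu_eq_one_iff w).mpr hw) le_rfl]
  · exact (G.mu_eq_one_iff _).mp (G.mu_drag_zero w)

/-- The gauge of a product. -/
noncomputable def prod {Q' : Type} [TopologicalSpace Q'] (G' : Gauge Q') : Gauge (Q × Q') where
  lam x := max (G.lam x.1) (G'.lam x.2)
  cont_lam := (G.cont_lam.comp continuous_fst).max (G'.cont_lam.comp continuous_snd)
  lam_nonneg x := (G.lam_nonneg x.1).trans (le_max_left _ _)
  lam_le_one x := max_le (G.lam_le_one _) (G'.lam_le_one _)
  scale κ x := (G.scale κ x.1, G'.scale κ x.2)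
  cont_scale := (G.cont_scale.comp (by fun_prop : Continuous fun p : ℝ × Q × Q' => (p.1, p.2.1))).prodMk
    (G'.cont_scale.comp (by fun_prop : Continuous fun p : ℝ × Q × Q' => (p.1, p.2.2)))
  scale_one x := by simp only [G.scale_one, G'.scale_one]
  lam_scale κ x hκ h := by
    rw [mul_max_of_nonneg _ _ hκ] at h ⊢
    rw [G.lam_scale κ _ hκ ((le_max_left _ _).trans h),
      G'.lam_scale κ _ hκ ((le_max_right _ _).trans h)]

end Gauge

/-- The gauge of a cube: twice the sup norm of the position with respect to the centre.  The homotheties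
are cut off outside the cube. -/
noncomputable def cubeGauge (ι : Type) [Fintype ι] : Gauge (ι → unitInterval) where
  lam x := 2 * ‖fun i => (x i : ℝ) - 1 / 2‖
  cont_lam := by fun_prop
  lam_nonneg x := by positivity
  lam_le_one x := by
    have : ‖fun i => (x i : ℝ) - 1 / 2‖ ≤ 1 / 2 := (pi_norm_le_iff_of_nonneg (by norm_num)).mpr
      fun i => by
        rw [Real.norm_eq_abs, abs_le]
        constructor <;> linarith [(x i).2.1, (x i).2.2]
    linarith
  scale κ x i := Set.projIcc 0 1 zero_le_one (1 / 2 + κ * (x i - 1 / 2))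
  cont_scale := continuous_pi fun i => continuous_projIcc.comp (by fun_prop)
  scale_one x := by
    funext i
    have : (1 / 2 + 1 * ((x i : ℝ) - 1 / 2)) = x i := by ring
    simp only [this, Set.projIcc_val]
  lam_scale κ x hκ h := by
    have hi : ∀ i, κ * |(x i : ℝ) - 1 / 2| ≤ 1 / 2 := fun i => by
      have := norm_le_pi_norm (fun i => (x i : ℝ) - 1 / 2) i
      rw [Real.norm_eq_abs] at this
      nlinarith
    have : (fun i => ((Set.projIcc (0 : ℝ) 1 zero_le_one (1 / 2 + κ * (x i - 1 / 2)) : ℝ)) - 1 / 2) =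
        κ • fun i => (x i : ℝ) - 1 / 2 := by
      funext i
      have h1 := hi i
      rw [← abs_of_nonneg hκ, ← abs_mul, abs_le] at h1
      rw [Set.projIcc_of_mem zero_le_one
        (show 1 / 2 + κ * ((x i : ℝ) - 1 / 2) ∈ Set.Icc (0 : ℝ) 1 from ⟨by linarith, by linarith⟩)]
      simp
    rw [this, norm_smul, Real.norm_of_nonneg hκ]
    ring

lemma cubeGauge_eq_one_iff {ι : Type} [Fintype ι] (x : ι → unitInterval) :
    (cubeGauge ι).lam x = 1 ↔ x ∈ Cube.boundary ι := by
  have hb : ∀ i, ‖(x i : ℝ) - 1 / 2‖ ≤ 1 / 2 := fun i => by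
    rw [Real.norm_eq_abs, abs_le]
    constructor <;> linarith [(x i).2.1, (x i).2.2]
  have hiff : ∀ i, ‖(x i : ℝ) - 1 / 2‖ = 1 / 2 ↔ (x i = 0 ∨ x i = 1) := fun i => by
    rw [Real.norm_eq_abs, abs_eq (by norm_num), Subtype.ext_iff, Subtype.ext_iff, or_comm]
    refine or_congr ?_ ?_
    · constructor <;> intro h
      · change (x i : ℝ) = 0; linarith
      · change (x i : ℝ) = 0 at h; linarith
    · constructor <;> intro h
      · change (x i : ℝ) = 1; linarith
      · change (x i : ℝ) = 1 at h; linarith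
  have hle : (cubeGauge ι).lam x ≤ 1 := (cubeGauge ι).lam_le_one x
  have hdef : (cubeGauge ι).lam x = 2 * ‖fun i => (x i : ℝ) - 1 / 2‖ := rfl
  constructor
  · intro h
    by_contra hc
    have hlt : ‖fun i => (x i : ℝ) - 1 / 2‖ < 1 / 2 := (pi_norm_lt_iff (by norm_num)).mpr
      fun i => lt_of_le_of_ne (hb i) fun e => hc ⟨i, (hiff i).mp e⟩
    linarith
  · rintro ⟨i, hi⟩
    have := norm_le_pi_norm (fun i => (x i : ℝ) - 1 / 2) i
    rw [(hiff i).mpr hi] at this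
    linarith

/-- The gauge of the unit interval. -/
noncomputable def intervalGauge : Gauge unitInterval where
  lam s := |2 * (s : ℝ) - 1|
  cont_lam := by fun_prop
  lam_nonneg x := abs_nonneg _
  lam_le_one s := by rw [abs_le]; constructor <;> linarith [s.2.1, s.2.2]
  scale κ s := Set.projIcc 0 1 zero_le_one (1 / 2 + κ * (s - 1 / 2))
  cont_scale := continuous_projIcc.comp (by fun_prop)
  scale_one s := by
    have : (1 / 2 + 1 * ((s : ℝ) - 1 / 2)) = s := by ring
    simp only [this, Set.projIcc_val]
  lam_scale κ s hκ h := by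
    have h1 := h
    rw [← abs_of_nonneg hκ, ← abs_mul, abs_le] at h1
    rw [Set.projIcc_of_mem zero_le_one
      (show 1 / 2 + κ * ((s : ℝ) - 1 / 2) ∈ Set.Icc (0 : ℝ) 1 from ⟨by linarith, by linarith⟩)]
    conv_rhs => rw [← abs_of_nonneg hκ, ← abs_mul]
    congr 1
    ring

lemma intervalGauge_eq_one_iff (s : unitInterval) : intervalGauge.lam s = 1 ↔ s = 0 ∨ s = 1 := by
  change |2 * (s : ℝ) - 1| = 1 ↔ _
  rw [abs_eq zero_le_one, Subtype.ext_iff, Subtype.ext_iff, or_comm]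
  refine or_congr ?_ ?_
  · constructor <;> intro h
    · change (s : ℝ) = 0; linarith
    · change (s : ℝ) = 0 at h; linarith
  · constructor <;> intro h
    · change (s : ℝ) = 1; linarith
    · change (s : ℝ) = 1 at h; linarith

/-! ### Connected maps -/

/-- `N`-connected maps of topological spaces, expressed by compression. -/
def ConnMap (N : ℤ) {X Y : Type} [TopologicalSpace X] [TopologicalSpace Y] (f : X → Y) : Prop :=
  ∀ k : ℕ, (k : ℤ) ≤ N → ∀ (a : C(Cube.boundary (Fin k), X)) (b : C(Fin k → unitInterval, Y)),
    (∀ s : Cube.boundary (Fin k), f (a s) = b s) →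
    ∃ (a' : C(Fin k → unitInterval, X)) (H : C((Fin k → unitInterval) × unitInterval, Y)),
      (∀ s : Cube.boundary (Fin k), a' s = a s) ∧ (∀ x, H (x, 0) = b x) ∧
      (∀ x, H (x, 1) = f (a' x)) ∧ ∀ x ∈ Cube.boundary (Fin k), ∀ s, H (x, s) = b x

lemma isConnectedMap_iff (N : ℤ) {X Y : PSpace} (f : X ⟶ Y) :
    IsConnectedMap N f ↔ ConnMap N f.toFun := by
  constructor
  · intro h k hk a b hab
    obtain ⟨a', ha', ⟨H⟩⟩ := h k hk a b hab
    refine ⟨a', ⟨fun p => H.symm (p.2, p.1), by fun_prop⟩, ha', fun x => ?_, fun x => ?_,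
      fun x hx s => ?_⟩
    · exact H.symm.apply_zero x
    · exact H.symm.apply_one x
    · exact H.symm.eq_fst s hx
  · intro h k hk a b hab
    obtain ⟨a', H, ha', h0, h1, hb⟩ := h k hk a b hab
    refine ⟨a', ha', ⟨ContinuousMap.HomotopyRel.symm
      { toFun := fun p => H (p.2, p.1)
        continuous_toFun := by fun_prop
        map_zero_left := h0
        map_one_left := h1
        prop' := fun s x hx => hb x hx s }⟩⟩

lemma ConnMap.mono {N M : ℤ} (h : M ≤ N) {X Y : Type} [TopologicalSpace X] [TopologicalSpace Y]
    {f : X → Y} (hf : ConnMap N f) : ConnMap M f :=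
  fun k hk => hf k (hk.trans h)

lemma isClosed_cubeBoundary (ι : Type) [Fintype ι] : IsClosed (Cube.boundary ι) := by
  have : Cube.boundary ι = {x | (cubeGauge ι).lam x = 1} :=
    Set.ext fun x => (cubeGauge_eq_one_iff x).symm
  rw [this]
  exact isClosed_eq (cubeGauge ι).cont_lam continuous_const

/-- A homotopy of maps on a cube may be changed such that its restriction to the boundary is
reparametrized.  The linear deformation of `ρ` to `ρ'`, on the boundary, is extended to the cube. -/
lemma exists_reparametrization {Z ι : Type} [TopologicalSpace Z] [Fintype ι]
    (k : (ι → unitInterval) × unitInterval → Z) (hk : Continuous k)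
    (L : (ι → unitInterval) × unitInterval → Z)
    (hL : ContinuousOn L {w | w.1 ∈ Cube.boundary ι}) {ρ ρ' : unitInterval → unitInterval}
    (hρ : Continuous ρ) (hρ' : Continuous ρ')
    (hkL : ∀ x ∈ Cube.boundary ι, ∀ s, k (x, s) = L (x, ρ s)) (h0 : ρ 0 = ρ' 0)
    (h1 : ρ 1 = ρ' 1) :
    ∃ k' : (ι → unitInterval) × unitInterval → Z, Continuous k' ∧ (∀ x, k' (x, 0) = k (x, 0)) ∧
      (∀ x, k' (x, 1) = k (x, 1)) ∧ (∀ x ∈ Cube.boundary ι, ∀ s, k' (x, s) = L (x, ρ' s)) ∧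
      ∀ U : Set Z, (∀ w, k w ∈ U) → (∀ w, w.1 ∈ Cube.boundary ι → L w ∈ U) → ∀ w, k' w ∈ U := by
  classical
  let Q := ι → unitInterval
  let G := cubeGauge ι
  have hG : ∀ x : Q, G.lam x = 1 ↔ x ∈ Cube.boundary ι := cubeGauge_eq_one_iff
  let G₂ := G.prod intervalGauge
  have hG₂ : ∀ w : Q × unitInterval, G₂.lam w = 1 ↔ (w.1 ∈ Cube.boundary ι ∨ w.2 = 0) ∨ w.2 = 1 := by
    intro w
    change max (G.lam w.1) (intervalGauge.lam w.2) = 1 ↔ _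
    rw [or_assoc, ← intervalGauge_eq_one_iff, ← hG]
    constructor
    · intro hm
      rcases max_choice (G.lam w.1) (intervalGauge.lam w.2) with hc | hc <;> rw [hc] at hm
      · exact .inl hm
      · exact .inr hm
    · rintro (hm | hm)
      · rw [hm, max_eq_left (intervalGauge.lam_le_one _)]
      · rw [hm, max_eq_right (G.lam_le_one _)]
  -- the linear interpolation between `ρ` and `ρ'`
  let mix : unitInterval → unitInterval → unitInterval := fun s r =>
    Set.projIcc 0 1 zero_le_one ((1 - r) * ρ s + r * ρ' s)
  have hmix : Continuous fun p : unitInterval × unitInterval => mix p.1 p.2 :=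
    continuous_projIcc.comp (by fun_prop)
  have hmixe : ∀ s r, ρ s = ρ' s → mix s r = ρ s := fun s r e => by
    simp only [mix, ← e]
    rw [show (1 - (r : ℝ)) * ρ s + r * ρ s = ρ s by ring, Set.projIcc_val]
  have hmixs0 : ∀ s, mix s 0 = ρ s := fun s => by simp [mix]
  have hmixs1 : ∀ s, mix s 1 = ρ' s := fun s => by simp [mix]
  -- an extension over a further interval; its end is the required homotopy
  obtain ⟨k₄, hk₄, hk₄e, hk₄v⟩ := G₂.exists_extension
    (fun z : (Q × unitInterval) × unitInterval => if z.1.1 ∈ Cube.boundary ι then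
      L (z.1.1, mix z.1.2 z.2) else k z.1) (by
    have : {z : (Q × unitInterval) × unitInterval | G₂.lam z.1 = 1 ∨ z.2 = 0} =
        {z | z.1.1 ∈ Cube.boundary ι} ∪ {z | z.1.2 = 0 ∨ z.1.2 = 1 ∨ z.2 = 0} := by
      ext z
      simp only [hG₂, Set.mem_ofPred_eq, Set.mem_union]
      tauto
    rw [this]
    refine ContinuousOn.union_of_isClosed ?_ ?_ ?_ ?_
    · refine ContinuousOn.congr
        (f := fun z : (Q × unitInterval) × unitInterval => L (z.1.1, mix z.1.2 z.2)) ?_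
        fun z hz => if_pos (show z.1.1 ∈ Cube.boundary ι from hz)
      refine hL.comp (Continuous.continuousOn ?_) fun z hz => hz
      exact Continuous.prodMk (by fun_prop)
        (hmix.comp (by fun_prop : Continuous fun z : (Q × unitInterval) × unitInterval =>
          (z.1.2, z.2)))
    · refine ContinuousOn.congr (f := fun z => k z.1) (by fun_prop) fun z hz => ?_
      obtain ⟨⟨x, s⟩, r⟩ := z
      dsimp only
      split_ifs with hx
      · rw [hkL x hx]
        rcases hz with hz | hz | hz
        · obtain rfl : s = 0 := hz
          rw [hmixe _ _ h0]
        · obtain rfl : s = 1 := hz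
          rw [hmixe _ _ h1]
        · obtain rfl : r = 0 := hz
          rw [hmixs0]
      · rfl
    · exact (isClosed_cubeBoundary ι).preimage (by fun_prop)
    · exact (isClosed_eq (by fun_prop) continuous_const).union
        ((isClosed_eq (by fun_prop) continuous_const).union
          (isClosed_eq (by fun_prop) continuous_const)))
  refine ⟨fun w => k₄ (w, 1), by fun_prop, fun x => ?_, fun x => ?_, fun x hx s => ?_,
    fun U hkU hLU w => ?_⟩
  · change k₄ ((x, 0), 1) = k (x, 0)
    rw [hk₄e _ (.inl ((hG₂ _).mpr (.inl (.inr rfl))))]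
    split_ifs with hx
    · exact (congrArg (fun r => L (x, r)) (hmixe 0 1 h0)).trans (hkL x hx 0).symm
    · rfl
  · change k₄ ((x, 1), 1) = k (x, 1)
    rw [hk₄e _ (.inl ((hG₂ _).mpr (.inr rfl)))]
    split_ifs with hx
    · exact (congrArg (fun r => L (x, r)) (hmixe 1 1 h1)).trans (hkL x hx 1).symm
    · rfl
  · change k₄ ((x, s), 1) = L (x, ρ' s)
    rw [hk₄e _ (.inl ((hG₂ _).mpr (.inl (.inl hx)))), if_pos hx, hmixs1]
  · obtain ⟨z, -, e⟩ := hk₄v (w, 1)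
    change k₄ (w, 1) ∈ U
    rw [e]
    split_ifs with hz
    · exact hLU _ hz
    · exact hkU _

/-- Compression of a cube whose boundary is compressed by a given homotopy, inside an open set. -/
lemma ConnMap.strong {N : ℤ} {X Y : Type} [TopologicalSpace X] [TopologicalSpace Y] {f : X → Y}
    {U : Set Y} (hf : ConnMap N (U.restrictPreimage f)) {ι : Type} [Fintype ι]
    (hι : (Fintype.card ι : ℤ) ≤ N) (b : (ι → unitInterval) → Y) (hb : Continuous b)
    (hbU : ∀ x, b x ∈ U) (h : (ι → unitInterval) × unitInterval → Y)
    (hh : ContinuousOn h {w | w.1 ∈ Cube.boundary ι})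
    (hhU : ∀ w, w.1 ∈ Cube.boundary ι → h w ∈ U) (a : (ι → unitInterval) → X)
    (ha : ContinuousOn a (Cube.boundary ι)) (h0 : ∀ x ∈ Cube.boundary ι, h (x, 0) = b x)
    (h1 : ∀ x ∈ Cube.boundary ι, h (x, 1) = f (a x)) :
    ∃ (H : (ι → unitInterval) × unitInterval → Y) (a' : (ι → unitInterval) → X),
      Continuous H ∧ Continuous a' ∧ (∀ w, H w ∈ U) ∧ (∀ x, H (x, 0) = b x) ∧
      (∀ x, H (x, 1) = f (a' x)) ∧ (∀ w, w.1 ∈ Cube.boundary ι → H w = h w) ∧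
      ∀ x ∈ Cube.boundary ι, a' x = a x := by
  classical
  let Q := ι → unitInterval
  let G := cubeGauge ι
  have hG : ∀ x : Q, G.lam x = 1 ↔ x ∈ Cube.boundary ι := cubeGauge_eq_one_iff
  have hcl := isClosed_cubeBoundary ι
  have hclp : IsClosed {w : Q × unitInterval | w.1 ∈ Cube.boundary ι} := hcl.preimage continuous_fst
  have hcl0 : IsClosed {w : Q × unitInterval | w.2 = 0} := isClosed_eq continuous_snd continuous_const
  -- extension of the homotopy from the boundary
  obtain ⟨k₁, hk₁, hk₁e, hk₁v⟩ := G.exists_extension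
    (fun w => if w.1 ∈ Cube.boundary ι then h w else b w.1) (by
      have : {w : Q × unitInterval | G.lam w.1 = 1 ∨ w.2 = 0} =
          {w | w.1 ∈ Cube.boundary ι} ∪ {w | w.2 = 0} := by ext w; simp [hG]
      rw [this]
      refine ContinuousOn.union_of_isClosed (hh.congr fun w hw => if_pos hw) ?_ hclp hcl0
      refine (hb.comp continuous_fst).continuousOn.congr fun w hw => ?_
      obtain ⟨x, s⟩ := w
      obtain rfl : s = 0 := hw
      by_cases hx : x ∈ Cube.boundary ι
      · simp only [if_pos hx]; exact h0 x hx
      · simp only [if_neg hx]; rfl)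
  have hk₁U : ∀ w, k₁ w ∈ U := fun w => by
    obtain ⟨w', -, e⟩ := hk₁v w
    rw [e]
    split_ifs with h
    · exact hhU _ h
    · exact hbU _
  have hk₁0 : ∀ x, k₁ (x, 0) = b x := fun x => by
    rw [hk₁e _ (.inr rfl)]
    dsimp only
    split_ifs with h
    · exact h0 x h
    · rfl
  have hk₁b : ∀ w : Q × unitInterval, w.1 ∈ Cube.boundary ι → k₁ w = h w := fun w hw => by
    rw [hk₁e _ (.inl ((hG _).mpr hw)), if_pos hw]
  -- compression of the end of the extended homotopy
  let e : ι ≃ Fin (Fintype.card ι) := Fintype.equivFin ι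
  let E : Q ≃ₜ (Fin (Fintype.card ι) → unitInterval) := Homeomorph.piCongrLeft (Y := fun _ => unitInterval) e
  have hE : ∀ x : Q, ∀ i, E x (e i) = x i := fun x i =>
    Equiv.piCongrLeft_apply_apply (fun _ => unitInterval) e x i
  have hEb : ∀ y, E.symm y ∈ Cube.boundary ι ↔ y ∈ Cube.boundary (Fin (Fintype.card ι)) := by
    intro y
    obtain ⟨x, rfl⟩ := E.surjective y
    rw [E.symm_apply_apply]
    constructor
    · rintro ⟨i, hi⟩
      exact ⟨e i, by rwa [hE]⟩
    · rintro ⟨j, hj⟩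
      obtain ⟨i, rfl⟩ := e.surjective j
      exact ⟨i, by rwa [hE] at hj⟩
  have hac : Continuous fun s : Cube.boundary (Fin (Fintype.card ι)) => a (E.symm s) :=
    ha.comp_continuous (E.symm.continuous.comp continuous_subtype_val) fun s => (hEb _).mpr s.2
  have haU : ∀ x ∈ Cube.boundary ι, f (a x) ∈ U := fun x hx => h1 x hx ▸ hhU (x, 1) hx
  obtain ⟨a₁, H₁, ha₁, h₁0, h₁1, h₁b⟩ := hf (Fintype.card ι) hι
    ⟨fun s => ⟨a (E.symm s), haU _ ((hEb _).mpr s.2)⟩, hac.subtype_mk _⟩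
    ⟨fun y => ⟨k₁ (E.symm y, 1), hk₁U _⟩, Continuous.subtype_mk (by fun_prop) _⟩ (fun s => by
      refine Subtype.ext ?_
      have hs := (hEb s).mpr s.2
      exact (h1 _ hs).symm.trans (hk₁b (E.symm s, 1) hs).symm)
  let a' : Q → X := fun x => (a₁ (E x)).1
  have ha'c : Continuous a' := by fun_prop
  have ha'b : ∀ x ∈ Cube.boundary ι, a' x = a x := fun x hx => by
    have h2 : E x ∈ Cube.boundary _ := by rwa [← hEb, E.symm_apply_apply]
    have := congrArg Subtype.val (ha₁ ⟨E x, h2⟩)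
    refine this.trans ?_
    simp
  let k₂ : Q × unitInterval → Y := fun w => (H₁ (E w.1, w.2)).1
  have hk₂ : Continuous k₂ := by fun_prop
  have hk₂0 : ∀ x, k₂ (x, 0) = k₁ (x, 1) := fun x => by
    have := congrArg Subtype.val (h₁0 (E x))
    refine this.trans ?_
    simp
  have hk₂1 : ∀ x, k₂ (x, 1) = f (a' x) := fun x => congrArg Subtype.val (h₁1 (E x))
  have hk₂b : ∀ x ∈ Cube.boundary ι, ∀ s, k₂ (x, s) = h (x, 1) := fun x hx s => by
    have h2 : E x ∈ Cube.boundary _ := by rwa [← hEb, E.symm_apply_apply]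
    have := congrArg Subtype.val (h₁b (E x) h2 s)
    refine this.trans ?_
    simp only [ContinuousMap.coe_mk, E.symm_apply_apply]
    exact hk₁b (x, 1) hx
  have hk₂U : ∀ w, k₂ w ∈ U := fun w => (H₁ (E w.1, w.2)).2
  -- the concatenation of the two homotopies
  let dbl : unitInterval → unitInterval := fun s => Set.projIcc 0 1 zero_le_one (2 * s)
  let dbl' : unitInterval → unitInterval := fun s => Set.projIcc 0 1 zero_le_one (2 * s - 1)
  have hdbl : Continuous dbl := continuous_projIcc.comp (by fun_prop)
  have hdbl' : Continuous dbl' := continuous_projIcc.comp (by fun_prop)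
  let k₃ : Q × unitInterval → Y := fun w =>
    if (w.2 : ℝ) ≤ 1 / 2 then k₁ (w.1, dbl w.2) else k₂ (w.1, dbl' w.2)
  have hk₃ : Continuous k₃ := by
    refine Continuous.if_le (by fun_prop) (by fun_prop) (by fun_prop) continuous_const ?_
    intro w hw
    have e1 : dbl w.2 = 1 := by simp only [dbl, hw]; norm_num
    have e2 : dbl' w.2 = 0 := by simp only [dbl', hw]; norm_num
    rw [e1, e2, hk₂0]
  have hk₃U : ∀ w, k₃ w ∈ U := fun w => by
    simp only [k₃]
    split_ifs
    exacts [hk₁U _, hk₂U _]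
  have hk₃0 : ∀ x, k₃ (x, 0) = b x := fun x => by
    have e1 : dbl 0 = 0 := by simp [dbl]
    simp only [k₃]
    rw [if_pos (by norm_num), e1, hk₁0]
  have hk₃1 : ∀ x, k₃ (x, 1) = f (a' x) := fun x => by
    have e1 : dbl' 1 = 1 := by simp only [dbl', Set.Icc.coe_one]; norm_num
    simp only [k₃]
    rw [if_neg (by norm_num), e1, hk₂1]
  have hk₃b : ∀ x ∈ Cube.boundary ι, ∀ s, k₃ (x, s) = h (x, dbl s) := fun x hx s => by
    simp only [k₃]
    split_ifs with hs
    · exact hk₁b _ hx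
    · rw [hk₂b x hx]
      have : dbl s = 1 := Set.projIcc_of_right_le _ (by linarith)
      rw [this]
  obtain ⟨k₄, hk₄, hk₄0, hk₄1, hk₄b, hk₄U⟩ := exists_reparametrization k₃ hk₃ h hh hdbl
    continuous_id hk₃b (by simp [dbl]) (Set.projIcc_of_right_le _ (by norm_num))
  refine ⟨k₄, a', hk₄, ha'c, hk₄U U hk₃U hhU, fun x => (hk₄0 x).trans (hk₃0 x),
    fun x => (hk₄1 x).trans (hk₃1 x), fun w hw => hk₄b w.1 hw w.2, ha'b⟩

end Multilin

namespace Multilin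

/-! ### Calculus of connected maps -/

/-- A compression up to homotopies that move the boundary forth and back along `L` can be made
relative to the boundary. -/
lemma exists_compression_of_conjugate {Z ι : Type} [TopologicalSpace Z] [Fintype ι]
    {H₁ H₂ H₃ L : (ι → unitInterval) × unitInterval → Z} (h₁ : Continuous H₁) (h₂ : Continuous H₂)
    (h₃ : Continuous H₃) (hL : ContinuousOn L {w | w.1 ∈ Cube.boundary ι})
    (h₁₂ : ∀ x, H₁ (x, 1) = H₂ (x, 0)) (h₂₃ : ∀ x, H₂ (x, 1) = H₃ (x, 1))
    (hL₁ : ∀ x ∈ Cube.boundary ι, ∀ s, H₁ (x, s) = L (x, s))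
    (hL₂ : ∀ x ∈ Cube.boundary ι, ∀ s, H₂ (x, s) = L (x, 1))
    (hL₃ : ∀ x ∈ Cube.boundary ι, ∀ s, H₃ (x, s) = L (x, s)) :
    ∃ H : (ι → unitInterval) × unitInterval → Z, Continuous H ∧ (∀ x, H (x, 0) = H₁ (x, 0)) ∧
      (∀ x, H (x, 1) = H₃ (x, 0)) ∧ ∀ x ∈ Cube.boundary ι, ∀ s, H (x, s) = H₁ (x, 0) := by
  let ρ₁ : unitInterval → unitInterval := fun s => Set.projIcc 0 1 zero_le_one (4 * s)
  let ρ₂ : unitInterval → unitInterval := fun s => Set.projIcc 0 1 zero_le_one (4 * s - 1)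
  let ρ₃ : unitInterval → unitInterval := fun s => Set.projIcc 0 1 zero_le_one (2 - 2 * s)
  have hρ₁ : Continuous ρ₁ := continuous_projIcc.comp (by fun_prop)
  have hρ₂ : Continuous ρ₂ := continuous_projIcc.comp (by fun_prop)
  have hρ₃ : Continuous ρ₃ := continuous_projIcc.comp (by fun_prop)
  -- the concatenation of `H₁`, `H₂` and the reversed `H₃`
  let k : (ι → unitInterval) × unitInterval → Z := fun w =>
    if (w.2 : ℝ) ≤ 1 / 2 then (if (w.2 : ℝ) ≤ 1 / 4 then H₁ (w.1, ρ₁ w.2) else H₂ (w.1, ρ₂ w.2))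
      else H₃ (w.1, ρ₃ w.2)
  have hk : Continuous k := by
    refine Continuous.if_le (Continuous.if_le (by fun_prop) (by fun_prop) (by fun_prop)
      continuous_const ?_) (by fun_prop) (by fun_prop) continuous_const ?_
    · intro w hw
      have e1 : ρ₁ w.2 = 1 := by simp only [ρ₁, hw]; norm_num
      have e2 : ρ₂ w.2 = 0 := by simp only [ρ₂, hw]; norm_num
      rw [e1, e2, h₁₂]
    · intro w hw
      rw [if_neg (by rw [hw]; norm_num)]
      have e1 : ρ₂ w.2 = 1 := by simp only [ρ₂, hw]; norm_num
      have e2 : ρ₃ w.2 = 1 := by simp only [ρ₃, hw]; norm_num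
      rw [e1, e2, h₂₃]
  -- on the boundary, it runs along `L` according to `ρ`, which is deformed to the constant `0`
  let ρ : unitInterval → unitInterval := fun s => min (ρ₁ s) (ρ₃ s)
  have hρ0 : ρ 0 = 0 := by simp [ρ, ρ₁]
  have hρ1 : ρ 1 = 0 := by simp [ρ, ρ₃]
  obtain ⟨H, hH, H0, H1, Hb, -⟩ := exists_reparametrization k hk L hL (ρ := ρ)
    (ρ' := fun _ => 0) (hρ₁.min hρ₃) continuous_const (fun x hx s => by
      simp only [k]
      split_ifs with hs hs'
      · have : ρ₃ s = 1 := Set.projIcc_of_right_le _ (by linarith)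
        rw [hL₁ x hx]
        simp only [ρ, this]
        rw [min_eq_left (unitInterval.le_one' )]
      · have h1 : ρ₁ s = 1 := Set.projIcc_of_right_le _ (by linarith)
        have h2 : ρ₃ s = 1 := Set.projIcc_of_right_le _ (by linarith)
        rw [hL₂ x hx]
        simp only [ρ, h1, h2, min_self]
      · have h1 : ρ₁ s = 1 := Set.projIcc_of_right_le _ (by linarith)
        rw [hL₃ x hx]
        simp only [ρ, h1]
        rw [min_eq_right (unitInterval.le_one' )]) hρ0 hρ1
  have e1 : ρ₁ 0 = 0 := by simp [ρ₁]
  have e3 : ρ₃ 1 = 0 := by simp [ρ₃]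
  have hk0 : ∀ x, k (x, 0) = H₁ (x, 0) := fun x => by
    simp only [k]
    rw [if_pos (by norm_num), if_pos (by norm_num), e1]
  refine ⟨H, hH, fun x => (H0 x).trans (hk0 x), fun x => (H1 x).trans ?_, fun x hx s => ?_⟩
  · simp only [k]
    rw [if_neg (by norm_num), e3]
  · rw [Hb x hx, hL₁ x hx]

section calculus

variable {X Y Z : Type} [TopologicalSpace X] [TopologicalSpace Y] [TopologicalSpace Z] {N : ℤ}

/-- A map on a cube with a homotopy of its restriction to the boundary: extension of the
homotopy. -/
lemma exists_homotopy_extension {ι : Type} [Fintype ι] (b : (ι → unitInterval) → Y)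
    (hb : Continuous b) (h : (ι → unitInterval) × unitInterval → Y)
    (hh : ContinuousOn h {w | w.1 ∈ Cube.boundary ι})
    (h0 : ∀ x ∈ Cube.boundary ι, h (x, 0) = b x) :
    ∃ k : (ι → unitInterval) × unitInterval → Y, Continuous k ∧ (∀ x, k (x, 0) = b x) ∧
      ∀ w, w.1 ∈ Cube.boundary ι → k w = h w := by
  classical
  have hG : ∀ x, (cubeGauge ι).lam x = 1 ↔ x ∈ Cube.boundary ι := cubeGauge_eq_one_iff
  obtain ⟨k, hk, hke, -⟩ := (cubeGauge ι).exists_extension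
    (fun w => if w.1 ∈ Cube.boundary ι then h w else b w.1) (by
      have : {w : (ι → unitInterval) × unitInterval | (cubeGauge ι).lam w.1 = 1 ∨ w.2 = 0} =
          {w | w.1 ∈ Cube.boundary ι} ∪ {w | w.2 = 0} := by ext w; simp [hG]
      rw [this]
      refine ContinuousOn.union_of_isClosed (hh.congr fun w hw => if_pos hw) ?_
        ((isClosed_cubeBoundary ι).preimage continuous_fst)
        (isClosed_eq continuous_snd continuous_const)
      refine (hb.comp continuous_fst).continuousOn.congr fun w hw => ?_
      obtain ⟨x, s⟩ := w
      obtain rfl : s = 0 := hw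
      by_cases hx : x ∈ Cube.boundary ι
      · simp only [if_pos hx]; exact h0 x hx
      · simp only [if_neg hx]; rfl)
  refine ⟨k, hk, fun x => ?_, fun w hw => ?_⟩
  · rw [hke _ (.inr rfl)]
    split_ifs with hx
    · exact h0 x hx
    · rfl
  · rw [hke _ (.inl ((hG _).mpr hw)), if_pos hw]

lemma continuousOn_boundary {k : ℕ} (a : C(Cube.boundary (Fin k), X)) {W : Type}
    [TopologicalSpace W] (F : X × unitInterval → W) (hF : Continuous F)
    (L : (Fin k → unitInterval) × unitInterval → W)
    (hL : ∀ (x : Cube.boundary (Fin k)) (s : unitInterval), L (x.1, s) = F (a x, s)) :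
    ContinuousOn L {w | w.1 ∈ Cube.boundary (Fin k)} := by
  rw [continuousOn_iff_continuous_domRestrict]
  have : Continuous fun w : {w : (Fin k → unitInterval) × unitInterval |
      w.1 ∈ Cube.boundary (Fin k)} => F (a ⟨w.1.1, w.2⟩, w.1.2) := by
    refine hF.comp ((a.continuous.comp (Continuous.subtype_mk (by fun_prop) _)).prodMk (by fun_prop))
  refine this.congr fun w => ?_
  exact (hL ⟨w.1.1, w.2⟩ w.1.2).symm

/-- A map which is homotopic to the identity is connected. -/
lemma ConnMap.of_homotopic_id {φ : X → X} (K : X × unitInterval → X)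
    (hK : Continuous K) (K0 : ∀ x, K (x, 0) = x) (K1 : ∀ x, K (x, 1) = φ x) : ConnMap N φ := by
  intro k _ a b hab
  classical
  let ae : (Fin k → unitInterval) → X := fun x =>
    if hx : x ∈ Cube.boundary (Fin k) then a ⟨x, hx⟩ else b x
  have hae : ∀ s : Cube.boundary (Fin k), ae s = a s := fun s => dif_pos s.2
  let L : (Fin k → unitInterval) × unitInterval → X := fun w => K (ae w.1, unitInterval.symm w.2)
  have hL : ContinuousOn L {w | w.1 ∈ Cube.boundary (Fin k)} :=
    continuousOn_boundary a (fun p => K (p.1, unitInterval.symm p.2)) (by fun_prop) L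
      fun x s => by simp only [L, hae]
  obtain ⟨H₁, hH₁, H₁0, H₁b⟩ := exists_homotopy_extension b b.continuous L hL fun x hx => by
    simp only [L, hae ⟨x, hx⟩, unitInterval.symm_zero, K1]
    exact hab ⟨x, hx⟩
  have ha' : ∀ s : Cube.boundary (Fin k), H₁ (s.1, 1) = a s := fun s => by
    rw [H₁b _ s.2]
    simp only [L, hae, unitInterval.symm_one, K0]
  obtain ⟨H, hH, h0, h1, hb⟩ := exists_compression_of_conjugate (H₁ := H₁)
    (H₂ := fun w => H₁ (w.1, 1)) (H₃ := fun w => K (H₁ (w.1, 1), unitInterval.symm w.2)) (L := L)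
    hH₁ (by fun_prop) (by fun_prop) hL (fun x => rfl) (fun x => by simp [K0])
    (fun x hx s => H₁b _ hx) (fun x hx s => H₁b _ hx) (fun x hx s => by
      simp only [L, ha' ⟨x, hx⟩, hae ⟨x, hx⟩])
  exact ⟨⟨fun x => H₁ (x, 1), by fun_prop⟩, ⟨H, hH⟩, ha', fun x => (h0 x).trans (H₁0 x),
    fun x => (h1 x).trans (by simp [K1]), fun x hx s => (hb x hx s).trans (H₁0 x)⟩

lemma ConnMap.comp {g : Y → Z} {f : X → Y} (hg : ConnMap N g) (hf : ConnMap N f)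
    (hgc : Continuous g) (hfc : Continuous f) : ConnMap N (g ∘ f) := by
  intro k hk a b hab
  obtain ⟨b', H, hb', H0, H1, Hb⟩ := hg k hk ⟨fun s => f (a s), by fun_prop⟩ b hab
  obtain ⟨a', H', ha', H'0, H'1, H'b⟩ := hf k hk a b' fun s => (hb' s).symm
  obtain ⟨E, hE, E0, E1, Eb⟩ := exists_compression_of_conjugate (H₁ := H)
    (H₂ := fun w => g (H' w)) (H₃ := fun w => g (f (a' w.1))) (L := fun w => b w.1)
    (by fun_prop) (by fun_prop) (by fun_prop) (by fun_prop) (fun x => by rw [H1, H'0])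
    (fun x => by rw [H'1]) Hb (fun x hx s => by
      rw [H'b x hx, hb' ⟨x, hx⟩]; exact hab ⟨x, hx⟩) (fun x hx s => by
      rw [ha' ⟨x, hx⟩]; exact hab ⟨x, hx⟩)
  exact ⟨a', ⟨E, hE⟩, ha', fun x => (E0 x).trans (H0 x), E1, fun x hx s => (Eb x hx s).trans (H0 x)⟩

/-- If `β ∘ α` is homotopic to the identity and `α ∘ i` is `N`-connected, then so is `i`. -/
lemma ConnMap.of_homotopy_retract {i : X → Y} {α : Y → Z} {β : Z → Y} (hi : Continuous i)
    (hα : Continuous α) (hβ : Continuous β) (K : Y × unitInterval → Y) (hK : Continuous K)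
    (K0 : ∀ y, K (y, 0) = y) (K1 : ∀ y, K (y, 1) = β (α y)) (h : ConnMap N (α ∘ i)) :
    ConnMap N i := by
  intro k hk a b hab
  obtain ⟨a', H, ha', H0, H1, Hb⟩ := h k hk a ⟨fun x => α (b x), by fun_prop⟩
    fun s => congrArg α (hab s)
  obtain ⟨E, hE, E0, E1, Eb⟩ := exists_compression_of_conjugate (H₁ := fun w => K (b w.1, w.2))
    (H₂ := fun w => β (H w)) (H₃ := fun w => K (i (a' w.1), w.2)) (L := fun w => K (b w.1, w.2))
    (by fun_prop) (by fun_prop) (by fun_prop) (by fun_prop) (fun x => by simp [K1, H0])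
    (fun x => by simp [K1, H1]) (fun _ _ _ => rfl) (fun x hx s => by simp [K1, Hb x hx])
    (fun x hx s => by rw [ha' ⟨x, hx⟩, hab ⟨x, hx⟩])
  exact ⟨a', ⟨E, hE⟩, ha', fun x => (E0 x).trans (K0 _), fun x => (E1 x).trans (K0 _),
    fun x hx s => (Eb x hx s).trans (K0 _)⟩

/-- Homotopy equivalences are connected. -/
lemma ConnMap.of_homotopyEquiv {f : X → Y} {g : Y → X} (hf : Continuous f) (hg : Continuous g)
    (K : X × unitInterval → X) (hK : Continuous K) (K0 : ∀ x, K (x, 0) = x)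
    (K1 : ∀ x, K (x, 1) = g (f x)) (E : Y × unitInterval → Y) (hE : Continuous E)
    (E0 : ∀ y, E (y, 0) = y) (E1 : ∀ y, E (y, 1) = f (g y)) : ConnMap N f :=
  ConnMap.of_homotopy_retract hf hg hf E hE E0 E1
    (ConnMap.of_homotopic_id K hK K0 K1)

lemma ConnMap.of_homeomorph (e : X ≃ₜ Y) : ConnMap N e :=
  .of_homotopyEquiv e.continuous e.symm.continuous Prod.fst continuous_fst (fun _ => rfl)
    (fun x => by simp) Prod.fst continuous_fst (fun _ => rfl) (fun x => by simp)

lemma ConnMap.prodMap_id {f : X → Y} (hf : ConnMap N f) :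
    ConnMap N (Prod.map f (id : Z → Z)) := by
  intro k hk a b hab
  obtain ⟨a', H, ha', H0, H1, Hb⟩ := hf k hk ⟨fun s => (a s).1, by fun_prop⟩
    ⟨fun s => (b s).1, by fun_prop⟩ fun s => congrArg Prod.fst (hab s)
  refine ⟨⟨fun x => (a' x, (b x).2), by fun_prop⟩, ⟨fun w => (H w, (b w.1).2), by fun_prop⟩,
    fun s => Prod.ext (ha' s) (congrArg Prod.snd (hab s)).symm,
    fun x => Prod.ext (H0 x) rfl, fun x => Prod.ext (H1 x) rfl,
    fun x hx s => Prod.ext (Hb x hx s) rfl⟩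

/-- A connected map restricts to a connected map over each open and closed part of the target. -/
lemma ConnMap.restrictPreimage_of_isClopen {f : X → Y} (hf : ConnMap N f)
    {V : Set Y} (hV : IsClopen V) : ConnMap N (V.restrictPreimage f) := by
  intro k hk a b hab
  obtain ⟨a', H, ha', H0, H1, Hb⟩ := hf k hk ⟨fun s => (a s).1, by fun_prop⟩
    ⟨fun s => (b s).1, by fun_prop⟩ fun s => congrArg Subtype.val (hab s)
  have hHV : ∀ w, H w ∈ V := by
    rintro ⟨x, s⟩
    have hc : IsClopen ((fun s => H (x, s)) ⁻¹' V) := hV.preimage (by fun_prop)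
    have := hc.eq_univ ⟨0, by
      change H (x, 0) ∈ V
      rw [H0]; exact (b x).2⟩
    exact this.symm.subset (Set.mem_univ s)
  refine ⟨⟨fun x => ⟨a' x, by
      have := hHV (x, 1)
      rwa [H1] at this⟩, by fun_prop⟩, ⟨fun w => ⟨H w, hHV w⟩, by fun_prop⟩,
    fun s => Subtype.ext (ha' s), fun x => Subtype.ext (H0 x), fun x => Subtype.ext (H1 x),
    fun x hx s => Subtype.ext (Hb x hx s)⟩

end calculus

end Multilin

namespace Multilin

/-! ### Cell-by-cell compression on a cubical grid -/

section grid

variable {k : ℕ}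

/-- The cell of the cubical grid of `ℝ^k` with index `c`: in the direction `i` it is the point
`c i / 2` if `c i` is even, and the unit interval with midpoint `c i / 2` if `c i` is odd. -/
def cellSet (c : Fin k → ℕ) : Set (Fin k → ℝ) :=
  {x | ∀ i, ((c i / 2 : ℕ) : ℝ) ≤ x i ∧ x i ≤ (((c i + 1) / 2 : ℕ) : ℝ)}

/-- The cell `d` is a face of the cell `c`. -/
def IsFace (d c : Fin k → ℕ) : Prop :=
  ∀ i, d i = c i ∨ (c i % 2 = 1 ∧ (d i + 1 = c i ∨ d i = c i + 1))

/-- The dimension of a cell. -/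
def cellDim (c : Fin k → ℕ) : ℕ := Fintype.card {i // c i % 2 = 1}

lemma cellDim_le (c : Fin k → ℕ) : cellDim c ≤ k :=
  (Fintype.card_subtype_le _).trans (Fintype.card_fin k).le

lemma IsFace.refl (c : Fin k → ℕ) : IsFace c c := fun _ => .inl rfl

lemma IsFace.trans {c d e : Fin k → ℕ} (h : IsFace c d) (h' : IsFace d e) : IsFace c e := by
  intro i
  have h1 := h i
  have h2 := h' i
  omega

lemma IsFace.cellSet_subset {d c : Fin k → ℕ} (h : IsFace d c) : cellSet d ⊆ cellSet c := by
  intro x hx i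
  have h1 := h i
  have h2 := hx i
  have h3 : c i / 2 ≤ d i / 2 := by omega
  have h4 : (d i + 1) / 2 ≤ (c i + 1) / 2 := by omega
  exact ⟨le_trans (by exact_mod_cast h3) h2.1, h2.2.trans (by exact_mod_cast h4)⟩

lemma IsFace.cellDim_lt {d c : Fin k → ℕ} (h : IsFace d c) (hne : d ≠ c) :
    cellDim d < cellDim c := by
  obtain ⟨i, hi⟩ := Function.ne_iff.mp hne
  have h1 := h i
  unfold cellDim
  rw [Fintype.card_subtype, Fintype.card_subtype]
  refine Finset.card_lt_card (Finset.ssubset_iff_of_subset ?_ |>.mpr ⟨i, ?_, ?_⟩)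
  · intro j
    have := h j
    simp only [Finset.mem_filter, Finset.mem_univ, true_and]
    omega
  · simp only [Finset.mem_filter, Finset.mem_univ, true_and]
    omega
  · simp only [Finset.mem_filter, Finset.mem_univ, true_and]
    omega

lemma isClosed_cellSet (c : Fin k → ℕ) : IsClosed (cellSet c) := by
  simp only [cellSet, Set.ofPred_forall]
  exact isClosed_iInter fun i => (isClosed_le continuous_const (continuous_apply i)).inter
    (isClosed_le (continuous_apply i) continuous_const)

/-- The boundary of a cell. -/
def cellBdry (c : Fin k → ℕ) : Set (Fin k → ℝ) :=
  {x | x ∈ cellSet c ∧ ∃ i, c i % 2 = 1 ∧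
    (x i = ((c i / 2 : ℕ) : ℝ) ∨ x i = (((c i + 1) / 2 : ℕ) : ℝ))}

lemma exists_face_of_mem_cellBdry {c : Fin k → ℕ} {x : Fin k → ℝ} (hx : x ∈ cellBdry c) :
    ∃ d, IsFace d c ∧ d ≠ c ∧ x ∈ cellSet d := by
  obtain ⟨hx, i, hi, h⟩ := hx
  have key : ∀ n, (n + 1 = c i ∨ n = c i + 1) → ((n / 2 : ℕ) : ℝ) = x i →
      ((n + 1) / 2 = n / 2) → ∃ d, IsFace d c ∧ d ≠ c ∧ x ∈ cellSet d := by
    intro n hn hnx hn2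
    refine ⟨Function.update c i n, fun j => ?_, fun e => ?_, fun j => ?_⟩
    · by_cases hj : j = i
      · subst hj; simp only [Function.update_self]; omega
      · simp [hj]
    · have := congrFun e i
      simp only [Function.update_self] at this
      omega
    · by_cases hj : j = i
      · subst hj; simp only [Function.update_self, hn2]
        exact ⟨hnx.le, hnx.ge⟩
      · simp only [Function.update_of_ne hj]
        exact hx j
  rcases h with h | h
  · refine key (c i - 1) (by omega) ?_ (by omega)
    rw [h, show (c i - 1) / 2 = c i / 2 by omega]
  · refine key (c i + 1) (by omega) h.symm (by omega)

lemma mem_cellBdry_of_mem {c d : Fin k → ℕ} {x : Fin k → ℝ} (hc : x ∈ cellSet c)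
    (hd : x ∈ cellSet d) (h : ¬ IsFace c d) : x ∈ cellBdry c := by
  refine ⟨hc, ?_⟩
  by_contra hcon
  push Not at hcon
  refine h fun i => ?_
  have h1 := hc i
  have h2 := hd i
  have e1 : d i / 2 ≤ (c i + 1) / 2 := by exact_mod_cast h2.1.trans h1.2
  have e2 : c i / 2 ≤ (d i + 1) / 2 := by exact_mod_cast h1.1.trans h2.2
  by_cases hi : c i % 2 = 1
  · have h3 := hcon i hi
    have l1 : ((c i / 2 : ℕ) : ℝ) < x i := lt_of_le_of_ne h1.1 (Ne.symm h3.1)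
    have l2 : x i < (((c i + 1) / 2 : ℕ) : ℝ) := lt_of_le_of_ne h1.2 h3.2
    have e3 : d i / 2 < (c i + 1) / 2 := by exact_mod_cast h2.1.trans_lt l2
    have e4 : c i / 2 < (d i + 1) / 2 := by exact_mod_cast l1.trans_le h2.2
    omega
  · omega

/-- The parametrization of a cell by a cube. -/
noncomputable def cellMap (c : Fin k → ℕ) (y : {i // c i % 2 = 1} → unitInterval) : Fin k → ℝ :=
  fun i => ((c i / 2 : ℕ) : ℝ) + if h : c i % 2 = 1 then (y ⟨i, h⟩ : ℝ) else 0

/-- The coordinates of the points of a cell. -/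
noncomputable def cellCoord (c : Fin k → ℕ) (x : Fin k → ℝ) : {i // c i % 2 = 1} → unitInterval :=
  fun i => Set.projIcc 0 1 zero_le_one (x i - ((c i / 2 : ℕ) : ℝ))

lemma continuous_cellMap (c : Fin k → ℕ) : Continuous (cellMap c) := by
  refine continuous_pi fun i => ?_
  by_cases h : c i % 2 = 1
  · simp only [cellMap, dif_pos h]; fun_prop
  · simp only [cellMap, dif_neg h]; fun_prop

lemma continuous_cellCoord (c : Fin k → ℕ) : Continuous (cellCoord c) :=
  continuous_pi fun i => continuous_projIcc.comp (by fun_prop)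

lemma cellMap_mem (c : Fin k → ℕ) (y : {i // c i % 2 = 1} → unitInterval) :
    cellMap c y ∈ cellSet c := by
  intro i
  by_cases h : c i % 2 = 1
  · simp only [cellMap, dif_pos h]
    rw [show (c i + 1) / 2 = c i / 2 + 1 by omega]
    push_cast
    have := (y ⟨i, h⟩).2
    exact ⟨by linarith [this.1], by linarith [this.2]⟩
  · simp only [cellMap, dif_neg h]
    rw [show (c i + 1) / 2 = c i / 2 by omega]
    simp

lemma cellMap_cellCoord {c : Fin k → ℕ} {x : Fin k → ℝ} (hx : x ∈ cellSet c) :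
    cellMap c (cellCoord c x) = x := by
  funext i
  have h1 := hx i
  by_cases h : c i % 2 = 1
  · rw [show (c i + 1) / 2 = c i / 2 + 1 by omega] at h1
    push_cast at h1
    simp only [cellMap, dif_pos h, cellCoord]
    rw [Set.projIcc_of_mem zero_le_one (show x i - ((c i / 2 : ℕ) : ℝ) ∈ Set.Icc (0 : ℝ) 1 from
      ⟨by linarith, by linarith⟩)]
    ring
  · rw [show (c i + 1) / 2 = c i / 2 by omega] at h1
    simp only [cellMap, dif_neg h]
    linarith

lemma cellMap_mem_bdry_iff (c : Fin k → ℕ) (y : {i // c i % 2 = 1} → unitInterval) :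
    cellMap c y ∈ cellBdry c ↔ y ∈ Cube.boundary {i // c i % 2 = 1} := by
  have key : ∀ i (h : c i % 2 = 1), (cellMap c y i = ((c i / 2 : ℕ) : ℝ) ∨
      cellMap c y i = (((c i + 1) / 2 : ℕ) : ℝ)) ↔ y ⟨i, h⟩ = 0 ∨ y ⟨i, h⟩ = 1 := by
    intro i h
    simp only [cellMap, dif_pos h]
    rw [show (c i + 1) / 2 = c i / 2 + 1 by omega, Subtype.ext_iff, Subtype.ext_iff]
    push_cast
    simp
  constructor
  · rintro ⟨-, i, hi, h⟩
    exact ⟨⟨i, hi⟩, (key i hi).mp h⟩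
  · rintro ⟨⟨i, hi⟩, h⟩
    exact ⟨cellMap_mem c y, i, hi, (key i hi).mpr h⟩

variable {X Y : Type} [TopologicalSpace X] [TopologicalSpace Y] {N : ℤ}

/-- Compression on a finite union of cells, relative to a subcomplex on which it is already given,
such that the homotopy on each cell `c` stays in a given set `U c`. -/
theorem exists_compression_on_cells {f : X → Y} (U : (Fin k → ℕ) → Set Y)
    (hU : ∀ c d, IsFace d c → U d ⊆ U c) (b : (Fin k → ℝ) → Y) (h₀ : (Fin k → ℝ) × unitInterval → Y)
    (a₀ : (Fin k → ℝ) → X) (S₀ : Finset (Fin k → ℕ)) (hS₀ : ∀ c ∈ S₀, ∀ d, IsFace d c → d ∈ S₀)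
    (hh₀ : ContinuousOn h₀ {w | ∃ c ∈ S₀, w.1 ∈ cellSet c})
    (ha₀ : ContinuousOn a₀ {x | ∃ c ∈ S₀, x ∈ cellSet c})
    (h₀b : ∀ c ∈ S₀, ∀ x ∈ cellSet c, h₀ (x, 0) = b x)
    (h₀a : ∀ c ∈ S₀, ∀ x ∈ cellSet c, h₀ (x, 1) = f (a₀ x))
    (h₀U : ∀ c ∈ S₀, ∀ x ∈ cellSet c, ∀ s, h₀ (x, s) ∈ U c)
    (n : ℕ) : ∀ S : Finset (Fin k → ℕ), S.card ≤ n + S₀.card → S₀ ⊆ S →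
    (∀ c ∈ S, ∀ d, IsFace d c → d ∈ S) →
    (∀ c ∈ S \ S₀, (cellDim c : ℤ) ≤ N ∧ ConnMap N ((U c).restrictPreimage f) ∧
      ContinuousOn b (cellSet c) ∧ Set.MapsTo b (cellSet c) (U c)) →
    ∃ (h : (Fin k → ℝ) × unitInterval → Y) (a : (Fin k → ℝ) → X),
      ContinuousOn h {w | ∃ c ∈ S, w.1 ∈ cellSet c} ∧
      ContinuousOn a {x | ∃ c ∈ S, x ∈ cellSet c} ∧
      (∀ c ∈ S, ∀ x ∈ cellSet c, h (x, 0) = b x) ∧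
      (∀ c ∈ S, ∀ x ∈ cellSet c, h (x, 1) = f (a x)) ∧
      (∀ c ∈ S, ∀ x ∈ cellSet c, ∀ s, h (x, s) ∈ U c) ∧
      ∀ c ∈ S₀, ∀ x ∈ cellSet c, a x = a₀ x ∧ ∀ s, h (x, s) = h₀ (x, s) := by
  classical
  induction n with
  | zero =>
    intro S hS hsub _ _
    obtain rfl : S₀ = S := Finset.eq_of_subset_of_card_le hsub (by simpa using hS)
    exact ⟨h₀, a₀, hh₀, ha₀, h₀b, h₀a, h₀U, fun _ _ _ _ => ⟨rfl, fun _ => rfl⟩⟩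
  | succ n ih =>
    intro S hS hsub hface hcell
    by_cases hemp : (S \ S₀).Nonempty
    swap
    · obtain rfl : S₀ = S := hsub.antisymm
        (Finset.sdiff_eq_empty_iff_subset.mp (Finset.not_nonempty_iff_eq_empty.mp hemp))
      exact ⟨h₀, a₀, hh₀, ha₀, h₀b, h₀a, h₀U, fun _ _ _ _ => ⟨rfl, fun _ => rfl⟩⟩
    -- a cell of maximal dimension is not a face of another cell
    obtain ⟨c, hc, hmax⟩ := Finset.exists_max_image (S \ S₀) cellDim hemp
    have hcS : c ∈ S := (Finset.mem_sdiff.mp hc).1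
    have hcS₀ : c ∉ S₀ := (Finset.mem_sdiff.mp hc).2
    have htop : ∀ d ∈ S, d ≠ c → ¬ IsFace c d := by
      intro d hd hdc hf
      have h1 := hf.cellDim_lt hdc.symm
      have h2 : d ∉ S₀ := fun h => hcS₀ (hS₀ d h c hf)
      exact absurd (hmax d (Finset.mem_sdiff.mpr ⟨hd, h2⟩)) (by omega)
    obtain ⟨h', a', hh', ha', h'b, h'a, h'U, h'₀⟩ := ih (S.erase c)
      (by rw [Finset.card_erase_of_mem hcS]; omega)
      (fun d hd => Finset.mem_erase.mpr ⟨fun e => hcS₀ (e ▸ hd), hsub hd⟩)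
      (fun d hd e he => Finset.mem_erase.mpr ⟨fun e' => htop d (Finset.mem_erase.mp hd).2
        (Finset.mem_erase.mp hd).1 (e' ▸ he), hface d (Finset.mem_erase.mp hd).2 e he⟩)
      (fun d hd => hcell d (Finset.mem_sdiff.mpr ⟨(Finset.mem_erase.mp (Finset.mem_sdiff.mp hd).1).2,
        (Finset.mem_sdiff.mp hd).2⟩))
    obtain ⟨hdim, hconn, hbc, hbU⟩ := hcell c hc
    have hbd : ∀ x ∈ cellBdry c, ∃ d ∈ S.erase c, IsFace d c ∧ x ∈ cellSet d := by
      intro x hx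
      obtain ⟨d, hd, hdc, hxd⟩ := exists_face_of_mem_cellBdry hx
      exact ⟨d, Finset.mem_erase.mpr ⟨hdc, hface c hcS d hd⟩, hd, hxd⟩
    have hbd' : ∀ x ∈ cellSet c, (∃ d ∈ S.erase c, x ∈ cellSet d) → x ∈ cellBdry c := by
      rintro x hx ⟨d, hd, hxd⟩
      exact mem_cellBdry_of_mem hx hxd (htop d (Finset.mem_erase.mp hd).2 (Finset.mem_erase.mp hd).1)
    have hm : ∀ y, y ∈ Cube.boundary {i // c i % 2 = 1} → cellMap c y ∈ cellBdry c :=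
      fun y hy => (cellMap_mem_bdry_iff c y).mpr hy
    -- the compression of the boundary of `c` is extended to `c`
    obtain ⟨H, A, hH, hA, HU, H0, H1, Hb, Ab⟩ := ConnMap.strong hconn hdim
      (fun y => b (cellMap c y))
      (hbc.comp_continuous (continuous_cellMap c) (cellMap_mem c)) (fun y => hbU (cellMap_mem c y))
      (fun w => h' (cellMap c w.1, w.2))
      (hh'.comp (((continuous_cellMap c).comp continuous_fst).prodMk continuous_snd).continuousOn
        fun w hw => by
          obtain ⟨d, hd, -, hx⟩ := hbd _ (hm _ hw)
          exact ⟨d, hd, hx⟩)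
      (fun w hw => by
        obtain ⟨d, hd, hdf, hx⟩ := hbd _ (hm _ hw)
        exact hU c d hdf (h'U d hd _ hx _))
      (fun y => a' (cellMap c y))
      (ha'.comp (continuous_cellMap c).continuousOn fun y hy => by
        obtain ⟨d, hd, -, hx⟩ := hbd _ (hm _ hy)
        exact ⟨d, hd, hx⟩)
      (fun y hy => by
        obtain ⟨d, hd, -, hx⟩ := hbd _ (hm _ hy)
        exact h'b d hd _ hx)
      (fun y hy => by
        obtain ⟨d, hd, -, hx⟩ := hbd _ (hm _ hy)
        exact h'a d hd _ hx)
    have hco : ∀ x ∈ cellBdry c, cellCoord c x ∈ Cube.boundary {i // c i % 2 = 1} := fun x hx => by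
      rw [← cellMap_mem_bdry_iff, cellMap_cellCoord hx.1]
      exact hx
    let h : (Fin k → ℝ) × unitInterval → Y := fun w =>
      if w.1 ∈ cellSet c then H (cellCoord c w.1, w.2) else h' w
    let a : (Fin k → ℝ) → X := fun x => if x ∈ cellSet c then A (cellCoord c x) else a' x
    have hc1 : ∀ x ∈ cellSet c, ∀ s, h (x, s) = H (cellCoord c x, s) := fun x hx s => if_pos hx
    have ac1 : ∀ x ∈ cellSet c, a x = A (cellCoord c x) := fun x hx => if_pos hx
    have hc2 : ∀ d ∈ S.erase c, ∀ x ∈ cellSet d, ∀ s, h (x, s) = h' (x, s) := fun d hd x hx s => by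
      by_cases hxc : x ∈ cellSet c
      · have hxb := hbd' x hxc ⟨d, hd, hx⟩
        rw [hc1 x hxc, Hb _ (hco x hxb), cellMap_cellCoord hxc]
      · exact if_neg hxc
    have ac2 : ∀ d ∈ S.erase c, ∀ x ∈ cellSet d, a x = a' x := fun d hd x hx => by
      by_cases hxc : x ∈ cellSet c
      · have hxb := hbd' x hxc ⟨d, hd, hx⟩
        rw [ac1 x hxc, Ab _ (hco x hxb), cellMap_cellCoord hxc]
      · exact if_neg hxc
    have hset : ∀ x, (∃ d ∈ S, x ∈ cellSet d) ↔ x ∈ cellSet c ∨ ∃ d ∈ S.erase c, x ∈ cellSet d := by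
      intro x
      constructor
      · rintro ⟨d, hd, hx⟩
        by_cases e : d = c
        · exact .inl (e ▸ hx)
        · exact .inr ⟨d, Finset.mem_erase.mpr ⟨e, hd⟩, hx⟩
      · rintro (hx | ⟨d, hd, hx⟩)
        · exact ⟨c, hcS, hx⟩
        · exact ⟨d, (Finset.mem_erase.mp hd).2, hx⟩
    have hclosed : IsClosed {x : Fin k → ℝ | ∃ d ∈ S.erase c, x ∈ cellSet d} := by
      have : {x : Fin k → ℝ | ∃ d ∈ S.erase c, x ∈ cellSet d} = ⋃ d ∈ S.erase c, cellSet d := by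
        ext x; simp
      rw [this]
      exact (S.erase c).finite_toSet.isClosed_biUnion fun d _ => isClosed_cellSet d
    have split : ∀ d ∈ S, d = c ∨ d ∈ S.erase c := fun d hd => by
      by_cases e : d = c
      · exact .inl e
      · exact .inr (Finset.mem_erase.mpr ⟨e, hd⟩)
    refine ⟨h, a, ?_, ?_, fun d hd x hx => ?_, fun d hd x hx => ?_, fun d hd x hx s => ?_,
      fun d hd x hx => ?_⟩
    · have : {w : (Fin k → ℝ) × unitInterval | ∃ d ∈ S, w.1 ∈ cellSet d} =
          {w | w.1 ∈ cellSet c} ∪ {w | ∃ d ∈ S.erase c, w.1 ∈ cellSet d} :=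
        Set.ext fun w => hset w.1
      rw [this]
      refine ContinuousOn.union_of_isClosed ?_ ?_ ((isClosed_cellSet c).preimage continuous_fst)
        (hclosed.preimage continuous_fst)
      · refine ContinuousOn.congr (f := fun w => H (cellCoord c w.1, w.2)) ?_
          fun w hw => hc1 w.1 hw w.2
        exact (hH.comp (((continuous_cellCoord c).comp continuous_fst).prodMk
          continuous_snd)).continuousOn
      · exact hh'.congr fun w ⟨d, hd, hw⟩ => hc2 d hd w.1 hw w.2
    · have : {x : Fin k → ℝ | ∃ d ∈ S, x ∈ cellSet d} =
          cellSet c ∪ {x | ∃ d ∈ S.erase c, x ∈ cellSet d} := Set.ext fun x => hset x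
      rw [this]
      refine ContinuousOn.union_of_isClosed ?_ ?_ (isClosed_cellSet c) hclosed
      · refine ContinuousOn.congr (f := fun x => A (cellCoord c x)) ?_ fun x hx => ac1 x hx
        exact (hA.comp (continuous_cellCoord c)).continuousOn
      · exact ha'.congr fun x ⟨d, hd, hx⟩ => ac2 d hd x hx
    · rcases split d hd with rfl | hd'
      · rw [hc1 x hx, H0, cellMap_cellCoord hx]
      · rw [hc2 d hd' x hx, h'b d hd' x hx]
    · rcases split d hd with rfl | hd'
      · rw [hc1 x hx, ac1 x hx, H1]
      · rw [hc2 d hd' x hx, ac2 d hd' x hx, h'a d hd' x hx]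
    · rcases split d hd with rfl | hd'
      · rw [hc1 x hx]
        exact HU _
      · rw [hc2 d hd' x hx]
        exact h'U d hd' x hx s
    · have hd' : d ∈ S.erase c := Finset.mem_erase.mpr ⟨fun e => hcS₀ (e ▸ hd), hsub hd⟩
      refine ⟨(ac2 d hd' x hx).trans (h'₀ d hd x hx).1, fun s => ?_⟩
      rw [hc2 d hd' x hx, (h'₀ d hd x hx).2]

end grid

end Multilin

namespace Multilin

section grid

variable {k : ℕ}

/-- The cells of the cube `[0, M]^k`. -/
def grid (k M : ℕ) : Finset (Fin k → ℕ) := Fintype.piFinset fun _ => Finset.range (2 * M + 1)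

lemma mem_grid {M : ℕ} {c : Fin k → ℕ} : c ∈ grid k M ↔ ∀ i, c i ≤ 2 * M := by
  simp [grid]

/-- The cells of the boundary of the cube `[0, M]^k`. -/
def gridBdry (k M : ℕ) : Finset (Fin k → ℕ) :=
  (grid k M).filter fun c => ∃ i, c i = 0 ∨ c i = 2 * M

lemma grid_face {M : ℕ} : ∀ c ∈ grid k M, ∀ d, IsFace d c → d ∈ grid k M := by
  intro c hc d hd
  rw [mem_grid] at *
  intro i
  have h1 := hc i
  have h2 := hd i
  omega

lemma gridBdry_face {M : ℕ} : ∀ c ∈ gridBdry k M, ∀ d, IsFace d c → d ∈ gridBdry k M := by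
  intro c hc d hd
  obtain ⟨h, i, hi⟩ := Finset.mem_filter.mp hc
  refine Finset.mem_filter.mpr ⟨grid_face c h d hd, i, ?_⟩
  have h2 := hd i
  omega

/-- The rescaling `[0, M]^k → [0, 1]^k`. -/
noncomputable def shrink (M : ℕ) (x : Fin k → ℝ) : Fin k → unitInterval :=
  fun i => Set.projIcc 0 1 zero_le_one (x i / M)

/-- The rescaling `[0, 1]^k → [0, M]^k`. -/
def enlarge (M : ℕ) (y : Fin k → unitInterval) : Fin k → ℝ := fun i => M * y i

lemma continuous_shrink (M : ℕ) : Continuous (shrink M : (Fin k → ℝ) → _) :=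
  continuous_pi fun i => continuous_projIcc.comp (by fun_prop)

lemma continuous_enlarge (M : ℕ) : Continuous (enlarge M : (Fin k → unitInterval) → _) :=
  continuous_pi fun i => by unfold enlarge; fun_prop

lemma shrink_enlarge {M : ℕ} (hM : 0 < M) (y : Fin k → unitInterval) :
    shrink M (enlarge M y) = y := by
  funext i
  have : (M : ℝ) ≠ 0 := by positivity
  simp only [shrink, enlarge, mul_div_cancel_left₀ _ this, Set.projIcc_val]

lemma exists_cell {M : ℕ} (hM : 0 < M) (y : Fin k → unitInterval) :
    ∃ c ∈ grid k M, enlarge M y ∈ cellSet c ∧ (y ∈ Cube.boundary (Fin k) → c ∈ gridBdry k M) := by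
  have key : ∀ i, ∃ n : ℕ, n ≤ 2 * M ∧ ((n / 2 : ℕ) : ℝ) ≤ M * y i ∧
      (M * y i : ℝ) ≤ (((n + 1) / 2 : ℕ) : ℝ) ∧ (y i = 0 → n = 0) ∧ (y i = 1 → n = 2 * M) := by
    intro i
    by_cases h0 : y i = 0
    · refine ⟨0, by omega, ?_, ?_, fun _ => rfl, fun h1 => ?_⟩
      · simp [h0]
      · simp [h0]
      · rw [h0] at h1
        exact absurd h1 zero_ne_one
    by_cases h1 : y i = 1
    · refine ⟨2 * M, le_rfl, ?_, ?_, fun h => absurd h h0, fun _ => rfl⟩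
      · simp [h1]
      · rw [show (2 * M + 1) / 2 = M by omega]
        simp [h1]
    have hy : (y i : ℝ) < 1 := lt_of_le_of_ne (y i).2.2 fun e => h1 (Subtype.ext e)
    have hnn : (0 : ℝ) ≤ M * y i := mul_nonneg (Nat.cast_nonneg _) (y i).2.1
    refine ⟨2 * ⌊(M * y i : ℝ)⌋₊ + 1, ?_, ?_, ?_, fun h => absurd h h0, fun h => absurd h h1⟩
    · have : ⌊(M * y i : ℝ)⌋₊ < M := by
        rw [Nat.floor_lt hnn]
        have : (0 : ℝ) < M := by exact_mod_cast hM
        nlinarith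
      omega
    · rw [show (2 * ⌊(M * y i : ℝ)⌋₊ + 1) / 2 = ⌊(M * y i : ℝ)⌋₊ by omega]
      exact Nat.floor_le hnn
    · rw [show (2 * ⌊(M * y i : ℝ)⌋₊ + 1 + 1) / 2 = ⌊(M * y i : ℝ)⌋₊ + 1 by omega]
      push_cast
      exact (Nat.lt_floor_add_one _).le
  choose c h1 h2 h3 h4 h5 using key
  refine ⟨c, mem_grid.mpr h1, fun i => ⟨h2 i, h3 i⟩, ?_⟩
  rintro ⟨i, hi⟩
  exact Finset.mem_filter.mpr ⟨mem_grid.mpr h1, i, hi.imp (h4 i) (h5 i)⟩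

lemma shrink_mem_boundary {M : ℕ} (hM : 0 < M) {c : Fin k → ℕ} (hc : c ∈ gridBdry k M)
    {x : Fin k → ℝ} (hx : x ∈ cellSet c) : shrink M x ∈ Cube.boundary (Fin k) := by
  obtain ⟨-, i, hi⟩ := Finset.mem_filter.mp hc
  have h := hx i
  refine ⟨i, hi.imp (fun e => ?_) fun e => ?_⟩
  · rw [e] at h
    have : x i = 0 := le_antisymm (by simpa using h.2) (by simpa using h.1)
    simp [shrink, this]
  · rw [e, show 2 * M / 2 = M by omega, show (2 * M + 1) / 2 = M by omega] at h
    have : x i = M := le_antisymm h.2 h.1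
    have hM' : (M : ℝ) ≠ 0 := by positivity
    simp only [shrink, this, div_self hM']
    exact Set.projIcc_right ..

lemma dist_shrink_le {M : ℕ} (hM : 0 < M) {c : Fin k → ℕ} {x x' : Fin k → ℝ} (hx : x ∈ cellSet c)
    (hx' : x' ∈ cellSet c) : dist (shrink M x) (shrink M x') ≤ 1 / M := by
  have hM' : (0 : ℝ) < M := by exact_mod_cast hM
  refine (dist_pi_le_iff (by positivity)).mpr fun i => ?_
  have h := hx i
  have h' := hx' i
  have e : (((c i + 1) / 2 : ℕ) : ℝ) ≤ ((c i / 2 : ℕ) : ℝ) + 1 := by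
    exact_mod_cast (by omega : (c i + 1) / 2 ≤ c i / 2 + 1)
  rw [Subtype.dist_eq, Real.dist_eq]
  refine (Set.abs_projIcc_sub_projIcc (zero_le_one (α := ℝ))).trans ?_
  rw [← sub_div, abs_div, abs_of_pos hM']
  refine div_le_div_of_nonneg_right ?_ hM'.le
  rw [abs_le]
  constructor <;> linarith

end grid

section local_to_global

variable {X Y Z : Type} [TopologicalSpace X] [TopologicalSpace Y] [TopologicalSpace Z] {N : ℤ}

lemma ConnMap.nonempty {f : X → Y} (hf : ConnMap N f) (hN : 0 ≤ N) (y : Y) : Nonempty X := by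
  have : IsEmpty (Cube.boundary (Fin 0)) := ⟨fun ⟨_, i, _⟩ => i.elim0⟩
  obtain ⟨a', -⟩ := hf 0 hN ⟨isEmptyElim, continuous_of_const fun s => isEmptyElim s⟩
    ⟨fun _ => y, continuous_const⟩ isEmptyElim
  exact ⟨a' fun i => i.elim0⟩

/-- A map which is `N`-connected over each member of an open cover that is closed under
intersections is `N`-connected. -/
theorem ConnMap.of_cover {f : X → Y} (𝒪 : Set (Set Y)) (hopen : ∀ U ∈ 𝒪, IsOpen U)
    (hcover : ∀ y, ∃ U ∈ 𝒪, y ∈ U) (hinter : ∀ U ∈ 𝒪, ∀ V ∈ 𝒪, U ∩ V ∈ 𝒪)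
    (h : ∀ U ∈ 𝒪, ConnMap N (U.restrictPreimage f)) : ConnMap N f := by
  classical
  intro k hk a b hab
  have hX : Nonempty X := by
    obtain ⟨U, hU, hy⟩ := hcover (b fun _ => 0)
    obtain ⟨x⟩ := (h U hU).nonempty (by omega) ⟨_, hy⟩
    exact ⟨x.1⟩
  -- a subdivision of the cube whose cells are mapped to members of the cover
  obtain ⟨δ, hδ, hleb⟩ := lebesgue_number_lemma_of_metric_sUnion
    (s := (Set.univ : Set (Fin k → unitInterval))) (c := (fun U => b ⁻¹' U) '' 𝒪) isCompact_univ
    (by rintro _ ⟨U, hU, rfl⟩; exact (hopen U hU).preimage b.continuous)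
    (fun y _ => by
      obtain ⟨U, hU, hy⟩ := hcover (b y)
      exact ⟨_, ⟨U, hU, rfl⟩, hy⟩)
  obtain ⟨m, hm⟩ := exists_nat_one_div_lt hδ
  obtain ⟨M, hM, hMδ⟩ : ∃ M : ℕ, 0 < M ∧ 1 / (M : ℝ) < δ := ⟨m + 1, by omega, by exact_mod_cast hm⟩
  have hO : ∀ c : Fin k → ℕ, ∃ U ∈ 𝒪, Set.MapsTo (fun x => b (shrink M x)) (cellSet c) U := by
    intro c
    obtain ⟨x₀, hx₀⟩ : (cellSet c).Nonempty := ⟨_, cellMap_mem c fun _ => 0⟩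
    obtain ⟨_, ⟨U, hU, rfl⟩, hb⟩ := hleb (shrink M x₀) trivial
    exact ⟨U, hU, fun x hx => hb ((dist_shrink_le hM hx hx₀).trans_lt hMδ)⟩
  choose O hO hOb using hO
  -- a cell is contained in all cells of which it is a face, so that `U` is monotone
  let U : (Fin k → ℕ) → Set Y := fun d => {y | ∀ c ∈ grid k M, IsFace d c → y ∈ O c}
  have hUO : ∀ d ∈ grid k M, U d ∈ 𝒪 := by
    intro d hd
    have key : ∀ T : Finset (Fin k → ℕ), T.Nonempty → {y | ∀ c ∈ T, y ∈ O c} ∈ 𝒪 := by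
      intro T hT
      induction hT using Finset.Nonempty.cons_induction with
      | singleton c => simpa using hO c
      | cons c T hc hT ih =>
        have : {y | ∀ c' ∈ Finset.cons c T hc, y ∈ O c'} = O c ∩ {y | ∀ c' ∈ T, y ∈ O c'} := by
          ext y; simp
        rw [this]
        exact hinter _ (hO c) _ ih
    have := key ((grid k M).filter fun c => IsFace d c)
      ⟨d, Finset.mem_filter.mpr ⟨hd, IsFace.refl d⟩⟩
    simpa [U] using this
  have hbc : Continuous fun x : Fin k → ℝ => b (shrink M x) := b.continuous.comp (continuous_shrink M)
  let a₀ : (Fin k → ℝ) → X := fun x => if hx : shrink M x ∈ Cube.boundary (Fin k) then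
    a ⟨_, hx⟩ else Classical.arbitrary X
  have ha₀ : ∀ c (hc : c ∈ gridBdry k M) x (hx : x ∈ cellSet c),
      a₀ x = a ⟨shrink M x, shrink_mem_boundary hM hc hx⟩ :=
    fun c hc x hx => dif_pos (shrink_mem_boundary hM hc hx)
  have hUb : ∀ c, ∀ x ∈ cellSet c, b (shrink M x) ∈ U c :=
    fun c x hx d _ hcd => hOb d (hcd.cellSet_subset hx)
  obtain ⟨H, A, hH, hA, H0, H1, -, hr⟩ := exists_compression_on_cells (N := N) (f := f) U
    (fun c d hdc y hy e he hce => hy e he (hdc.trans hce)) (fun x => b (shrink M x))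
    (fun w => b (shrink M w.1)) a₀ (gridBdry k M) gridBdry_face
    (hbc.comp continuous_fst).continuousOn (by
      rw [continuousOn_iff_continuous_domRestrict]
      have : Continuous fun x : {x : Fin k → ℝ | ∃ c ∈ gridBdry k M, x ∈ cellSet c} =>
          a ⟨shrink M x.1, by obtain ⟨c, hc, hx⟩ := x.2; exact shrink_mem_boundary hM hc hx⟩ :=
        a.continuous.comp (Continuous.subtype_mk
          ((continuous_shrink M).comp continuous_subtype_val) _)
      refine this.congr fun x => ?_
      obtain ⟨c, hc, hx⟩ := x.2
      exact (ha₀ c hc x.1 hx).symm)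
    (fun _ _ _ _ => rfl) (fun c hc x hx => by
      dsimp only
      rw [ha₀ c hc x hx]
      exact (hab ⟨_, shrink_mem_boundary hM hc hx⟩).symm)
    (fun c _ x hx _ => hUb c x hx)
    (grid k M).card (grid k M) (by omega) (Finset.filter_subset _ _) grid_face
    (fun c hc => ⟨le_trans (by exact_mod_cast cellDim_le c) hk, h _ (hUO c (Finset.mem_sdiff.mp hc).1),
      hbc.continuousOn, fun x hx => hUb c x hx⟩)
  have hcell : ∀ y : Fin k → unitInterval, ∃ c ∈ grid k M, enlarge M y ∈ cellSet c := fun y => by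
    obtain ⟨c, hc, hy, -⟩ := exists_cell hM y
    exact ⟨c, hc, hy⟩
  refine ⟨⟨fun y => A (enlarge M y), hA.comp_continuous (continuous_enlarge M) hcell⟩,
    ⟨fun w => H (enlarge M w.1, w.2), hH.comp_continuous
      (((continuous_enlarge M).comp continuous_fst).prodMk continuous_snd) fun w => hcell w.1⟩,
    fun s => ?_, fun y => ?_, fun y => ?_, fun y hy s => ?_⟩
  · obtain ⟨c, -, hy, hc⟩ := exists_cell hM s.1
    refine ((hr c (hc s.2) _ hy).1.trans (ha₀ c (hc s.2) _ hy)).trans ?_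
    congr 1
    exact Subtype.ext (shrink_enlarge hM _)
  · obtain ⟨c, hc, hy⟩ := hcell y
    exact (H0 c hc _ hy).trans (by rw [shrink_enlarge hM])
  · obtain ⟨c, hc, hy⟩ := hcell y
    exact H1 c hc _ hy
  · obtain ⟨c, -, hy', hc⟩ := exists_cell hM y
    exact ((hr c (hc hy) _ hy').2 s).trans (by simp only [shrink_enlarge hM])

/-- Compression of a map on the boundary of a cube. -/
lemma ConnMap.exists_compression_boundary [Nonempty X] {f : X → Y} (hf : ConnMap N f) {k : ℕ}
    (hk : (k : ℤ) ≤ N) (a : C(Cube.boundary (Fin k), Y)) :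
    ∃ (h : (Fin k → unitInterval) × unitInterval → Y) (a' : C(Cube.boundary (Fin k), X)),
      ContinuousOn h {w | w.1 ∈ Cube.boundary (Fin k)} ∧
      (∀ s : Cube.boundary (Fin k), h (s.1, 0) = a s) ∧
      ∀ s : Cube.boundary (Fin k), h (s.1, 1) = f (a' s) := by
  classical
  rcases isEmpty_or_nonempty Y with hY | hY
  · exact (hY.false (f (Classical.arbitrary X))).elim
  let b : (Fin k → ℝ) → Y := fun x => if hx : shrink 1 x ∈ Cube.boundary (Fin k) then
    a ⟨_, hx⟩ else Classical.arbitrary Y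
  have hb : ∀ c (hc : c ∈ gridBdry k 1) x (hx : x ∈ cellSet c),
      b x = a ⟨shrink 1 x, shrink_mem_boundary one_pos hc hx⟩ :=
    fun c hc x hx => dif_pos (shrink_mem_boundary one_pos hc hx)
  have hf' : ConnMap N (Set.univ.restrictPreimage f) :=
    hf.restrictPreimage_of_isClopen isClopen_univ
  obtain ⟨H, A, hH, hA, H0, H1, -, -⟩ := exists_compression_on_cells (N := N) (f := f)
    (fun _ => Set.univ) (fun _ _ _ => subset_rfl) b (fun w => b w.1)
    (fun _ => Classical.arbitrary X) ∅ (by simp) (by simp) (by simp) (by simp) (by simp) (by simp)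
    (gridBdry k 1).card (gridBdry k 1) (by omega) (by simp) gridBdry_face
    (fun c hc => ⟨le_trans (by exact_mod_cast cellDim_le c) hk, hf', by
      rw [Finset.sdiff_empty] at hc
      rw [continuousOn_iff_continuous_domRestrict]
      have : Continuous fun x : cellSet c =>
          a ⟨shrink 1 x.1, shrink_mem_boundary one_pos hc x.2⟩ :=
        a.continuous.comp (Continuous.subtype_mk
          ((continuous_shrink 1).comp continuous_subtype_val) _)
      exact this.congr fun x => (hb c hc x.1 x.2).symm, fun _ _ => trivial⟩)
  have hcell : ∀ y : Fin k → unitInterval, y ∈ Cube.boundary (Fin k) →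
      ∃ c ∈ gridBdry k 1, enlarge 1 y ∈ cellSet c := fun y hy => by
    obtain ⟨c, -, hy', hc⟩ := exists_cell one_pos y
    exact ⟨c, hc hy, hy'⟩
  refine ⟨fun w => H (enlarge 1 w.1, w.2), ⟨fun s => A (enlarge 1 s.1),
    hA.comp_continuous ((continuous_enlarge 1).comp continuous_subtype_val) fun s => hcell s.1 s.2⟩,
    hH.comp (((continuous_enlarge 1).comp continuous_fst).prodMk continuous_snd).continuousOn
      fun w hw => hcell w.1 hw, fun s => ?_, fun s => ?_⟩
  · obtain ⟨c, hc, hy⟩ := hcell s.1 s.2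
    refine (H0 c hc _ hy).trans ((hb c hc _ hy).trans ?_)
    congr 1
    exact Subtype.ext (shrink_enlarge one_pos _)
  · obtain ⟨c, hc, hy⟩ := hcell s.1 s.2
    exact H1 c hc _ hy

/-- If `f` and `g ∘ f` are `N`-connected, then so is `g`.  The boundary of a cube is first moved into
the image of `f`; the homotopy obtained from `g ∘ f` is then conjugated by this motion. -/
theorem ConnMap.of_comp {f : X → Y} {g : Y → Z} (hf : ConnMap N f) (hgf : ConnMap N (g ∘ f))
    (hfc : Continuous f) (hg : Continuous g) : ConnMap N g := by
  intro k hk a b hab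
  have hX : Nonempty X := hgf.nonempty (by omega) (b fun _ => 0)
  obtain ⟨h, a', hh, h0, h1⟩ := hf.exists_compression_boundary hk a
  obtain ⟨K, hK, K0, Kb⟩ := exists_homotopy_extension b b.continuous (fun w => g (h w))
    (hg.comp_continuousOn hh) fun x hx => (congrArg g (h0 ⟨x, hx⟩)).trans (hab ⟨x, hx⟩)
  obtain ⟨A, H, hA, H0, H1, Hb⟩ := hgf k hk a' ⟨fun x => K (x, 1), by fun_prop⟩ fun s => by
    refine Eq.trans ?_ (Kb (s.1, 1) s.2).symm
    exact congrArg g (h1 s).symm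
  obtain ⟨K', hK', K'0, K'b⟩ := exists_homotopy_extension (fun x => f (A x)) (by fun_prop)
    (fun w => h (w.1, unitInterval.symm w.2))
    (hh.comp (by fun_prop : Continuous fun w : (Fin k → unitInterval) × unitInterval =>
      (w.1, unitInterval.symm w.2)).continuousOn fun w hw => hw) fun x hx => by
      rw [unitInterval.symm_zero, hA ⟨x, hx⟩]
      exact h1 ⟨x, hx⟩
  obtain ⟨E, hE, E0, E1, Eb⟩ := exists_compression_of_conjugate (H₁ := K) (H₂ := H)
    (H₃ := fun w => g (K' (w.1, unitInterval.symm w.2))) (L := fun w => g (h w))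
    hK (by fun_prop) (by fun_prop) (hg.comp_continuousOn hh) (fun x => (H0 x).symm)
    (fun x => by rw [H1, unitInterval.symm_one, K'0]; rfl) (fun x hx s => Kb _ hx)
    (fun x hx s => (Hb x hx s).trans (Kb _ hx)) (fun x hx s => by
      rw [K'b _ hx]
      simp)
  refine ⟨⟨fun x => K' (x, 1), by fun_prop⟩, ⟨E, hE⟩, fun s => ?_, fun x => (E0 x).trans (K0 x),
    fun x => (E1 x).trans (by simp), fun x hx s => (Eb x hx s).trans (K0 x)⟩
  refine (K'b (s.1, 1) s.2).trans ?_
  simp [h0]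

end local_to_global

end Multilin

namespace Multilin

/-! ### Normal forms of the points of a realization -/

lemma orderHom_eq_id_of_surjective {n : ℕ} {e : Fin (n + 1) →o Fin (n + 1)}
    (h : Function.Surjective e) : e = OrderHom.id := by
  have hs : StrictMono e := e.monotone.strictMono_of_injective (Finite.injective_iff_surjective.mpr h)
  exact OrderHom.ext _ _ (funext fun j => le_antisymm (hs.le_id j) (hs.id_le j))

lemma exists_image_factorization {n q : ℕ} (e : Fin (n + 1) →o Fin (q + 1)) :
    ∃ (m : ℕ) (π : Fin (n + 1) →o Fin (m + 1)) (ι : Fin (m + 1) ↪o Fin (q + 1)),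
      m ≤ n ∧ Function.Surjective π ∧ ∀ j, e j = ι (π j) := by
  classical
  let S : Finset (Fin (q + 1)) := Finset.univ.image e
  have hpos : 0 < S.card := Finset.card_pos.mpr ⟨e 0, Finset.mem_image_of_mem _ (Finset.mem_univ _)⟩
  obtain ⟨m, hm⟩ : ∃ m, S.card = m + 1 := ⟨S.card - 1, by omega⟩
  have hle : m ≤ n := by
    have : S.card ≤ _ := Finset.card_image_le
    simp at this
    omega
  have hmem : ∀ j, e j ∈ S := fun j => Finset.mem_image_of_mem _ (Finset.mem_univ _)
  let E := S.orderIsoOfFin hm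
  refine ⟨m, ⟨fun j => E.symm ⟨e j, hmem j⟩, fun a b h => E.symm.monotone (e.monotone h)⟩,
    S.orderEmbOfFin hm, hle, fun i => ?_, fun j => ?_⟩
  · obtain ⟨j, -, hj⟩ := Finset.mem_image.mp (E i).2
    refine ⟨j, ?_⟩
    change E.symm ⟨e j, hmem j⟩ = i
    rw [OrderIso.symm_apply_eq]
    exact Subtype.ext hj
  · change e j = (E (E.symm ⟨e j, hmem j⟩)).1
    rw [OrderIso.apply_symm_apply]

/-- A monotone surjection has a monotone section through a given point, which preserves `0` unless
the point lies over `0`. -/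
lemma exists_section {r m : ℕ} {η : Fin (r + 1) →o Fin (m + 1)} (hη : Function.Surjective η)
    (j : Fin (r + 1)) : ∃ s : Fin (m + 1) →o Fin (r + 1), (∀ i, η (s i) = i) ∧ s (η j) = j ∧
      (η j ≠ 0 → s 0 = 0) := by
  classical
  let g : Fin (m + 1) → Fin (r + 1) := fun i => if i = η j then j else
    if i = 0 then 0 else Function.surjInv hη i
  have h0 : η 0 = 0 := by
    obtain ⟨i, hi⟩ := hη 0
    exact le_antisymm ((η.monotone (Fin.zero_le i)).trans hi.le) (Fin.zero_le _)
  have hg : ∀ i, η (g i) = i := fun i => by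
    simp only [g]
    split_ifs with h h'
    · exact h.symm
    · rw [h0, h']
    · exact Function.surjInv_eq hη i
  refine ⟨⟨g, fun a b hab => ?_⟩, hg, if_pos rfl, fun h => ?_⟩
  · rcases hab.eq_or_lt with rfl | hlt
    · rfl
    · by_contra hc
      have := η.monotone (not_le.mp hc).le
      rw [hg, hg] at this
      exact absurd this (not_le.mpr hlt)
  · change g 0 = 0
    simp only [g, if_neg (Ne.symm h), if_true]

section normalForm

variable {X : SSp}

/-- Nondegenerate simplices.  The condition says that the simplex is not induced from a simplex of
lower dimension; it is formulated by means of endomorphisms of `[n]`. -/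
def Nondeg {n : ℕ} (x : X.obj n) : Prop :=
  ∀ e : Fin (n + 1) →o Fin (n + 1), e 0 = 0 → X.act e x = x → e = OrderHom.id

/-- Each simplex is a degeneracy of a nondegenerate simplex. -/
lemma exists_nondeg {n : ℕ} (x : X.obj n) : ∃ (m : ℕ) (η : Fin (n + 1) →o Fin (m + 1))
    (s : Fin (m + 1) →o Fin (n + 1)), m ≤ n ∧ Function.Surjective η ∧ s 0 = 0 ∧
      (∀ i, η (s i) = i) ∧ Nondeg (X.act s x) ∧ X.act η (X.act s x) = x := by
  classical
  let P : ℕ → Prop := fun m => ∃ (η : Fin (n + 1) →o Fin (m + 1)) (s : Fin (m + 1) →o Fin (n + 1)),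
    η 0 = 0 ∧ s 0 = 0 ∧ X.act η (X.act s x) = x
  have hP : ∃ m, P m := ⟨n, OrderHom.id, OrderHom.id, rfl, rfl, by rw [X.act_id, X.act_id]⟩
  -- the minimal `m` for which such a presentation exists
  obtain ⟨η, s, h0, s0, hx⟩ := Nat.find_spec hP
  have hmin := fun m (h : m < Nat.find hP) => Nat.find_min hP h
  have hle : Nat.find hP ≤ n := Nat.find_min' hP ⟨OrderHom.id, OrderHom.id, rfl, rfl, by
    rw [X.act_id, X.act_id]⟩
  generalize Nat.find hP = m at *
  have hnd : Nondeg (X.act s x) := by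
    intro e e0 he
    obtain ⟨m', π, ι, hm', hπ, hf⟩ := exists_image_factorization e
    have π0 : π 0 = 0 := by
      obtain ⟨i, hi⟩ := hπ 0
      exact le_antisymm ((π.monotone (Fin.zero_le i)).trans hi.le) (Fin.zero_le _)
    have ι0 : ι 0 = 0 := by rw [← π0, ← hf, e0]
    have hcomp : (ι.toOrderHom).comp π = e := by
      ext j
      exact congrArg Fin.val (hf j).symm
    rcases hm'.lt_or_eq with hlt | rfl
    · refine absurd ⟨π.comp η, s.comp ι.toOrderHom, ?_, ?_, ?_⟩ (hmin m' hlt)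
      · change π (η 0) = 0
        rw [h0, π0]
      · change s (ι 0) = 0
        rw [ι0, s0]
      · rw [← X.act_act, ← X.act_act, X.act_act π, hcomp, he, hx]
    · have hπ' := orderHom_eq_id_of_surjective hπ
      have hι : Function.Surjective ι := Finite.injective_iff_surjective.mp ι.injective
      refine orderHom_eq_id_of_surjective fun i => ?_
      obtain ⟨j, hj⟩ := hι i
      exact ⟨j, by rw [hf, hπ']; exact hj⟩
  have hsec : η.comp s = OrderHom.id := hnd _ (by change η (s 0) = 0; rw [s0, h0]) (by
    rw [← X.act_act, hx])
  have hsec' : ∀ i, η (s i) = i := fun i => congrArg (fun f : Fin (m + 1) →o Fin (m + 1) => f i) hsec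
  exact ⟨m, η, s, hle, fun i => ⟨s i, hsec' i⟩, s0, hsec', hnd, hx⟩

/-- The presentation of a simplex as a degeneracy of a nondegenerate simplex is unique. -/
lemma nondeg_unique {r m m' : ℕ} {η : Fin (r + 1) →o Fin (m + 1)} {η' : Fin (r + 1) →o Fin (m' + 1)}
    (hη : Function.Surjective η) (hη' : Function.Surjective η') {y : X.obj m} {y' : X.obj m'}
    (hy : Nondeg y) (hy' : Nondeg y') (h : X.act η y = X.act η' y') :
    (⟨m, y, η⟩ : Σ m, X.obj m × (Fin (r + 1) →o Fin (m + 1))) = ⟨m', y', η'⟩ := by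
  have zero : ∀ {m : ℕ} {η : Fin (r + 1) →o Fin (m + 1)}, Function.Surjective η → η 0 = 0 := by
    intro m η hη
    obtain ⟨i, hi⟩ := hη 0
    exact le_antisymm ((η.monotone (Fin.zero_le i)).trans hi.le) (Fin.zero_le _)
  obtain ⟨s, hs, hs0, -⟩ := exists_section hη 0
  obtain ⟨s', hs', hs'0, -⟩ := exists_section hη' 0
  rw [zero hη] at hs0
  rw [zero hη'] at hs'0
  have act_sec : ∀ {m : ℕ} {η : Fin (r + 1) →o Fin (m + 1)} {s : Fin (m + 1) →o Fin (r + 1)}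
      (y : X.obj m), (∀ i, η (s i) = i) → X.act s (X.act η y) = y := by
    intro m η s y hs
    have : η.comp s = OrderHom.id := by
      ext i
      exact congrArg Fin.val (hs i)
    rw [X.act_act, this, X.act_id]
  have e1 : X.act (η'.comp s) y' = y := by rw [← X.act_act, ← h, act_sec y hs]
  have e2 : X.act (η.comp s') y = y' := by rw [← X.act_act, h, act_sec y' hs']
  -- `η' s` and `η s'` carry `y'` and `y` to each other, hence are inverse to each other
  have c1 := hy ((η.comp s').comp (η'.comp s))
    (by change η (s' (η' (s 0))) = 0; rw [hs0, zero hη', hs'0, zero hη])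
    (by rw [← X.act_act, e2, e1])
  have c2 := hy' ((η'.comp s).comp (η.comp s'))
    (by change η' (s (η (s' 0))) = 0; rw [hs'0, zero hη, hs0, zero hη'])
    (by rw [← X.act_act, e1, e2])
  have i1 : Function.Injective (η'.comp s) := Function.LeftInverse.injective (g := η.comp s')
    fun i => congrArg (fun f : Fin (m + 1) →o Fin (m + 1) => f i) c1
  have i2 : Function.Injective (η.comp s') := Function.LeftInverse.injective (g := η'.comp s)
    fun i => congrArg (fun f : Fin (m' + 1) →o Fin (m' + 1) => f i) c2
  obtain rfl : m = m' := by
    have h1 := Fintype.card_le_of_injective _ i1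
    have h2 := Fintype.card_le_of_injective _ i2
    simp only [Fintype.card_fin] at h1 h2
    omega
  obtain rfl : y = y' := by
    rw [orderHom_eq_id_of_surjective (Finite.injective_iff_surjective.mp i1), X.act_id] at e1
    exact e1.symm
  -- a section of `η` may be chosen through each `j`
  have key : ∀ {η η' : Fin (r + 1) →o Fin (m + 1)}, Function.Surjective η →
      Function.Surjective η' → X.act η y = X.act η' y → ∀ j, η j ≠ 0 → η' j = η j := by
    intro η η' hη hη' h j hj
    obtain ⟨s, hs, hsj, hs0⟩ := exists_section hη j
    have c := hy (η'.comp s) (by change η' (s 0) = 0; rw [hs0 hj, zero hη'])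
      (by rw [← X.act_act, ← h, act_sec y hs])
    have := congrArg (fun f : Fin (m + 1) →o Fin (m + 1) => f (η j)) c
    change η' (s (η j)) = η j at this
    rwa [hsj] at this
  obtain rfl : η = η' := by
    refine OrderHom.ext _ _ (funext fun j => ?_)
    by_cases hj : η j = 0
    · by_cases hj' : η' j = 0
      · rw [hj, hj']
      · exact key hη' hη h.symm j hj'
    · exact (key hη hη' h j hj).symm
  rfl

lemma map_pos_of_surjective {p q : ℕ} {η : Fin (p + 1) →o Fin (q + 1)} (hη : Function.Surjective η)
    {τ : Δ p} (hτ : ∀ j, 0 < τ j) (i : Fin (q + 1)) : 0 < stdSimplex.map η τ i := by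
  obtain ⟨j, rfl⟩ := hη i
  rw [map_apply_eq_sum]
  exact Finset.sum_pos' (fun j _ => (hτ j).le) ⟨j, by simp, hτ j⟩

lemma map_pos_iff {p q : ℕ} (θ : Fin (p + 1) →o Fin (q + 1)) (t : Δ p) (i : Fin (q + 1)) :
    0 < stdSimplex.map θ t i ↔ ∃ j, θ j = i ∧ 0 < t j := by
  rw [map_apply_eq_sum]
  constructor
  · intro h
    by_contra hc
    push Not at hc
    refine absurd h (not_lt.mpr (Finset.sum_nonpos fun j hj => hc j ?_))
    simpa using hj
  · rintro ⟨j, hj, h⟩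
    exact Finset.sum_pos' (fun j _ => stdSimplex.zero_le t j) ⟨j, by simp [hj], h⟩

lemma map_injective {p q : ℕ} (ε : Fin (p + 1) ↪o Fin (q + 1)) :
    Function.Injective (stdSimplex.map ε : Δ p → Δ q) := by
  intro t t' h
  have key : ∀ (t : Δ p) i, stdSimplex.map ε t (ε i) = t i := fun t i => by
    rw [map_apply_eq_sum, Finset.sum_eq_single i]
    · intro j hj hji
      simp only [Finset.mem_filter, Finset.mem_univ, true_and] at hj
      exact absurd (ε.injective hj) hji
    · intro hi
      simp at hi
  refine stdSimplex.ext (funext fun i => ?_)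
  rw [← key t i, ← key t' i, h]

/-- The point `w` of `⨿ Xₚ × Δᵖ` is a normal form of the point `z`. -/
def IsReduction (z w : PreReal X) : Prop :=
  ∃ (r : ℕ) (ε : Fin (r + 1) ↪o Fin (z.1 + 1)) (τ : Δ r) (η : Fin (r + 1) →o Fin (w.1 + 1)),
    (∀ j, 0 < τ j) ∧ stdSimplex.map ε τ = z.2.2 ∧ Function.Surjective η ∧
      X.act ε.toOrderHom z.2.1 = X.act η w.2.1 ∧ stdSimplex.map η τ = w.2.2 ∧ Nondeg w.2.1

lemma exists_isReduction (z : PreReal X) : ∃ w, IsReduction z w := by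
  obtain ⟨p, x, t⟩ := z
  obtain ⟨r, -, τ, ε, hτ, hε, -⟩ := exists_restrict_support t
  obtain ⟨m, η, s, -, hη, -, -, hnd, hx⟩ := exists_nondeg (X.act ε.toOrderHom x)
  exact ⟨⟨m, _, stdSimplex.map η τ⟩, r, ε, τ, η, hτ, hε, hη, hx.symm, rfl, hnd⟩

/-- Normal forms are invariant under the simplicial relations: an order-preserving map `θ` restricts to a
surjection `φ` between the supports, along which the presentations are compared. -/
lemma IsReduction.eq_of_rel {p q : ℕ} (θ : Fin (p + 1) →o Fin (q + 1)) (x : X.obj q) (t : Δ p)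
    {w w' : PreReal X} (h : IsReduction ⟨q, x, stdSimplex.map θ t⟩ w)
    (h' : IsReduction ⟨p, X.act θ x, t⟩ w') : w = w' := by
  obtain ⟨m, y, u⟩ := w
  obtain ⟨m', y', u'⟩ := w'
  obtain ⟨r, ε, τ, η, hτ, hε, hη, hx, hu, hy⟩ := h
  obtain ⟨r', ε', τ', η', hτ', hε', hη', hx', hu', hy'⟩ := h'
  simp only at *
  have h1 : ∀ j, ∃ i, ε i = θ (ε' j) := fun j => by
    have : 0 < stdSimplex.map ε.toOrderHom τ (θ (ε' j)) := by
      change 0 < stdSimplex.map ε τ (θ (ε' j))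
      rw [hε, map_pos_iff]
      refine ⟨ε' j, rfl, ?_⟩
      rw [← hε']
      exact (map_pos_iff ε'.toOrderHom τ' _).mpr ⟨j, rfl, hτ' j⟩
    obtain ⟨i, hi, -⟩ := (map_pos_iff ε.toOrderHom τ _).mp this
    exact ⟨i, hi⟩
  choose φ hφ using h1
  let φ' : Fin (r' + 1) →o Fin (r + 1) := ⟨φ, fun a b hab => by
    rw [← ε.le_iff_le, hφ, hφ]
    exact θ.monotone (ε'.monotone hab)⟩
  have hc : ε.toOrderHom.comp φ' = θ.comp ε'.toOrderHom := by
    refine OrderHom.ext _ _ (funext fun j => hφ j)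
  have hτφ : stdSimplex.map φ' τ' = τ := by
    refine map_injective ε ?_
    have e1 := map_map_simplex φ' ε.toOrderHom τ'
    have e2 := map_map_simplex ε'.toOrderHom θ τ'
    rw [hc] at e1
    refine (e1.trans e2.symm).trans (Eq.trans ?_ hε.symm)
    exact congrArg _ hε'
  have hφs : Function.Surjective φ' := fun i => by
    have := hτ i
    rw [← hτφ, map_pos_iff] at this
    obtain ⟨j, hj, -⟩ := this
    exact ⟨j, hj⟩
  have hact : X.act (η.comp φ') y = X.act η' y' := by
    rw [← X.act_act, ← hx, X.act_act, hc, ← X.act_act, hx']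
  have := nondeg_unique (η := η.comp φ') (hη.comp hφs) hη' hy hy' hact
  rw [Sigma.mk.injEq] at this
  obtain ⟨rfl, h2⟩ := this
  obtain ⟨rfl, h3⟩ := Prod.mk.inj (eq_of_heq h2)
  congr 2
  rw [← hu, ← hu', ← hτφ, map_map_simplex, h3]

/-- The normal form of a point of a realization. -/
noncomputable def normalForm (h : Real X) : PreReal X :=
  Quot.lift (fun z => (exists_isReduction z).choose) (by
    rintro _ _ ⟨θ, x, t⟩
    exact IsReduction.eq_of_rel θ x t (exists_isReduction _).choose_spec
      (exists_isReduction _).choose_spec) h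

lemma normalForm_mk_eq {p : ℕ} {x : X.obj p} {t : Δ p} {w : PreReal X}
    (h : IsReduction ⟨p, x, t⟩ w) : normalForm (Real.mk X x t) = w := by
  refine IsReduction.eq_of_rel (OrderHom.id) x t ?_ (by rw [X.act_id]; exact h)
  have : stdSimplex.map (OrderHom.id : Fin (p + 1) →o Fin (p + 1)) t = t := stdSimplex.map_id_apply t
  rw [this]
  exact (exists_isReduction ⟨p, x, t⟩).choose_spec

/-- The dimension of the open cell that contains a point. -/
noncomputable def Real.dim (h : Real X) : ℕ := (normalForm h).1

lemma normalForm_mk {p : ℕ} {x : X.obj p} {t : Δ p} (hx : Nondeg x) (ht : ∀ j, 0 < t j) :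
    normalForm (Real.mk X x t) = ⟨p, x, t⟩ :=
  normalForm_mk_eq ⟨p, RelEmbedding.refl _, t, OrderHom.id, ht, stdSimplex.map_id_apply t,
    Function.surjective_id, rfl, stdSimplex.map_id_apply t, hx⟩

lemma normalForm_spec (h : Real X) : Nondeg (normalForm h).2.1 ∧ (∀ j, 0 < (normalForm h).2.2 j) ∧
    Real.mk X (normalForm h).2.1 (normalForm h).2.2 = h := by
  obtain ⟨p, x, t, rfl⟩ := Real.ind h
  obtain ⟨w, hw⟩ := exists_isReduction (⟨p, x, t⟩ : PreReal X)
  rw [normalForm_mk_eq hw]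
  obtain ⟨m, y, u⟩ := w
  obtain ⟨r, ε, τ, η, hτ, hε, hη, hx, hu, hy⟩ := hw
  simp only at *
  refine ⟨hy, fun j => hu ▸ map_pos_of_surjective hη hτ j, ?_⟩
  rw [← hu, ← hε, Real.sound, ← hx]
  exact (Real.sound X ε.toOrderHom x τ).symm

lemma Real.dim_mk_le {p : ℕ} (x : X.obj p) (t : Δ p) : Real.dim (Real.mk X x t) ≤ p := by
  obtain ⟨w, hw⟩ := exists_isReduction (⟨p, x, t⟩ : PreReal X)
  rw [Real.dim, normalForm_mk_eq hw]
  obtain ⟨r, ε, τ, η, -, -, hη, -⟩ := hw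
  have h1 := Fintype.card_le_of_injective _ ε.injective
  have h2 := Fintype.card_le_of_surjective _ hη
  simp only [Fintype.card_fin] at h1 h2
  change w.1 ≤ p
  change r + 1 ≤ p + 1 at h1
  omega

lemma Real.dim_mk {p : ℕ} {x : X.obj p} {t : Δ p} (hx : Nondeg x) (ht : ∀ j, 0 < t j) :
    Real.dim (Real.mk X x t) = p := by
  rw [Real.dim, normalForm_mk hx ht]

lemma nondeg_of_dim_mk_eq {p : ℕ} {x : X.obj p} {t : Δ p} (h : Real.dim (Real.mk X x t) = p) :
    Nondeg x ∧ ∀ j, 0 < t j := by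
  obtain ⟨w, hw⟩ := exists_isReduction (⟨p, x, t⟩ : PreReal X)
  rw [Real.dim, normalForm_mk_eq hw] at h
  obtain ⟨m, y, u⟩ := w
  obtain rfl : m = p := h
  obtain ⟨r, ε, τ, η, hτ, hε, hη, hx, hu, hy⟩ := hw
  simp only at *
  obtain rfl : r = m := by
    have h1 := Fintype.card_le_of_injective _ ε.injective
    have h2 := Fintype.card_le_of_surjective _ hη
    simp only [Fintype.card_fin] at h1 h2
    omega
  have hε' : ε.toOrderHom = OrderHom.id := orderHom_eq_id_of_surjective
    (Finite.injective_iff_surjective.mp ε.injective)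
  rw [hε', orderHom_eq_id_of_surjective hη, X.act_id, X.act_id] at hx
  subst hx
  refine ⟨hy, fun j => ?_⟩
  rw [← hε]
  have := map_pos_of_surjective (η := ε.toOrderHom) (by rw [hε']; exact Function.surjective_id) hτ j
  exact this

lemma Real.mk_inj {p q : ℕ} {x : X.obj p} {t : Δ p} (hx : Nondeg x) (ht : ∀ j, 0 < t j)
    {y : X.obj q} {u : Δ q} (hy : Nondeg y) (hu : ∀ j, 0 < u j)
    (h : Real.mk X x t = Real.mk X y u) : (⟨p, x, t⟩ : PreReal X) = ⟨q, y, u⟩ := by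
  rw [← normalForm_mk hx ht, h, normalForm_mk hy hu]

end normalForm

end Multilin

namespace Multilin

/-! ### The skeletal filtration of a realization -/

section skeleton

instance finiteOrderHom (a b : ℕ) : Finite (Fin a →o Fin b) :=
  Finite.of_injective (fun f => (f : Fin a → Fin b)) DFunLike.coe_injective

/-- The degenerate simplices of each dimension, with respect to each degeneracy operator, are open
and closed. -/
def ClopenDeg (X : SSp) : Prop := ∀ (r : ℕ) (e : Fin (r + 1) →o Fin (r + 1)), e 0 = 0 →
  IsClopen {x : X.obj r | X.act e x = x}

variable {X : SSp} (hX : ClopenDeg X)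

include hX in
lemma ClopenDeg.isClopen_nondeg (n : ℕ) : IsClopen {x : X.obj n | Nondeg x} := by
  have : {x : X.obj n | Nondeg x} = ⋂ e : {e : Fin (n + 1) →o Fin (n + 1) // e 0 = 0 ∧
      e ≠ OrderHom.id}, {x : X.obj n | X.act e.1 x = x}ᶜ := by
    ext x
    simp only [Nondeg, Set.mem_iInter, Subtype.forall, Set.mem_compl_iff, Set.mem_ofPred_eq]
    exact ⟨fun h e he hx => he.2 (h e he.1 hx), fun h e he hx => by
      by_contra hc
      exact h e ⟨he, hc⟩ hx⟩
  rw [this]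
  exact isClopen_iInter_of_finite fun e => (hX n e.1 e.2.1).compl

/-- A set is closed if, in terms of normal forms, it is given by closed sets of representatives. -/
lemma ClopenDeg.isClosed (hX : ClopenDeg X) (A : Set (Real X)) (B : ∀ m, Set (X.obj m × Δ m))
    (hB : ∀ m, IsClosed (B m)) (h1 : ∀ m (y : X.obj m) (u : Δ m), (y, u) ∈ B m → Real.mk X y u ∈ A)
    (h2 : ∀ m (y : X.obj m) (u : Δ m), Nondeg y → (∀ j, 0 < u j) → Real.mk X y u ∈ A →
      (y, u) ∈ B m) : IsClosed A := by
  refine (isQuotientMap_quot_mk (r := RealRel X)).isClosed_preimage.mp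
    (isClosed_sigma_iff.mpr fun p => ?_)
  -- the preimage of `A` is the union, over all faces `ε` and all degeneracies `η` (with a section
  -- `s`), of the points of the face whose simplex is degenerate along `η`, with representative in `B`
  let C (r : Fin (p + 1)) (ε : Fin (r.1 + 1) →o Fin (p + 1)) (m : Fin (p + 1))
      (η : Fin (r.1 + 1) →o Fin (m.1 + 1))
      (s : {s : Fin (m.1 + 1) →o Fin (r.1 + 1) // (s.comp η) 0 = 0}) : Set (X.obj p × Δ r.1) :=
    {z | X.act (s.1.comp η) (X.act ε z.1) = X.act ε z.1} ∩
      {z | (X.act s.1 (X.act ε z.1), stdSimplex.map η z.2) ∈ B m.1}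
  have hC : ∀ r ε m η s, IsClosed (C r ε m η s) := by
    intro r ε m η s
    refine IsClosed.inter ?_ ?_
    · exact (hX r.1 (s.1.comp η) s.2).1.preimage ((X.cont_act ε).comp continuous_fst)
    · refine (hB m.1).preimage (Continuous.prodMk ?_ ?_)
      · exact (X.cont_act _).comp ((X.cont_act ε).comp continuous_fst)
      · exact (stdSimplex.continuous_map η).comp continuous_snd
  have hmap : ∀ (r : Fin (p + 1)) (ε : Fin (r.1 + 1) →o Fin (p + 1)),
      IsClosedMap (Prod.map id (stdSimplex.map ε) : X.obj p × Δ r.1 → X.obj p × Δ p) := fun r ε =>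
    (isProperMap_id.prodMap (stdSimplex.continuous_map ε).isProperMap).isClosedMap
  have : Sigma.mk p ⁻¹' (Quot.mk (RealRel X) ⁻¹' A) = ⋃ r, ⋃ ε : Fin (r.1 + 1) →o Fin (p + 1), ⋃ m, ⋃ η, ⋃ s,
      Prod.map id (stdSimplex.map ε) '' C r ε m η s := by
    ext z
    obtain ⟨x, t⟩ := z
    simp only [Set.mem_iUnion]
    constructor
    · intro hz
      obtain ⟨r, hr, τ, ε, hτ, hε, -⟩ := exists_restrict_support t
      obtain ⟨m, η, s, hm, hη, s0, hs, hnd, hx⟩ := exists_nondeg (X.act ε.toOrderHom x)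
      have η0 : η 0 = 0 := by rw [← hs 0, s0]
      refine ⟨⟨r, by omega⟩, ε.toOrderHom, ⟨m, by omega⟩, η, ⟨s, by
        change s (η 0) = 0; rw [η0, s0]⟩, (x, τ), ⟨?_, ?_⟩, Prod.ext rfl hε⟩
      · exact (X.act_act η s _).symm.trans hx
      · refine h2 m _ _ hnd (map_pos_of_surjective hη hτ) ?_
        rw [Real.sound, hx, ← Real.sound]
        change Real.mk X x (stdSimplex.map ε τ) ∈ A
        rw [hε]
        exact hz
    · rintro ⟨r, ε, m, η, s, ⟨x', τ⟩, ⟨hc1, hc2⟩, hz⟩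
      obtain ⟨rfl, rfl⟩ := Prod.mk.inj hz
      have := h1 _ _ _ hc2
      rw [Real.sound, X.act_act] at this
      have hc1' : X.act (s.1.comp η) (X.act ε x') = X.act ε x' := hc1
      change Real.mk X x' (stdSimplex.map ε τ) ∈ A
      rw [Real.sound, ← hc1']
      exact this
  rw [this]
  exact isClosed_iUnion_of_finite fun r => isClosed_iUnion_of_finite fun ε =>
    isClosed_iUnion_of_finite fun m => isClosed_iUnion_of_finite fun η =>
    isClosed_iUnion_of_finite fun s => hmap r ε _ (hC r ε m η s)

/-- The union of the cells of dimension less than `n`. -/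
def skel (X : SSp) (n : ℕ) : Set (Real X) := {h | Real.dim h < n}

/-- The quotient map to the skeleton. -/
def skelMk (X : SSp) (n : ℕ) (z : Σ p : Fin n, X.obj p.1 × Δ p.1) : skel X n :=
  ⟨Real.mk X z.2.1 z.2.2, (Real.dim_mk_le _ _).trans_lt z.1.2⟩

lemma ClopenDeg.isQuotientMap_skelMk (hX : ClopenDeg X) (n : ℕ) : IsQuotientMap (skelMk X n) := by
  have hc : Continuous (skelMk X n) := continuous_sigma fun p =>
    (Real.continuous_mk X p.1).subtype_mk _
  refine isQuotientMap_iff_isClosed.mpr ⟨?_, fun T => ⟨fun h => h.preimage hc, fun h => ?_⟩⟩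
  · rintro ⟨h, hh⟩
    obtain ⟨-, -, e⟩ := normalForm_spec h
    exact ⟨⟨⟨(normalForm h).1, hh⟩, (normalForm h).2⟩, Subtype.ext e⟩
  · have hA : IsClosed (Subtype.val '' T) := by
      refine hX.isClosed _ (fun m => {z | m < n ∧ Real.mk X z.1 z.2 ∈ Subtype.val '' T})
        (fun m => ?_) (fun m y u hz => hz.2) (fun m y u hy hu hz => ⟨?_, hz⟩)
      · by_cases hm : m < n
        · simp only [hm, true_and]
          have := isClosed_sigma_iff.mp h ⟨m, hm⟩
          convert this using 1
          ext z
          constructor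
          · rintro ⟨w, hw, e⟩
            change skelMk X n ⟨⟨m, hm⟩, z⟩ ∈ T
            rwa [show skelMk X n ⟨⟨m, hm⟩, z⟩ = w from Subtype.ext e.symm]
          · exact fun hz => ⟨_, hz, rfl⟩
        · simp [hm]
      · obtain ⟨w, -, e⟩ := hz
        have := w.2
        rw [e] at this
        exact (Real.dim_mk hy hu).symm.trans_lt this
    have := hA.preimage (continuous_subtype_val (p := fun h => h ∈ skel X n))
    rwa [Set.preimage_image_eq _ Subtype.val_injective] at this

/-- Continuity on a skeleton may be tested on simplices, also in the presence of parameters. -/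
lemma ClopenDeg.continuousOn_skel (hX : ClopenDeg X) {T Z : Type} [TopologicalSpace T]
    [LocallyCompactSpace T] [TopologicalSpace Z] {n : ℕ} (g : Real X × T → Z)
    (h : ∀ p < n, Continuous fun z : (X.obj p × Δ p) × T => g (Real.mk X z.1.1 z.1.2, z.2)) :
    ContinuousOn g {w | w.1 ∈ skel X n} := by
  have hcont : ∀ w : skel X n, Continuous fun t => g (w.1, t) := by
    intro w
    obtain ⟨⟨p, x, t⟩, rfl⟩ := (hX.isQuotientMap_skelMk n).surjective w
    exact (h p.1 p.2).comp (Continuous.prodMk_right (x, t))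
  let G : skel X n → C(T, Z) := fun w => ⟨fun t => g (w.1, t), hcont w⟩
  have hG : Continuous G := by
    refine (hX.isQuotientMap_skelMk n).continuous_iff.mpr (continuous_sigma fun p => ?_)
    exact (ContinuousMap.curry ⟨_, h p.1 p.2⟩).continuous
  have := ContinuousMap.continuous_uncurry_of_continuous ⟨G, hG⟩
  rw [continuousOn_iff_continuous_domRestrict]
  exact this.comp (f := fun w : {w : Real X × T | w.1 ∈ skel X n} => ((⟨w.1.1, w.2⟩ : skel X n), w.1.2))
    (by fun_prop)

/-- Continuity on a realization may be tested on simplices, also in the presence of parameters. -/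
lemma Real.continuous_lift_prod {T Z : Type} [TopologicalSpace T]
    [LocallyCompactSpace T] [TopologicalSpace Z] (g : Real X × T → Z)
    (h : ∀ p, Continuous fun z : (X.obj p × Δ p) × T => g (Real.mk X z.1.1 z.1.2, z.2)) :
    Continuous g := by
  have hcont : ∀ w : Real X, Continuous fun t => g (w, t) := by
    intro w
    obtain ⟨p, x, t, rfl⟩ := Real.ind w
    exact (h p).comp (Continuous.prodMk_right (x, t))
  let G : Real X → C(T, Z) := fun w => ⟨fun t => g (w, t), hcont w⟩
  have hG : Continuous G := Real.continuous_lift _ fun p =>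
    (ContinuousMap.curry ⟨_, h p⟩).continuous
  exact ContinuousMap.continuous_uncurry_of_continuous ⟨G, hG⟩

/-- A compact set meets the interiors of cells of bounded dimension only. -/
lemma ClopenDeg.exists_skel_of_compact (hX : ClopenDeg X) {K : Type} [TopologicalSpace K]
    [CompactSpace K] (b : K → Real X) (hb : Continuous b) : ∃ n, ∀ k, b k ∈ skel X n := by
  classical
  by_contra hcon
  push Not at hcon
  -- a point in each simplex whose cells are met
  have hv : ∀ m, ∃ v : Δ m, (∃ k, Real.dim (b k) = m) → ∃ (k : K) (y : X.obj m), Nondeg y ∧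
      (∀ j, 0 < v j) ∧ b k = Real.mk X y v := by
    intro m
    by_cases hm : ∃ k, Real.dim (b k) = m
    · obtain ⟨k, rfl⟩ := hm
      obtain ⟨h1, h2, h3⟩ := normalForm_spec (b k)
      exact ⟨_, fun _ => ⟨k, _, h1, h2, h3.symm⟩⟩
    · exact ⟨stdSimplex.vertex 0, fun h => absurd h hm⟩
  choose v hv using hv
  let T : ℕ → Set (Real X) := fun n => {h | n ≤ Real.dim h ∧ (normalForm h).2.2 = v (normalForm h).1}
  have hT : ∀ n, IsClosed (T n) := by
    intro n
    refine hX.isClosed _ (fun m => {z | Nondeg z.1} ∩ {z | (n ≤ m ∧ ∀ j, 0 < v m j) ∧ z.2 = v m})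
      (fun m => ?_) (fun m y u hz => ?_) (fun m y u hy hu hz => ?_)
    · refine IsClosed.inter ((hX.isClopen_nondeg m).1.preimage continuous_fst) ?_
      by_cases hm : n ≤ m ∧ ∀ j, 0 < v m j
      · have : {z : X.obj m × Δ m | (n ≤ m ∧ ∀ j, 0 < v m j) ∧ z.2 = v m} = Prod.snd ⁻¹' {v m} :=
          Set.ext fun z => ⟨fun h => h.2, fun h => ⟨hm, h⟩⟩
        rw [this]
        exact isClosed_singleton.preimage continuous_snd
      · simp only [hm, false_and]
        exact isClosed_empty
    · obtain ⟨hy, ⟨hm, hv⟩, hu⟩ := hz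
      have hu' : u = v m := hu
      rw [hu']
      refine ⟨(Real.dim_mk hy hv).symm ▸ hm, ?_⟩
      rw [normalForm_mk hy hv]
    · obtain ⟨hm, he⟩ := hz
      rw [Real.dim_mk hy hu] at hm
      rw [normalForm_mk hy hu] at he
      refine ⟨hy, ⟨hm, ?_⟩, he⟩
      rw [← show u = v m from he]
      exact hu
  have hne : (⋂ n, b ⁻¹' T n).Nonempty := by
    refine IsCompact.nonempty_iInter_of_sequence_nonempty_isCompact_isClosed _ (fun n k hk => ?_)
      (fun n => ?_) ((hT 0).preimage hb).isCompact fun n => (hT n).preimage hb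
    · exact ⟨n.le_succ.trans hk.1, hk.2⟩
    · obtain ⟨k, hk⟩ := hcon n
      obtain ⟨k', y, hy, hv', he⟩ := hv _ ⟨k, rfl⟩
      refine ⟨k', ?_⟩
      rw [Set.mem_preimage, he]
      refine ⟨?_, ?_⟩
      · rw [Real.dim_mk hy hv']
        exact not_lt.mp hk
      · rw [normalForm_mk hy hv']
  obtain ⟨k, hk⟩ := hne
  have := (Set.mem_iInter.mp hk (Real.dim (b k) + 1)).1
  omega

end skeleton

/-- The smallest barycentric coordinate. -/
noncomputable def simplexMin {n : ℕ} (t : Δ n) : ℝ :=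
  Finset.univ.inf' ⟨0, Finset.mem_univ _⟩ fun j => t j

lemma simplexMin_le {n : ℕ} (t : Δ n) (j : Fin (n + 1)) : simplexMin t ≤ t j :=
  Finset.inf'_le _ (Finset.mem_univ j)

lemma exists_simplexMin {n : ℕ} (t : Δ n) : ∃ j, simplexMin t = t j := by
  obtain ⟨j, -, h⟩ := Finset.exists_mem_eq_inf' (s := Finset.univ) ⟨0, Finset.mem_univ _⟩ fun j => t j
  exact ⟨j, h⟩

lemma continuous_simplexCoord {n : ℕ} (j : Fin (n + 1)) : Continuous fun t : Δ n => t j :=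
  (continuous_apply j).comp continuous_subtype_val

lemma continuous_simplexMin {n : ℕ} : Continuous (simplexMin : Δ n → ℝ) := by
  unfold simplexMin
  exact Continuous.finset_inf'_apply _ fun j _ => continuous_simplexCoord j

lemma simplexMin_nonneg {n : ℕ} (t : Δ n) : 0 ≤ simplexMin t := by
  obtain ⟨j, h⟩ := exists_simplexMin t
  exact h ▸ stdSimplex.zero_le t j

lemma simplexMin_le_inv {n : ℕ} (t : Δ n) : (n + 1) * simplexMin t ≤ 1 := by
  rw [← stdSimplex.sum_eq_one t]
  have : ∑ _j : Fin (n + 1), simplexMin t ≤ ∑ j, t j :=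
    Finset.sum_le_sum fun j _ => simplexMin_le t j
  simpa using this

/-- The homothety of a simplex with respect to the barycentre, corrected outside the simplex. -/
noncomputable def simplexCoords {n : ℕ} (κ : ℝ) (t : Δ n) (j : Fin (n + 1)) : ℝ :=
  1 / (n + 1) + κ * (t j - 1 / (n + 1))

lemma sum_simplexCoords {n : ℕ} (κ : ℝ) (t : Δ n) : ∑ j, simplexCoords κ t j = 1 := by
  have h := stdSimplex.sum_eq_one t
  have hn : ((n : ℝ) + 1) ≠ 0 := by positivity
  simp only [simplexCoords, Finset.sum_add_distrib, ← Finset.mul_sum, Finset.sum_sub_distrib]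
  simp only [Finset.sum_const, Finset.card_univ, Fintype.card_fin, nsmul_eq_mul, h]
  push_cast
  field_simp
  ring

lemma one_le_sum_max {n : ℕ} (κ : ℝ) (t : Δ n) : 1 ≤ ∑ j, max 0 (simplexCoords κ t j) :=
  (sum_simplexCoords κ t).symm.le.trans (Finset.sum_le_sum fun _ _ => le_max_right _ _)

/-- The homothety of a simplex with respect to the barycentre; the points which it moves out of the
simplex are moved back. -/
noncomputable def simplexScale {n : ℕ} (κ : ℝ) (t : Δ n) : Δ n :=
  ⟨fun j => max 0 (simplexCoords κ t j) / ∑ i, max 0 (simplexCoords κ t i),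
    fun j => div_nonneg (le_max_left _ _) (zero_le_one.trans (one_le_sum_max κ t)), by
      rw [← Finset.sum_div, div_self (zero_lt_one.trans_le (one_le_sum_max κ t)).ne']⟩

lemma simplexScale_apply {n : ℕ} {κ : ℝ} {t : Δ n} (h : ∀ j, 0 ≤ simplexCoords κ t j)
    (j : Fin (n + 1)) : simplexScale κ t j = simplexCoords κ t j := by
  change max 0 (simplexCoords κ t j) / ∑ i, max 0 (simplexCoords κ t i) = _
  simp only [max_eq_right (h _), sum_simplexCoords, div_one]

/-- The gauge of a simplex. -/
noncomputable def simplexGauge (n : ℕ) : Gauge (Δ n) where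
  lam t := 1 - (n + 1) * simplexMin t
  cont_lam := by
    have := continuous_simplexMin (n := n)
    fun_prop
  lam_nonneg t := sub_nonneg.mpr (simplexMin_le_inv t)
  lam_le_one t := by
    have := simplexMin_nonneg t
    have : 0 ≤ ((n : ℝ) + 1) * simplexMin t := by positivity
    linarith
  scale := simplexScale
  cont_scale := by
    have h : ∀ j : Fin (n + 1), Continuous fun p : ℝ × Δ n => max 0 (simplexCoords p.1 p.2 j) := by
      intro j
      have := (continuous_simplexCoord j).comp (continuous_snd (X := ℝ) (Y := Δ n))
      unfold simplexCoords
      simp only [Function.comp_def] at this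
      fun_prop
    refine Continuous.subtype_mk (continuous_pi fun j => (h j).div
      (continuous_finsetSum _ fun i _ => h i) fun p =>
        (zero_lt_one.trans_le (one_le_sum_max p.1 p.2)).ne') _
  scale_one t := by
    have h : ∀ j, simplexCoords 1 t j = t j := fun j => by unfold simplexCoords; ring
    refine stdSimplex.ext (funext fun j => ?_)
    exact (simplexScale_apply (fun j => (h j).symm ▸ stdSimplex.zero_le t j) j).trans (h j)
  lam_scale κ t hκ hle := by
    have hn : (0 : ℝ) < n + 1 := by positivity
    have hb : ∀ j, (1 - κ * (1 - (n + 1) * simplexMin t)) / (n + 1) ≤ simplexCoords κ t j := by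
      intro j
      rw [div_le_iff₀ hn]
      unfold simplexCoords
      have h1 := mul_le_mul_of_nonneg_left (simplexMin_le t j) (mul_nonneg hκ hn.le)
      have : (1 / ((n : ℝ) + 1) + κ * (t j - 1 / (n + 1))) * (n + 1) =
          1 + κ * (n + 1) * t j - κ := by field_simp; ring
      rw [this]
      linarith
    have h0 : ∀ j, 0 ≤ simplexCoords κ t j := fun j =>
      le_trans (div_nonneg (by linarith) hn.le) (hb j)
    obtain ⟨i, hi⟩ := exists_simplexMin t
    have hm : simplexMin (simplexScale κ t) =
        (1 - κ * (1 - (n + 1) * simplexMin t)) / (n + 1) := by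
      refine le_antisymm ((simplexMin_le _ i).trans (le_of_eq ?_)) ?_
      · rw [simplexScale_apply h0, hi]
        unfold simplexCoords
        field_simp
        ring
      · obtain ⟨j, hj⟩ := exists_simplexMin (simplexScale κ t)
        rw [hj, simplexScale_apply h0]
        exact hb j
    rw [hm]
    field_simp
    ring

lemma simplexGauge_lt_one_iff {n : ℕ} (t : Δ n) : (simplexGauge n).lam t < 1 ↔ ∀ j, 0 < t j := by
  change 1 - ((n : ℝ) + 1) * simplexMin t < 1 ↔ _
  have hn : (0 : ℝ) < n + 1 := by positivity
  constructor
  · intro h j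
    refine lt_of_lt_of_le ?_ (simplexMin_le t j)
    by_contra hc
    have := mul_nonpos_of_nonneg_of_nonpos hn.le (not_lt.mp hc)
    linarith
  · intro h
    obtain ⟨j, hj⟩ := exists_simplexMin t
    have := mul_pos hn (hj ▸ h j)
    linarith

end Multilin

namespace Multilin

/-! ### Realizations of levelwise connected maps -/

section restrict

variable {X Y : Type} [TopologicalSpace X] [TopologicalSpace Y] {N : ℤ}

/-- A map is connected if it becomes so after composition with homeomorphisms. -/
lemma ConnMap.of_homeomorph_square {A B : Type} [TopologicalSpace A] [TopologicalSpace B]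
    {f : X → Y} {g : A → B} (hg : ConnMap N g) (hgc : Continuous g) (e : X ≃ₜ A) (e' : Y ≃ₜ B)
    (h : ∀ x, e' (f x) = g (e x)) : ConnMap N f := by
  have : f = e'.symm ∘ (g ∘ e) := funext fun x => by simp [← h]
  rw [this]
  exact (ConnMap.of_homeomorph e'.symm).comp (hg.comp (ConnMap.of_homeomorph e) hgc e.continuous)
    e'.symm.continuous (hgc.comp e.continuous)

/-- A map which is connected over each member of a cover by relatively open subsets of `W`, closed
under intersections, is connected over `W`. -/
lemma ConnMap.of_cover_on {f : X → Y} (W : Set Y) (𝒪 : Set (Set Y))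
    (hsub : ∀ U ∈ 𝒪, U ⊆ W) (hopen : ∀ U ∈ 𝒪, IsOpen ((↑) ⁻¹' U : Set W))
    (hcover : ∀ y ∈ W, ∃ U ∈ 𝒪, y ∈ U) (hinter : ∀ U ∈ 𝒪, ∀ V ∈ 𝒪, U ∩ V ∈ 𝒪)
    (h : ∀ U ∈ 𝒪, ConnMap N (U.restrictPreimage f)) : ConnMap N (W.restrictPreimage f) := by
  refine ConnMap.of_cover ((fun U => ((↑) ⁻¹' U : Set W)) '' 𝒪) ?_ (fun y => ?_) ?_ ?_
  · rintro _ ⟨U, hU, rfl⟩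
    exact hopen U hU
  · obtain ⟨U, hU, hy⟩ := hcover y.1 y.2
    exact ⟨_, ⟨U, hU, rfl⟩, hy⟩
  · rintro _ ⟨U, hU, rfl⟩ _ ⟨V, hV, rfl⟩
    exact ⟨U ∩ V, hinter U hU V hV, rfl⟩
  · rintro _ ⟨U, hU, rfl⟩ k hk a b hab
    obtain ⟨a', H, ha', H0, H1, Hb⟩ := h U hU k hk
      ⟨fun s => ⟨(a s).1.1, (a s).2⟩, by fun_prop⟩ ⟨fun s => ⟨(b s).1.1, (b s).2⟩, by fun_prop⟩
      fun s => Subtype.ext (congrArg (fun z => z.1.1) (hab s))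
    refine ⟨⟨fun x => ⟨⟨(a' x).1, hsub U hU (a' x).2⟩, (a' x).2⟩, by fun_prop⟩,
      ⟨fun x => ⟨⟨(H x).1, hsub U hU (H x).2⟩, (H x).2⟩, by fun_prop⟩,
      fun s => by
        have := congrArg (fun z => z.1) (ha' s)
        exact Subtype.ext (Subtype.ext this),
      fun s => by
        have := congrArg (fun z => z.1) (H0 s)
        exact Subtype.ext (Subtype.ext this),
      fun s => by
        have := congrArg (fun z => z.1) (H1 s)
        exact Subtype.ext (Subtype.ext this),
      fun x hx s => by
        have := congrArg (fun z => z.1) (Hb x hx s)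
        exact Subtype.ext (Subtype.ext this)⟩

end restrict

section collar

variable {X : SSp} (n : ℕ)

/-- The gauge of the open cells of dimension `n`, extended by `1`. -/
noncomputable def cellGauge (h : Real X) : ℝ :=
  if (normalForm h).1 = n then (simplexGauge _).lam (normalForm h).2.2 else 1

/-- The radial deformation of a cell to the boundary. -/
noncomputable def pushOut {p : ℕ} (s : unitInterval) (t : Δ p) : Δ p :=
  (simplexGauge p).scale (1 / max ((simplexGauge p).lam t) (1 - s / 2)) t

lemma pushOut_aux {p : ℕ} (s : unitInterval) (t : Δ p) :
    0 < max ((simplexGauge p).lam t) (1 - s / 2) :=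
  lt_of_lt_of_le (by linarith [s.2.2]) (le_max_right _ _)

lemma lam_pushOut {p : ℕ} (s : unitInterval) (t : Δ p) : (simplexGauge p).lam (pushOut s t) =
    (simplexGauge p).lam t / max ((simplexGauge p).lam t) (1 - s / 2) := by
  have h := pushOut_aux s t
  rw [pushOut, (simplexGauge p).lam_scale _ _ (by positivity), one_div, inv_mul_eq_div]
  rw [one_div, inv_mul_eq_div, div_le_one h]
  exact le_max_left _ _

lemma pushOut_zero {p : ℕ} (t : Δ p) : pushOut 0 t = t := by
  have : max ((simplexGauge p).lam t) (1 - ((0 : unitInterval) : ℝ) / 2) = 1 := by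
    simp [(simplexGauge p).lam_le_one t]
  rw [pushOut, this, div_one, (simplexGauge p).scale_one]

lemma pushOut_of_lam {p : ℕ} (s : unitInterval) {t : Δ p} (h : (simplexGauge p).lam t = 1) :
    pushOut s t = t := by
  have : max ((simplexGauge p).lam t) (1 - s / 2) = 1 := by
    rw [h, max_eq_left (by linarith [s.2.1])]
  rw [pushOut, this, div_one, (simplexGauge p).scale_one]

lemma continuous_pushOut {p : ℕ} : Continuous fun z : Δ p × unitInterval => pushOut z.2 z.1 := by
  have h0 : ∀ z : Δ p × unitInterval, max ((simplexGauge p).lam z.1) (1 - (z.2 : ℝ) / 2) ≠ 0 :=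
    fun z => (pushOut_aux z.2 z.1).ne'
  unfold pushOut
  generalize simplexGauge p = G at *
  have h := G.cont_lam
  have h1 : Continuous fun z : Δ p × unitInterval =>
      1 / max (G.lam z.1) (1 - (z.2 : ℝ) / 2) :=
    continuous_const.div ((h.comp continuous_fst).max (by fun_prop)) h0
  exact G.cont_scale.comp (h1.prodMk continuous_fst)

/-- The radial deformation of the open cells of dimension `n`. -/
noncomputable def radial (w : Real X × unitInterval) : Real X :=
  if (normalForm w.1).1 = n then Real.mk X (normalForm w.1).2.1 (pushOut w.2 (normalForm w.1).2.2)
  else w.1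

variable {n}

lemma cellGauge_of_dim_ne {h : Real X} (hh : Real.dim h ≠ n) : cellGauge n h = 1 := if_neg hh

lemma radial_of_dim_ne {h : Real X} (hh : Real.dim h ≠ n) (s : unitInterval) :
    radial n (h, s) = h := if_neg hh

lemma lam_eq_one_of_not {p : ℕ} {t : Δ p} (h : ¬ ∀ j, 0 < t j) : (simplexGauge p).lam t = 1 :=
  le_antisymm ((simplexGauge p).lam_le_one t) (not_lt.mp fun h' => h ((simplexGauge_lt_one_iff t).mp h'))

lemma cellGauge_mk {x : X.obj n} (hx : Nondeg x) (t : Δ n) :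
    cellGauge n (Real.mk X x t) = (simplexGauge n).lam t := by
  by_cases ht : ∀ j, 0 < t j
  · rw [cellGauge, normalForm_mk hx ht, if_pos rfl]
  · rw [cellGauge_of_dim_ne fun h => ht (nondeg_of_dim_mk_eq h).2, lam_eq_one_of_not ht]

lemma cellGauge_mk_of_not {x : X.obj n} (hx : ¬ Nondeg x) (t : Δ n) :
    cellGauge n (Real.mk X x t) = 1 := cellGauge_of_dim_ne fun h => hx (nondeg_of_dim_mk_eq h).1

lemma radial_mk {x : X.obj n} (hx : Nondeg x) (t : Δ n) (s : unitInterval) :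
    radial n (Real.mk X x t, s) = Real.mk X x (pushOut s t) := by
  by_cases ht : ∀ j, 0 < t j
  · simp only [radial]
    rw [normalForm_mk hx ht, if_pos rfl]
  · rw [radial_of_dim_ne fun h => ht (nondeg_of_dim_mk_eq h).2, pushOut_of_lam _ (lam_eq_one_of_not ht)]

lemma radial_mk_of_not {x : X.obj n} (hx : ¬ Nondeg x) (t : Δ n) (s : unitInterval) :
    radial n (Real.mk X x t, s) = Real.mk X x t :=
  radial_of_dim_ne (fun h => hx (nondeg_of_dim_mk_eq h).1) s

/-- Gluing of continuous maps on nondegenerate and degenerate simplices. -/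
lemma ClopenDeg.continuous_of_nondeg (hX : ClopenDeg X) {T Z : Type} [TopologicalSpace T]
    [TopologicalSpace Z] {g g₁ g₂ : (X.obj n × Δ n) × T → Z} (h₁ : Continuous g₁)
    (h₂ : Continuous g₂) (e₁ : ∀ w, Nondeg w.1.1 → g w = g₁ w)
    (e₂ : ∀ w, ¬ Nondeg w.1.1 → g w = g₂ w) : Continuous g := by
  classical
  have hcl : IsClopen {w : (X.obj n × Δ n) × T | Nondeg w.1.1} :=
    (hX.isClopen_nondeg n).preimage (continuous_fst.comp continuous_fst)
  have : g = fun w => if Nondeg w.1.1 then g₁ w else g₂ w := funext fun w => by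
    by_cases h : Nondeg w.1.1
    · rw [if_pos h, e₁ w h]
    · rw [if_neg h, e₂ w h]
  rw [this]
  refine continuous_if (fun w hw => ?_) h₁.continuousOn h₂.continuousOn
  have := hcl.frontier_eq
  rw [show {a : (X.obj n × Δ n) × T | Nondeg a.1.1} = {w | Nondeg w.1.1} from rfl, this] at hw
  exact hw.elim

lemma ClopenDeg.continuousOn_cellGauge (hX : ClopenDeg X) :
    ContinuousOn (cellGauge n : Real X → ℝ) (skel X (n + 1)) := by
  have h := hX.continuousOn_skel (T := PUnit) (n := n + 1)
    (fun w : Real X × PUnit => cellGauge n w.1) fun p hp => by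
    rcases (Nat.lt_succ_iff.mp hp).lt_or_eq with hp | rfl
    · refine continuous_const (y := (1 : ℝ)) |>.congr fun z => ?_
      exact (cellGauge_of_dim_ne ((Real.dim_mk_le _ _).trans_lt hp).ne).symm
    · exact hX.continuous_of_nondeg
        ((simplexGauge p).cont_lam.comp (continuous_snd.comp continuous_fst)) continuous_const
        (fun w hw => cellGauge_mk hw _) fun w hw => cellGauge_mk_of_not hw _
  exact h.comp (f := fun w => (w, PUnit.unit)) (by fun_prop) fun w hw => hw

lemma ClopenDeg.continuousOn_radial (hX : ClopenDeg X) :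
    ContinuousOn (radial n : Real X × unitInterval → Real X) {w | w.1 ∈ skel X (n + 1)} := by
  refine hX.continuousOn_skel _ fun p hp => ?_
  rcases (Nat.lt_succ_iff.mp hp).lt_or_eq with hp | rfl
  · refine ((Real.continuous_mk X p).comp continuous_fst).congr fun z => ?_
    exact (radial_of_dim_ne ((Real.dim_mk_le _ _).trans_lt hp).ne _).symm
  · refine hX.continuous_of_nondeg ((Real.continuous_mk X p).comp
      ((continuous_fst.comp continuous_fst).prodMk (continuous_pushOut.comp
        ((continuous_snd.comp continuous_fst).prodMk continuous_snd))))
      ((Real.continuous_mk X p).comp continuous_fst) (fun w hw => ?_) fun w hw => ?_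
    · exact radial_mk hw _ _
    · exact radial_mk_of_not hw _ _

/-- The collar of the skeleton of dimension less than `n` in the next one: the points of the open cells
of dimension `n` that are not too close to the barycentre are added. -/
def collar (X : SSp) (n : ℕ) : Set (Real X) := {h | h ∈ skel X (n + 1) ∧ 1 / 2 < cellGauge n h}

lemma skel_subset_collar : skel X n ⊆ collar X n := fun h hh =>
  ⟨Nat.lt_succ_of_lt hh, by rw [cellGauge_of_dim_ne (ne_of_lt hh)]; norm_num⟩

lemma radial_cases {h : Real X} (hh : h ∈ skel X (n + 1)) :
    h ∈ skel X n ∨ ∃ (y : X.obj n) (u : Δ n), Nondeg y ∧ (∀ j, 0 < u j) ∧ h = Real.mk X y u := by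
  obtain ⟨h1, h2, h3⟩ := normalForm_spec h
  rcases (Nat.lt_succ_iff.mp hh).lt_or_eq with hn | hn
  · exact .inl hn
  · refine .inr ?_
    rw [Real.dim] at hn
    generalize normalForm h = w at *
    obtain ⟨m, y, u⟩ := w
    obtain rfl : m = n := hn
    exact ⟨y, u, h1, h2, h3.symm⟩

lemma radial_mem_collar {h : Real X} (hh : h ∈ collar X n) (s : unitInterval) :
    radial n (h, s) ∈ collar X n := by
  rcases radial_cases hh.1 with h' | ⟨y, u, hy, hu, rfl⟩
  · rw [radial_of_dim_ne (ne_of_lt h')]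
    exact hh
  · rw [radial_mk hy]
    refine ⟨Nat.lt_succ_of_le (Real.dim_mk_le _ _), ?_⟩
    have h2 := hh.2
    rw [cellGauge_mk hy] at h2 ⊢
    rw [lam_pushOut, lt_div_iff₀ (pushOut_aux s u)]
    have : max ((simplexGauge n).lam u) (1 - s / 2) ≤ 1 :=
      max_le ((simplexGauge n).lam_le_one u) (by linarith [s.2.1])
    linarith

lemma radial_one_mem_skel {h : Real X} (hh : h ∈ collar X n) : radial n (h, 1) ∈ skel X n := by
  rcases radial_cases hh.1 with h' | ⟨y, u, hy, hu, rfl⟩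
  · rw [radial_of_dim_ne (ne_of_lt h')]
    exact h'
  · rw [radial_mk hy]
    have h2 := hh.2
    rw [cellGauge_mk hy] at h2
    refine lt_of_le_of_ne (Real.dim_mk_le _ _) fun e => ?_
    have h3 := (simplexGauge_lt_one_iff _).mpr (nondeg_of_dim_mk_eq e).2
    have h4 : max ((simplexGauge n).lam u) (1 - ((1 : unitInterval) : ℝ) / 2) =
        (simplexGauge n).lam u := max_eq_left (by rw [Set.Icc.coe_one]; linarith)
    rw [lam_pushOut, h4, div_self (by linarith)] at h3
    exact lt_irrefl _ h3

lemma radial_zero {h : Real X} : radial n (h, 0) = h := by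
  by_cases hh : Real.dim h = n
  · refine (if_pos (show (normalForm h).1 = n from hh)).trans ?_
    rw [pushOut_zero]
    exact (normalForm_spec h).2.2
  · exact radial_of_dim_ne hh _

/-- The radial deformation retracts the collar to the skeleton. -/
lemma ClopenDeg.connMap_collar (hX : ClopenDeg X) (N : ℤ) :
    ConnMap N (Set.inclusion (skel_subset_collar (X := X) (n := n))) := by
  have hc : Continuous fun w : collar X n × unitInterval => radial n (w.1.1, w.2) :=
    hX.continuousOn_radial.comp_continuous (by fun_prop) fun w => w.1.2.1
  refine ConnMap.of_homotopyEquiv (g := fun h => ⟨radial n (h.1, 1), radial_one_mem_skel h.2⟩)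
    (continuous_inclusion _) ?_ Prod.fst continuous_fst (fun _ => rfl) (fun h => Subtype.ext ?_)
    (fun w => ⟨radial n (w.1.1, w.2), radial_mem_collar w.1.2 w.2⟩) (hc.subtype_mk _)
    (fun h => Subtype.ext radial_zero) fun h => rfl
  · exact (hc.comp (Continuous.prodMk_left 1)).subtype_mk _
  · exact (radial_of_dim_ne (ne_of_lt h.2) _).symm

/-- The part of the open cells of dimension `n` with simplex coordinates in `V`. -/
def openCells (X : SSp) (n : ℕ) (V : Set (Δ n)) : Set (Real X) :=
  {h | ∃ (y : X.obj n) (u : Δ n), Nondeg y ∧ u ∈ V ∧ h = Real.mk X y u}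

/-- The coordinates on the open cells. -/
def cellsMk (X : SSp) (n : ℕ) (V : Set (Δ n)) (z : {y : X.obj n | Nondeg y} × V) : openCells X n V :=
  ⟨Real.mk X z.1.1 z.2.1, z.1.1, z.2.1, z.1.2, z.2.2, rfl⟩

/-- The part of the open cells with simplex coordinates in `V` is a product. -/
noncomputable def ClopenDeg.cellsHomeo (hX : ClopenDeg X) {V : Set (Δ n)} (hV : IsOpen V)
    (hVi : ∀ t ∈ V, ∀ j, 0 < t j) : {y : X.obj n | Nondeg y} × V ≃ₜ openCells X n V := by
  have hc : Continuous (cellsMk X n V) := ((Real.continuous_mk X n).comp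
    (by fun_prop : Continuous fun z : {y : X.obj n | Nondeg y} × V => (z.1.1, z.2.1))).subtype_mk _
  refine (Equiv.ofBijective (cellsMk X n V) ⟨fun z z' h => ?_, fun h => ?_⟩).toHomeomorphOfContinuousOpen
    hc fun O hO => ?_
  · have := Real.mk_inj z.1.2 (hVi _ z.2.2) z'.1.2 (hVi _ z'.2.2) (congrArg Subtype.val h)
    rw [Sigma.mk.injEq] at this
    have := Prod.mk.inj (eq_of_heq this.2)
    exact Prod.ext (Subtype.ext this.1) (Subtype.ext this.2)
  · obtain ⟨h, y, u, hy, hu, rfl⟩ := h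
    exact ⟨(⟨y, hy⟩, ⟨u, hu⟩), rfl⟩
  · have hO' : IsOpen (Prod.map Subtype.val Subtype.val '' O : Set (X.obj n × Δ n)) :=
      ((hX.isClopen_nondeg n).2.isOpenEmbedding_subtypeVal.isOpenMap.prodMap
        hV.isOpenEmbedding_subtypeVal.isOpenMap) O hO
    have hmem : ∀ (y : X.obj n) (u : Δ n), Real.mk X y u ∈ (fun z => (cellsMk X n V z).1) '' O →
        (y, u) ∈ (Prod.map Subtype.val Subtype.val '' O : Set (X.obj n × Δ n)) := by
      rintro y u ⟨z, hz, e⟩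
      have e : Real.mk X z.1.1 z.2.1 = Real.mk X y u := e
      have hi := hVi _ z.2.2
      have hd : Real.dim (Real.mk X y u) = n := e ▸ Real.dim_mk z.1.2 hi
      obtain ⟨hy, hu⟩ := nondeg_of_dim_mk_eq hd
      have := Real.mk_inj z.1.2 hi hy hu e
      rw [Sigma.mk.injEq] at this
      exact ⟨z, hz, eq_of_heq this.2⟩
    -- the complement of the image is closed in the skeleton
    have hcl : IsClosed (skel X (n + 1) \ ((fun z => (cellsMk X n V z).1) '' O)) := by
      refine hX.isClosed _ (fun m => {z | m < n + 1 ∧ Real.mk X z.1 z.2 ∉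
        (fun z => (cellsMk X n V z).1) '' O}) (fun m => ?_) (fun m y u h => ?_) fun m y u hy hu h => ?_
      · by_cases hm : m < n + 1
        · rcases (Nat.lt_succ_iff.mp hm).lt_or_eq with hm' | rfl
          · convert isClosed_univ
            refine Set.eq_univ_of_forall fun z => ⟨hm, ?_⟩
            rintro ⟨w, -, e⟩
            have h1 := Real.dim_mk w.1.2 (hVi _ w.2.2)
            have h2 := Real.dim_mk_le z.1 z.2
            change Real.mk X w.1.1 w.2.1 = _ at e
            rw [e] at h1
            omega
          · convert hO'.isClosed_compl using 1
            ext z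
            constructor
            · rintro ⟨-, h⟩ ⟨w, hw, rfl⟩
              exact h ⟨w, hw, rfl⟩
            · exact fun h => ⟨hm, fun h' => h (hmem _ _ h')⟩
        · simp [hm]
      · exact ⟨(Real.dim_mk_le _ _).trans_lt h.1, h.2⟩
      · exact ⟨(Real.dim_mk hy hu).symm.trans_lt h.1, h.2⟩
    have hopen := (hcl.preimage (continuous_subtype_val (p := fun h => h ∈ openCells X n V))).isOpen_compl
    convert hopen using 1
    ext h
    constructor
    · rintro ⟨z, hz, rfl⟩ hcon
      exact hcon.2 ⟨z, hz, rfl⟩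
    · intro hcon
      by_contra hne
      refine hcon ⟨?_, ?_⟩
      · obtain ⟨h, y, u, hy, hu, rfl⟩ := h
        exact Nat.lt_succ_of_le (Real.dim_mk_le _ _)
      · rintro ⟨z, hz, e⟩
        exact hne ⟨z, hz, Subtype.ext e⟩

end collar

end Multilin

namespace Multilin

/-- A restriction of a map to the full preimage of a set. -/
lemma connMap_restrictPreimage_iff {X Y : Type} [TopologicalSpace X] [TopologicalSpace Y]
    {f : X → Y} {A : Set Y} {A' : Set X} (h : f ⁻¹' A = A') (hm : Set.MapsTo f A' A) {N : ℤ} :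
    ConnMap N (A.restrictPreimage f) ↔ ConnMap N (hm.restrict f A' A) := by
  subst h
  rfl

section realization

variable {X X' : SSp} {N : ℤ} (f : SHom X' X)

/-- A simplicial map reflects degeneracies. -/
def SHom.ReflectsDeg : Prop := ∀ (r : ℕ) (e : Fin (r + 1) →o Fin (r + 1)) (x : X'.obj r), e 0 = 0 →
  X.act e (f.app x) = f.app x → X'.act e x = x

variable {f} (hf : f.ReflectsDeg)

include hf

lemma SHom.ReflectsDeg.nondeg_iff {n : ℕ} (x : X'.obj n) : Nondeg (f.app x) ↔ Nondeg x := by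
  constructor
  · intro h e he hx
    exact h e he (by rw [← f.app_act, hx])
  · intro h e he hx
    exact h e he (hf n e x he hx)

lemma SHom.ReflectsDeg.normalForm_map (h : Real X') : normalForm (Real.map f h) =
    ⟨(normalForm h).1, f.app (normalForm h).2.1, (normalForm h).2.2⟩ := by
  obtain ⟨h1, h2, h3⟩ := normalForm_spec h
  conv_lhs => rw [← h3, Real.map_mk]
  exact normalForm_mk ((hf.nondeg_iff _).mpr h1) h2

lemma SHom.ReflectsDeg.dim_map (h : Real X') : Real.dim (Real.map f h) = Real.dim h := by
  rw [Real.dim, hf.normalForm_map]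
  rfl

lemma SHom.ReflectsDeg.preimage_skel (n : ℕ) : Real.map f ⁻¹' skel X n = skel X' n := by
  ext h
  change Real.dim _ < n ↔ Real.dim _ < n
  rw [hf.dim_map]

lemma SHom.ReflectsDeg.cellGauge_map (n : ℕ) (h : Real X') :
    cellGauge n (Real.map f h) = cellGauge n h := by
  rw [cellGauge, hf.normalForm_map]
  rfl

lemma SHom.ReflectsDeg.preimage_collar (n : ℕ) : Real.map f ⁻¹' collar X n = collar X' n := by
  ext h
  change (Real.dim _ < n + 1 ∧ _ < cellGauge n _) ↔ (Real.dim _ < n + 1 ∧ _ < cellGauge n _)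
  rw [hf.dim_map, hf.cellGauge_map]

lemma SHom.ReflectsDeg.mem_openCells_map {n : ℕ} {V : Set (Δ n)} (hVi : ∀ t ∈ V, ∀ j, 0 < t j)
    (h : Real X') : Real.map f h ∈ openCells X n V ↔ h ∈ openCells X' n V := by
  constructor
  · rintro ⟨y, u, hy, hu, e⟩
    obtain ⟨h1, h2, h3⟩ := normalForm_spec h
    have e' := hf.normalForm_map h
    rw [e, normalForm_mk hy (hVi u hu)] at e'
    generalize normalForm h = w at *
    obtain ⟨m, x, t⟩ := w
    rw [Sigma.mk.injEq] at e'
    obtain ⟨rfl, e'⟩ := e'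
    obtain ⟨-, rfl⟩ := Prod.mk.inj (eq_of_heq e')
    exact ⟨x, u, h1, hu, h3.symm⟩
  · rintro ⟨y, u, hy, hu, rfl⟩
    exact ⟨f.app y, u, (hf.nondeg_iff y).mpr hy, hu, rfl⟩

variable (hX' : ClopenDeg X') (hX : ClopenDeg X)

include hX' hX

/-- The open cells of dimension `n` are the product of the space of nondegenerate simplices with an
open simplex. -/
lemma SHom.ReflectsDeg.connMap_openCells {n : ℕ} (hN : ConnMap N (f.app (p := n)))
    {V : Set (Δ n)} (hV : IsOpen V) (hVi : ∀ t ∈ V, ∀ j, 0 < t j) :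
    ConnMap N ((openCells X n V).restrictPreimage (Real.map f)) := by
  have hm : Set.MapsTo (Real.map f) (openCells X' n V) (openCells X n V) :=
    fun h hh => (hf.mem_openCells_map hVi h).mpr hh
  have hpre : Real.map f ⁻¹' openCells X n V = openCells X' n V :=
    Set.ext fun h => hf.mem_openCells_map hVi h
  refine (connMap_restrictPreimage_iff hpre hm).mpr ?_
  have hm' : Set.MapsTo (f.app (p := n)) {y | Nondeg y} {y | Nondeg y} :=
    fun y hy => (hf.nondeg_iff y).mpr hy
  have h1 : ConnMap N (hm'.restrict _ _ _) :=
    (connMap_restrictPreimage_iff (A := {y : X.obj n | Nondeg y}) (A' := {y : X'.obj n | Nondeg y})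
      (Set.ext fun y => hf.nondeg_iff y) hm').mp
      (hN.restrictPreimage_of_isClopen (hX.isClopen_nondeg n))
  have hc : Continuous (hm'.restrict _ _ _) := (f.cont n).restrict hm'
  refine (h1.prodMap_id (Z := V)).of_homeomorph_square (hc.prodMap continuous_id)
    (hX'.cellsHomeo hV hVi).symm (hX.cellsHomeo hV hVi).symm fun h => ?_
  obtain ⟨z, rfl⟩ := (hX'.cellsHomeo hV hVi).surjective h
  rw [Homeomorph.symm_apply_apply, Homeomorph.symm_apply_eq]
  rfl

/-- The skeleton is covered by a collar of the preceding skeleton, which is deformed to the latter, and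
the open cells.  The intersection of both is again a product with an open subset of the simplex. -/
lemma SHom.ReflectsDeg.connMap_skel (hN : ∀ p, ConnMap N (f.app (p := p))) (n : ℕ) :
    ConnMap N ((skel X n).restrictPreimage (Real.map f)) := by
  induction n with
  | zero =>
    intro k _ _ b _
    exact absurd (b fun _ => 0).2 (Nat.not_lt_zero _)
  | succ n ih =>
    let V : Set (Δ n) := {t | (simplexGauge n).lam t < 1}
    let V' : Set (Δ n) := {t | (simplexGauge n).lam t < 1 ∧ 1 / 2 < (simplexGauge n).lam t}
    have hV : IsOpen V := isOpen_lt (simplexGauge n).cont_lam continuous_const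
    have hV' : IsOpen V' := hV.inter (isOpen_lt continuous_const (simplexGauge n).cont_lam)
    have hVi : ∀ t ∈ V, ∀ j, 0 < t j := fun t ht => (simplexGauge_lt_one_iff t).mp ht
    have hVi' : ∀ t ∈ V', ∀ j, 0 < t j := fun t ht => hVi t ht.1
    have hinter : collar X n ∩ openCells X n V = openCells X n V' := by
      ext h
      constructor
      · rintro ⟨h1, y, u, hy, hu, rfl⟩
        have h2 := h1.2
        rw [cellGauge_mk hy] at h2
        exact ⟨y, u, hy, ⟨hu, h2⟩, rfl⟩
      · rintro ⟨y, u, hy, hu, rfl⟩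
        exact ⟨⟨Nat.lt_succ_of_le (Real.dim_mk_le _ _), by rw [cellGauge_mk hy]; exact hu.2⟩,
          y, u, hy, hu.1, rfl⟩
    have hsub : openCells X n V ⊆ skel X (n + 1) := by
      rintro h ⟨y, u, hy, hu, rfl⟩
      exact Nat.lt_succ_of_le (Real.dim_mk_le _ _)
    have hgauge : Continuous fun h : skel X (n + 1) => cellGauge n h.1 :=
      hX.continuousOn_cellGauge.comp_continuous continuous_subtype_val fun h => h.2
    have ho1 : IsOpen ((↑) ⁻¹' collar X n : Set (skel X (n + 1))) := by
      convert isOpen_lt (continuous_const (y := (1 / 2 : ℝ))) hgauge using 1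
      ext h
      exact ⟨fun hh => hh.2, fun hh => ⟨h.2, hh⟩⟩
    have ho2 : IsOpen ((↑) ⁻¹' openCells X n V : Set (skel X (n + 1))) := by
      convert isOpen_lt hgauge (continuous_const (y := (1 : ℝ))) using 1
      ext h
      constructor
      · rintro ⟨y, u, hy, hu, e⟩
        change cellGauge n h.1 < 1
        rw [e, cellGauge_mk hy]
        exact hu
      · intro hh
        have hh : cellGauge n h.1 < 1 := hh
        rcases radial_cases h.2 with h' | ⟨y, u, hy, hu, e⟩
        · rw [cellGauge_of_dim_ne (ne_of_lt h')] at hh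
          exact absurd hh (lt_irrefl _)
        · exact ⟨y, u, hy, (simplexGauge_lt_one_iff u).mpr hu, e⟩
    -- over the collar
    have hmc : Set.MapsTo (Real.map f) (collar X' n) (collar X n) := fun h hh => by
      rw [← hf.preimage_collar] at hh
      exact hh
    have hms : Set.MapsTo (Real.map f) (skel X' n) (skel X n) := fun h hh => by
      rw [← hf.preimage_skel] at hh
      exact hh
    have hcollar : ConnMap N ((collar X n).restrictPreimage (Real.map f)) := by
      refine (connMap_restrictPreimage_iff (hf.preimage_collar n) hmc).mpr ?_
      refine ConnMap.of_comp (hX'.connMap_collar (n := n) N) ?_ (continuous_inclusion _)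
        ((Real.continuous_map f).restrict hmc)
      have h1 := (connMap_restrictPreimage_iff (hf.preimage_skel n) hms).mp ih
      exact (hX.connMap_collar (n := n) N).comp h1 (continuous_inclusion _)
        ((Real.continuous_map f).restrict hms)
    refine ConnMap.of_cover_on _ {collar X n, openCells X n V, openCells X n V'} ?_ ?_ ?_ ?_ ?_
    · rintro U (rfl | rfl | rfl)
      · exact fun h hh => hh.1
      · exact hsub
      · rw [← hinter]
        exact Set.inter_subset_right.trans hsub
    · rintro U (rfl | rfl | rfl)
      · exact ho1
      · exact ho2
      · rw [← hinter, Set.preimage_inter]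
        exact ho1.inter ho2
    · intro h hh
      rcases radial_cases hh with h' | ⟨y, u, hy, hu, e⟩
      · exact ⟨_, .inl rfl, skel_subset_collar h'⟩
      · exact ⟨_, .inr (.inl rfl), y, u, hy, (simplexGauge_lt_one_iff u).mpr hu, e⟩
    · have i1 : openCells X n V' ⊆ collar X n := hinter ▸ Set.inter_subset_left
      have i2 : openCells X n V' ⊆ openCells X n V := hinter ▸ Set.inter_subset_right
      rintro U (rfl | rfl | rfl) W (rfl | rfl | rfl)
      · rw [Set.inter_self]; exact .inl rfl
      · rw [hinter]; exact .inr (.inr rfl)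
      · rw [Set.inter_eq_right.mpr i1]; exact .inr (.inr rfl)
      · rw [Set.inter_comm, hinter]; exact .inr (.inr rfl)
      · rw [Set.inter_self]; exact .inr (.inl rfl)
      · rw [Set.inter_eq_right.mpr i2]; exact .inr (.inr rfl)
      · rw [Set.inter_eq_left.mpr i1]; exact .inr (.inr rfl)
      · rw [Set.inter_eq_left.mpr i2]; exact .inr (.inr rfl)
      · rw [Set.inter_self]; exact .inr (.inr rfl)
    · rintro U (rfl | rfl | rfl)
      · exact hcollar
      · exact hf.connMap_openCells hX' hX (hN n) hV hVi
      · exact hf.connMap_openCells hX' hX (hN n) hV' hVi'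

/-- The realization of a levelwise `N`-connected map which reflects degeneracies is
`N`-connected. -/
theorem SHom.ReflectsDeg.connMap_real (hN : ∀ p, ConnMap N (f.app (p := p))) :
    ConnMap N (Real.map f) := by
  intro k hk a b hab
  -- a compact subset of the realization is contained in a skeleton
  obtain ⟨n, hn⟩ := hX.exists_skel_of_compact b b.continuous
  obtain ⟨a', H, ha', H0, H1, Hb⟩ := hf.connMap_skel hX' hX hN n k hk
    ⟨fun s => ⟨a s, by
      change Real.map f (a s) ∈ skel X n
      rw [hab]; exact hn _⟩, by fun_prop⟩
    ⟨fun s => ⟨b s, hn s⟩, by fun_prop⟩ fun s => Subtype.ext (hab s)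
  refine ⟨⟨fun x => (a' x).1, by fun_prop⟩, ⟨fun w => (H w).1, by fun_prop⟩,
    fun s => by
      have := congrArg (fun z => z.1) (ha' s)
      exact this, fun s => by
      have := congrArg (fun z => z.1) (H0 s)
      exact this, fun s => by
      have := congrArg (fun z => z.1) (H1 s)
      exact this, fun x hx s => by
      have := congrArg (fun z => z.1) (Hb x hx s)
      exact this⟩

end realization

end Multilin

namespace Multilin

/-! ### Natural transformations and homotopies -/

section homotopy

variable {C C' : Type} [Category.{0} C] [Category.{0} C'] {D : C ⥤ PSpace} {D' : C' ⥤ PSpace}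

/-- The map of simplicial replacements over a functor. -/
def chainMap (Φ : C ⥤ C') (α : D ⟶ Φ ⋙ D') : SHom (chainS D) (chainS D') where
  app z := ⟨z.1 ⋙ Φ, (α.app (z.1.obj 0)).toFun z.2⟩
  cont p := continuous_sigma fun c =>
    (continuous_sigmaMk (σ := fun c : Fin (p + 1) ⥤ C' => D'.obj (c.obj 0))
      (i := c ⋙ Φ)).comp (α.app (c.obj 0)).cont
  app_act {p q} θ z := by
    have h := congrArg (fun φ => PSpace.Hom.toFun φ z.2)
      (α.naturality (z.1.map (homOfLE (Fin.zero_le (θ 0)))))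
    exact congrArg (Sigma.mk (β := fun c : Fin (p + 1) ⥤ C' => D'.obj (c.obj 0))
      (θ.monotone.functor ⋙ z.1 ⋙ Φ)) h

/-- The simplicial set `Δ¹`, as a discrete simplicial space. -/
def deltaS : SSp where
  obj p := Fin (p + 1) →o Fin 2
  top _ := ⊥
  act θ ε := ε.comp θ
  cont_act _ := continuous_bot
  act_id _ := rfl
  act_act _ _ _ := rfl

instance (p : ℕ) : DiscreteTopology (deltaS.obj p) := ⟨rfl⟩

instance (p : ℕ) : IsGeneratedBy CH (deltaS.obj p) :=
  have : Finite (deltaS.obj p) := finiteOrderHom _ _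
  instGeneratedOfCompact _

variable {Φ Ψ : C ⥤ C'} (u : Φ ⟶ Ψ) (α : D ⟶ Φ ⋙ D')

/-- The chain `i ↦ Φ cᵢ` or `Ψ cᵢ`, depending on the value of `ε i`. -/
def mixChain {p : ℕ} (c : Fin (p + 1) ⥤ C) (ε : Fin (p + 1) →o Fin 2) : Fin (p + 1) ⥤ C' :=
  Functor.prod' c (ε.monotone.functor ⋙ ComposableArrows.mk₁ u) ⋙ evaluationUncurried C C'

/-- The maps of the simplicial homotopy given by a natural transformation. -/
def mixFun {p : ℕ} (y : (chainS D).obj p) (ε : Fin (p + 1) →o Fin 2) : (chainS D').obj p :=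
  ⟨mixChain u y.1 ε, (D'.map (((ComposableArrows.mk₁ u).map
    (homOfLE (Fin.zero_le (ε 0)))).app (y.1.obj 0))).toFun ((α.app (y.1.obj 0)).toFun y.2)⟩

lemma continuous_mixFun {p : ℕ} (ε : Fin (p + 1) →o Fin 2) :
    Continuous fun y : (chainS D).obj p => mixFun u α y ε :=
  continuous_sigma fun c => (continuous_sigmaMk
    (σ := fun c : Fin (p + 1) ⥤ C' => D'.obj (c.obj 0)) (i := mixChain u c ε)).comp
    (show Continuous fun x => (D'.map (((ComposableArrows.mk₁ u).map
      (homOfLE (Fin.zero_le (ε 0)))).app (c.obj 0))).toFun ((α.app (c.obj 0)).toFun x) from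
      (D'.map _).cont.comp (α.app (c.obj 0)).cont)

lemma mixFun_act {p q : ℕ} (θ : Fin (q + 1) →o Fin (p + 1)) (y : (chainS D).obj p)
    (ε : Fin (p + 1) →o Fin 2) :
    mixFun u α ((chainS D).act θ y) (ε.comp θ) = (chainS D').act θ (mixFun u α y ε) := by
  obtain ⟨c, x⟩ := y
  refine congrArg (Sigma.mk (β := fun c : Fin (q + 1) ⥤ C' => D'.obj (c.obj 0))
    (mixChain u (θ.monotone.functor ⋙ c) (ε.comp θ))) ?_
  have h1 := congrArg (fun φ => PSpace.Hom.toFun φ x)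
    (α.naturality (c.map (homOfLE (Fin.zero_le (θ 0)))))
  refine (congrArg _ h1).trans ?_
  change (D'.map _).toFun ((D'.map _).toFun _) = (D'.map _).toFun ((D'.map _).toFun _)
  refine (map_toFun_comp D' rfl _).trans (map_toFun_comp D' ?_ _).symm
  have h2 : (homOfLE (Fin.zero_le (ε (θ 0))) : (0 : Fin 2) ⟶ ε (θ 0)) =
    homOfLE (Fin.zero_le (ε 0)) ≫ homOfLE (ε.monotone (Fin.zero_le (θ 0))) := rfl
  have h3 : (ComposableArrows.mk₁ u).map (homOfLE (Fin.zero_le ((ε.comp θ) 0))) =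
    (ComposableArrows.mk₁ u).map (homOfLE (Fin.zero_le (ε 0))) ≫
    (ComposableArrows.mk₁ u).map (homOfLE (ε.monotone (Fin.zero_le (θ 0)))) :=
    (congrArg _ h2).trans (Functor.map_comp _ _ _)
  have h4 := ((ComposableArrows.mk₁ u).map (homOfLE (Fin.zero_le (ε 0)))).naturality
    (c.map (homOfLE (Fin.zero_le (θ 0))))
  change _ = _ ≫ (((ComposableArrows.mk₁ u).obj _).map _ ≫ _)
  refine (congrArg (fun η => _ ≫ NatTrans.app η _) h3).trans ?_
  exact ((Category.assoc _ _ _).symm.trans (congrArg (· ≫ _) h4)).trans (Category.assoc _ _ _)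

/-- The simplicial homotopy given by a natural transformation. -/
def homotopyS : SHom (prodS fun b : Bool => bif b then chainS D else deltaS) (chainS D') where
  app {p} z := mixFun u α (z true) (z false)
  cont p := by
    have hF : Continuous fun w : (chainS D).obj p × deltaS.obj p => mixFun u α w.1 w.2 :=
      continuous_prod_of_discrete_right.mpr fun ε => continuous_mixFun u α ε
    have h1 : Continuous fun z : ∀ b : Bool, (bif b then chainS D else deltaS).obj p =>
        (((z true, z false)) : (chainS D).obj p × deltaS.obj p) :=
      (continuous_apply (A := fun b : Bool => (bif b then chainS D else deltaS).obj p)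
      true).prodMk (continuous_apply (A := fun b : Bool => (bif b then chainS D else deltaS).obj p)
      false)
    exact (hF.comp h1).comp WithGeneratedByTopology.continuous_equiv
  app_act {p q} θ z := mixFun_act u α θ (z true) (z false)

lemma mixFun_zero {p : ℕ} (y : (chainS D).obj p) (ε : Fin (p + 1) →o Fin 2) (h : ∀ i, ε i = 0) :
    mixFun u α y ε = (chainMap Φ α).app y := by
  obtain rfl : ε = OrderHom.const _ 0 := OrderHom.ext _ _ (funext h)
  obtain ⟨c, x⟩ := y
  refine chainS_ext ?_ ?_
  · refine Functor.hext (fun _ => rfl) fun a b f => heq_of_eq ?_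
    change Φ.map (c.map f) ≫ 𝟙 _ = Φ.map (c.map f)
    exact Category.comp_id _
  · refine (map_toFun_comp D' rfl _).trans (map_toFun_id D' ?_ _)
    exact Category.comp_id (𝟙 _)

lemma mixFun_one {p : ℕ} (y : (chainS D).obj p) (ε : Fin (p + 1) →o Fin 2) (h : ∀ i, ε i = 1) :
    mixFun u α y ε = (chainMap Ψ (α ≫ Functor.whiskerRight u D')).app y := by
  obtain rfl : ε = OrderHom.const _ 1 := OrderHom.ext _ _ (funext h)
  obtain ⟨c, x⟩ := y
  refine chainS_ext ?_ ?_
  · refine Functor.hext (fun _ => rfl) fun a b f => heq_of_eq ?_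
    change Ψ.map (c.map f) ≫ 𝟙 _ = Ψ.map (c.map f)
    exact Category.comp_id _
  · refine map_toFun_id D' (eqToHom_refl _ _) _

/-- The path in the realization of `Δ¹` from one vertex to the other. -/
noncomputable def edgePath (s : unitInterval) : Real deltaS :=
  Real.mk deltaS (p := 1) (OrderHom.id : Fin 2 →o Fin 2)
    ⟨![1 - s, s], by
      refine ⟨fun i => ?_, ?_⟩
      · fin_cases i
        · exact sub_nonneg.mpr s.2.2
        · exact s.2.1
      · simp⟩

lemma continuous_edgePath : Continuous edgePath := by
  refine (Real.continuous_mk deltaS 1).comp (continuous_const.prodMk ?_)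
  refine Continuous.subtype_mk (continuous_pi fun i => ?_) _
  fin_cases i
  · exact continuous_const.sub continuous_subtype_val
  · exact continuous_subtype_val

lemma edgePath_vertex (b : Fin 2) {p : ℕ} (t : Δ p) :
    edgePath (if b = 0 then 0 else 1) = Real.mk deltaS (OrderHom.const _ b : Fin (p + 1) →o Fin 2) t := by
  refine Eq.trans ?_ (Real.sound deltaS (OrderHom.const (Fin (p + 1)) b : Fin (p + 1) →o Fin 2)
    (OrderHom.id : Fin 2 →o Fin 2) t)
  refine congrArg (Real.mk deltaS (p := 1) (OrderHom.id : Fin 2 →o Fin 2)) ?_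
  ext i
  rw [map_apply_eq_sum]
  have := t.2.2
  fin_cases b <;> fin_cases i <;> simp <;> rfl

/-- The homotopy of realizations given by a natural transformation `u : Φ ⟶ Ψ`. -/
noncomputable def homR (w : Real (chainS D) × unitInterval) : Real (chainS D') :=
  Real.map (homotopyS u α) (prodReal _ fun b : Bool =>
    match b with
    | true => w.1
    | false => edgePath w.2)

instance : ∀ (i : Bool) (p : ℕ), IsGeneratedBy CH ((bif i then chainS D else deltaS).obj p)
  | true, p => inferInstanceAs (IsGeneratedBy CH ((chainS D).obj p))
  | false, p => inferInstanceAs (IsGeneratedBy CH (deltaS.obj p))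

lemma continuous_homR : Continuous (homR u α) := by
  refine (IsGeneratedBy.continuous_iff CH _).mpr fun K a => ?_
  refine (Real.continuous_map _).comp ?_
  refine continuousGeneratedBy_prodReal (fun b : Bool => bif b then chainS D else deltaS) (i := K)
    ⟨fun k b => match b with
      | true => (a k).1
      | false => edgePath (a k).2, continuous_pi fun b => ?_⟩
  cases b
  · exact continuous_edgePath.comp (continuous_snd.comp a.continuous)
  · exact continuous_fst.comp a.continuous

lemma homR_mk {p : ℕ} (y : (chainS D).obj p) (t : Δ p) (s : unitInterval)
    (ε : Fin (p + 1) →o Fin 2) (h : edgePath s = Real.mk deltaS ε t) :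
    homR u α (Real.mk _ y t, s) = Real.mk _ (mixFun u α y ε) t := by
  have h1 := prodReal_mk_same (fun b : Bool => bif b then chainS D else deltaS) (p := p)
    (fun b => match b with
      | true => y
      | false => ε) t
  refine (congrArg (Real.map (homotopyS u α)) (Eq.trans (congrArg _ (funext fun b => ?_)) h1)).trans
    (Real.map_mk _ _ _)
  cases b
  · exact h
  · rfl

lemma homR_zero (h : Real (chainS D)) : homR u α (h, 0) = Real.map (chainMap Φ α) h := by
  obtain ⟨p, y, t, rfl⟩ := Real.ind h
  rw [homR_mk u α y t 0 _ (edgePath_vertex 0 t), mixFun_zero u α y _ fun _ => rfl, Real.map_mk]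

lemma homR_one (h : Real (chainS D)) :
    homR u α (h, 1) = Real.map (chainMap Ψ (α ≫ Functor.whiskerRight u D')) h := by
  obtain ⟨p, y, t, rfl⟩ := Real.ind h
  rw [homR_mk u α y t 1 _ (edgePath_vertex 1 t), mixFun_one u α y _ fun _ => rfl, Real.map_mk]

lemma exists_homR_rep {p : ℕ} (y : (chainS D).obj p) (t : Δ p) (s : unitInterval) :
    ∃ (r : ℕ) (τ : Δ r) (θ : Fin (r + 1) →o Fin (p + 1)) (ε : Fin (r + 1) →o Fin 2),
      homR u α (Real.mk _ y t, s) = Real.mk _ (mixFun u α ((chainS D).act θ y) ε) τ := by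
  obtain ⟨q, ε, t', h⟩ := Real.ind (edgePath s)
  obtain ⟨r, τ, θ, φ, -, rfl, rfl⟩ := exists_refinement₂ t t'
  refine ⟨r, τ, θ, deltaS.act φ ε, ?_⟩
  rw [Real.sound] at h
  rw [Real.sound, homR_mk u α _ τ s _ h]

lemma homR_mem_baseSet {h : Real (chainS D)} (hh : h ∈ baseSet D) (s : unitInterval) :
    homR u α (h, s) ∈ baseSet D' := by
  obtain ⟨p, c, t, rfl⟩ := hh
  obtain ⟨r, τ, θ, ε, e⟩ := exists_homR_rep u α ⟨c, (D.obj (c.obj 0)).pt⟩ t s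
  refine ⟨r, _, τ, e.trans (congrArg (fun x => Real.mk (chainS D') ⟨_, x⟩ τ) ?_)⟩
  refine (congrArg _ (congrArg _ (PSpace.Hom.map_pt _))).trans ?_
  exact (congrArg _ (PSpace.Hom.map_pt _)).trans (PSpace.Hom.map_pt _)

variable [Nonempty C] [Nonempty C']

/-- A map of realizations which preserves basepoints induces a map of based homotopy colimits. -/
lemma exists_descent {L : Type} [TopologicalSpace L] [LocallyCompactSpace L]
    (H : Real (chainS D) × L → Real (chainS D')) (hH : Continuous H)
    (hb : ∀ h ∈ baseSet D, ∀ s, H (h, s) ∈ baseSet D') :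
    ∃ H' : hocolim D × L → hocolim D', Continuous H' ∧
      ∀ h s, H' (toHocolim D h, s) = toHocolim D' (H (h, s)) := by
  have key : ∀ h s, toHocolim D' (H (Function.surjInv (surjective_toHocolim D) (toHocolim D h), s)) =
      toHocolim D' (H (h, s)) := fun h s => by
    have := (toHocolim_eq_iff D).mp (Function.surjInv_eq (surjective_toHocolim D) (toHocolim D h))
    rcases this with e | ⟨h1, h2⟩
    · rw [e]
    · rw [toHocolim_eq_pt D' (hb _ h1 s), toHocolim_eq_pt D' (hb _ h2 s)]
  refine ⟨fun w => toHocolim D' (H (Function.surjInv (surjective_toHocolim D) w.1, w.2)), ?_, key⟩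
  refine (isQuotientMap_toHocolim D).continuous_lift_prod_left ?_
  simp only [key]
  exact (continuous_toHocolim D').comp hH

lemma toHocolim_chainMap (h : Real (chainS D)) :
    toHocolim D' (Real.map (chainMap Φ α) h) = (hocolim.map Φ α).toFun (toHocolim D h) := by
  obtain ⟨p, y, t, rfl⟩ := Real.ind h
  rfl

/-- Natural transformations induce homotopies of homotopy colimits. -/
lemma exists_homotopy_hocolim : ∃ H : hocolim D × unitInterval → hocolim D', Continuous H ∧
    (∀ h, H (h, 0) = (hocolim.map Φ α).toFun h) ∧
    ∀ h, H (h, 1) = (hocolim.map Ψ (α ≫ Functor.whiskerRight u D')).toFun h := by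
  obtain ⟨H, hH, hH'⟩ := exists_descent (homR u α) (continuous_homR u α)
    fun h hh s => homR_mem_baseSet u α hh s
  refine ⟨H, hH, fun h => ?_, fun h => ?_⟩ <;> obtain ⟨h, rfl⟩ := surjective_toHocolim D h
  · rw [hH', homR_zero, toHocolim_chainMap]
  · rw [hH', homR_one, toHocolim_chainMap]

end homotopy

end Multilin

namespace Multilin

/-! ### The homotopy extension property of realizations -/

/-- The data of a neighbourhood deformation retract `{u = 0}` of a space `A`. -/
structure NDRData (A : Type) [TopologicalSpace A] where
  u : A → ℝ
  cont_u : Continuous u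
  u_nonneg : ∀ x, 0 ≤ u x
  h : A × unitInterval → A
  cont_h : Continuous h
  h_zero : ∀ x, h (x, 0) = x
  h_of_zero : ∀ x t, u x = 0 → h (x, t) = x
  u_h_one : ∀ x, u x < 1 → u (h (x, 1)) = 0

namespace NDRData

variable {A : Type} [TopologicalSpace A] (R : NDRData A)

/-- The deformation at the speed `1 / u`. -/
noncomputable def push (z : A × ℝ) : A :=
  R.h (z.1, Set.projIcc 0 1 zero_le_one (z.2 / R.u z.1))

lemma push_zero (x : A) : R.push (x, 0) = x := by
  rw [push, zero_div, Set.projIcc_left]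
  exact R.h_zero x

lemma cont_push : Continuous R.push := by
  refine continuous_iff_continuousAt.mpr fun z => ?_
  by_cases h : R.u z.1 = 0
  · -- the whole track of a point close to a fixed point stays close to it
    intro N hN
    rw [push, R.h_of_zero _ _ h] at hN
    have h1 : ∀ᶠ y in 𝓝 z.1, ∀ t : unitInterval, R.h (y, t) ∈ N := by
      have := (isCompact_univ (X := unitInterval)).eventually_forall_of_forall_eventually
        (x₀ := z.1) (P := fun y t => R.h (y, t) ∈ N) fun t _ => by
          have h2 := R.cont_h.continuousAt (x := (z.1, t))
          rw [ContinuousAt, R.h_of_zero _ _ h] at h2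
          exact h2 hN
      exact this.mono fun y hy t => hy t (Set.mem_univ t)
    exact (continuous_fst.continuousAt (x := z)).eventually h1 |>.mono fun w hw => hw _
  · have h1 : ContinuousAt (fun w : A × ℝ => w.2 / R.u w.1) z :=
      continuousAt_snd.div (R.cont_u.comp continuous_fst).continuousAt h
    exact R.cont_h.continuousAt.comp
      (continuousAt_fst.prodMk (continuous_projIcc.continuousAt.comp h1))

/-- A map on `{u = 0} × Q × [0, 1]` and on the bottom and the sides of `A × Q × [0, 1]` extends: a point
is deformed to this subspace by pushing it to `{u = 0}` and, for the time that remains after its arrival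
there, back along the rays to the bottom and the sides. -/
lemma exists_extension {Q Z : Type} [TopologicalSpace Q] [TopologicalSpace Z] (G : Gauge Q)
    (g : A × Q × unitInterval → Z)
    (hg : ContinuousOn g {z | R.u z.1 = 0 ∨ G.lam z.2.1 = 1 ∨ z.2.2 = 0}) :
    ∃ g' : A × Q × unitInterval → Z, Continuous g' ∧
      ∀ z, R.u z.1 = 0 ∨ G.lam z.2.1 = 1 ∨ z.2.2 = 0 → g' z = g z := by
  have hm := G.cont_mu
  have hu := R.cont_u
  have hpush : Continuous fun z : A × Q × unitInterval => R.push (z.1, 1 - G.mu z.2) :=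
    R.cont_push.comp (by fun_prop : Continuous fun z : A × Q × unitInterval => (z.1, 1 - G.mu z.2))
  have hdrag : Continuous fun z : A × Q × unitInterval =>
      G.drag z.2 (max 0 (1 - G.mu z.2 - R.u z.1)) :=
    G.cont_drag.comp (by fun_prop : Continuous fun z : A × Q × unitInterval =>
      (z.2, max 0 (1 - G.mu z.2 - R.u z.1)))
  refine ⟨fun z => g (R.push (z.1, 1 - G.mu z.2), G.drag z.2 (max 0 (1 - G.mu z.2 - R.u z.1))),
    ?_, fun z hz => ?_⟩
  · refine hg.comp_continuous (hpush.prodMk hdrag) fun z => ?_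
    have h1 := G.half_le_mu z.2
    have h2 := G.mu_le_one z.2
    rcases le_or_gt (1 - G.mu z.2) (R.u z.1) with h | h
    · right
      rw [max_eq_left (by linarith)]
      exact (G.mu_eq_one_iff _).mp (G.mu_drag_zero z.2)
    · left
      change R.u (R.push _) = 0
      rw [push]
      by_cases h0 : R.u z.1 = 0
      · rw [R.h_of_zero _ _ h0]
        exact h0
      · have hpos : 0 < R.u z.1 := lt_of_le_of_ne (R.u_nonneg _) (Ne.symm h0)
        rw [Set.projIcc_of_right_le _ ((one_le_div hpos).mpr h.le)]
        exact R.u_h_one _ (by linarith)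
  · rcases hz with h | h
    · have h1 : R.push (z.1, 1 - G.mu z.2) = z.1 := R.h_of_zero _ _ h
      have h2 : max 0 (1 - G.mu z.2 - R.u z.1) = 1 - G.mu z.2 := by
        rw [h, sub_zero, max_eq_right]
        linarith [G.mu_le_one z.2]
      simp only [h1, h2, G.drag_mu]
    · have h' := (G.mu_eq_one_iff _).mpr h
      have h1 : R.push (z.1, 1 - G.mu z.2) = z.1 := by rw [h', sub_self]; exact R.push_zero _
      simp only [h1, G.drag_of_mu h' (le_max_left _ _)]

end NDRData

section HEP

variable {X : SSp} (hX : ClopenDeg X) (R : ∀ p, NDRData (X.obj p))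
  (hR : ∀ {p q : ℕ} (θ : Fin (p + 1) →o Fin (q + 1)) (x : X.obj q), (R q).u x = 0 →
    (R p).u (X.act θ x) = 0)

include hR in
lemma u_normalForm {p : ℕ} (x : X.obj p) (t : Δ p) (h : (R p).u x = 0) :
    (R _).u (normalForm (Real.mk X x t)).2.1 = 0 := by
  obtain ⟨w, hw⟩ := exists_isReduction (⟨p, x, t⟩ : PreReal X)
  rw [normalForm_mk_eq hw]
  obtain ⟨r, ε, τ, η, -, -, hη, e, -⟩ := hw
  obtain ⟨s, hs, -⟩ := exists_section hη 0
  have h1 : X.act s (X.act η w.2.1) = w.2.1 := by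
    rw [X.act_act, show η.comp s = OrderHom.id from OrderHom.ext _ _ (funext hs), X.act_id]
  rw [← h1, ← e]
  exact hR _ _ (hR _ _ h)

variable {Z : Type} [TopologicalSpace Z] (f : Real X → Z) (K : Real X × unitInterval → Z)

/-- `Ω` extends the homotopy `K` over the skeleton of dimension less than `n`. -/
def ExtendsOn (n : ℕ) (Ω : Real X × unitInterval → Z) : Prop :=
  ContinuousOn Ω {w | w.1 ∈ skel X n} ∧ (∀ h ∈ skel X n, Ω (h, 0) = f h) ∧
    ∀ h ∈ skel X n, (R _).u (normalForm h).2.1 = 0 → ∀ s, Ω (h, s) = K (h, s)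

include hX hR in
/-- The homotopy is extended over the `n`-simplices, relative to the subspace `{u = 0}`, the boundary of
the standard simplex and the start of the interval. -/
lemma ExtendsOn.exists_succ (hf : Continuous f) (hK : Continuous K)
    (hfK : ∀ h, (R _).u (normalForm h).2.1 = 0 → K (h, 0) = f h) {n : ℕ}
    {Ω : Real X × unitInterval → Z} (hΩ : ExtendsOn R f K n Ω) :
    ∃ Ω', ExtendsOn R f K (n + 1) Ω' ∧ ∀ h ∈ skel X n, ∀ s, Ω' (h, s) = Ω (h, s) := by
  classical
  obtain ⟨hc, h0, hA⟩ := hΩ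
  have hside : ∀ (y : X.obj n) (t : Δ n), (simplexGauge n).lam t = 1 → Real.mk X y t ∈ skel X n := by
    intro y t ht
    refine lt_of_le_of_ne (Real.dim_mk_le _ _) fun e => ?_
    exact absurd ht ((simplexGauge_lt_one_iff t).mpr (nondeg_of_dim_mk_eq e).2).ne
  have hu := (R n).cont_u
  have hmk : Continuous fun z : X.obj n × Δ n × unitInterval => (Real.mk X z.1 z.2.1, z.2.2) :=
    ((Real.continuous_mk X n).comp (by fun_prop : Continuous fun z : X.obj n × Δ n × unitInterval =>
      (z.1, z.2.1))).prodMk (continuous_snd.comp continuous_snd)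
  obtain ⟨E, hE, hEv⟩ := (R n).exists_extension (simplexGauge n)
    (fun z => if (R n).u z.1 = 0 then K (Real.mk X z.1 z.2.1, z.2.2) else
      if (simplexGauge n).lam z.2.1 = 1 then Ω (Real.mk X z.1 z.2.1, z.2.2)
      else f (Real.mk X z.1 z.2.1)) (by
    have hlam := (simplexGauge n).cont_lam
    have c1 : IsClosed {z : X.obj n × Δ n × unitInterval | (R n).u z.1 = 0} :=
      isClosed_eq (by fun_prop) continuous_const
    have c2 : IsClosed {z : X.obj n × Δ n × unitInterval | (simplexGauge n).lam z.2.1 = 1} :=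
      isClosed_eq (hlam.comp (by fun_prop)) continuous_const
    have c3 : IsClosed {z : X.obj n × Δ n × unitInterval | z.2.2 = 0} :=
      isClosed_eq (by fun_prop) continuous_const
    refine ContinuousOn.union_of_isClosed ?_ (ContinuousOn.union_of_isClosed ?_ ?_ c2 c3) c1
      (c2.union c3)
    · exact (hK.comp hmk).continuousOn.congr fun z hz => if_pos hz
    · refine (hc.comp hmk.continuousOn fun z hz => hside _ _ hz).congr fun z hz => ?_
      by_cases hz0 : (R n).u z.1 = 0
      · rw [if_pos hz0]
        exact (hA _ (hside _ _ hz) (u_normalForm R hR _ _ hz0) _).symm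
      · rw [if_neg hz0]
        exact if_pos hz
    · refine (hf.comp (continuous_fst.comp hmk)).continuousOn.congr fun z hz => ?_
      obtain ⟨y, t, s⟩ := z
      obtain rfl : s = 0 := hz
      dsimp only
      split_ifs with h1 h2
      · exact hfK _ (u_normalForm R hR _ _ h1)
      · exact h0 _ (hside _ _ h2)
      · rfl)
  -- `E` need not be compatible with degeneracies: it is used only on the nondegenerate simplices, which
  -- are open and closed
  let Ω' : Real X × unitInterval → Z := fun w =>
    if e : (normalForm w.1).1 = n then
      E (cast (congrArg X.obj e) (normalForm w.1).2.1,
        cast (congrArg (fun n => Δ n) e) (normalForm w.1).2.2, w.2) else Ω w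
  have hΩ'1 : ∀ h ∈ skel X n, ∀ s, Ω' (h, s) = Ω (h, s) := fun h hh s =>
    dif_neg (show Real.dim h ≠ n from ne_of_lt hh)
  have hΩ'2 : ∀ (y : X.obj n) (t : Δ n), Nondeg y → ∀ s, Ω' (Real.mk X y t, s) = E (y, t, s) := by
    intro y t hy s
    by_cases ht : ∀ j, 0 < t j
    · have key : ∀ w : PreReal X, w = ⟨n, y, t⟩ → (if e : w.1 = n then
        E (cast (congrArg X.obj e) w.2.1, cast (congrArg (fun n => Δ n) e) w.2.2, s)
          else Ω (Real.mk X y t, s)) = E (y, t, s) := by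
        rintro _ rfl
        exact dif_pos rfl
      exact key _ (normalForm_mk hy ht)
    · have hl := lam_eq_one_of_not ht
      rw [hΩ'1 _ (hside y t hl), hEv _ (.inr (.inl hl))]
      dsimp only
      split_ifs with h1
      · exact hA _ (hside _ _ hl) (u_normalForm R hR _ _ h1) _
      · rfl
  refine ⟨Ω', ⟨?_, fun h hh => ?_, fun h hh hu0 s => ?_⟩, hΩ'1⟩
  · refine hX.continuousOn_skel _ fun p hp => ?_
    rcases (Nat.lt_succ_iff.mp hp).lt_or_eq with hp | rfl
    · have hsk : ∀ z : (X.obj p × Δ p) × unitInterval, Real.mk X z.1.1 z.1.2 ∈ skel X n :=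
        fun z => (Real.dim_mk_le _ _).trans_lt hp
      refine (hc.comp_continuous (((Real.continuous_mk X p).comp continuous_fst).prodMk
        continuous_snd) hsk).congr fun z => (hΩ'1 _ (hsk z) _).symm
    · have hmk' : Continuous fun z : (X.obj p × Δ p) × unitInterval =>
          (Real.mk X z.1.1 z.1.2, z.2) :=
        ((Real.continuous_mk X p).comp continuous_fst).prodMk continuous_snd
      have hcl : IsClopen {w : (X.obj p × Δ p) × unitInterval | Nondeg w.1.1} :=
        (hX.isClopen_nondeg p).preimage (continuous_fst.comp continuous_fst)
      have h1 : ContinuousOn (fun z : (X.obj p × Δ p) × unitInterval =>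
          Ω' (Real.mk X z.1.1 z.1.2, z.2)) {w | Nondeg w.1.1} := by
        refine (hE.comp (by fun_prop : Continuous fun z : (X.obj p × Δ p) × unitInterval =>
          (z.1.1, z.1.2, z.2))).continuousOn.congr fun z hz => hΩ'2 _ _ hz _
      have hsk : ∀ z : (X.obj p × Δ p) × unitInterval, ¬ Nondeg z.1.1 →
          Real.mk X z.1.1 z.1.2 ∈ skel X p := fun z hz =>
        lt_of_le_of_ne (Real.dim_mk_le _ _) fun e => hz (nondeg_of_dim_mk_eq e).1
      have h2 : ContinuousOn (fun z : (X.obj p × Δ p) × unitInterval =>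
          Ω' (Real.mk X z.1.1 z.1.2, z.2)) {w | Nondeg w.1.1}ᶜ :=
        (hc.comp hmk'.continuousOn hsk).congr fun z hz => hΩ'1 _ (hsk z hz) _
      have h3 := h1.union_of_isOpen h2 hcl.isOpen hcl.compl.isOpen
      rw [Set.union_compl_self] at h3
      exact continuousOn_univ.mp h3
  · rcases radial_cases hh with h' | ⟨y, t, hy, -, rfl⟩
    · rw [hΩ'1 _ h']
      exact h0 _ h'
    · rw [hΩ'2 _ _ hy, hEv _ (.inr (.inr rfl))]
      dsimp only
      split_ifs with h1 h2
      · exact hfK _ (u_normalForm R hR _ _ h1)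
      · exact h0 _ (hside _ _ h2)
      · rfl
  · rcases radial_cases hh with h' | ⟨y, t, hy, ht, rfl⟩
    · rw [hΩ'1 _ h']
      exact hA _ h' hu0 s
    · have key : ∀ w : PreReal X, w = ⟨n, y, t⟩ → (R _).u w.2.1 = 0 → (R n).u y = 0 := by
        rintro _ rfl h
        exact h
      have h1 := key _ (normalForm_mk hy ht) hu0
      rw [hΩ'2 _ _ hy, hEv _ (.inl h1)]
      exact if_pos h1

include hX hR in
/-- The homotopy extension property of the subcomplex of a realization that consists of the simplices
in the subspaces `{u = 0}`. -/
lemma exists_homotopy_extension_real (hf : Continuous f) (hK : Continuous K)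
    (hfK : ∀ h, (R _).u (normalForm h).2.1 = 0 → K (h, 0) = f h) :
    ∃ Ω : Real X × unitInterval → Z, Continuous Ω ∧ (∀ h, Ω (h, 0) = f h) ∧
      ∀ (p : ℕ) (x : X.obj p) (t : Δ p), (R p).u x = 0 → ∀ s,
        Ω (Real.mk X x t, s) = K (Real.mk X x t, s) := by
  have step := fun n (Ω : {Ω // ExtendsOn R f K n Ω}) =>
    ExtendsOn.exists_succ hX R hR f K hf hK hfK Ω.2
  choose F hF hF' using step
  -- compatible extensions over the skeleta
  let S : ∀ n, {Ω // ExtendsOn R f K n Ω} := fun n => Nat.rec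
    ⟨fun w => f w.1, (hf.comp continuous_fst).continuousOn, fun _ _ => rfl,
      fun h hh => absurd hh (Nat.not_lt_zero _)⟩ (fun n Ω => ⟨F n Ω, hF n Ω⟩) n
  have hS : ∀ n m, n ≤ m → ∀ h ∈ skel X n, ∀ s, (S m).1 (h, s) = (S n).1 (h, s) := by
    intro n m hnm h hh s
    induction m, hnm using Nat.le_induction with
    | base => rfl
    | succ m hm ih => exact (hF' m (S m) h (lt_of_lt_of_le hh hm) s).trans ih
  have hΩ : ∀ n, ∀ h ∈ skel X n, ∀ s, (S (Real.dim h + 1)).1 (h, s) = (S n).1 (h, s) :=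
    fun n h hh s => (hS _ n hh h (Nat.lt_succ_self _) s).symm
  refine ⟨fun w => (S (Real.dim w.1 + 1)).1 w, ?_, fun h => ?_, fun p x t hx s => ?_⟩
  · refine Real.continuous_lift_prod _ fun p => ?_
    have hsk : ∀ z : (X.obj p × Δ p) × unitInterval, Real.mk X z.1.1 z.1.2 ∈ skel X (p + 1) :=
      fun z => Nat.lt_succ_of_le (Real.dim_mk_le _ _)
    refine ((S (p + 1)).2.1.comp_continuous (((Real.continuous_mk X p).comp continuous_fst).prodMk
      continuous_snd) hsk).congr fun z => (hΩ _ _ (hsk z) _).symm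
  · exact (S _).2.2.1 h (Nat.lt_succ_self _)
  · exact (S _).2.2.2 _ (Nat.lt_succ_self _) (u_normalForm R hR x t hx) s

end HEP

end Multilin

namespace Multilin

/-! ### Homotopy colimits over categories with an initial object -/

section well_pointed

variable {C : Type} [Category.{0} C] (D : C ⥤ PSpace)

lemma isClopen_chain {p : ℕ} (S : Set (Fin (p + 1) ⥤ C)) :
    IsClopen {z : (chainS D).obj p | z.1 ∈ S} := by
  have h : ∀ S : Set (Fin (p + 1) ⥤ C), IsOpen {z : (chainS D).obj p | z.1 ∈ S} := fun S =>
    isOpen_sigma_iff.mpr fun c => by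
      by_cases hc : c ∈ S
      · convert isOpen_univ
        exact Set.eq_univ_of_forall fun _ => hc
      · convert isOpen_empty
        exact Set.eq_empty_of_forall_notMem fun _ => hc
  exact ⟨⟨h Sᶜ⟩, h S⟩

lemma clopenDeg_chainS : ClopenDeg (chainS D) := by
  intro r e he
  convert isClopen_chain D {c : Fin (r + 1) ⥤ C | e.monotone.functor ⋙ c = c} using 1
  ext ⟨c, x⟩
  refine ⟨fun h => congrArg Sigma.fst h, fun h => chainS_ext h ?_⟩
  refine (map_toFun_comp D rfl _).trans (map_toFun_id D ?_ _)
  have h0 : (homOfLE (Fin.zero_le (e 0)) : (0 : Fin (r + 1)) ⟶ e 0) = eqToHom he.symm :=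
    Subsingleton.elim _ _
  change c.map _ ≫ _ = _
  rw [h0, eqToHom_map]
  exact (eqToHom_trans _ _).trans (eqToHom_refl _ _)

/-- The neighbourhood deformation retracts of the spaces of simplices of the simplicial
replacement. -/
noncomputable def ndrChain (hD : ∀ c, WellPointed (D.obj c)) (p : ℕ) :
    NDRData ((chainS D).obj p) where
  u z := ((hD (z.1.obj 0)).choose z.2 : unitInterval)
  cont_u := continuous_sigma fun c =>
    continuous_subtype_val.comp (hD (c.obj 0)).choose.continuous
  u_nonneg z := ((hD (z.1.obj 0)).choose z.2).2.1
  h z := ⟨z.1.1, (hD (z.1.1.obj 0)).choose_spec.choose (z.1.2, z.2)⟩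
  cont_h := by
    have h2 : Continuous fun z : (Σ c : Fin (p + 1) ⥤ C, D.obj (c.obj 0) × unitInterval) =>
        (⟨z.1, (hD (z.1.obj 0)).choose_spec.choose z.2⟩ : (chainS D).obj p) :=
      continuous_sigma fun c => (continuous_sigmaMk
        (σ := fun c : Fin (p + 1) ⥤ C => D.obj (c.obj 0)) (i := c)).comp
        (hD (c.obj 0)).choose_spec.choose.continuous
    exact h2.comp (Homeomorph.continuous Homeomorph.sigmaProdDistrib)
  h_zero z := congrArg (Sigma.mk z.1) ((hD (z.1.obj 0)).choose_spec.choose_spec.2.1 z.2)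
  h_of_zero z t h := by
    obtain ⟨c, x⟩ := z
    have hx := ((hD (c.obj 0)).choose_spec.choose_spec.1 x).mp (Subtype.ext h)
    dsimp only
    rw [hx]
    exact congrArg (Sigma.mk c) ((hD (c.obj 0)).choose_spec.choose_spec.2.2.1 t)
  u_h_one z h := congrArg Subtype.val (((hD (z.1.obj 0)).choose_spec.choose_spec.1 _).mpr
    ((hD (z.1.obj 0)).choose_spec.choose_spec.2.2.2 z.2 h))

lemma ndrChain_u_eq_zero (hD : ∀ c, WellPointed (D.obj c)) {p : ℕ} (z : (chainS D).obj p) :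
    (ndrChain D hD p).u z = 0 ↔ z.2 = (D.obj (z.1.obj 0)).pt :=
  Iff.trans ⟨fun h => Subtype.ext h, fun h => congrArg Subtype.val h⟩
    ((hD (z.1.obj 0)).choose_spec.choose_spec.1 z.2)

/-- The one-point space. -/
def pointSpace : PSpace where
  carrier := PUnit
  pt := PUnit.unit

variable {b : C} (hb : Limits.IsInitial b)

/-- The natural transformation from the constant functor at an initial object to the identity. -/
def fromInitial : (Functor.const C).obj b ⟶ 𝟭 C where
  app c := hb.to c
  naturality _ _ _ := hb.hom_ext _ _

/-- The unbased homotopy colimit of a constant diagram over a category with an initial object is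
contracted to the fibre over the initial object. -/
lemma exists_cone {b : C} (hb : Limits.IsInitial b) (A : PSpace) : ∃ H : Real (chainS ((Functor.const C).obj A)) × unitInterval →
    Real (chainS ((Functor.const C).obj A)), Continuous H ∧ (∀ h, H (h, 1) = h) ∧
      ∀ (p : ℕ) (c : Fin (p + 1) ⥤ C) (x : A) (t : Δ p), H (Real.mk _ ⟨c, x⟩ t, 0) =
        Real.mk (chainS ((Functor.const C).obj A)) (p := 0) ⟨(Functor.const _).obj b, x⟩
          (stdSimplex.vertex 0) := by
  let α : (Functor.const C).obj A ⟶ (Functor.const C).obj b ⋙ (Functor.const C).obj A :=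
    { app := fun _ => 𝟙 A
      naturality := fun _ _ _ => rfl }
  refine ⟨homR (fromInitial hb) α, continuous_homR _ _, fun h => ?_, fun p c x t => ?_⟩
  · rw [homR_one]
    obtain ⟨p, y, t, rfl⟩ := Real.ind h
    rfl
  · rw [homR_zero, Real.map_mk]
    refine Eq.trans ?_ (Real.sound (chainS ((Functor.const C).obj A)) (OrderHom.const _ 0)
      ⟨(Functor.const (Fin 1)).obj b, x⟩ t).symm |>.trans ?_
    · rfl
    · congr 1
      exact Subsingleton.elim _ _

variable [Nonempty C]

include hb in
/-- For a well-pointed diagram over a category with an initial object, the unbased homotopy colimit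
is homotopy equivalent to the based one: a contraction of the subcomplex of the basepoints extends to
a deformation. -/
lemma connMap_toHocolim (hD : ∀ c, WellPointed (D.obj c)) (N : ℤ) : ConnMap N (toHocolim D) := by
  obtain ⟨H, hH, H1, H0⟩ := exists_cone hb pointSpace
  let pr : D ⟶ 𝟭 C ⋙ (Functor.const C).obj pointSpace :=
    { app := fun c => zeroHom _ _
      naturality := fun _ _ _ => rfl }
  let jB : (Functor.const C).obj pointSpace ⟶ 𝟭 C ⋙ D :=
    { app := fun c => zeroHom _ _
      naturality := fun _ _ f => by
        ext x
        exact (PSpace.Hom.map_pt (D.map f)).symm }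
  -- the contraction of the subcomplex of basepoints
  let K : Real (chainS D) × unitInterval → Real (chainS D) := fun w =>
    Real.map (chainMap (𝟭 C) jB) (H (Real.map (chainMap (𝟭 C) pr) w.1, unitInterval.symm w.2))
  have hK : Continuous K := (Real.continuous_map _).comp (hH.comp
    (((Real.continuous_map _).comp continuous_fst).prodMk (by fun_prop)))
  have hKb : ∀ w, K w ∈ baseSet D := fun w => by
    obtain ⟨p, ⟨c, x⟩, t, e⟩ := Real.ind
      (H (Real.map (chainMap (𝟭 C) pr) w.1, unitInterval.symm w.2))
    refine ⟨p, c, t, ?_⟩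
    change Real.map _ _ = _
    rw [e]
    rfl
  obtain ⟨Ω, hΩ, Ω0, Ω1⟩ := exists_homotopy_extension_real (clopenDeg_chainS D) (ndrChain D hD)
    (fun {p q} θ x hx => by
      rw [ndrChain_u_eq_zero] at hx ⊢
      change (D.map _).toFun x.2 = _
      rw [hx]
      exact PSpace.Hom.map_pt _) (fun h => h) K continuous_id hK fun h hh => by
      obtain ⟨-, -, e⟩ := normalForm_spec h
      rw [ndrChain_u_eq_zero] at hh
      generalize normalForm h = w at *
      obtain ⟨p, ⟨c, x⟩, t⟩ := w
      obtain rfl : x = (D.obj (c.obj 0)).pt := hh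
      rw [← e]
      change Real.map _ (H (_, unitInterval.symm 0)) = _
      rw [unitInterval.symm_zero, H1]
      rfl
  have hΩb : ∀ h ∈ baseSet D, ∀ s, Ω (h, s) = K (h, s) := by
    rintro _ ⟨p, c, t, rfl⟩ s
    exact Ω1 p _ t ((ndrChain_u_eq_zero D hD _).mpr rfl) s
  have hΩ1 : ∀ h ∈ baseSet D, ∀ h' ∈ baseSet D, Ω (h, 1) = Ω (h', 1) := by
    have : ∀ h ∈ baseSet D, Ω (h, 1) = Real.map (chainMap (𝟭 C) jB) (Real.mk _ (p := 0)
        ⟨(Functor.const _).obj b, PUnit.unit⟩ (stdSimplex.vertex 0)) := by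
      rintro h hh
      rw [hΩb h hh]
      obtain ⟨p, c, t, rfl⟩ := hh
      change Real.map _ (H (_, unitInterval.symm 1)) = _
      rw [unitInterval.symm_one]
      exact congrArg _ (H0 p c PUnit.unit t)
    intro h hh h' hh'
    rw [this h hh, this h' hh']
  -- the end of the deformation is constant on the subcomplex, hence is defined on the quotient
  let ψ : hocolim D → Real (chainS D) := fun h => Ω (Function.surjInv (surjective_toHocolim D) h, 1)
  have hψ : ∀ h, ψ (toHocolim D h) = Ω (h, 1) := fun h => by
    rcases (toHocolim_eq_iff D).mp (Function.surjInv_eq (surjective_toHocolim D) (toHocolim D h))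
      with e | ⟨h1, h2⟩
    · exact congrArg (fun h => Ω (h, 1)) e
    · exact hΩ1 _ h1 _ h2
  have hψc : Continuous ψ := (isQuotientMap_toHocolim D).continuous_iff.mpr (by
    rw [show ψ ∘ toHocolim D = fun h => Ω (h, 1) from funext hψ]
    exact hΩ.comp (by fun_prop))
  obtain ⟨E, hE, hE'⟩ := exists_descent Ω hΩ fun h hh s => (hΩb h hh s) ▸ hKb _
  refine ConnMap.of_homotopyEquiv (continuous_toHocolim D) hψc Ω hΩ Ω0 (fun h => (hψ h).symm) E hE
    (fun h => ?_) fun h => ?_ <;> obtain ⟨h, rfl⟩ := surjective_toHocolim D h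
  · rw [hE', Ω0]
  · rw [hE', hψ]

end well_pointed

section inclusion

lemma ConnMap.of_homotopic {X Y : Type} [TopologicalSpace X] [TopologicalSpace Y] {N : ℤ}
    (H : X × unitInterval → Y) (hH : Continuous H) (h : ConnMap N fun x => H (x, 0)) :
    ConnMap N fun x => H (x, 1) := by
  have key : ∀ s : unitInterval, ConnMap N fun x : X => (x, s) := fun s => by
    refine ConnMap.of_homotopyEquiv (g := Prod.fst) (by fun_prop) continuous_fst Prod.fst
      continuous_fst (fun _ => rfl) (fun _ => rfl)
      (fun w => (w.1.1, Set.projIcc 0 1 zero_le_one ((1 - w.2) * w.1.2 + w.2 * s)))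
      (continuous_fst.fst.prodMk (continuous_projIcc.comp (by fun_prop))) (fun y => ?_) fun y => ?_
    · simp
    · simp
  exact (ConnMap.of_comp (key 0) h (by fun_prop) hH).comp (key 1) hH (by fun_prop)

lemma ConnMap.sigmaMap {ι : Type} {A B : ι → Type} [∀ i, TopologicalSpace (A i)]
    [∀ i, TopologicalSpace (B i)] {N : ℤ} (f : ∀ i, A i → B i) (hf : ∀ i, ConnMap N (f i)) :
    ConnMap N fun z : (Σ i, A i) => (⟨z.1, f z.1 z.2⟩ : Σ i, B i) := by
  intro k hk a b hab
  obtain ⟨i, b', hb'⟩ := b.exists_lift_sigma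
  have hbi : ∀ x, b x = ⟨i, b' x⟩ := fun x => congrArg (fun φ => φ x) hb'
  obtain ⟨a', ha', ha''⟩ := exists_lift_sigma a a.continuous i fun s =>
    (congrArg Sigma.fst ((hab s).trans (hbi s)))
  obtain ⟨A', H, h1, h2, h3, h4⟩ := hf i k hk ⟨a', ha'⟩ b' fun s => by
    have := (hab s).trans (hbi s)
    rw [ha''] at this
    exact eq_of_heq (Sigma.mk.inj this).2
  refine ⟨⟨fun x => ⟨i, A' x⟩, by fun_prop⟩, ⟨fun w => ⟨i, H w⟩, by fun_prop⟩, fun s => ?_,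
    fun x => ?_, fun x => ?_, fun x hx s => ?_⟩
  · exact (congrArg (Sigma.mk i) (h1 s)).trans (ha'' s).symm
  · exact (congrArg (Sigma.mk i) (h2 x)).trans (hbi x).symm
  · exact congrArg (Sigma.mk i) (h3 x)
  · exact (congrArg (Sigma.mk i) (h4 x hx s)).trans (hbi x).symm

variable {C : Type} [Category.{0} C] [Nonempty C] (D : C ⥤ PSpace)

/-- The inclusion of a space of a diagram into the homotopy colimit. -/
noncomputable def hocolim.incl (c : C) (x : D.obj c) : hocolim D :=
  hocolim.mk D (p := 0) ((Functor.const _).obj c) x (stdSimplex.vertex 0)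

lemma hocolim.continuous_incl (c : C) : Continuous (hocolim.incl D c) :=
  (hocolim.continuous_mk D (p := 0) ((Functor.const _).obj c)).comp
    (continuous_id.prodMk continuous_const)

/-- A point over a vertex of a simplex is in the image of an inclusion. -/
lemma hocolim.mk_vertex {p : ℕ} (c : Fin (p + 1) ⥤ C) (x : D.obj (c.obj 0)) (i : Fin (p + 1))
    (t : Δ p) (ht : t = stdSimplex.map (OrderHom.const (Fin 1) i) (stdSimplex.vertex 0)) :
    hocolim.mk D c x t =
      hocolim.incl D (c.obj i) ((D.map (c.map (homOfLE (Fin.zero_le i)))).toFun x) := by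
  subst ht
  refine (Quot.sound (HocolimRel.simplicial (OrderHom.const (Fin (0 + 1)) i) c x _)).trans ?_
  exact hocolim.mk_congr D (c := (OrderHom.const (Fin (0 + 1)) i).monotone.functor ⋙ c)
    (c' := (Functor.const _).obj (c.obj i)) (ComposableArrows.ext₀ rfl) _ _
    (map_toFun_id D (eqToHom_refl _ _) _) _

/-- A morphism `c ⟶ c'` gives a homotopy from the inclusion of `D c` to the map induced by the
inclusion of `D c'`. -/
lemma hocolim.exists_homotopy_incl {c c' : C} (f : c ⟶ c') :
    ∃ H : D.obj c × unitInterval → hocolim D, Continuous H ∧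
      (∀ x, H (x, 0) = hocolim.incl D c x) ∧
      ∀ x, H (x, 1) = hocolim.incl D c' ((D.map f).toFun x) := by
  let T : unitInterval → Δ 1 := fun s => ⟨![1 - s, s], by
    refine ⟨fun i => ?_, by simp⟩
    fin_cases i
    · exact sub_nonneg.mpr s.2.2
    · exact s.2.1⟩
  have hT : Continuous T := by
    refine Continuous.subtype_mk (continuous_pi fun i => ?_) _
    fin_cases i
    · exact continuous_const.sub continuous_subtype_val
    · exact continuous_subtype_val
  have hTv : ∀ i : Fin 2, T (if i = 0 then 0 else 1) =
      stdSimplex.map (OrderHom.const (Fin 1) i) (stdSimplex.vertex 0) := fun i => by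
    ext j
    rw [map_apply_eq_sum]
    fin_cases i <;> fin_cases j <;> simp [T] <;> rfl
  refine ⟨fun w => hocolim.mk D (ComposableArrows.mk₁ f) w.1 (T w.2),
    (hocolim.continuous_mk D (ComposableArrows.mk₁ f)).comp
      (continuous_fst.prodMk (hT.comp continuous_snd)), fun x => ?_, fun x => ?_⟩
  · refine (hocolim.mk_vertex D (ComposableArrows.mk₁ f) x 0 _ (hTv 0)).trans ?_
    exact congrArg (hocolim.incl D c) (map_toFun_id D rfl x)
  · exact hocolim.mk_vertex D (ComposableArrows.mk₁ f) x 1 _ (hTv 1)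

/-- If a well-pointed diagram over a category with an initial object sends all maps to `N`-connected
maps, its spaces are included in the homotopy colimit by `N`-connected maps.  The diagram is compared
to the constant diagram at its value on the initial object. -/
theorem connMap_incl {b : C} (hb : Limits.IsInitial b) (hD : ∀ c, WellPointed (D.obj c)) {N : ℤ}
    (hN : ∀ (c c' : C) (f : c ⟶ c'), ConnMap N (D.map f).toFun) (c : C) :
    ConnMap N (hocolim.incl D c) := by
  obtain ⟨H, hH, H1, H0⟩ := exists_cone hb (D.obj b)
  let A := (Functor.const C).obj (D.obj b)
  let ζ : A ⟶ 𝟭 C ⋙ D :=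
    { app := fun c => D.map (hb.to c)
      naturality := fun c c' f => by
        change 𝟙 _ ≫ D.map _ = D.map _ ≫ D.map f
        rw [Category.id_comp, ← D.map_comp, hb.hom_ext (hb.to c') (hb.to c ≫ f)] }
  let e : D.obj b → Real (chainS A) := fun x =>
    Real.mk (chainS A) (p := 0) ⟨(Functor.const _).obj b, x⟩ (stdSimplex.vertex 0)
  have hec : Continuous e := (Real.continuous_mk (chainS A) 0).comp
    ((continuous_sigmaMk (σ := fun c : Fin 1 ⥤ C => A.obj (c.obj 0))).prodMk continuous_const)
  let r : Real (chainS A) → D.obj b := Quot.lift (fun z => z.2.1.2) (by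
    rintro _ _ ⟨θ, x, t⟩
    rfl)
  have hrc : Continuous r := Real.continuous_lift r fun p => by
    have h : Continuous fun z : (Σ _ : Fin (p + 1) ⥤ C, D.obj b) => z.2 :=
      continuous_sigma fun _ => continuous_id
    exact h.comp continuous_fst
  have he : ConnMap N e := by
    refine ConnMap.of_homotopyEquiv hec hrc Prod.fst continuous_fst (fun _ => rfl) (fun _ => rfl)
      (fun w => H (w.1, unitInterval.symm w.2)) (hH.comp (by fun_prop)) (fun h => ?_) fun h => ?_
    · rw [unitInterval.symm_zero]
      exact H1 h
    · obtain ⟨p, ⟨c, x⟩, t, rfl⟩ := Real.ind h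
      rw [unitInterval.symm_one]
      exact H0 p c x t
  have hζ : ConnMap N (Real.map (chainMap (𝟭 C) ζ)) := by
    refine SHom.ReflectsDeg.connMap_real (f := chainMap (𝟭 C) ζ) (hf := fun r e z h0 h => ?_)
      (clopenDeg_chainS A) (clopenDeg_chainS D) fun p => ?_
    · obtain ⟨c, x⟩ := z
      have hc : e.monotone.functor ⋙ c = c := congrArg Sigma.fst h
      exact chainS_ext hc rfl
    · exact ConnMap.sigmaMap (A := fun _ : Fin (p + 1) ⥤ C => D.obj b)
        (B := fun c : Fin (p + 1) ⥤ C => D.obj (c.obj 0)) (fun c => (D.map (hb.to (c.obj 0))).toFun)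
        fun c => hN _ _ _
  have hib : ConnMap N (hocolim.incl D b) := by
    have := (connMap_toHocolim D hb hD N).comp (hζ.comp he (Real.continuous_map _) hec)
      (continuous_toHocolim D) ((Real.continuous_map _).comp hec)
    convert this using 1
    funext x
    refine congrArg (fun y => hocolim.mk D (p := 0) ((Functor.const _).obj b) y
      (stdSimplex.vertex 0)) ?_
    exact (map_toFun_id D (hb.hom_ext _ _) x).symm
  -- from the initial object to `c`
  obtain ⟨E, hE, E0, E1⟩ := hocolim.exists_homotopy_incl D (hb.to c)
  have h1 : ConnMap N fun x => E (x, 1) := by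
    refine ConnMap.of_homotopic E hE ?_
    simp only [E0]
    exact hib
  simp only [E1] at h1
  exact ConnMap.of_comp (hN _ _ (hb.to c)) h1 (PSpace.Hom.cont _) (hocolim.continuous_incl D c)

end inclusion

end Multilin

namespace Multilin

/-! ### Shifts and the comparison with the usual multilinearization -/

section shift

variable {C : Type} [Category.{0} C] [Nonempty C] (G : C ⥤ PSpace)

/-- If the restriction of `G` along an endofunctor `T` with a natural transformation `u` from the
identity sends all maps to `N`-connected maps, the values of `T` are included in the homotopy colimit
of `G` by `N`-connected maps: up to homotopy, the homotopy colimit of `G` is a retract of that of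
`T ⋙ G`. -/
theorem connMap_incl_shift {b : C} (hb : Limits.IsInitial b) (T : C ⥤ C) (u : 𝟭 C ⟶ T)
    (hG : ∀ c, WellPointed (G.obj c)) {N : ℤ}
    (hN : ∀ (c c' : C) (f : c ⟶ c'), ConnMap N (G.map (T.map f)).toFun)
    (hu : ConnMap N (G.map (u.app (T.obj b))).toFun) :
    ConnMap N (hocolim.incl G (T.obj b)) := by
  let α : hocolim G ⟶ hocolim (T ⋙ G) := hocolim.map (𝟭 C) (Functor.whiskerRight u G)
  let β : hocolim (T ⋙ G) ⟶ hocolim G := hocolim.map T (𝟙 (T ⋙ G))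
  obtain ⟨H, hH, H0, H1⟩ := exists_homotopy_hocolim (D := G) (D' := G) u (𝟙 G)
  refine ConnMap.of_homotopy_retract (hocolim.continuous_incl G _) α.cont β.cont H hH
    (fun y => ?_) (fun y => ?_) ?_
  · rw [H0]
    obtain ⟨p, c, x, t, rfl⟩ := hocolim.ind y
    rfl
  · rw [H1]
    obtain ⟨p, c, x, t, rfl⟩ := hocolim.ind y
    rfl
  · exact (connMap_incl (T ⋙ G) hb (fun c => hG _) (fun c c' f => hN c c' f) (T.obj b)).comp hu
      (hocolim.continuous_incl _ _) (PSpace.Hom.cont (G.map (u.app (T.obj b))))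

end shift

section shiftII

variable {K : Type}

/-- The shift functor `m ∐ -` on `𝕀^K`. -/
def shiftII (m : ℕ) : (K → II) ⥤ (K → II) where
  obj U k := ⟨m + (U k).card⟩
  map f k := (addInj (Function.Embedding.refl (Fin m)) (II.inj (f k)) : Fin _ ↪ Fin _)
  map_id _ := funext fun _ => addInj_refl m _
  map_comp _ _ := funext fun _ =>
    addInj_trans (Function.Embedding.refl (Fin m)) (Function.Embedding.refl (Fin m)) _ _

/-- The inclusions `U → m ∐ U`. -/
def toShiftII (m : ℕ) : 𝟭 (K → II) ⟶ shiftII m where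
  app U k := (Fin.natAddEmb m : Fin (U k).card ↪ Fin (m + (U k).card))
  naturality U V f := by
    funext k
    refine Function.Embedding.ext fun x => ?_
    change Fin.natAdd m (II.inj (f k) x) =
      addInj (Function.Embedding.refl (Fin m)) (II.inj (f k)) (Fin.natAdd m x)
    simp [addInj]

/-- The empty sets are initial. -/
def isInitialII : Limits.IsInitial (fun _ : K => (⟨0⟩ : II)) :=
  Limits.IsInitial.ofUniqueHom
    (fun _ _ => (⟨fun x => x.elim0, fun x => x.elim0⟩ : Fin 0 ↪ Fin _))
    fun _ f => funext fun k => Function.Embedding.ext (f := II.inj (f k)) fun x => x.elim0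

/-- The shift functor `m + -` on `ℕ^K`. -/
def shiftNN (m : ℕ) : (K → NN) ⥤ (K → NN) where
  obj U k := ⟨m + (U k).card⟩
  map f k := ⟨Nat.add_le_add_left (f k).down m⟩
  map_id _ := rfl
  map_comp _ _ := rfl

/-- The inequalities `n ≤ m + n`. -/
def toShiftNN (m : ℕ) : 𝟭 (K → NN) ⟶ shiftNN m where
  app U k := ⟨Nat.le_add_left (U k).card m⟩
  naturality _ _ _ := rfl

/-- The zero tuple is initial. -/
def isInitialNN : Limits.IsInitial (fun _ : K => (⟨0⟩ : NN)) :=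
  Limits.IsInitial.ofUniqueHom (fun _ _ => ⟨Nat.zero_le _⟩) fun _ _ => rfl

lemma nonempty_hom_const {m : ℕ} (U : K → II) (h : ∀ k, m ≤ (U k).card) :
    Nonempty ((fun _ : K => (⟨m⟩ : II)) ⟶ U) :=
  ⟨fun k => (Fin.castLEEmb (h k) : Fin m ↪ Fin (U k).card)⟩

/-- For a well-pointed diagram on `𝕀^K` that satisfies the connectivity condition, the homotopy
colimit over `ℕ^K` is weakly equivalent to the one over `𝕀^K`: for each `N`, both are compared, by
`N`-connected maps, to the value of the diagram at a large constant tuple. -/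
theorem isWeakEquiv_of_connectivityCondition [Nonempty K] (G : (K → II) ⥤ PSpace)
    (hG : ∀ U, WellPointed (G.obj U)) (h : ConnectivityCondition G) :
    IsWeakEquiv (hocolim.map (inclPi K) (𝟙 (inclPi K ⋙ G)) : hocolim (inclPi K ⋙ G) ⟶ hocolim G) := by
  intro N
  obtain ⟨ν, hν, hc⟩ := h
  obtain ⟨m, hm⟩ := (hν.eventually_ge_atTop N).exists
  have hsize : size (fun _ : K => (⟨m⟩ : II)) = m := ciInf_const
  have hconn : ∀ (y z : K → II) (f : y ⟶ z), (∀ k, m ≤ (y k).card) → ConnMap N (G.map f).toFun := by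
    intro y z f hy
    obtain ⟨i⟩ := nonempty_hom_const y hy
    have := hc _ y z ⟨i⟩ ⟨i ≫ f⟩ f
    rw [hsize] at this
    exact ((isConnectedMap_iff _ _).mp this).mono hm
  have h1 : ConnMap N (hocolim.incl G fun _ : K => (⟨m + 0⟩ : II)) :=
    connMap_incl_shift G isInitialII (shiftII m) (toShiftII m) hG
      (fun c c' f => hconn _ _ _ fun k => Nat.le_add_right _ _) (hconn _ _ _ fun k => le_rfl)
  have h2 : ConnMap N (hocolim.incl (inclPi K ⋙ G) fun _ : K => (⟨m + 0⟩ : NN)) :=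
    connMap_incl_shift (inclPi K ⋙ G) isInitialNN (shiftNN m) (toShiftNN m) (fun _ => hG _)
      (fun c c' f => hconn _ _ _ fun k => Nat.le_add_right _ _) (hconn _ _ _ fun k => le_rfl)
  refine (isConnectedMap_iff _ _).mpr (ConnMap.of_comp h2 ?_ (hocolim.continuous_incl _ _)
    (PSpace.Hom.cont _))
  -- the comparison map is compatible with the inclusions of this value
  have e : ∀ x : G.obj fun _ => ⟨m + 0⟩,
      (hocolim.map (inclPi K) (𝟙 (inclPi K ⋙ G)) : hocolim (inclPi K ⋙ G) ⟶ hocolim G).toFun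
        (hocolim.incl (inclPi K ⋙ G) (fun _ : K => (⟨m + 0⟩ : NN)) x) = hocolim.incl G _ x := by
    intro x
    exact hocolim.mk_congr G (ComposableArrows.ext₀ rfl) _ _ (map_toFun_id G (eqToHom_refl _ _) _) _
  rw [← funext e] at h1
  exact h1

end shiftII

end Multilin

namespace Multilin

/-! ### Addition on the one-point compactification -/

/-- The addition of real numbers, extended by `∞`. -/
def addInfty (z d : OnePoint ℝ) : OnePoint ℝ :=
  OnePoint.elim z OnePoint.infty fun r => OnePoint.map (fun s => r + s) d

@[simp] lemma addInfty_coe (r s : ℝ) : addInfty r s = ((r + s : ℝ) : OnePoint ℝ) := rfl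

@[simp] lemma addInfty_infty_left (d : OnePoint ℝ) : addInfty OnePoint.infty d = OnePoint.infty := rfl

@[simp] lemma addInfty_infty_right (z : OnePoint ℝ) :
    addInfty z OnePoint.infty = OnePoint.infty := by
  induction z using OnePoint.rec <;> rfl

lemma addInfty_comm (z d : OnePoint ℝ) : addInfty z d = addInfty d z := by
  induction z using OnePoint.rec with
  | infty => simp
  | coe r =>
    induction d using OnePoint.rec with
    | infty => simp
    | coe s => rw [addInfty_coe, addInfty_coe, add_comm]

/-- A bounded translation preserves neighbourhoods of infinity. -/
lemma continuousAt_addInfty_infty (s : ℝ) :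
    ContinuousAt (fun p : OnePoint ℝ × OnePoint ℝ => addInfty p.1 p.2)
      (OnePoint.infty, (s : OnePoint ℝ)) := by
  rw [ContinuousAt, nhds_prod_eq, addInfty_infty_left, OnePoint.nhds_infty_eq, Filter.sup_prod,
    OnePoint.nhds_coe_eq]
  refine Filter.Tendsto.sup ?_ ?_
  · rw [Filter.prod_map_map_eq, Filter.tendsto_map'_iff]
    refine Filter.Tendsto.mono_right ?_ le_sup_left
    refine (Filter.tendsto_map (f := ((↑) : ℝ → OnePoint ℝ))
      (x := Filter.coclosedCompact ℝ)).comp ?_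
    rw [Filter.coclosedCompact_eq_cocompact]
    rw [← Metric.cobounded_eq_cocompact, ← comap_norm_atTop (E := ℝ)]
    refine Filter.tendsto_comap_iff.mpr ?_
    have h1 : Filter.Tendsto (fun p : ℝ × ℝ => ‖p.1‖) (Filter.comap norm Filter.atTop ×ˢ 𝓝 s)
        Filter.atTop := Filter.tendsto_comap.comp Filter.tendsto_fst
    have h2 : Filter.Tendsto (fun p : ℝ × ℝ => -‖p.2‖) (Filter.comap norm Filter.atTop ×ˢ 𝓝 s)
        (𝓝 (-‖s‖)) := (continuous_norm.neg.tendsto s).comp Filter.tendsto_snd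
    refine Filter.tendsto_atTop_mono (fun p => ?_) (h1.atTop_add h2)
    have := norm_sub_le (p.1 + p.2) p.2
    rw [add_sub_cancel_right] at this
    simp only [Function.comp_apply]
    linarith
  · refine Filter.Tendsto.mono_right ?_ le_sup_right
    refine Filter.tendsto_pure.mpr ?_
    have : ∀ᶠ p : OnePoint ℝ × OnePoint ℝ in
        (pure OnePoint.infty : Filter (OnePoint ℝ)) ×ˢ Filter.map ((↑) : ℝ → OnePoint ℝ) (𝓝 s),
        p.1 = OnePoint.infty :=
      ((Filter.eventually_pure (p := fun z : OnePoint ℝ => z = OnePoint.infty)).mpr rfl).prod_inl _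
    exact this.mono fun p hp => by rw [hp, addInfty_infty_left]

lemma continuousAt_addInfty {p : OnePoint ℝ × OnePoint ℝ}
    (h : ¬ (p.1 = OnePoint.infty ∧ p.2 = OnePoint.infty)) :
    ContinuousAt (fun p : OnePoint ℝ × OnePoint ℝ => addInfty p.1 p.2) p := by
  obtain ⟨z, d⟩ := p
  induction z using OnePoint.rec with
  | infty =>
    induction d using OnePoint.rec with
    | infty => exact absurd ⟨rfl, rfl⟩ h
    | coe s => exact continuousAt_addInfty_infty s
  | coe r =>
    induction d using OnePoint.rec with
    | infty =>
      have := (continuousAt_addInfty_infty r).comp (f := Prod.swap)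
        (x := ((r : OnePoint ℝ), OnePoint.infty)) continuous_swap.continuousAt
      refine this.congr (Filter.Eventually.of_forall fun p => ?_)
      exact addInfty_comm _ _
    | coe s =>
      have he := (OnePoint.isOpenEmbedding_coe (X := ℝ)).prodMap (OnePoint.isOpenEmbedding_coe (X := ℝ))
      refine (he.continuousAt_iff (x := (r, s))).mp ?_
      have : Continuous fun p : ℝ × ℝ => ((p.1 + p.2 : ℝ) : OnePoint ℝ) :=
        OnePoint.continuous_coe.comp continuous_add
      exact this.continuousAt

/-- The relation `w = z + d` on the one-point compactification.  It is satisfied by all `w` if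
`z = d = ∞`, so that it is closed. -/
def SumRel (z d w : OnePoint ℝ) : Prop :=
  (z = OnePoint.infty ∧ d = OnePoint.infty) ∨ w = addInfty z d

lemma isClosed_sumRel :
    IsClosed {p : OnePoint ℝ × OnePoint ℝ × OnePoint ℝ | SumRel p.1 p.2.1 p.2.2} := by
  refine isOpen_compl_iff.mp (isOpen_iff_mem_nhds.mpr fun p hp => ?_)
  have hp' : ¬ ((p.1 = OnePoint.infty ∧ p.2.1 = OnePoint.infty) ∨ p.2.2 = addInfty p.1 p.2.1) := hp
  push Not at hp'
  have h1 : ¬ (p.1 = OnePoint.infty ∧ p.2.1 = OnePoint.infty) := fun h => hp'.1 h.1 h.2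
  have hc : ContinuousAt (fun q : OnePoint ℝ × OnePoint ℝ × OnePoint ℝ =>
      (q.2.2, addInfty q.1 q.2.1)) p :=
    (by fun_prop : Continuous fun q : OnePoint ℝ × OnePoint ℝ × OnePoint ℝ => q.2.2).continuousAt.prodMk
      (ContinuousAt.comp (f := fun q : OnePoint ℝ × OnePoint ℝ × OnePoint ℝ => (q.1, q.2.1))
        (continuousAt_addInfty (p := (p.1, p.2.1)) h1) (by fun_prop : Continuous fun q : OnePoint ℝ × OnePoint ℝ × OnePoint ℝ =>
          (q.1, q.2.1)).continuousAt)
  have h2 := hc.eventually (isClosed_diagonal.isOpen_compl.mem_nhds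
    (show (p.2.2, addInfty p.1 p.2.1) ∈ (Set.diagonal (OnePoint ℝ))ᶜ from hp'.2))
  have hcl : IsClosed {q : OnePoint ℝ × OnePoint ℝ × OnePoint ℝ |
      q.1 = OnePoint.infty ∧ q.2.1 = OnePoint.infty} :=
    (isClosed_eq continuous_fst continuous_const).inter
      (isClosed_eq (continuous_fst.comp continuous_snd) continuous_const)
  filter_upwards [h2, hcl.isOpen_compl.mem_nhds h1] with q hq1 hq2 hq
  exact hq.elim hq2 hq1

lemma SumRel.eq_coe {z d : ℝ} {w : OnePoint ℝ} (h : SumRel z d w) : w = ((z + d : ℝ) : OnePoint ℝ) :=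
  h.resolve_left fun h => OnePoint.coe_ne_infty _ h.1

lemma SumRel.eq_infty_left {d : ℝ} {w : OnePoint ℝ} (h : SumRel OnePoint.infty d w) :
    w = OnePoint.infty :=
  h.resolve_left fun h => OnePoint.coe_ne_infty _ h.2

lemma SumRel.eq_infty_right {z : ℝ} {w : OnePoint ℝ} (h : SumRel z OnePoint.infty w) :
    w = OnePoint.infty :=
  (h.resolve_left fun h => OnePoint.coe_ne_infty _ h.1).trans (addInfty_infty_right _)

/-! ### Assembly maps -/

/-- The map `S^V → S^{m + V}` that inserts the coordinates `a` in `S^m`. -/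
noncomputable def glue {m n : ℕ} (a : Fin m → OnePoint ℝ) : sphere (Fin n) ⟶ sphere (Fin (m + n)) :=
  insertMap (Fin.natAddEmb m) (Fin.append a fun _ => ((0 : ℝ) : OnePoint ℝ))

lemma glue_coe {m n : ℕ} (a : Fin m → ℝ) (w : Fin n → ℝ) :
    (glue fun u => (a u : OnePoint ℝ)).toFun (sphere.coe w) = sphere.coe (Fin.append a w) := by
  have h1 : Fin.append (fun u => (a u : OnePoint ℝ)) (fun _ : Fin n => ((0 : ℝ) : OnePoint ℝ)) =
      fun v => ((Fin.append a (fun _ : Fin n => (0 : ℝ)) v : ℝ) : OnePoint ℝ) := by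
    funext v
    refine Fin.addCases (fun u => ?_) (fun u => ?_) v <;> simp
  rw [glue, h1, insertMap_coe]
  congr 1
  funext v
  refine Fin.addCases (fun u => ?_) (fun u => ?_) v
  · rw [Function.extend_apply', Fin.append_left, Fin.append_left]
    rintro ⟨w, hw⟩
    have := congrArg Fin.val hw
    simp at this
    omega
  · rw [Fin.append_right]
    exact (Fin.natAddEmb m).injective.extend_apply _ _ u

lemma glue_infty {m n : ℕ} (a : Fin m → OnePoint ℝ) {u : Fin m} (h : a u = OnePoint.infty) :
    (glue a : sphere (Fin n) ⟶ _) = zeroHom _ _ := by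
  refine insertMap_infty _ _ (v := Fin.castAdd _ u) ?_ ?_
  · rw [Fin.append_left, h]
  · rintro ⟨w, hw⟩
    have := congrArg Fin.val hw
    simp at this
    omega

lemma continuous_glue {m n : ℕ} {A : Type} [TopologicalSpace A] [CompactSpace A] [T2Space A]
    (c : A → Fin m → OnePoint ℝ) (hc : Continuous c) :
    Continuous fun a => (glue (c a) : sphere (Fin n) ⟶ sphere (Fin (m + n))) := by
  refine (continuous_hom_iff _).mpr fun L a M b => ?_
  have h1 : Continuous fun q : CH L × CH M =>
      ((Fin.append (c (a q.1)) fun _ => ((0 : ℝ) : OnePoint ℝ), b q.2) :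
        (Fin (m + n) → OnePoint ℝ) × sphere (Fin n)) := by
    refine Continuous.prodMk (continuous_pi fun v => ?_) (b.continuous.comp continuous_snd)
    refine Fin.addCases (fun u => ?_) (fun w => ?_) v
    · simp only [Fin.append_left]
      exact (continuous_apply u).comp (hc.comp (a.continuous.comp continuous_fst))
    · simp only [Fin.append_right]
      exact continuous_const
  exact (continuous_insertFun (Fin.natAddEmb m)).comp h1

lemma slide_coe {J : Type} [Nonempty J] (F : MFunctor J) {m : ℕ} (V : J → ℕ)
    (d : J → Fin m → ℝ) (x : F.functor.obj fun j => sphere (Fin (V j))) (z : Fin m → ℝ) :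
    (slide F V d x).toFun (sphere.coe z) = (F.functor.map (X := fun j => sphere (Fin (V j)))
      (Y := fun j => sphere (Fin (m + V j)))
      fun j => glue fun u => ((z u + d j u : ℝ) : OnePoint ℝ)).toFun x := rfl

section slide

variable {J : Type} (F : MFunctor J) {m : ℕ} (V : J → ℕ)

/-- The extension of `slide` to infinite translations. -/
noncomputable def slideInfty (d : J → Fin m → OnePoint ℝ)
    (x : F.functor.obj fun j => sphere (Fin (V j))) :
    sphere (Fin m) → F.functor.obj fun j => sphere (Fin (m + V j)) :=
  sphereElim (F.functor.obj _).pt fun z =>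
    (F.functor.map (X := fun j => sphere (Fin (V j))) (Y := fun j => sphere (Fin (m + V j)))
      fun j => glue fun u => addInfty (z u) (d j u)).toFun x

lemma map_glue_infty {w : J → Fin m → OnePoint ℝ} (x : F.functor.obj fun j => sphere (Fin (V j)))
    {j : J} {u : Fin m} (h : w j u = OnePoint.infty) :
    (F.functor.map (X := fun j => sphere (Fin (V j))) (Y := fun j => sphere (Fin (m + V j)))
      fun j => glue (w j)).toFun x = (F.functor.obj _).pt := by
  rw [F.map_zero (k := j) _ (glue_infty (w j) h)]
  rfl

lemma slideInfty_infty {d : J → Fin m → OnePoint ℝ} {j : J} {u : Fin m} (h : d j u = OnePoint.infty)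
    (x : F.functor.obj fun j => sphere (Fin (V j))) (s : sphere (Fin m)) :
    slideInfty F V d x s = (F.functor.obj _).pt := by
  rcases sphere_cases s with rfl | ⟨z, rfl⟩
  · rfl
  · exact map_glue_infty F V x (j := j) (u := u) (by rw [h, addInfty_infty_right])

/-- The translations `d` in the sphere operad: in each coordinate, some of them are zero. -/
def IsSlide (d : J → Fin m → OnePoint ℝ) : Prop := ∀ u, ∃ j, d j u = ((0 : ℝ) : OnePoint ℝ)

lemma isClosed_isSlide [Finite J] : IsClosed {d : J → Fin m → OnePoint ℝ | IsSlide d} := by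
  have : {d : J → Fin m → OnePoint ℝ | IsSlide d} =
      ⋂ u, ⋃ j, {d | d j u = ((0 : ℝ) : OnePoint ℝ)} := by
    ext d
    simp [IsSlide]
  rw [this]
  exact isClosed_iInter fun u => isClosed_iUnion_of_finite fun j => isClosed_eq
    ((continuous_apply u).comp (continuous_apply j)) continuous_const

/-- The joint continuity of the maps `slideInfty`.  At the points where both the argument and a
translation are infinite, the sum of both is not defined; the continuity is tested on the space of
all triples `(z, d, w)` in the closure of the relation `w = z + d`. -/
lemma continuous_slideInfty [Finite J] {A : Type} [TopologicalSpace A] [CompactSpace A] [T2Space A]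
    (d : A → J → Fin m → OnePoint ℝ) (hd : Continuous d) (hd' : ∀ a, IsSlide (d a))
    (x : A → F.functor.obj fun j => sphere (Fin (V j))) (hx : Continuous x) :
    Continuous fun p : A × sphere (Fin m) => slideInfty F V (d p.1) (x p.1) p.2 := by
  refine continuous_of_collapse _ ?_ continuous_const
  -- a compact space which is mapped onto `A × (Fin m → OnePoint ℝ)`, hence by a quotient map
  let S : Set ((A × (Fin m → OnePoint ℝ)) × (J → Fin m → OnePoint ℝ)) :=
    {q | ∀ j u, SumRel (q.1.2 u) (d q.1.1 j u) (q.2 j u)}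
  have hS : IsClosed S := by
    have : S = ⋂ j, ⋂ u, {q | SumRel (q.1.2 u) (d q.1.1 j u) (q.2 j u)} := by
      ext
      simp [S]
    rw [this]
    refine isClosed_iInter fun j => isClosed_iInter fun u => isClosed_sumRel.preimage
      (f := fun q : (A × (Fin m → OnePoint ℝ)) × (J → Fin m → OnePoint ℝ) =>
        (q.1.2 u, d q.1.1 j u, q.2 j u)) ?_
    have hdc : Continuous fun q : (A × (Fin m → OnePoint ℝ)) × (J → Fin m → OnePoint ℝ) =>
        d q.1.1 j u := (continuous_apply u).comp ((continuous_apply j).comp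
          (hd.comp (continuous_fst.comp continuous_fst)))
    exact ((continuous_apply u).comp (continuous_snd.comp continuous_fst)).prodMk (hdc.prodMk
      ((continuous_apply u).comp ((continuous_apply j).comp continuous_snd)))
  have : CompactSpace S := isCompact_iff_compactSpace.mp hS.isCompact
  let q : S → A × (Fin m → OnePoint ℝ) := fun s => s.1.1
  have hq : Continuous q := continuous_fst.comp continuous_subtype_val
  have hsurj : Function.Surjective q := fun p =>
    ⟨⟨(p, fun j u => addInfty (p.2 u) (d p.1 j u)), fun j u => .inr rfl⟩, rfl⟩
  rw [(IsQuotientMap.of_surjective_continuous hsurj hq).continuous_iff]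
  have key : Continuous fun s : S => (F.functor.map (X := fun j => sphere (Fin (V j)))
      (Y := fun j => sphere (Fin (m + V j))) fun j => glue (s.1.2 j)).toFun (x s.1.1.1) :=
    F.continuous_apply (X := fun j => sphere (Fin (V j))) (Y := fun j => sphere (Fin (m + V j)))
      (fun s : S => fun j => glue (s.1.2 j)) (fun j => continuous_glue _
        ((continuous_apply j).comp (continuous_snd.comp continuous_subtype_val)))
      (hx.comp (continuous_fst.comp (continuous_fst.comp continuous_subtype_val)))
  refine key.congr ?_
  rintro ⟨⟨⟨a, z⟩, w⟩, hw⟩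
  change _ = slideInfty F V (d a) (x a) (collapse z)
  rcases eq_coe_or_infty z with ⟨z, rfl⟩ | ⟨u, hu⟩
  · rw [collapse_coe]
    change _ = (F.functor.map _).toFun (x a)
    congr 2
    funext j
    congr 1
    funext u
    exact (hw j u).resolve_left fun h => OnePoint.coe_ne_infty _ h.1
  -- the translation `j` that is zero at `u` leaves the coordinate infinite
  · rw [collapse_infty z hu]
    obtain ⟨j, hj⟩ := hd' a u
    refine map_glue_infty F V _ (j := j) (u := u) ?_
    have := hw j u
    simp only at this
    rw [hu, hj] at this
    exact this.eq_infty_left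

/-- `slideInfty` as a based map. -/
noncomputable def slideHom [Finite J] {d : J → Fin m → OnePoint ℝ} (hd : IsSlide d)
    (x : F.functor.obj fun j => sphere (Fin (V j))) :
    sphere (Fin m) ⟶ F.functor.obj fun j => sphere (Fin (m + V j)) where
  toFun := slideInfty F V d x
  cont := (continuous_slideInfty F V (fun _ : PUnit => d) continuous_const (fun _ => hd)
    (fun _ => x) continuous_const).comp (Continuous.prodMk_right PUnit.unit)
  map_pt := rfl

lemma continuous_slideHom [Finite J] {A : Type} [TopologicalSpace A] [CompactSpace A] [T2Space A]
    (d : A → J → Fin m → OnePoint ℝ) (hd : Continuous d) (hd' : ∀ a, IsSlide (d a))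
    (x : A → F.functor.obj fun j => sphere (Fin (V j))) (hx : Continuous x) :
    Continuous fun a => slideHom F V (hd' a) (x a) := by
  refine (continuous_hom_iff _).mpr fun L a M b => ?_
  have h := continuous_slideInfty F V (A := CH L) (fun l => d (a l)) (hd.comp a.continuous)
    (fun l => hd' _) (fun l => x (a l)) (hx.comp a.continuous)
  exact h.comp (continuous_fst.prodMk (b.continuous.comp continuous_snd))

lemma slideHom_coe [Finite J] [Nonempty J] {d : J → Fin m → ℝ}
    (hd : IsSlide fun j u => (d j u : OnePoint ℝ)) (x : F.functor.obj fun j => sphere (Fin (V j))) :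
    slideHom F V hd x = slide F V d x := sphereHom_ext fun _ => rfl

lemma slideHom_infty [Finite J] {d : J → Fin m → OnePoint ℝ} (hd : IsSlide d) {j : J} {u : Fin m}
    (h : d j u = OnePoint.infty) (x : F.functor.obj fun j => sphere (Fin (V j))) :
    slideHom F V hd x = zeroHom _ _ := by
  ext s
  exact slideInfty_infty F V h x s

end slide

end Multilin

namespace Multilin

/-! ### The composition of loops -/

lemma continuous_eval {X Y : PSpace} {A : Type} [TopologicalSpace A] [CompactSpace A] [T2Space A]
    {f : A → (X ⟶ Y)} (hf : Continuous f) {x : A → X} (hx : Continuous x) :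
    Continuous fun a => (f a).toFun (x a) :=
  ((continuous_hom_iff f).mp hf (K := CompHaus.of A) ⟨id, continuous_id⟩
    (L := CompHaus.of A) ⟨x, hx⟩).comp (continuous_id.prodMk continuous_id)

/-- The infinite point and the non-positive real numbers. -/
def NonposInfty (d : OnePoint ℝ) : Prop := ∀ r : ℝ, d = r → r ≤ 0

lemma isClosed_nonposInfty : IsClosed {d | NonposInfty d} := by
  have : {d | NonposInfty d} = (((↑) : ℝ → OnePoint ℝ) '' Set.Ioi 0)ᶜ := by
    ext d
    simp only [NonposInfty, Set.mem_compl_iff, Set.mem_image, not_exists, not_and]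
    exact ⟨fun h r hr e => absurd (h r e.symm) (not_le.mpr hr), fun h r e => by
      by_contra hc
      exact h r (not_le.mp hc) e.symm⟩
  rw [this]
  exact (OnePoint.isOpenMap_coe _ isOpen_Ioi).isClosed_compl

section loops

variable {K : Type} {J : K → Type} [Finite K] [Nonempty K] [∀ k, Finite (J k)] [∀ k, Nonempty (J k)]
  {U : K → II} {V : ∀ k, J k → II}

/-- The coordinates `max_j y_{k,j}`. -/
noncomputable def maxCoord (y : Coord (addObj U V) → ℝ) : Coord U → ℝ :=
  fun c => ⨆ j : J c.1, y ⟨⟨c.1, j⟩, Fin.castAdd _ c.2⟩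

/-- The coordinates `y_{k,j} - max_j y_{k,j}`. -/
noncomputable def diffCoord (y : Coord (addObj U V) → ℝ) (k : K) (j : J k) (u : Fin (U k).card) : ℝ :=
  y ⟨⟨k, j⟩, Fin.castAdd _ u⟩ - maxCoord y ⟨k, u⟩

/-- The coordinates in the sets `V_{k,j}`. -/
def restCoord {R : Type} (y : Coord (addObj U V) → R) (k : K) : Coord (V k) → R :=
  fun c => y ⟨⟨k, c.1⟩, Fin.natAdd _ c.2⟩

omit [Finite K] [Nonempty K] [∀ k, Nonempty (J k)] in
lemma le_maxCoord (y : Coord (addObj U V) → ℝ) (k : K) (j : J k) (u : Fin (U k).card) :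
    y ⟨⟨k, j⟩, Fin.castAdd _ u⟩ ≤ maxCoord y ⟨k, u⟩ :=
  le_ciSup (f := fun j : J k => y ⟨⟨k, j⟩, Fin.castAdd _ u⟩) (Set.finite_range _).bddAbove j

omit [Finite K] [Nonempty K] in
lemma maxCoord_eq (y : Coord (addObj U V) → ℝ) (c : Coord U) (r : ℝ)
    (h : ∀ j, y ⟨⟨c.1, j⟩, Fin.castAdd _ c.2⟩ ≤ r) {j : J c.1}
    (hj : y ⟨⟨c.1, j⟩, Fin.castAdd _ c.2⟩ = r) : maxCoord y c = r :=
  le_antisymm (ciSup_le h) (hj ▸ le_maxCoord y c.1 j c.2)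

variable (O : FunctorOperad)

/-- The composition of the loop `g` with the loops `f_k`. -/
noncomputable def loopCompFun (g : sphere (Coord U) ⟶ (O.F K).functor.obj (spheres U))
    (f : ∀ k, sphere (Coord (V k)) ⟶ (O.F (J k)).functor.obj (spheres (V k))) :
    sphere (Coord (addObj U V)) → (O.F (Σ k, J k)).functor.obj (spheres (addObj U V)) :=
  sphereElim (PSpace.pt _) fun y => (O.γ (spheres (addObj U V))).toFun
    (((O.F K).functor.map (X := spheres U)
      (Y := fun k => (O.F (J k)).functor.obj fun j => spheres (addObj U V) ⟨k, j⟩)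
      fun k => slide (O.F (J k)) (fun j => (V k j).card) (diffCoord y k)
        ((f k).toFun (sphere.coe (restCoord y k)))).toFun (g.toFun (sphere.coe (maxCoord y))))

variable (U V) in
/-- The space of the coordinates `y` of a point of `S^{∐ (U_k ∐ V_{k,j})}`, together with its
maxima `m` and its differences `d`, compactified such that it projects onto the space of all
possibly infinite `y`. -/
def SplitCoord : Set ((Coord (addObj U V) → OnePoint ℝ) × (Coord U → OnePoint ℝ) ×
    (∀ k, J k → Fin (U k).card → OnePoint ℝ)) :=
  {q | (∀ k j u, SumRel (q.2.1 ⟨k, u⟩) (q.2.2 k j u) (q.1 ⟨⟨k, j⟩, Fin.castAdd _ u⟩)) ∧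
    (∀ k j u, NonposInfty (q.2.2 k j u)) ∧ ∀ k, IsSlide (q.2.2 k)}

omit [Finite K] [Nonempty K] [∀ k, Nonempty (J k)] in
lemma isClosed_splitCoord : IsClosed (SplitCoord U V) := by
  have hd : ∀ k j u, Continuous fun q : (Coord (addObj U V) → OnePoint ℝ) ×
      (Coord U → OnePoint ℝ) × (∀ k, J k → Fin (U k).card → OnePoint ℝ) => q.2.2 k j u :=
    fun k j u => (continuous_apply u).comp ((continuous_apply j).comp ((continuous_apply k).comp
      (continuous_snd.comp continuous_snd)))
  have : SplitCoord U V = (⋂ k, ⋂ j, ⋂ u,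
      {q | SumRel (q.2.1 ⟨k, u⟩) (q.2.2 k j u) (q.1 ⟨⟨k, j⟩, Fin.castAdd _ u⟩)}) ∩
      ((⋂ k, ⋂ j, ⋂ u, {q | NonposInfty (q.2.2 k j u)}) ∩ ⋂ k, {q | IsSlide (q.2.2 k)}) := by
    ext
    simp [SplitCoord]
  rw [this]
  refine IsClosed.inter ?_ (IsClosed.inter ?_ ?_)
  · refine isClosed_iInter fun k => isClosed_iInter fun j => isClosed_iInter fun u =>
      isClosed_sumRel.preimage (f := fun q : (Coord (addObj U V) → OnePoint ℝ) ×
        (Coord U → OnePoint ℝ) × (∀ k, J k → Fin (U k).card → OnePoint ℝ) =>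
          (q.2.1 ⟨k, u⟩, q.2.2 k j u, q.1 ⟨⟨k, j⟩, Fin.castAdd _ u⟩)) ?_
    exact ((continuous_apply _).comp (continuous_fst.comp continuous_snd)).prodMk
      ((hd k j u).prodMk ((continuous_apply _).comp continuous_fst))
  · exact isClosed_iInter fun k => isClosed_iInter fun j => isClosed_iInter fun u =>
      isClosed_nonposInfty.preimage (hd k j u)
  · exact isClosed_iInter fun k => isClosed_isSlide.preimage
      (f := fun q : (Coord (addObj U V) → OnePoint ℝ) × (Coord U → OnePoint ℝ) ×
        (∀ k, J k → Fin (U k).card → OnePoint ℝ) => q.2.2 k)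
      ((continuous_apply k).comp (continuous_snd.comp continuous_snd))

omit [Finite K] [Nonempty K] in
lemma exists_splitCoord (y : Coord (addObj U V) → OnePoint ℝ) : ∃ m d, (y, m, d) ∈ SplitCoord U V := by
  have key : ∀ (k : K) (u : Fin (U k).card), ∃ (m : OnePoint ℝ) (d : J k → OnePoint ℝ),
      (∀ j, SumRel m (d j) (y ⟨⟨k, j⟩, Fin.castAdd _ u⟩)) ∧ (∀ j, NonposInfty (d j)) ∧
        ∃ j, d j = ((0 : ℝ) : OnePoint ℝ) := by
    intro k u
    rcases eq_coe_or_infty fun j : J k => y ⟨⟨k, j⟩, Fin.castAdd _ u⟩ with ⟨z, hz⟩ | ⟨j, hj⟩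
    · refine ⟨((⨆ j, z j : ℝ) : OnePoint ℝ), fun j => ((z j - ⨆ j, z j : ℝ) : OnePoint ℝ),
        fun j => .inr ?_, fun j r hr => ?_, ?_⟩
      · rw [addInfty_coe, add_sub_cancel]
        exact congrFun hz j
      · rw [← OnePoint.coe_eq_coe.mp hr]
        exact sub_nonpos.mpr (le_ciSup (Set.finite_range z).bddAbove j)
      · obtain ⟨j, hj⟩ := exists_eq_ciSup_of_finite (f := z)
        exact ⟨j, congrArg _ (sub_eq_zero.mpr hj)⟩
    -- if some coordinates are infinite, so is the maximum, and exactly these have the difference zero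
    · classical
      refine ⟨OnePoint.infty, fun i => if y ⟨⟨k, i⟩, Fin.castAdd _ u⟩ = OnePoint.infty then
        ((0 : ℝ) : OnePoint ℝ) else OnePoint.infty, fun i => ?_, fun i r hr => ?_, j, if_pos hj⟩
      · dsimp only
        split_ifs with h
        · exact .inr h
        · exact .inl ⟨rfl, rfl⟩
      · dsimp only at hr
        split_ifs at hr with h
        · exact (OnePoint.coe_eq_coe.mp hr).symm.le
        · exact absurd hr.symm (OnePoint.coe_ne_infty r)
  choose m d h1 h2 h3 using key
  exact ⟨fun c => m c.1 c.2, fun k j u => d k u j, fun k j u => h1 k u j, fun k j u => h2 k u j,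
    fun k u => h3 k u⟩

omit [Finite K] [Nonempty K] in
/-- Over the finite points, the maxima and differences are determined. -/
lemma eq_of_mem_splitCoord {y : Coord (addObj U V) → ℝ} {m : Coord U → OnePoint ℝ}
    {d : ∀ k, J k → Fin (U k).card → OnePoint ℝ}
    (h : ((fun c => (y c : OnePoint ℝ)), m, d) ∈ SplitCoord U V) :
    (m = fun c => (maxCoord y c : OnePoint ℝ)) ∧
      d = fun k j u => (diffCoord y k j u : OnePoint ℝ) := by
  obtain ⟨h1, h2, h3⟩ := h
  -- the maximum is finite, since it is equal to a coordinate, the one of difference zero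
  have hm : ∀ k u, ∃ r : ℝ, m ⟨k, u⟩ = r := by
    intro k u
    obtain ⟨j, hj⟩ := h3 k u
    have := h1 k j u
    simp only at this hj
    rw [hj] at this
    by_contra hc
    push Not at hc
    have hinf : m ⟨k, u⟩ = OnePoint.infty := by
      by_contra hne
      obtain ⟨r, hr⟩ := OnePoint.ne_infty_iff_exists.mp hne
      exact hc r hr.symm
    rw [hinf] at this
    exact OnePoint.coe_ne_infty _ this.eq_infty_left
  choose r hr using hm
  have hd : ∀ k j u, d k j u = ((y ⟨⟨k, j⟩, Fin.castAdd _ u⟩ - r k u : ℝ) : OnePoint ℝ) := by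
    intro k j u
    have h := h1 k j u
    simp only at h
    rw [hr k u] at h
    by_cases hne : d k j u = OnePoint.infty
    · rw [hne] at h
      exact absurd h.eq_infty_right (OnePoint.coe_ne_infty _)
    · obtain ⟨s, hs⟩ := OnePoint.ne_infty_iff_exists.mp hne
      rw [← hs] at h ⊢
      rw [OnePoint.coe_eq_coe.mp h.eq_coe, add_sub_cancel_left]
  have hmax : ∀ k u, maxCoord y ⟨k, u⟩ = r k u := by
    intro k u
    obtain ⟨j, hj⟩ := h3 k u
    refine maxCoord_eq y ⟨k, u⟩ _ (fun i => ?_) (j := j) ?_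
    · exact sub_nonpos.mp (h2 k i u _ (hd k i u))
    · exact sub_eq_zero.mp (OnePoint.coe_eq_coe.mp ((hd k j u).symm.trans hj))
  refine ⟨funext fun c => (hr c.1 c.2).trans (congrArg _ (hmax _ _).symm), ?_⟩
  funext k j u
  rw [hd, diffCoord, hmax]

/-- The joint continuity of the composition of loops.  It is tested on the compact space of all
decompositions of the coordinates into maxima and differences, which is mapped onto the space of
coordinates and on which the composition is visibly continuous. -/
lemma continuous_loopCompFun {A : Type} [TopologicalSpace A] [CompactSpace A] [T2Space A]
    (g : A → (sphere (Coord U) ⟶ (O.F K).functor.obj (spheres U))) (hg : Continuous g)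
    (f : A → ∀ k, sphere (Coord (V k)) ⟶ (O.F (J k)).functor.obj (spheres (V k)))
    (hf : ∀ k, Continuous fun a => f a k) :
    Continuous fun p : A × sphere (Coord (addObj U V)) => loopCompFun O (g p.1) (f p.1) p.2 := by
  refine continuous_of_collapse _ ?_ continuous_const
  have : CompactSpace (SplitCoord U V) := isCompact_iff_compactSpace.mp isClosed_splitCoord.isCompact
  let q : A × SplitCoord U V → A × (Coord (addObj U V) → OnePoint ℝ) := fun s => (s.1, s.2.1.1)
  have hq : Continuous q := by fun_prop
  have hsurj : Function.Surjective q := by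
    rintro ⟨a, y⟩
    obtain ⟨m, d, h⟩ := exists_splitCoord y
    exact ⟨(a, ⟨(y, m, d), h⟩), rfl⟩
  rw [(IsQuotientMap.of_surjective_continuous hsurj hq).continuous_iff]
  have hsub : Continuous fun s : A × SplitCoord U V => s.2.1 :=
    continuous_subtype_val.comp continuous_snd
  have hslide : ∀ (s : A × SplitCoord U V) k, IsSlide (s.2.1.2.2 k) := fun s => s.2.2.2.2
  have hfc : ∀ k, Continuous fun s : A × SplitCoord U V =>
      (f s.1 k).toFun (collapse (restCoord s.2.1.1 k)) := fun k =>
    continuous_eval ((hf k).comp continuous_fst) (continuous_collapse.comp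
      (continuous_pi fun c => (continuous_apply _).comp (continuous_fst.comp hsub)))
  have key : Continuous fun s : A × SplitCoord U V => (O.γ (spheres (addObj U V))).toFun
    (((O.F K).functor.map (X := spheres U)
      (Y := fun k => (O.F (J k)).functor.obj fun j => spheres (addObj U V) ⟨k, j⟩)
      fun k => slideHom (O.F (J k)) (fun j => (V k j).card) (hslide s k)
        ((f s.1 k).toFun (collapse (restCoord s.2.1.1 k)))).toFun
          ((g s.1).toFun (collapse s.2.1.2.1))) := by
    refine (O.γ (spheres (addObj U V))).cont.comp ?_
    refine (O.F K).continuous_apply (X := spheres U)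
      (Y := fun k => (O.F (J k)).functor.obj fun j => spheres (addObj U V) ⟨k, j⟩)
      (fun s : A × SplitCoord U V => fun k => slideHom (O.F (J k)) (fun j => (V k j).card)
        (hslide s k) ((f s.1 k).toFun (collapse (restCoord s.2.1.1 k)))) (fun k => ?_) ?_
    · exact continuous_slideHom (O.F (J k)) (fun j => (V k j).card) (fun s => s.2.1.2.2 k)
        ((continuous_apply k).comp (continuous_snd.comp (continuous_snd.comp hsub)))
        (fun s => hslide s k) _ (hfc k)
    · exact continuous_eval (hg.comp continuous_fst) (continuous_collapse.comp
        (continuous_fst.comp (continuous_snd.comp hsub)))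
  refine key.congr ?_
  rintro ⟨a, ⟨⟨y, m, d⟩, h⟩⟩
  change _ = loopCompFun O (g a) (f a) (collapse y)
  dsimp only
  rcases eq_coe_or_infty y with ⟨y, rfl⟩ | ⟨⟨⟨k, j⟩, i⟩, hi⟩
  · obtain ⟨rfl, rfl⟩ := eq_of_mem_splitCoord h
    rw [collapse_coe, collapse_coe]
    change (O.γ _).toFun (((O.F K).functor.map _).toFun _) =
      (O.γ _).toFun (((O.F K).functor.map _).toFun _)
    congr 3
    funext k
    exact (slideHom_coe (O.F (J k)) (fun j => (V k j).card) _ _).trans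
      (congrArg (fun s => slide (O.F (J k)) (fun j => (V k j).card) (diffCoord y k)
        ((f a k).toFun s)) (collapse_coe (restCoord y k)))
  · rw [collapse_infty y hi]
    refine Eq.trans ?_ (PSpace.Hom.map_pt (O.γ (spheres (addObj U V))))
    refine congrArg _ ?_
    have hzero : ∀ φ : (∀ k, spheres U k ⟶ (O.F (J k)).functor.obj fun j => spheres (addObj U V) ⟨k, j⟩),
        φ k = zeroHom _ _ → ∀ x, ((O.F K).functor.map (X := spheres U)
          (Y := fun k => (O.F (J k)).functor.obj fun j => spheres (addObj U V) ⟨k, j⟩) φ).toFun x =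
            PSpace.pt _ := fun φ hφ x => by
      rw [(O.F K).map_zero (k := k) φ hφ]
      rfl
    -- an infinite coordinate of a sphere `U k` has an infinite maximum or an infinite difference
    revert hi
    refine Fin.addCases (fun u => ?_) (fun w => ?_) i
    · intro hi
      have hrel := h.1 k j u
      simp only at hrel
      have hi' : y ⟨⟨k, j⟩, Fin.castAdd _ u⟩ = OnePoint.infty := hi
      rw [hi'] at hrel
      by_cases hm : m ⟨k, u⟩ = OnePoint.infty
      · rw [collapse_infty m hm, (g a).map_pt, PSpace.Hom.map_pt]
      · refine hzero _ (slideHom_infty _ _ _ (j := j) (u := u) ?_ _) _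
        by_contra hd
        obtain ⟨r, hr⟩ := OnePoint.ne_infty_iff_exists.mp hm
        obtain ⟨s, hs⟩ := OnePoint.ne_infty_iff_exists.mp hd
        rw [← hr, show d k j u = (s : OnePoint ℝ) from hs.symm] at hrel
        exact OnePoint.infty_ne_coe _ hrel.eq_coe
    · intro hi
      refine hzero _ ?_ _
      rw [collapse_infty (i := ⟨j, w⟩) (restCoord y k) hi, (f a k).map_pt]
      exact sphereHom_ext fun z => PSpace.Hom.map_pt _

/-- The composition of the loop `g` with the loops `f_k`, as a point of the loop space. -/
noncomputable def loopComp (g : loopSpace (O.F K) U) (f : ∀ k, loopSpace (O.F (J k)) (V k)) :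
    loopSpace (O.F (Σ k, J k)) (addObj U V) :=
  PSpace.Hom.mk (X := sphere (Coord (addObj U V))) (loopCompFun O g f)
    ((continuous_loopCompFun O (fun _ : PUnit => g) continuous_const (fun _ => f)
      fun _ => continuous_const).comp (Continuous.prodMk_right PUnit.unit)) rfl

lemma isLoopComposite_loopComp (g : loopSpace (O.F K) U) (f : ∀ k, loopSpace (O.F (J k)) (V k)) :
    IsLoopComposite O g f (loopComp O g f) := fun _ => rfl

lemma continuousGeneratedBy_loopComp : ContinuousGeneratedBy CH
    fun p : loopSpace (O.F K) U × ∀ k, loopSpace (O.F (J k)) (V k) => loopComp O p.1 p.2 := by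
  intro A a
  refine continuous_mapSpace ((continuous_hom_iff _).mpr fun L b M c => ?_)
  have h := continuous_loopCompFun O (A := CH A) (fun x => (a x).1)
    ((continuous_of_mapSpace _ _).comp (continuous_fst.comp a.continuous)) (fun x => (a x).2)
    fun k => (continuous_of_mapSpace _ _).comp ((continuous_apply k).comp
      (continuous_snd.comp a.continuous))
  exact h.comp ((b.continuous.comp continuous_fst).prodMk (c.continuous.comp continuous_snd))

end loops

end Multilin

namespace Multilin

/-! ### Naturality of the composition of loops -/

@[simp] lemma addInj_castAdd {m m' n n' : ℕ} (i : Fin m ↪ Fin m') (j : Fin n ↪ Fin n') (u : Fin m) :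
    addInj i j (Fin.castAdd n u) = Fin.castAdd n' (i u) := by simp [addInj]

@[simp] lemma addInj_natAdd {m m' n n' : ℕ} (i : Fin m ↪ Fin m') (j : Fin n ↪ Fin n') (w : Fin n) :
    addInj i j (Fin.natAdd m w) = Fin.natAdd m' (j w) := by simp [addInj]

/-- Assembling spheres is compatible with stabilization. -/
lemma insertMap_glue {m m' n n' : ℕ} (i : Fin m ↪ Fin m') (j : Fin n ↪ Fin n') (z : Fin m → ℝ)
    (M d : Fin m' → ℝ) (v : Fin n' → ℝ) :
    (insertMap j fun c => (v c : OnePoint ℝ)) ≫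
        glue (fun u => ((Function.extend i z M u + d u : ℝ) : OnePoint ℝ)) =
      glue (fun u => ((z u + d (i u) : ℝ) : OnePoint ℝ)) ≫ insertMap (addInj i j)
        fun c => ((Fin.append (fun u => M u + d u) v c : ℝ) : OnePoint ℝ) := by
  refine sphereHom_ext fun w => ?_
  rw [PSpace.comp_toFun, PSpace.comp_toFun, insertMap_coe, glue_coe, glue_coe, insertMap_coe]
  congr 1
  funext c
  refine Fin.addCases (fun u => ?_) (fun c => ?_) c
  · rw [Fin.append_left]
    by_cases h : ∃ u', i u' = u
    · obtain ⟨u', rfl⟩ := h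
      rw [i.injective.extend_apply, ← addInj_castAdd i j,
        (addInj i j).injective.extend_apply, Fin.append_left]
    · rw [Function.extend_apply' _ _ _ h, Function.extend_apply', Fin.append_left]
      rintro ⟨c, hc⟩
      revert hc
      refine Fin.addCases (fun u' hc => ?_) (fun w' hc => ?_) c
      · rw [addInj_castAdd] at hc
        exact h ⟨u', Fin.castAdd_injective _ _ hc⟩
      · rw [addInj_natAdd] at hc
        have := congrArg Fin.val hc
        simp at this
        omega
  · rw [Fin.append_right]
    by_cases h : ∃ w', j w' = c
    · obtain ⟨w', rfl⟩ := h
      rw [j.injective.extend_apply, ← addInj_natAdd i j,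
        (addInj i j).injective.extend_apply, Fin.append_right]
    · rw [Function.extend_apply' _ _ _ h, Function.extend_apply', Fin.append_right]
      rintro ⟨c', hc⟩
      revert hc
      refine Fin.addCases (fun u' hc => ?_) (fun w' hc => ?_) c'
      · rw [addInj_castAdd] at hc
        have := congrArg Fin.val hc
        simp at this
        omega
      · rw [addInj_natAdd] at hc
        exact h ⟨w', Fin.natAdd_injective _ _ hc⟩

lemma slide_naturality {J : Type} [Nonempty J] (F : MFunctor J) {m m' : ℕ} {V V' : J → ℕ}
    (i : Fin m ↪ Fin m') (j : ∀ a, Fin (V a) ↪ Fin (V' a)) (M : Fin m' → ℝ) (d : J → Fin m' → ℝ)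
    (v : ∀ a, Fin (V' a) → ℝ) (x : F.functor.obj fun a => sphere (Fin (V a))) :
    insertMap i (fun c => (M c : OnePoint ℝ)) ≫ slide F V' d ((F.functor.map
        (X := fun a => sphere (Fin (V a))) (Y := fun a => sphere (Fin (V' a)))
        fun a => insertMap (j a) fun c => (v a c : OnePoint ℝ)).toFun x) =
      slide F V (fun a u => d a (i u)) x ≫ F.functor.map
        (X := fun a => sphere (Fin (m + V a))) (Y := fun a => sphere (Fin (m' + V' a)))
        fun a => insertMap (addInj i (j a))
          fun c => ((Fin.append (fun u => M u + d a u) (v a) c : ℝ) : OnePoint ℝ) := by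
  refine sphereHom_ext fun z => ?_
  rw [PSpace.comp_toFun, insertMap_coe, slide_coe, PSpace.comp_toFun, slide_coe,
    ← PSpace.comp_toFun, ← PSpace.comp_toFun, ← F.functor.map_comp, ← F.functor.map_comp]
  exact congrArg (fun φ => (F.functor.map (X := fun a => sphere (Fin (V a)))
    (Y := fun a => sphere (Fin (m' + V' a))) φ).toFun x)
    (funext fun a => insertMap_glue i (j a) z M (d a) (v a))

lemma MFunctor.map_map {L : Type} (F : MFunctor L) {X Y Z : L → PSpace} (f : ∀ k, X k ⟶ Y k)
    (g : ∀ k, Y k ⟶ Z k) (x : F.functor.obj X) :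
    (F.functor.map (X := Y) (Y := Z) g).toFun ((F.functor.map (X := X) (Y := Y) f).toFun x) =
      (F.functor.map (X := X) (Y := Z) fun k => f k ≫ g k).toFun x :=
  congrArg (fun φ => PSpace.Hom.toFun φ x) (F.functor.map_comp (X := X) (Y := Y) (Z := Z) f g).symm

lemma MFunctor.map_congr {L : Type} (F : MFunctor L) {X Y : L → PSpace} {f g : ∀ k, X k ⟶ Y k}
    (h : ∀ k, f k = g k) (x : F.functor.obj X) :
    (F.functor.map (X := X) (Y := Y) f).toFun x = (F.functor.map (X := X) (Y := Y) g).toFun x :=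
  congrArg (fun φ => (F.functor.map (X := X) (Y := Y) φ).toFun x) (funext h)

lemma MFunctor.map_eq_pt {L : Type} (F : MFunctor L) {X Y : L → PSpace} (f : ∀ k, X k ⟶ Y k)
    (x : F.functor.obj X) {k : L} (h : f k = zeroHom _ _) :
    (F.functor.map (X := X) (Y := Y) f).toFun x = (F.functor.obj Y).pt :=
  congrArg (fun φ => PSpace.Hom.toFun φ x) (F.map_zero (X := X) (Y := Y) f h)

/-- The value of a point of the loop space at the finite point `y` of the sphere. -/
def evalLoop {L : Type} [Finite L] {F : MFunctor L} {A : L → II} (f : loopSpace F A)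
    (y : Coord A → ℝ) : F.functor.obj (spheres A) :=
  PSpace.Hom.toFun (X := sphere (Coord A)) f (sphere.coe y)

lemma loopSpace_ext {L : Type} [Finite L] {F : MFunctor L} {A : L → II} {f g : loopSpace F A}
    (h : ∀ y, evalLoop f y = evalLoop g y) : f = g := sphereHom_ext h

lemma evalLoop_stabMap {L : Type} [Finite L] (F : MFunctor L) {A B : L → II} (i : A ⟶ B)
    (f : loopSpace F A) (y : Coord B → ℝ) :
    evalLoop ((stabMap F i).toFun f) y =
      (F.functor.map (insertMaps i fun v => (y v : OnePoint ℝ))).toFun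
        (evalLoop f fun c => y (coordMap i c)) := rfl

section loops

variable {K : Type} {J : K → Type} [Finite K] [Nonempty K] [∀ k, Finite (J k)] [∀ k, Nonempty (J k)]
  {U U' : K → II} {V V' : ∀ k, J k → II} (O : FunctorOperad)

/-- The functor `∐` on morphisms. -/
def addHom (i : U ⟶ U') (j : ∀ k, V k ⟶ V' k) : addObj U V ⟶ addObj U' V' :=
  fun q => (addInj (II.inj (i q.1)) (II.inj (j q.1 q.2)) : Fin _ ↪ Fin _)

/-- The assembly of the variables in the composition of loops: the maps `S^{U_k} → F_{J k}(…)`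
given by points `x_k` of `F_{J k}((S^{V_{k,j}})_j)` and by the differences of the coordinates `y`. -/
noncomputable def assemble (y : Coord (addObj U V) → ℝ)
    (x : ∀ k, (O.F (J k)).functor.obj (spheres (V k))) (k : K) :
    spheres U k ⟶ (O.F (J k)).functor.obj fun j => spheres (addObj U V) ⟨k, j⟩ :=
  slide (O.F (J k)) (fun j => (V k j).card) (diffCoord y k) (x k)

lemma evalLoop_loopComp (g : loopSpace (O.F K) U) (f : ∀ k, loopSpace (O.F (J k)) (V k))
    (y : Coord (addObj U V) → ℝ) :
    evalLoop (loopComp O g f) y = (O.γ (spheres (addObj U V))).toFun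
      (((O.F K).functor.map (X := spheres U)
        (Y := fun k => (O.F (J k)).functor.obj fun j => spheres (addObj U V) ⟨k, j⟩)
        (assemble O y fun k => evalLoop (f k) (restCoord y k))).toFun
          (evalLoop g (maxCoord y))) := rfl

lemma γ_naturality_apply {X Y : (Σ k, J k) → PSpace} (f : X ⟶ Y)
    (x : (O.F K).functor.obj (fun k => (O.F (J k)).functor.obj fun j => X ⟨k, j⟩)) :
    (O.γ Y).toFun (((O.F K).functor.map (X := fun k => (O.F (J k)).functor.obj fun j => X ⟨k, j⟩)
        (Y := fun k => (O.F (J k)).functor.obj fun j => Y ⟨k, j⟩)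
        (fun k => (O.F (J k)).functor.map (X := fun j => X ⟨k, j⟩) (Y := fun j => Y ⟨k, j⟩)
          fun j => f ⟨k, j⟩)).toFun x) =
      ((O.F (Σ k, J k)).functor.map f).toFun ((O.γ X).toFun x) :=
  congrArg (fun φ => PSpace.Hom.toFun φ x) (O.γ_naturality f)

omit [Nonempty K] [Finite K] [∀ k, Finite (J k)] [∀ k, Nonempty (J k)] in
lemma maxCoord_coordMap (i : U ⟶ U') (j : ∀ k, V k ⟶ V' k) (y : Coord (addObj U' V') → ℝ) :
    maxCoord (fun c => y (coordMap (addHom i j) c)) = fun c => maxCoord y (coordMap i c) := by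
  funext c
  refine congrArg _ (funext fun a => congrArg (fun u => y ⟨⟨c.1, a⟩, u⟩) ?_)
  exact addInj_castAdd (II.inj (i c.1)) (II.inj (j c.1 a)) c.2

omit [Nonempty K] [Finite K] [∀ k, Finite (J k)] [∀ k, Nonempty (J k)] in
lemma diffCoord_coordMap (i : U ⟶ U') (j : ∀ k, V k ⟶ V' k) (y : Coord (addObj U' V') → ℝ) (k : K) :
    diffCoord (fun c => y (coordMap (addHom i j) c)) k =
      fun a u => diffCoord y k a (II.inj (i k) u) := by
  funext a u
  refine congrArg₂ (· - ·) (congrArg (fun u => y ⟨⟨k, a⟩, u⟩)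
    (addInj_castAdd (II.inj (i k)) (II.inj (j k a)) u)) ?_
  exact congrFun (maxCoord_coordMap i j y) ⟨k, u⟩

omit [Nonempty K] [Finite K] [∀ k, Finite (J k)] [∀ k, Nonempty (J k)] in
lemma restCoord_coordMap (i : U ⟶ U') (j : ∀ k, V k ⟶ V' k) (y : Coord (addObj U' V') → ℝ) (k : K) :
    restCoord (fun c => y (coordMap (addHom i j) c)) k =
      fun c => restCoord y k (coordMap (j k) c) := by
  funext c
  exact congrArg (fun u => y ⟨⟨k, c.1⟩, u⟩) (addInj_natAdd (II.inj (i k)) (II.inj (j k c.1)) c.2)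

omit [Nonempty K] [Finite K] [∀ k, Finite (J k)] [∀ k, Nonempty (J k)] in
lemma append_coord (y : Coord (addObj U V) → ℝ) (k : K) (a : J k) :
    Fin.append (fun u => maxCoord y ⟨k, u⟩ + diffCoord y k a u) (fun w => restCoord y k ⟨a, w⟩) =
      fun c => y ⟨⟨k, a⟩, c⟩ := by
  funext c
  refine Fin.addCases (fun u => ?_) (fun w => ?_) c
  · rw [Fin.append_left]
    exact add_sub_cancel _ _
  · rw [Fin.append_right]
    rfl

omit [Nonempty K] [Finite K] in
lemma assemble_naturality (i : U ⟶ U') (j : ∀ k, V k ⟶ V' k) (y : Coord (addObj U' V') → ℝ)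
    (x : ∀ k, (O.F (J k)).functor.obj (spheres (V k))) (k : K) :
    insertMaps i (fun v => (maxCoord y v : OnePoint ℝ)) k ≫ assemble O y
        (fun k => ((O.F (J k)).functor.map
          (insertMaps (j k) fun v => ((restCoord y k v : ℝ) : OnePoint ℝ))).toFun (x k)) k =
      assemble O (fun c => y (coordMap (addHom i j) c)) x k ≫
        (O.F (J k)).functor.map (X := fun a => spheres (addObj U V) ⟨k, a⟩)
          (Y := fun a => spheres (addObj U' V') ⟨k, a⟩)
          fun a => insertMaps (addHom i j) (fun v => (y v : OnePoint ℝ)) ⟨k, a⟩ := by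
  have h := slide_naturality (O.F (J k)) (V := fun a => (V k a).card) (V' := fun a => (V' k a).card)
    (II.inj (i k)) (fun a => II.inj (j k a)) (fun u => maxCoord y ⟨k, u⟩) (diffCoord y k)
    (fun a c => restCoord y k ⟨a, c⟩) (x k)
  refine h.trans ?_
  rw [assemble, diffCoord_coordMap]
  simp only [append_coord y k]
  rfl

/-- The composition of loops is natural with respect to stabilization. -/
lemma loopComp_naturality (i : U ⟶ U') (j : ∀ k, V k ⟶ V' k) (g : loopSpace (O.F K) U)
    (f : ∀ k, loopSpace (O.F (J k)) (V k)) :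
    loopComp O ((stabMap (O.F K) i).toFun g) (fun k => (stabMap (O.F (J k)) (j k)).toFun (f k)) =
      (stabMap (O.F (Σ k, J k)) (addHom i j)).toFun (loopComp O g f) := by
  refine loopSpace_ext fun y => ?_
  rw [evalLoop_stabMap, evalLoop_loopComp, evalLoop_loopComp]
  refine Eq.trans ?_ (γ_naturality_apply O (X := spheres (addObj U V))
    (Y := spheres (addObj U' V')) _ _)
  refine congrArg (O.γ (spheres (addObj U' V'))).toFun ?_
  rw [maxCoord_coordMap]
  refine Eq.trans ?_ (MFunctor.map_map _ _ _ _).symm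
  refine (MFunctor.map_map (O.F K) _ _ _).trans (MFunctor.map_congr _ (fun k => ?_) _)
  simp only [restCoord_coordMap]
  exact assemble_naturality O i j y (fun k => evalLoop (f k) fun c => restCoord y k (coordMap (j k) c)) k

lemma loopComp_pt_left (f : ∀ k, loopSpace (O.F (J k)) (V k)) :
    loopComp O (loopSpace (O.F K) U).pt f = (loopSpace (O.F (Σ k, J k)) (addObj U V)).pt := by
  refine loopSpace_ext fun y => (evalLoop_loopComp O _ _ y).trans ?_
  exact (congrArg (O.γ _).toFun (PSpace.Hom.map_pt _)).trans (PSpace.Hom.map_pt _)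

lemma loopComp_pt_right (g : loopSpace (O.F K) U) (f : ∀ k, loopSpace (O.F (J k)) (V k)) (k : K)
    (hk : f k = (loopSpace (O.F (J k)) (V k)).pt) :
    loopComp O g f = (loopSpace (O.F (Σ k, J k)) (addObj U V)).pt := by
  refine loopSpace_ext fun y => (evalLoop_loopComp O _ _ y).trans ?_
  refine Eq.trans (congrArg (O.γ _).toFun (MFunctor.map_eq_pt _ _ _ (k := k) ?_)) (PSpace.Hom.map_pt _)
  rw [assemble, hk]
  exact sphereHom_ext fun z => PSpace.Hom.map_pt _

end loops

end Multilin

namespace Multilin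

/-! ### The composition of the operad -/

/-- The continuity of a map on a product of disjoint unions may be tested on the products of the
summands. -/
lemma continuousGeneratedBy_pi_sigma {ι : Type} [Finite ι] {κ : ι → Type} {A : ∀ i, κ i → Type}
    [∀ i k, TopologicalSpace (A i k)] {Z : Type} [TopologicalSpace Z]
    (f : (∀ i, Σ k, A i k) → Z)
    (h : ∀ k : ∀ i, κ i, ContinuousGeneratedBy CH fun x : ∀ i, A i (k i) => f fun i => ⟨k i, x i⟩) :
    ContinuousGeneratedBy CH f := by
  intro K a
  change Continuous fun l : CH K => f (a l)
  rw [continuous_iff_continuousAt]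
  intro l₀
  let U : Set (CH K) := {l | ∀ i, (a l i).1 = (a l₀ i).1}
  have hU : IsClopen U := by
    have : U = ⋂ i, (fun l => a l i) ⁻¹' (Sigma.fst ⁻¹' {(a l₀ i).1}) := by ext; simp [U]
    rw [this]
    refine isClopen_iInter_of_finite fun i => ?_
    rw [← Set.range_sigmaMk]
    exact isClopen_range_sigmaMk.preimage ((continuous_apply i).comp a.continuous)
  have hc : CompactSpace (CH K) := inferInstanceAs (CompactSpace K)
  have ht : T2Space (CH K) := inferInstanceAs (T2Space K)
  have : CompactSpace U := isCompact_iff_compactSpace.mp hU.1.isCompact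
  have hlift := fun i => exists_lift_sigma (fun u : U => a u.1 i)
    ((continuous_apply i).comp (a.continuous.comp continuous_subtype_val)) (a l₀ i).1
    fun u => u.2 i
  choose g hg hg' using hlift
  have h' := h (fun i => (a l₀ i).1) (i := CompHaus.of U)
    ⟨fun (u : U) i => g i u, continuous_pi hg⟩
  have h2 : ContinuousOn (fun l => f (a l)) U := by
    rw [continuousOn_iff_continuous_domRestrict]
    convert h' using 1
    funext u
    exact congrArg f (funext fun i => hg' i u)
  exact h2.continuousAt (hU.2.mem_nhds fun i => rfl)

lemma continuous_withGeneratedBy {Y Z : Type} [TopologicalSpace Y] [TopologicalSpace Z] {f : Y → Z}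
    (h : ContinuousGeneratedBy CH f) :
    Continuous fun y : WithGeneratedByTopology CH Y => f (WithGeneratedByTopology.equiv y) :=
  (WithGeneratedByTopology.continuous_from_iff _).mpr h

section comp

variable (O : FunctorOperad) (K : Type) (J : K → Type) [Finite K] [Nonempty K]
  [∀ k, Finite (J k)] [∀ k, Nonempty (J k)]

/-- The diagrams whose homotopy colimits are composed, indexed by `K` together with an additional
point for the diagram of `O.F K`. -/
noncomputable def compDgm : Option K → Dgm
  | none => ⟨K → II, loopDiagram (O.F K)⟩
  | some k => ⟨J k → II, loopDiagram (O.F (J k))⟩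

/-- The composition of loops as a map of simplicial spaces. -/
noncomputable def compS : SHom (prodS fun o => chainS (compDgm O K J o).D)
    (chainS (loopDiagram (O.F (Σ k, J k)))) where
  app x := ⟨addChain (x none).1 fun k => (x (some k)).1,
    loopComp O (x none).2 fun k => (x (some k)).2⟩
  cont p := by
    suffices h : ContinuousGeneratedBy CH fun x : (∀ o, Σ c : Fin (p + 1) ⥤ (compDgm O K J o).C,
        (compDgm O K J o).D.obj (c.obj 0)) => (⟨addChain (x none).1 fun k => (x (some k)).1,
          loopComp O (x none).2 fun k => (x (some k)).2⟩ : (chainS (loopDiagram (O.F (Σ k, J k)))).obj p)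
      from continuous_withGeneratedBy h
    refine continuousGeneratedBy_pi_sigma _ fun c => ?_
    intro L a
    have h1 := continuousGeneratedBy_loopComp O (U := (c none).obj 0)
      (V := fun k => (c (some k)).obj 0) (i := L)
      ⟨fun l => (a l none, fun k => a l (some k)), by
        refine Continuous.prodMk ?_ (continuous_pi fun k => ?_)
        · exact (continuous_apply none).comp a.continuous
        · exact (continuous_apply (some k)).comp a.continuous⟩
    exact (continuous_sigmaMk (σ := fun c : Fin (p + 1) ⥤ ((Σ k, J k) → II) =>
      (loopDiagram (O.F (Σ k, J k))).obj (c.obj 0))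
        (i := addChain (c none) fun k => c (some k))).comp h1
  app_act θ x := congrArg (Sigma.mk _) (loopComp_naturality O
    ((x none).1.map (homOfLE (Fin.zero_le (θ 0))))
    (fun k => (x (some k)).1.map (homOfLE (Fin.zero_le (θ 0)))) (x none).2 fun k => (x (some k)).2)

lemma pointedMap_compS : PointedMap (E := ⟨_, loopDiagram (O.F (Σ k, J k))⟩) (compDgm O K J)
    (compS O K J) := by
  rintro p x (_ | k) h
  · have h' : (x none).2 = ((loopDiagram (O.F K)).obj ((x none).1.obj 0)).pt := h
    refine (congrArg (fun g => loopComp O g fun k => (x (some k)).2) h').trans ?_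
    exact loopComp_pt_left O _
  · exact loopComp_pt_right O _ _ k h

variable {K J}

/-- The composition of the operad. -/
noncomputable def operadComp (a : multilin (O.F K)) (b : ∀ k, multilin (O.F (J k))) :
    multilin (O.F (Σ k, J k)) :=
  smashHocolim (E := ⟨_, loopDiagram (O.F (Σ k, J k))⟩) (compDgm O K J) (compS O K J)
    fun o => match o with
      | none => a
      | some k => b k

lemma operadComp_mk {p : ℕ} (t : Δ p) (U : Fin (p + 1) ⥤ (K → II))
    (V : ∀ k, Fin (p + 1) ⥤ (J k → II)) (g : loopSpace (O.F K) (U.obj 0))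
    (f : ∀ k, loopSpace (O.F (J k)) ((V k).obj 0)) :
    operadComp O (hocolim.mk (loopDiagram (O.F K)) U g t)
        (fun k => hocolim.mk (loopDiagram (O.F (J k))) (V k) (f k) t) =
      hocolim.mk (loopDiagram (O.F (Σ k, J k))) (addChain U V) (loopComp O g f) t := by
  let x : ∀ o, (chainS (compDgm O K J o).D).obj p := fun o => match o with
    | none => ⟨U, g⟩
    | some k => ⟨V k, f k⟩
  have e : (fun o => match o with
      | none => hocolim.mk (loopDiagram (O.F K)) U g t
      | some k => hocolim.mk (loopDiagram (O.F (J k))) (V k) (f k) t :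
      ∀ o, hocolim (compDgm O K J o).D) =
      fun o => hocolim.mk (compDgm O K J o).D (x o).1 (x o).2 t := by
    funext o
    cases o <;> rfl
  have h := smashHocolim_mk (E := ⟨_, loopDiagram (O.F (Σ k, J k))⟩) (μ := compS O K J)
    (pointedMap_compS O K J) t (fun o => (x o).1) fun o => (x o).2
  exact (congrArg (smashHocolim (E := ⟨_, loopDiagram (O.F (Σ k, J k))⟩) (compDgm O K J)
    (compS O K J)) e).trans h

lemma operadComp_pt_left (b : ∀ k, multilin (O.F (J k))) :
    operadComp O (multilin (O.F K)).pt b = (multilin (O.F (Σ k, J k))).pt :=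
  smashHocolim_pt (pointedMap_compS O K J) _ none rfl

lemma operadComp_pt_right (a : multilin (O.F K)) (b : ∀ k, multilin (O.F (J k))) (k : K)
    (h : b k = (multilin (O.F (J k))).pt) :
    operadComp O a b = (multilin (O.F (Σ k, J k))).pt :=
  smashHocolim_pt (pointedMap_compS O K J) _ (some k) h

lemma continuousGeneratedBy_operadComp : ContinuousGeneratedBy CH
    fun p : multilin (O.F K) × (∀ k, multilin (O.F (J k))) => operadComp O p.1 p.2 := by
  intro L a
  refine continuousGeneratedBy_smashHocolim (pointedMap_compS O K J) (i := L)
    ⟨fun l o => match o with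
      | none => (a l).1
      | some k => (a l).2 k, continuous_pi fun o => ?_⟩
  cases o with
  | none => exact continuous_fst.comp a.continuous
  | some k => exact (continuous_apply k).comp (continuous_snd.comp a.continuous)

end comp

end Multilin

namespace Multilin

/-! ### Equality of points of the multilinearization -/

/-- The identification of spheres along an equality of dimensions. -/
def sphereCast {m n : ℕ} (h : m = n) : sphere (Fin m) ⟶ sphere (Fin n) := sphereRelabel (finCongr h)

lemma sphereCast_coe {m n : ℕ} (h : m = n) (w : Fin m → ℝ) :
    (sphereCast h).toFun (sphere.coe w) = sphere.coe fun u => w (Fin.cast h.symm u) := rfl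

lemma sphereCast_rfl {n : ℕ} (h : n = n) : sphereCast h = 𝟙 _ := sphereHom_ext fun _ => rfl

lemma II.inj_eqToHom {m n : II} (h : m = n) (x : Fin m.card) :
    II.inj (eqToHom h) x = Fin.cast (congrArg II.card h) x := by
  subst h
  rfl

lemma evalLoop_map_eqToHom {L : Type} [Finite L] (F : MFunctor L) {U U' : L → II} (h : U = U')
    (h' : ∀ l, (U l).card = (U' l).card) (x : loopSpace F U) (y : Coord U' → ℝ) :
    evalLoop (((loopDiagram F).map (eqToHom h)).toFun x) y =
      (F.functor.map (X := spheres U) (Y := spheres U') fun l => sphereCast (h' l)).toFun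
        (evalLoop x fun c => y ⟨c.1, Fin.cast (h' c.1) c.2⟩) := by
  subst h
  refine (congrArg (fun x => evalLoop x y) (map_toFun_id (loopDiagram F) rfl x)).trans ?_
  have : (fun l => sphereCast (h' l)) = 𝟙 (spheres U) := funext fun l => sphereCast_rfl _
  rw [this, F.functor.map_id]
  rfl

/-- Two loops over chains of objects of equal cardinalities, with equal maps, represent the same
point if they correspond to each other under the identification of the spheres. -/
lemma hocolim_mk_eq {L : Type} [Finite L] (F : MFunctor L) {p : ℕ} {c c' : Fin (p + 1) ⥤ (L → II)}
    (h : ∀ a l, (c.obj a l).card = (c'.obj a l).card)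
    (hm : ∀ {a b : Fin (p + 1)} (f : a ⟶ b) l (u : Fin (c.obj a l).card),
      Fin.cast (h b l) (II.inj (c.map f l) u) = II.inj (c'.map f l) (Fin.cast (h a l) u))
    (x : loopSpace F (c.obj 0)) (x' : loopSpace F (c'.obj 0))
    (hx : ∀ y : Coord (c'.obj 0) → ℝ,
      (F.functor.map (X := spheres (c.obj 0)) (Y := spheres (c'.obj 0))
        fun l => sphereCast (h 0 l)).toFun
          (evalLoop x fun c => y ⟨c.1, Fin.cast (h 0 c.1) c.2⟩) = evalLoop x' y) (t : Δ p) :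
    hocolim.mk (loopDiagram F) c x t = hocolim.mk (loopDiagram F) c' x' t := by
  have hobj : ∀ a, c.obj a = c'.obj a := fun a => funext fun l => congrArg II.mk (h a l)
  have hc : c = c' := by
    refine CategoryTheory.Functor.ext hobj fun a b f => funext fun l => ?_
    refine Function.Embedding.ext fun u => ?_
    change _ = II.inj (eqToHom (hobj b).symm l) (II.inj (c'.map f l) (II.inj (eqToHom (hobj a) l) u))
    rw [Functor.eqToHom_proj, Functor.eqToHom_proj, II.inj_eqToHom, II.inj_eqToHom]
    have := congrArg Fin.val (hm f l u)
    exact Fin.ext this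
  exact hocolim.mk_congr (loopDiagram F) hc x x' (loopSpace_ext (F := F) (A := c'.obj 0) fun y =>
    (evalLoop_map_eqToHom F _ (h 0) x y).trans (hx y)) t

lemma exists_coord_eq {L L' : Type} (e : L ≃ L') (U : L' → II) (y : Coord (fun l => U (e l)) → ℝ) :
    ∃ z : Coord U → ℝ, y = fun c => z ⟨e c.1, c.2⟩ :=
  ⟨fun c => y ((Equiv.sigmaCongrLeft (β := fun k => Fin (U k).card) e).symm c),
    funext fun c => congrArg y ((Equiv.sigmaCongrLeft
      (β := fun k => Fin (U k).card) e).symm_apply_apply c).symm⟩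

lemma evalLoop_loopAct (S : SymmFun) {L L' : Type} [Finite L] [Nonempty L] [Finite L'] [Nonempty L']
    (e : L ≃ L') (U : L' → II) (f : loopSpace (S.F L') U) (z : Coord U → ℝ) :
    evalLoop ((loopAct S e U).toFun f) (fun c => z ⟨e c.1, c.2⟩) =
      (S.σ e (spheres U)).toFun (evalLoop f z) :=
  loopAct_coe S e U f z

lemma σ_naturality_apply (S : SymmFun) {L L' : Type} [Finite L] [Nonempty L] [Finite L'] [Nonempty L']
    (e : L ≃ L') {X Y : L' → PSpace} (f : ∀ l, X l ⟶ Y l) (x : (S.F L').functor.obj X) :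
    (S.σ e Y).toFun (((S.F L').functor.map (X := X) (Y := Y) f).toFun x) =
      ((S.F L).functor.map (X := fun k => X (e k)) (Y := fun k => Y (e k))
        fun k => f (e k)).toFun ((S.σ e X).toFun x) :=
  congrArg (fun φ => PSpace.Hom.toFun φ x) (S.σ_naturality e f)

/-! ### Equivariance -/

section equivariance

variable (O : FunctorOperad) {K K' : Type} {J : K → Type} {J' : K' → Type} [Finite K] [Nonempty K]
    [Finite K'] [Nonempty K'] [∀ k, Finite (J k)] [∀ k, Nonempty (J k)] [∀ k, Finite (J' k)]
    [∀ k, Nonempty (J' k)] (e : K ≃ K') (e' : ∀ k, J k ≃ J' (e k))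

lemma slide_σ {L L' : Type} [Finite L] [Nonempty L] [Finite L'] [Nonempty L'] (ε : L ≃ L') {m : ℕ}
    (V : L' → ℕ) (d : L' → Fin m → ℝ) (x : (O.F L').functor.obj fun j => sphere (Fin (V j))) :
    slide (O.F L') V d x ≫ O.σ ε _ = slide (O.F L) (fun l => V (ε l)) (fun l => d (ε l))
      ((O.σ ε fun j => sphere (Fin (V j))).toFun x) :=
  sphereHom_ext fun _ => σ_naturality_apply O.toSymmFun ε _ x

variable {U : K' → II} {V : ∀ k, J' k → II}

lemma loopComp_equivariant (g : loopSpace (O.F K') U) (f : ∀ k, loopSpace (O.F (J' k)) (V k)) :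
    (loopAct O.toSymmFun (Equiv.sigmaCongr e e') (addObj U V)).toFun (loopComp O g f) =
      loopComp O (U := fun k => U (e k)) (V := fun k j => V (e k) (e' k j))
        ((loopAct O.toSymmFun e U).toFun g)
        fun k => (loopAct O.toSymmFun (e' k) (V (e k))).toFun (f (e k)) := by
  refine loopSpace_ext fun y => ?_
  obtain ⟨z, rfl⟩ := exists_coord_eq (Equiv.sigmaCongr e e') (addObj U V) y
  refine (evalLoop_loopAct _ _ _ _ z).trans ?_
  let y : Coord (addObj (fun k => U (e k)) fun k j => V (e k) (e' k j)) → ℝ :=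
    fun c => z ⟨⟨e c.1.1, e' c.1.1 c.1.2⟩, c.2⟩
  have hmax : maxCoord y = fun c => maxCoord z ⟨e c.1, c.2⟩ := funext fun c =>
    (e' c.1).iSup_comp (g := fun j => z ⟨⟨e c.1, j⟩, Fin.castAdd _ c.2⟩)
  have hdiff : ∀ k, diffCoord y k = fun j => diffCoord z (e k) (e' k j) := fun k =>
    funext fun j => funext fun u => congrArg (fun r => _ - r) (congrFun hmax ⟨k, u⟩)
  refine Eq.trans ?_ (evalLoop_loopComp O _ _ y).symm
  rw [hmax, evalLoop_loopComp]
  refine (congrArg (fun φ => PSpace.Hom.toFun φ _)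
    (O.equivariant e e' (spheres (addObj U V)))).trans ?_
  refine congrArg (O.γ _).toFun ?_
  refine (congrArg _ (σ_naturality_apply O.toSymmFun e _ _)).trans ?_
  refine (MFunctor.map_map _ _ _ _).trans ?_
  refine Eq.trans ?_ (congrArg _ (evalLoop_loopAct O.toSymmFun e U g (maxCoord z)).symm)
  refine MFunctor.map_congr _ (fun k => ?_) _
  refine (slide_σ O (e' k) (fun j => (V (e k) j).card) (diffCoord z (e k)) _).trans ?_
  rw [assemble, hdiff]
  exact congrArg _ (evalLoop_loopAct O.toSymmFun (e' k) (V (e k)) (f (e k)) (restCoord z (e k))).symm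

end equivariance

end Multilin

namespace Multilin

/-! ### Associativity -/

lemma glue_sphereCast_assoc {a b c : ℕ} (x : Fin a → ℝ) (y : Fin b → ℝ) :
    glue (fun v => (y v : OnePoint ℝ)) ≫ glue (fun u => (x u : OnePoint ℝ)) ≫
        sphereCast (Nat.add_assoc a b c).symm =
      glue fun w => ((Fin.append x y w : ℝ) : OnePoint ℝ) := by
  refine sphereHom_ext fun v => ?_
  rw [PSpace.comp_toFun, PSpace.comp_toFun, glue_coe, glue_coe, glue_coe, sphereCast_coe,
    Fin.append_assoc]
  rfl

section assoc

variable (O : FunctorOperad) {K : Type} {J : K → Type} {L : ∀ k, J k → Type} [Finite K] [Nonempty K]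
  [∀ k, Finite (J k)] [∀ k, Nonempty (J k)] [∀ k j, Finite (L k j)] [∀ k j, Nonempty (L k j)]
  {U : K → II} {V : ∀ k, J k → II} {W : ∀ k j, L k j → II}

/-- The coordinates `y`, with the sums `(U + V) + W` replaced by `U + (V + W)`. -/
def reassoc (y : Coord (addObj (addObj U V) fun p => W p.1 p.2) → ℝ) :
    Coord (addObj U fun k => addObj (V k) (W k)) → ℝ :=
  fun c => y ⟨⟨⟨c.1.1, c.1.2.1⟩, c.1.2.2⟩, Fin.cast (Nat.add_assoc _ _ _).symm c.2⟩

section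

omit [Nonempty K] [Finite K]

variable (y : Coord (addObj (addObj U V) fun p => W p.1 p.2) → ℝ)

lemma maxCoord_reassoc : maxCoord (reassoc y) = maxCoord (maxCoord y) := by
  funext c
  obtain ⟨j, hj⟩ := exists_eq_ciSup_of_finite
    (f := fun j : J c.1 => maxCoord y ⟨⟨c.1, j⟩, Fin.castAdd _ c.2⟩)
  obtain ⟨l, hl⟩ := exists_eq_ciSup_of_finite
    (f := fun l : L c.1 j => y ⟨⟨⟨c.1, j⟩, l⟩, Fin.castAdd _ (Fin.castAdd _ c.2)⟩)
  refine maxCoord_eq (reassoc y) c _ (fun q => ?_) (j := ⟨j, l⟩) (hl.trans hj)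
  exact (le_maxCoord y ⟨c.1, q.1⟩ q.2 (Fin.castAdd _ c.2)).trans (le_maxCoord (maxCoord y) c.1 q.1 c.2)

omit [∀ k, Finite (J k)] [∀ k, Nonempty (J k)] [∀ k j, Finite (L k j)]
  [∀ k j, Nonempty (L k j)] in
lemma maxCoord_restCoord (k : K) :
    maxCoord (restCoord (reassoc y) k) = restCoord (maxCoord y) k := by
  funext c
  refine congrArg iSup (funext fun l => congrArg (fun u => y ⟨⟨⟨k, c.1⟩, l⟩, u⟩) (Fin.ext ?_))
  rfl

omit [∀ k, Finite (J k)] [∀ k, Nonempty (J k)] [∀ k j, Finite (L k j)]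
  [∀ k j, Nonempty (L k j)] in
lemma restCoord_restCoord (k : K) (j : J k) :
    restCoord (restCoord (reassoc y) k) j = restCoord y ⟨k, j⟩ := by
  funext c
  refine congrArg (fun u => y ⟨⟨⟨k, j⟩, c.1⟩, u⟩) (Fin.ext ?_)
  exact (Nat.add_assoc _ _ _).symm

/-- The coordinates of a point in terms of iterated maxima and differences, in both orders. -/
lemma append_reassoc (k : K) (j : J k) (l : L k j) (s : Fin (U k).card → ℝ)
    (w : Fin (V k j).card → ℝ) :
    Fin.append (fun u => s u + diffCoord (reassoc y) k ⟨j, l⟩ u)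
        (fun v => w v + diffCoord (restCoord (reassoc y) k) j l v) =
      fun c => Fin.append (fun u => s u + diffCoord (maxCoord y) k j u) w c +
        diffCoord y ⟨k, j⟩ l c := by
  funext c
  refine Fin.addCases (fun u => ?_) (fun v => ?_) c
  · have h1 : diffCoord (reassoc y) k ⟨j, l⟩ u =
        y ⟨⟨⟨k, j⟩, l⟩, Fin.castAdd _ (Fin.castAdd _ u)⟩ - maxCoord (maxCoord y) ⟨k, u⟩ :=
      congrArg (fun r => _ - r) (congrFun (maxCoord_reassoc y) ⟨k, u⟩)
    have h2 : diffCoord (maxCoord y) k j u =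
        maxCoord y ⟨⟨k, j⟩, Fin.castAdd _ u⟩ - maxCoord (maxCoord y) ⟨k, u⟩ := rfl
    have h3 : diffCoord y ⟨k, j⟩ l (Fin.castAdd _ u) =
        y ⟨⟨⟨k, j⟩, l⟩, Fin.castAdd _ (Fin.castAdd _ u)⟩ -
          maxCoord y ⟨⟨k, j⟩, Fin.castAdd _ u⟩ := rfl
    rw [Fin.append_left, Fin.append_left, h1, h2]
    refine Eq.trans ?_ (congrArg (fun r => _ + r) h3.symm)
    ring
  · rw [Fin.append_right, Fin.append_right]
    exact congrArg (fun r => w v + (y ⟨⟨⟨k, j⟩, l⟩, Fin.castAdd _ (Fin.natAdd _ v)⟩ - r))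
      (congrFun (maxCoord_restCoord y k) ⟨j, v⟩)

end

omit [Nonempty K] [Finite K] in
/-- Associativity of the assembly of spheres, in one of the variables. -/
lemma assemble_assoc (y : Coord (addObj (addObj U V) fun p => W p.1 p.2) → ℝ)
    (x : ∀ k j, (O.F (L k j)).functor.obj (spheres (W k j))) (k : K) (j : J k)
    (s : Fin (U k).card → ℝ) :
    assemble O (restCoord (reassoc y) k) (x k) j ≫
        (O.F (L k j)).functor.map
          (X := fun l => spheres (addObj (V k) (W k)) ⟨j, l⟩)
          (Y := fun l => spheres (addObj (addObj U V) fun p => W p.1 p.2) ⟨⟨k, j⟩, l⟩)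
          (fun l => glue (fun u => ((s u + diffCoord (reassoc y) k ⟨j, l⟩ u : ℝ) : OnePoint ℝ)) ≫
            sphereCast (Nat.add_assoc _ _ _).symm) =
      glue (fun u => ((s u + diffCoord (maxCoord y) k j u : ℝ) : OnePoint ℝ)) ≫
        assemble O y (fun p => x p.1 p.2) ⟨k, j⟩ := by
  refine sphereHom_ext fun w => ?_
  refine Eq.trans ?_ (congrArg (assemble O y (fun p => x p.1 p.2) ⟨k, j⟩).toFun
    (glue_coe _ w)).symm
  refine (congrArg (PSpace.Hom.toFun _) (slide_coe (O.F (L k j)) (fun l => (W k j l).card)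
    (diffCoord (restCoord (reassoc y) k) j) (x k j) w)).trans ?_
  refine Eq.trans ?_ (slide_coe (O.F (L k j)) (fun l => (W k j l).card)
    (diffCoord y ⟨k, j⟩) (x k j) _).symm
  refine (MFunctor.map_map _ _ _ _).trans (MFunctor.map_congr _ (fun l => ?_) _)
  refine (glue_sphereCast_assoc _ _).trans ?_
  exact congrArg (fun a => glue fun u => (a u : OnePoint ℝ)) (append_reassoc y k j l s w)

lemma assoc_apply (X : (Σ k, Σ j, L k j) → PSpace)
    (x : (O.F K).functor.obj fun k => (O.F (J k)).functor.obj fun j =>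
      (O.F (L k j)).functor.obj fun l => X ⟨k, j, l⟩) :
    (O.σ (Equiv.sigmaAssoc L) X).toFun ((O.γ X).toFun (((O.F K).functor.map
        (X := fun k => (O.F (J k)).functor.obj fun j => (O.F (L k j)).functor.obj fun l => X ⟨k, j, l⟩)
        (Y := fun k => (O.F (Σ j, L k j)).functor.obj fun q => X ⟨k, q⟩)
        (fun k => O.γ fun q : (Σ j, L k j) => X ⟨k, q⟩)).toFun x)) =
    (O.γ (fun q : (Σ p : (Σ k, J k), L p.1 p.2) => X ⟨q.1.1, q.1.2, q.2⟩)).toFun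
      ((O.γ (fun p : (Σ k, J k) =>
        (O.F (L p.1 p.2)).functor.obj fun l => X ⟨p.1, p.2, l⟩)).toFun x) :=
  congrArg (fun φ => PSpace.Hom.toFun φ x) (O.assoc X)

/-- Associativity of the composition of loops.  By naturality of `γ`, both sides are the value of the
threefold multiplication at the same point, where all spheres are assembled at once. -/
lemma evalLoop_assoc (g : loopSpace (O.F K) U) (f : ∀ k, loopSpace (O.F (J k)) (V k))
    (h : ∀ k j, loopSpace (O.F (L k j)) (W k j))
    (y : Coord (addObj (addObj U V) fun p => W p.1 p.2) → ℝ) :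
    ((O.F (Σ p : (Σ k, J k), L p.1 p.2)).functor.map
      (X := fun q => spheres (addObj U fun k => addObj (V k) (W k)) (Equiv.sigmaAssoc L q))
      (Y := spheres (addObj (addObj U V) fun p => W p.1 p.2))
      fun _ => sphereCast (Nat.add_assoc _ _ _).symm).toFun
        ((O.σ (Equiv.sigmaAssoc L) _).toFun
          (evalLoop (loopComp O g fun k => loopComp O (f k) (h k)) (reassoc y))) =
      evalLoop (loopComp O (loopComp O g f) fun p : (Σ k, J k) => h p.1 p.2) y := by
  let X : (Σ k, Σ j, L k j) → PSpace :=
    fun q => spheres (addObj (addObj U V) fun p => W p.1 p.2) ⟨⟨q.1, q.2.1⟩, q.2.2⟩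
  rw [evalLoop_loopComp, evalLoop_loopComp, evalLoop_loopComp, maxCoord_reassoc]
  refine (σ_naturality_apply O.toSymmFun (Equiv.sigmaAssoc L) (Y := X)
    (fun _ => sphereCast (Nat.add_assoc _ _ _).symm) _).symm.trans ?_
  refine Eq.trans ?_ (congrArg (O.γ _).toFun (γ_naturality_apply O
    (fun p => assemble O y (fun p => evalLoop (h p.1 p.2) (restCoord y p)) p) _))
  refine Eq.trans ?_ (congrArg _ (congrArg _ (MFunctor.map_map (O.F K) _ _ _).symm))
  refine Eq.trans ?_ (assoc_apply O X _)
  refine congrArg _ ((γ_naturality_apply O (Y := X) _ _).symm.trans ?_)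
  refine congrArg _ ((MFunctor.map_map _ _ _ _).trans (Eq.trans ?_ (MFunctor.map_map _ _ _ _).symm))
  refine MFunctor.map_congr _ (fun k => sphereHom_ext fun s => ?_) _
  refine (MFunctor.map_map (O.F (Σ j, L k j)) (X := fun q => spheres (addObj (V k) (W k)) q)
    (Z := fun q => X ⟨k, q⟩)
    (fun q => glue fun u => ((s u + diffCoord (reassoc y) k q u : ℝ) : OnePoint ℝ))
    (fun q => sphereCast (Nat.add_assoc _ _ _).symm) _).trans ?_
  refine (congrArg _ (evalLoop_loopComp O (f k) (h k) (restCoord (reassoc y) k))).trans ?_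
  refine (γ_naturality_apply O (X := fun q => spheres (addObj (V k) (W k)) q)
    (Y := fun q => X ⟨k, q⟩) _ _).symm.trans ?_
  refine congrArg _ ((MFunctor.map_map _ _ _ _).trans (Eq.trans ?_ (MFunctor.map_map _ _ _ _).symm))
  rw [maxCoord_restCoord]
  refine MFunctor.map_congr _ (fun j => ?_) _
  refine Eq.trans ?_ (assemble_assoc O y (fun k j => evalLoop (h k j) (restCoord y ⟨k, j⟩)) k j s)
  simp only [restCoord_restCoord]

end assoc

end Multilin

namespace Multilin

/-! ### Units -/

lemma addInj_zero_left {n n' : ℕ} (i : Fin 0 ↪ Fin 0) (j : Fin n ↪ Fin n') (u : Fin (0 + n)) :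
    Fin.cast (Nat.zero_add n') (addInj i j u) = j (Fin.cast (Nat.zero_add n) u) := by
  refine Fin.addCases (fun u => u.elim0) (fun w => ?_) u
  rw [addInj_natAdd]
  simp

lemma addInj_zero_right {m m' : ℕ} (i : Fin m ↪ Fin m') (j : Fin 0 ↪ Fin 0) (u : Fin (m + 0)) :
    addInj i j u = i u := by
  refine Fin.addCases (fun u => ?_) (fun w => w.elim0) u
  exact addInj_castAdd i j u

lemma addInj_assoc {m m' n n' l l' : ℕ} (i : Fin m ↪ Fin m') (j : Fin n ↪ Fin n')
    (k : Fin l ↪ Fin l') (u : Fin (m + (n + l))) :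
    Fin.cast (Nat.add_assoc m' n' l').symm (addInj i (addInj j k) u) =
      addInj (addInj i j) k (Fin.cast (Nat.add_assoc m n l).symm u) := by
  refine Fin.addCases (fun u => ?_) (fun w => Fin.addCases (fun v => ?_) (fun w => ?_) w) u
  · rw [addInj_castAdd]
    refine Eq.trans ?_ (addInj_castAdd (addInj i j) k (Fin.castAdd n u)).symm
    rw [addInj_castAdd]
    rfl
  · rw [addInj_natAdd, addInj_castAdd]
    refine Eq.trans ?_ (addInj_castAdd (addInj i j) k (Fin.natAdd m v)).symm
    rw [addInj_natAdd]
    rfl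
  · rw [addInj_natAdd, addInj_natAdd]
    have h : Fin.cast (Nat.add_assoc m n l).symm (Fin.natAdd m (Fin.natAdd n w)) =
        Fin.natAdd (m + n) w := Fin.ext (Nat.add_assoc _ _ _).symm
    rw [h, addInj_natAdd]
    exact Fin.ext (Nat.add_assoc _ _ _).symm

section unit

variable (O : FunctorOperad) {K : Type} [Finite K] [Nonempty K] {U : K → II}

/-- The finite point of `S^0`. -/
def zeroPoint : sphere (Fin 0) := sphere.coe fun u => u.elim0

lemma evalLoop_unitLoop (y : Coord (fun _ : Unit => (⟨0⟩ : II)) → ℝ) :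
    evalLoop (F := O.F Unit) (unitLoop O) y = (O.η (sphere (Fin 0))).toFun zeroPoint :=
  congrArg (fun z => (O.η (sphere (Fin 0))).toFun (sphere.coe z)) (Subsingleton.elim _ _)

lemma η_naturality_apply {X Y : PSpace} (f : X ⟶ Y) (x : X) :
    (O.η Y).toFun (f.toFun x) = ((O.F Unit).functor.map (X := fun _ => X) (Y := fun _ => Y)
      fun _ => f).toFun ((O.η X).toFun x) :=
  congrArg (fun φ => PSpace.Hom.toFun φ x) (O.η_naturality f)

lemma glue_sphereCast_zero_add {n : ℕ} (a : Fin 0 → OnePoint ℝ) :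
    glue a ≫ sphereCast (Nat.zero_add n) = 𝟙 (sphere (Fin n)) := by
  obtain rfl : a = fun u => ((Fin.elim0 u : ℝ) : OnePoint ℝ) := Subsingleton.elim _ _
  refine sphereHom_ext fun w => ?_
  rw [PSpace.comp_toFun, glue_coe, sphereCast_coe]
  refine congrArg sphere.coe (funext fun u => ?_)
  rw [show Fin.cast (Nat.zero_add n).symm u = Fin.natAdd 0 u from Fin.ext (Nat.zero_add _).symm,
    Fin.append_right]

lemma evalLoop_unit_comp (f : loopSpace (O.F K) U) (z : Coord U → ℝ) :
    ((O.F (Σ _ : Unit, K)).functor.map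
      (X := spheres (addObj (fun _ : Unit => (⟨0⟩ : II)) fun _ => U))
      (Y := fun p => spheres U p.2) fun _ => sphereCast (Nat.zero_add _)).toFun
        (evalLoop (loopComp O (unitLoop O) fun _ : Unit => f) fun c =>
          z ⟨c.1.2, Fin.cast (Nat.zero_add _) c.2⟩) =
      (O.σ (Equiv.uniqueSigma fun _ : Unit => K) (spheres U)).toFun (evalLoop f z) := by
  set y : Coord (addObj (fun _ : Unit => (⟨0⟩ : II)) fun _ => U) → ℝ := fun c =>
    z ⟨c.1.2, Fin.cast (Nat.zero_add _) c.2⟩ with hy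
  have hrest : restCoord y () = z := by
    funext c
    exact congrArg (fun u => z ⟨c.1, u⟩) (Fin.ext (Nat.zero_add _))
  refine (congrArg _ (evalLoop_loopComp O (unitLoop O) (fun _ : Unit => f) y)).trans ?_
  let ψ : sphere (Fin 0) ⟶ (O.F K).functor.obj (spheres U) :=
    assemble O y (fun _ => evalLoop f (restCoord y ())) () ≫ (O.F K).functor.map
      (X := fun k => spheres (addObj (fun _ : Unit => (⟨0⟩ : II)) fun _ => U) ⟨(), k⟩)
      (Y := spheres U) fun _ => sphereCast (Nat.zero_add _)
  refine (γ_naturality_apply O (Y := fun p : (Σ _ : Unit, K) => spheres U p.2)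
    (fun _ => sphereCast (Nat.zero_add _)) _).symm.trans ?_
  refine (congrArg _ (MFunctor.map_map _ _ _ _)).trans ?_
  refine (congrArg _ (congrArg _ (evalLoop_unitLoop O _))).trans ?_
  refine (congrArg _ (η_naturality_apply O ψ zeroPoint).symm).trans ?_
  refine (congrArg (fun φ => PSpace.Hom.toFun φ _) (O.η_γ (spheres U))).trans ?_
  refine congrArg _ ?_
  refine (congrArg _ (slide_coe (O.F K) (fun k => (U k).card) (diffCoord y ()) _ _)).trans ?_
  refine (MFunctor.map_map (O.F K) _ _ _).trans ?_
  refine (MFunctor.map_congr (O.F K) (g := fun k => 𝟙 (spheres U k))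
    (fun k => glue_sphereCast_zero_add _) _).trans ?_
  refine (congrArg (fun φ => PSpace.Hom.toFun φ _) ((O.F K).functor.map_id (spheres U))).trans ?_
  exact congrArg (evalLoop f) hrest

lemma evalLoop_comp_unit (g : loopSpace (O.F K) U) (z : Coord U → ℝ) :
    evalLoop (loopComp O g fun _ : K => unitLoop O) (fun c => z ⟨c.1.1, c.2⟩) =
      (O.σ (Equiv.sigmaPUnit K) (spheres U)).toFun (evalLoop g z) := by
  set y : Coord (addObj U fun _ (_ : Unit) => (⟨0⟩ : II)) → ℝ := fun c => z ⟨c.1.1, c.2⟩ with hy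
  have hmax : maxCoord y = z := by
    funext c
    exact ciSup_const (ι := Unit) (α := ℝ) (a := z c)
  refine (evalLoop_loopComp O g (fun _ : K => unitLoop O) y).trans ?_
  rw [hmax]
  refine Eq.trans ?_ (congrArg (fun φ => PSpace.Hom.toFun φ _) (O.map_η_γ (spheres U)))
  refine congrArg _ (MFunctor.map_congr _ (fun k => sphereHom_ext fun s => ?_) _)
  refine (slide_coe (O.F Unit) (fun _ => 0) (diffCoord y k) _ s).trans ?_
  refine (congrArg _ (evalLoop_unitLoop O _)).trans ?_
  have h : ∀ a : Unit, (glue fun u => ((s u + diffCoord y k a u : ℝ) : OnePoint ℝ)) =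
      (glue fun u => (s u : OnePoint ℝ) : sphere (Fin 0) ⟶ _) := fun a => by
    refine congrArg _ (funext fun u => congrArg _ ?_)
    refine (congrArg (fun r => s u + r) (sub_eq_zero.mpr ?_)).trans (add_zero _)
    exact (congrFun hmax ⟨k, u⟩).symm
  refine (MFunctor.map_congr _ h _).trans ?_
  refine (η_naturality_apply O (glue fun u => (s u : OnePoint ℝ) : sphere (Fin 0) ⟶ _)
    zeroPoint).symm.trans ?_
  refine congrArg _ ((glue_coe s _).trans ?_)
  refine congrArg sphere.coe (funext fun u => ?_)
  exact Fin.append_left s _ u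

/-- The unit of the operad, represented over any simplex. -/
lemma hocolim_mk_unitLoop {p : ℕ} (t : Δ p) :
    hocolim.mk (loopDiagram (O.F Unit)) (p := 0)
        ((Functor.const _).obj fun _ : Unit => (⟨0⟩ : II)) (unitLoop O) (stdSimplex.vertex 0) =
      hocolim.mk (loopDiagram (O.F Unit)) (p := p)
        ((Functor.const _).obj fun _ : Unit => (⟨0⟩ : II)) (unitLoop O) t := by
  let θ : Fin (p + 1) →o Fin 1 := ⟨fun _ => 0, monotone_const⟩
  have h := Quot.sound (HocolimRel.simplicial (D := loopDiagram (O.F Unit)) θ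
    ((Functor.const _).obj fun _ : Unit => (⟨0⟩ : II)) (unitLoop O) t)
  have ht : stdSimplex.map θ t = stdSimplex.vertex 0 := Subsingleton.elim _ _
  rw [ht] at h
  refine h.trans ?_
  exact congrArg (fun x => hocolim.mk (loopDiagram (O.F Unit)) (p := p)
    ((Functor.const _).obj fun _ : Unit => (⟨0⟩ : II)) x t)
      (map_toFun_id (loopDiagram (O.F Unit)) rfl (unitLoop O))

end unit

/-! ### The operad -/

section operad

variable (O : FunctorOperad) {K : Type} [Finite K] [Nonempty K]

lemma multilin_ind {L : Type} [Finite L] {F : MFunctor L} (a : multilin F) :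
    ∃ (p : ℕ) (U : Fin (p + 1) ⥤ (L → II)) (g : loopSpace F (U.obj 0)) (t : Δ p),
      a = hocolim.mk (loopDiagram F) U g t := hocolim.ind a

lemma operad_one_comp (a : multilin (O.F K)) :
    operadComp O (hocolim.mk (loopDiagram (O.F Unit)) (p := 0)
        ((Functor.const _).obj fun _ : Unit => (⟨0⟩ : II)) (unitLoop O) (stdSimplex.vertex 0))
      (fun _ : Unit => a) =
        (multilinAct O.toSymmFun (Equiv.uniqueSigma fun _ : Unit => K)).toFun a := by
  obtain ⟨p, U, g, t, rfl⟩ := multilin_ind a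
  rw [hocolim_mk_unitLoop O t]
  refine (operadComp_mk O t _ _ _ _).trans ?_
  refine hocolim_mk_eq (O.F (Σ _ : Unit, K))
    (c' := U ⋙ Pi.comap (fun _ : K => II) (Equiv.uniqueSigma fun _ : Unit => K))
    (fun a q => Nat.zero_add _) (fun f q u => ?_) _ _ (fun y => ?_) t
  · exact addInj_zero_left _ (II.inj (U.map f q.2)) u
  · obtain ⟨z, rfl⟩ := exists_coord_eq (Equiv.uniqueSigma fun _ : Unit => K) (U.obj 0) y
    exact (evalLoop_unit_comp O g z).trans (evalLoop_loopAct O.toSymmFun _ _ g z).symm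

lemma operad_comp_one (a : multilin (O.F K)) :
    operadComp O a (fun _ : K => hocolim.mk (loopDiagram (O.F Unit)) (p := 0)
        ((Functor.const _).obj fun _ : Unit => (⟨0⟩ : II)) (unitLoop O) (stdSimplex.vertex 0)) =
      (multilinAct O.toSymmFun (Equiv.sigmaPUnit K)).toFun a := by
  obtain ⟨p, U, g, t, rfl⟩ := multilin_ind a
  rw [hocolim_mk_unitLoop O t]
  refine (operadComp_mk O t _ _ _ _).trans ?_
  refine hocolim_mk_eq (O.F (Σ _ : K, Unit))
    (c := addChain U fun _ : K => (Functor.const _).obj fun _ : Unit => (⟨0⟩ : II))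
    (c' := U ⋙ Pi.comap (fun _ : K => II) (Equiv.sigmaPUnit K))
    (fun a q => rfl) (fun f q u => ?_) _ _ (fun y => ?_) t
  · exact addInj_zero_right (II.inj (U.map f q.1)) _ u
  · obtain ⟨z, rfl⟩ := exists_coord_eq (Equiv.sigmaPUnit K) (U.obj 0) y
    refine Eq.trans ?_ ((evalLoop_comp_unit O g z).trans
      (evalLoop_loopAct O.toSymmFun (Equiv.sigmaPUnit K) _ g z).symm)
    refine (MFunctor.map_congr _ (g := fun q => 𝟙 _) (fun q => sphereCast_rfl _) _).trans ?_
    exact congrArg (fun φ => PSpace.Hom.toFun φ _) ((O.F (Σ _ : K, Unit)).functor.map_id _)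

variable {J : K → Type} [∀ k, Finite (J k)] [∀ k, Nonempty (J k)]

lemma exists_common_rep_comp (a : multilin (O.F K)) (b : ∀ k, multilin (O.F (J k))) :
    ∃ (p : ℕ) (t : Δ p) (U : Fin (p + 1) ⥤ (K → II)) (V : ∀ k, Fin (p + 1) ⥤ (J k → II))
      (g : loopSpace (O.F K) (U.obj 0)) (f : ∀ k, loopSpace (O.F (J k)) ((V k).obj 0)),
      a = hocolim.mk (loopDiagram (O.F K)) U g t ∧
        b = fun k => hocolim.mk (loopDiagram (O.F (J k))) (V k) (f k) t := by
  obtain ⟨p, t, c, x, h⟩ := exists_common_rep_hocolim (compDgm O K J) fun o => match o with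
    | none => a
    | some k => b k
  exact ⟨p, t, c none, fun k => c (some k), x none, fun k => x (some k), h none,
    funext fun k => h (some k)⟩

lemma operad_assoc {L : ∀ k, J k → Type} [∀ k j, Finite (L k j)] [∀ k j, Nonempty (L k j)]
    (a : multilin (O.F K)) (b : ∀ k, multilin (O.F (J k))) (c : ∀ k j, multilin (O.F (L k j))) :
    (multilinAct O.toSymmFun (Equiv.sigmaAssoc L)).toFun
        (operadComp O a fun k => operadComp O (b k) (c k)) =
      operadComp O (operadComp O a b) fun p : (Σ k, J k) => c p.1 p.2 := by
  -- all operations are represented over the same point of a simplex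
  let Y : Option K ⊕ (Σ k, J k) → Dgm := Sum.elim (compDgm O K J)
    fun p => ⟨L p.1 p.2 → II, loopDiagram (O.F (L p.1 p.2))⟩
  obtain ⟨p, t, C, x, h⟩ := exists_common_rep_hocolim Y fun o => match o with
    | .inl none => a
    | .inl (some k) => b k
    | .inr q => c q.1 q.2
  let U : Fin (p + 1) ⥤ (K → II) := C (.inl none)
  let V : ∀ k, Fin (p + 1) ⥤ (J k → II) := fun k => C (.inl (some k))
  let W : ∀ k j, Fin (p + 1) ⥤ (L k j → II) := fun k j => C (.inr ⟨k, j⟩)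
  let g : loopSpace (O.F K) (U.obj 0) := x (.inl none)
  let f : ∀ k, loopSpace (O.F (J k)) ((V k).obj 0) := fun k => x (.inl (some k))
  let w : ∀ k j, loopSpace (O.F (L k j)) ((W k j).obj 0) := fun k j => x (.inr ⟨k, j⟩)
  have ha : a = hocolim.mk (loopDiagram (O.F K)) U g t := h (.inl none)
  have hb : ∀ k, b k = hocolim.mk (loopDiagram (O.F (J k))) (V k) (f k) t :=
    fun k => h (.inl (some k))
  have hc : ∀ k j, c k j = hocolim.mk (loopDiagram (O.F (L k j))) (W k j) (w k j) t :=
    fun k j => h (.inr ⟨k, j⟩)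
  clear_value U V W g f w
  obtain rfl : b = fun k => hocolim.mk (loopDiagram (O.F (J k))) (V k) (f k) t := funext hb
  obtain rfl : c = fun k j => hocolim.mk (loopDiagram (O.F (L k j))) (W k j) (w k j) t :=
    funext fun k => funext fun j => hc k j
  subst ha
  have e1 : (fun k => operadComp O (hocolim.mk (loopDiagram (O.F (J k))) (V k) (f k) t)
      fun j => hocolim.mk (loopDiagram (O.F (L k j))) (W k j) (w k j) t) = fun k =>
      hocolim.mk (loopDiagram (O.F (Σ j, L k j))) (addChain (V k) (W k))
        (loopComp O (f k) (w k)) t := funext fun k => operadComp_mk O t _ _ _ _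
  refine (congrArg _ ((congrArg (operadComp O _) e1).trans (operadComp_mk O t _ _ _ _))).trans ?_
  refine Eq.trans ?_ ((congrArg (fun z => operadComp O z _) (operadComp_mk O t U V g f)).trans
    (operadComp_mk O t (addChain U V) (fun q : (Σ k, J k) => W q.1 q.2) _
      fun q : (Σ k, J k) => w q.1 q.2)).symm
  refine hocolim_mk_eq (O.F (Σ q : (Σ k, J k), L q.1 q.2))
    (c := addChain U (fun k => addChain (V k) (W k)) ⋙
      Pi.comap (fun _ : (Σ k, Σ j, L k j) => II) (Equiv.sigmaAssoc L))
    (c' := addChain (addChain U V) fun q : (Σ k, J k) => W q.1 q.2)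
    (fun a q => (Nat.add_assoc _ _ _).symm) (fun f q u => ?_) _ _ (fun y => ?_) t
  · exact addInj_assoc (II.inj (U.map f q.1.1)) (II.inj ((V q.1.1).map f q.1.2))
      (II.inj ((W q.1.1 q.1.2).map f q.2)) u
  · refine Eq.trans (congrArg _ ?_) (evalLoop_assoc O g f w y)
    exact evalLoop_loopAct O.toSymmFun (Equiv.sigmaAssoc L) _ _ (reassoc (U := U.obj 0)
      (V := fun k => (V k).obj 0) (W := fun k j => (W k j).obj 0) y)

lemma operad_equivariant {K' : Type} {J' : K' → Type} [Finite K'] [Nonempty K']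
    [∀ k, Finite (J' k)] [∀ k, Nonempty (J' k)] (e : K ≃ K') (e' : ∀ k, J k ≃ J' (e k))
    (a : multilin (O.F K')) (b : ∀ k, multilin (O.F (J' k))) :
    (multilinAct O.toSymmFun (Equiv.sigmaCongr e e')).toFun (operadComp O a b) =
      operadComp O ((multilinAct O.toSymmFun e).toFun a)
        fun k => (multilinAct O.toSymmFun (e' k)).toFun (b (e k)) := by
  obtain ⟨p, t, U, V, g, f, rfl, rfl⟩ := exists_common_rep_comp O a b
  rw [operadComp_mk]
  refine Eq.trans ?_ (operadComp_mk O t (U ⋙ Pi.comap (fun _ : K' => II) e)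
    (fun k => V (e k) ⋙ Pi.comap (fun _ : J' (e k) => II) (e' k)) _ _).symm
  exact congrArg (fun x => hocolim.mk (loopDiagram (O.F (Σ k, J k)))
    (addChain (U ⋙ Pi.comap (fun _ : K' => II) e)
      fun k => V (e k) ⋙ Pi.comap (fun _ : J' (e k) => II) (e' k)) x t)
    (loopComp_equivariant O e e' g f)

/-- The operad structure on the multilinearizations of a functor-operad. -/
noncomputable def multilinOperad : OperadStructure (multilinSeq O.toSymmFun) where
  one := hocolim.mk (loopDiagram (O.F Unit)) (p := 0)
    ((Functor.const _).obj fun _ : Unit => (⟨0⟩ : II)) (unitLoop O) (stdSimplex.vertex 0)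
  comp a b := operadComp O a b
  continuous_comp := fun f => continuousGeneratedBy_operadComp O f
  comp_pt_left := operadComp_pt_left O
  comp_pt_right := operadComp_pt_right O
  equivariant := operad_equivariant O
  assoc := operad_assoc O
  one_comp := operad_one_comp O
  comp_one := operad_comp_one O

end operad

end Multilin
theorem mainTheorem2 (O : FunctorOperad) :
    (∃ P : OperadStructure (multilinSeq O.toSymmFun),
      P.one = hocolim.mk (loopDiagram (O.F Unit)) (p := 0)
        ((Functor.const _).obj fun _ : Unit => (⟨0⟩ : II)) (unitLoop O) (stdSimplex.vertex 0) ∧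
      ∀ (K : Type) (J : K → Type) [Finite K] [Nonempty K] [∀ k, Finite (J k)]
        [∀ k, Nonempty (J k)] (p : ℕ) (U : Fin (p + 1) ⥤ (K → II))
        (V : ∀ k, Fin (p + 1) ⥤ (J k → II)) (g : loopSpace (O.F K) (U.obj 0))
        (f : ∀ k, loopSpace (O.F (J k)) ((V k).obj 0)) (t : stdSimplex ℝ (Fin (p + 1))),
        ∃ h : loopSpace (O.F (Σ k, J k)) (addObj (U.obj 0) fun k => (V k).obj 0),
          IsLoopComposite O g f h ∧
          P.comp (hocolim.mk (loopDiagram (O.F K)) U g t)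
              (fun k => hocolim.mk (loopDiagram (O.F (J k))) (V k) (f k) t) =
            hocolim.mk (loopDiagram (O.F (Σ k, J k))) (addChain U V) h t) ∧
    (∀ (K : Type) [Finite K] [Nonempty K],
      (∀ U : K → II, WellPointed (loopSpace (O.F K) U)) →
      ConnectivityCondition (loopDiagram (O.F K)) → IsWeakEquiv (comparison (O.F K))) ∧
    (∀ (K : Type) [Finite K] [Nonempty K] (X : K → PSpace),
      (∀ U : K → II, WellPointed (loopSpace ((O.F K).smashRight X) U)) →
      ConnectivityCondition (loopDiagram ((O.F K).smashRight X)) →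
      IsWeakEquiv (comparison ((O.F K).smashRight X))) := by
  refine ⟨⟨multilinOperad O, rfl, fun K J _ _ _ _ p U V g f t =>
    ⟨loopComp O g f, isLoopComposite_loopComp O g f, operadComp_mk O t U V g f⟩⟩,
    fun K _ _ h1 h2 => isWeakEquiv_of_connectivityCondition _ h1 h2,
    fun K _ _ X h1 h2 => isWeakEquiv_of_connectivityCondition _ h1 h2⟩
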